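/- **Setting.** Let $Z\in\{0,1\}$ be a treatment, $X$ covariates, $(S_1,S_0)$ real potential post-treatment variables and $(Y_1,Y_0)$ integrable real potential outcomes. Observe $V=(Y,S,Z,X)$ with $S=S_Z$, $Y=Y_Z$; let $P$ be the law of $V$. Assume * treatment ignorability: $Z\perp (S_0,S_1,Y_0,Y_1)\mid X$; * principal ignorability: for $z=0,1$, $\mathbb E(Y_z\mid S_1,S_0,X)$ is a function of $(S_z,X)$; * a known copula: $\mathbb P(S_1\le s_1,S_0\le s_0\mid X)=\mathbb C\{\mathbb P(S_1\le s_1\mid X),\mathbb P(S_0\le s_0\mid X)\}$, where $\mathbb C$ is a copula with a density $c=\partial^2\mathbb C/\partial u\partial v$ that is continuously differentiable on $(0,1)^2$; * overlap: $0<\pi(X)<1$ almost surely, where $\pi(x)=\mathbb P(Z=1\mid X=x)$; * $S$ has conditional densities $p_z(s,x)$ given $Z=z$, $X=x$. Put $\mathbb F_z(s,x)=\int_{-\infty}^s p_z(t,x)\,dt$, $\mu_z(s,x)=\mathbb E(Y\mid S=s,Z=z,X=x)$, and let $e(s_1,s_0,x)=c(\mathbb F_1(s_1,x),\mathbb F_0(s_0,x))\,p_1(s_1,x)\,p_0(s_0,x)$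 be the principal density. Let $\tau(s_1,s_0)=\mathbb E(Y_1-Y_0\mid S_1=s_1,S_0=s_0)$ be the principal causal effect (PCE) surface. Let $w\ge 0$ be a weight function and $f(s_1,s_0;\eta)$, $\eta\in\mathbb R^q$, a working model with gradient $\dot f$ and Hessian $\ddot f$ in $\eta$. Assume that $$\eta_\tau=\arg\min_{\eta\in\mathbb R^q}\mathbb E\big[w(S_1,S_0)\{\tau(S_1,S_0)-f(S_1,S_0;\eta)\}^2\big]$$ is the unique minimizer, with finite minimum. For an observed law $P'$ that has nuisance functions as above (with overlap), the projection parameter is the minimizer of $\iint w\,(\tau_{P'}-f)^2\,e_{P'}\,ds_1ds_0$, where $e_{P'}(s_1,s_0)=\mathbb E_{P'}\{e_{P'}(s_1,s_0,X)\}$ and $\tau_{P'}(s_1,s_0)=\mathbb E_{P'}\big[\tfrac{e_{P'}(s_1,s_0,X)}{e_{P'}(s_1,s_0)}\{\mu_{1,P'}(s_1,X)-\mu_{0,P'}(s_0,X)\}\big]$. **Nonparametric model and EIF.** A submodel is a path $P_\theta$ of probability laws, for $\theta$ near $0$, through $P_0=P$, with density ratios $g_\theta=dP_\theta/dP$ satisfying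 $|g_\theta-1|\le K|\theta|$ $P$-a.s. for a constant $K$, and differentiable in $\theta$ at $0$ with score $\mathfrak s=\partial_\theta g_\theta|_{\theta=0}$. The tangent space is the closed linear span in $L^2(P)$ of all scores. An efficient influence function (EIF) is a function $\varphi$ with components in the tangent space such that, along every submodel, (i) there is a curve $\eta_\theta$ with $\eta_0=\eta_\tau$, continuous at $0$, where $\eta_\theta$ is, for $\theta$ near $0$, the unique minimizer (with finite minimum) of the $P_\theta$-objective over a fixed neighbourhood of $\eta_\tau$; and (ii) every such curve (in particular every curve of unique global minimizers that is continuous at $0$ with $\eta_0=\eta_\tau$) satisfies $\dot\eta_\theta|_{\theta=0}=\mathbb E\{\varphi(V)\mathfrak s(V)\}$. **Regularity.** $w$ and $f(\cdot;\eta)$ are measurable. For some $\rho\in(0,1)$, $f(s_1,s_0;\cdot)$ is $C^2$ on the ball of radius $\rho$ around $\eta_\tau$, where $|f|$ and all entries of $|\dot f|,|\ddot f|$ are at most $b(s_1,s_0)$; there is $K(u,v)$ with $c(u',v')$, $u(1-u)|\partial_uc(u',v')|$ and $v(1-v)|\partial_vc(u',v')|$ all at most $K(u,v)$ whenever $u,v\in(0,1)$,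 $|u'-u|\le\rho u(1-u)$, $|v'-v|\le\rho v(1-v)$; and $\mathbb E(Y^2)<\infty$, $$\mathbb E\iint w\,\{b^2+\mathbb E(Y^2\mid S=s_1,Z=1,X)+\mathbb E(Y^2\mid S=s_0,Z=0,X)\}\,K(\mathbb F_1(s_1,X),\mathbb F_0(s_0,X))\,p_1(s_1,X)p_0(s_0,X)\,ds_1ds_0<\infty .$$ The matrix $H_\tau$ below is invertible, and $t_1(X)+t_2(S,Z,X)+t_3(Y,S,Z,X)$ below has finite second moments. **Theorem.** The projection parameter of the observed law $P$ is $\eta_\tau$, and its EIF at $P$ exists, is unique up to $P$-null sets, and equals $$\varphi_\tau(V)=H_\tau^{-1}\{t_1(X)+t_2(S,Z,X)+t_3(Y,S,Z,X)\},$$ where $$H_\tau=\mathbb E\Big(w(S_1,S_0)\big[\dot f\dot f^{\mathsf T}-\{\tau(S_1,S_0)-f\}\ddot f\,\big]\Big)\quad\text{with } f,\dot f,\ddot f \text{ at }(S_1,S_0;\eta_\tau),$$ and, with $$\nu(s_1,s_0,x)=w(s_1,s_0)\dot f(s_1,s_0;\eta_\tau)e(s_1,s_0,x)\{\mu_1(s_1,x)-\mu_0(s_0,x)-f(s_1,s_0;\eta_\tau)\},$$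 $$r_u(s_1,s_0,S,x)=1-\frac{\dot c_u}{c}\{1(S\le s_1)-\mathbb F_1(s_1,x)\},\qquad r_v(s_1,s_0,S,x)=1-\frac{\dot c_v}{c}\{1(S\le s_0)-\mathbb F_0(s_0,x)\}$$ ($c$ and its partial derivatives $\dot c_u,\dot c_v$ evaluated at $(\mathbb F_1(s_1,x),\mathbb F_0(s_0,x))$), $$t_1(X)=\iint\nu(s_1,s_0,X)\,ds_1ds_0,$$ $$t_2(S,Z,X)=\frac{Z}{\pi(X)}\Big\{\frac{\int\nu(S,s_0,X)ds_0}{p_1(S,X)}-\iint\nu\, r_u(s_1,s_0,S,X)\,ds_1ds_0\Big\}+\frac{1-Z}{1-\pi(X)}\Big\{\frac{\int\nu(s_1,S,X)ds_1}{p_0(S,X)}-\iint\nu\, r_v(s_1,s_0,S,X)\,ds_1ds_0\Big\},$$ $$t_3(Y,S,Z,X)=\frac{Z}{\pi(X)}\frac{\int w\dot f(S,s_0;\eta_\tau)e(S,s_0,X)ds_0}{p_1(S,X)}\{Y-\mu_1(S,X)\}-\frac{1-Z}{1-\pi(X)}\frac{\int w\dot f(s_1,S;\eta_\tau)e(s_1,S,X)ds_1}{p_0(S,X)}\{Y-\mu_0(S,X)\}.$$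 -/

import Mathlib

open MeasureTheory ProbabilityTheory Filter Topology Set

noncomputable section

namespace PCE

/-! ## Working model -/

/-- The `i`-th component of the gradient `ḟ` of `f : ℝ^q → ℝ` at `η`. -/
def grad {q : ℕ} (f : (Fin q → ℝ) → ℝ) (η : Fin q → ℝ) (i : Fin q) : ℝ :=
  fderiv ℝ f η (Pi.single i 1)

/-- The `(i, j)` entry of the Hessian matrix `f̈` of `f : ℝ^q → ℝ` at `η`. -/
def hess {q : ℕ} (f : (Fin q → ℝ) → ℝ) (η : Fin q → ℝ) (i j : Fin q) : ℝ :=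
  grad (fun η' => grad f η' j) η i

/-! ## Copula -/

/-- The copula `C(u, v)` with density `c`. -/
def copula (c : ℝ → ℝ → ℝ) (u v : ℝ) : ℝ :=
  ∫ r in Ioc 0 u ×ˢ Ioc 0 v, c r.1 r.2

/-- `c` is a continuously differentiable density of a copula, that is, of a distribution function
on the unit square with uniform margins. -/
structure IsCopulaDensity (c : ℝ → ℝ → ℝ) : Prop where
  measurable : Measurable (Function.uncurry c)
  nonneg : ∀ u ∈ Ioo (0 : ℝ) 1, ∀ v ∈ Ioo (0 : ℝ) 1, 0 ≤ c u v
  integrable : IntegrableOn (Function.uncurry c) (Ioc 0 1 ×ˢ Ioc 0 1)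
  margin_fst : ∀ u ∈ Icc (0 : ℝ) 1, copula c u 1 = u
  margin_snd : ∀ v ∈ Icc (0 : ℝ) 1, copula c 1 v = v
  contDiffOn : ContDiffOn ℝ 1 (Function.uncurry c) (Ioo 0 1 ×ˢ Ioo 0 1)

/-- `∂c/∂u`. -/
def cu (c : ℝ → ℝ → ℝ) (u v : ℝ) : ℝ := deriv (fun u' => c u' v) u

/-- `∂c/∂v`. -/
def cv (c : ℝ → ℝ → ℝ) (u v : ℝ) : ℝ := deriv (fun v' => c u v') v

/-! ## Causal model -/

/-- Treatment, potential post-treatment variables, potential outcomes and covariates. The Boolean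
`true` is the treatment arm `1`, and `false` is the control arm `0`. -/
structure Causal (Ω 𝒳 : Type*) where
  Z : Ω → Bool
  S : Bool → Ω → ℝ
  Y : Bool → Ω → ℝ
  X : Ω → 𝒳

/-- The space of the observed data `V = (Y, S, Z, X)`. -/
abbrev Obs (𝒳 : Type*) := ℝ × ℝ × Bool × 𝒳

namespace Causal

variable {Ω 𝒳 : Type*} [MeasurableSpace Ω] [MeasurableSpace 𝒳]

/-- The observed data: `S = S_Z` and `Y = Y_Z`. -/
def obs (D : Causal Ω 𝒳) (ω : Ω) : Obs 𝒳 :=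
  (D.Y (D.Z ω) ω, D.S (D.Z ω) ω, D.Z ω, D.X ω)

/-- The law of the observed data. -/
def obsLaw (D : Causal Ω 𝒳) (Q : Measure Ω) : Measure (Obs 𝒳) := Q.map D.obs

/-- The principal stratum `U = (S₁, S₀)`. -/
def U (D : Causal Ω 𝒳) (ω : Ω) : ℝ × ℝ := (D.S true ω, D.S false ω)

/-- `σ(X)`. -/
@[reducible]
def sigmaX (D : Causal Ω 𝒳) : MeasurableSpace Ω := MeasurableSpace.comap D.X inferInstance

/-- The principal causal effect `τ(S₁, S₀) = E(Y₁ - Y₀ ∣ U)`. -/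
def tau (D : Causal Ω 𝒳) (Q : Measure Ω) : Ω → ℝ :=
  Q[fun ω => D.Y true ω - D.Y false ω | MeasurableSpace.comap D.U inferInstance]

/-- The potential variables are random variables, the potential outcomes have expectations, and
treatment ignorability, principal ignorability and the copula model for `(S₁, S₀)` given `X`
hold. -/
structure IsModel [StandardBorelSpace Ω] (D : Causal Ω 𝒳) (Q : Measure Ω) [IsFiniteMeasure Q]
    (c : ℝ → ℝ → ℝ) : Prop where
  measurable_Z : Measurable D.Z
  measurable_S : ∀ z, Measurable (D.S z)
  measurable_Y : ∀ z, Measurable (D.Y z)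
  measurable_X : Measurable D.X
  integrable_Y : ∀ z, Integrable (D.Y z) Q
  /-- `Z ⫫ (S₀, S₁, Y₀, Y₁) ∣ X` -/
  treatment_ignorability : CondIndepFun D.sigmaX (measurable_X.comap_le) D.Z
    (fun ω => (D.S false ω, D.S true ω, D.Y false ω, D.Y true ω)) Q
  /-- `E(Y_z ∣ U, X)` depends on `(S₁, S₀, X)` only through `(S_z, X)`. -/
  principal_ignorability : ∀ z, ∃ m : ℝ → 𝒳 → ℝ, Measurable (Function.uncurry m) ∧
    Q[D.Y z | MeasurableSpace.comap (fun ω => (D.U ω, D.X ω)) inferInstance]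
      =ᵐ[Q] fun ω => m (D.S z ω) (D.X ω)
  /-- `P(S₁ ≤ s₁, S₀ ≤ s₀ ∣ X) = C{P(S₁ ≤ s₁ ∣ X), P(S₀ ≤ s₀ ∣ X)}` -/
  copula_model : ∀ s₁ s₀ : ℝ,
    Q⟦{ω | D.S true ω ≤ s₁ ∧ D.S false ω ≤ s₀} | D.sigmaX⟧ =ᵐ[Q] fun ω =>
      copula c ((Q⟦{ω | D.S true ω ≤ s₁} | D.sigmaX⟧) ω) ((Q⟦{ω | D.S false ω ≤ s₀} | D.sigmaX⟧) ω)

/-- `E[w(S₁, S₀) {τ(S₁, S₀) - f(S₁, S₀; η)}²]`, with values in `[0, ∞]`. -/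
def objective {q : ℕ} (D : Causal Ω 𝒳) (Q : Measure Ω) (w : ℝ → ℝ → ℝ)
    (f : ℝ → ℝ → (Fin q → ℝ) → ℝ) (η : Fin q → ℝ) : ENNReal :=
  ∫⁻ ω, ENNReal.ofReal (w (D.S true ω) (D.S false ω) *
    (D.tau Q ω - f (D.S true ω) (D.S false ω) η) ^ 2) ∂Q

/-- `η` is the projection parameter: the unique minimizer of the objective over `ℝ^q`. -/
def IsProjection {q : ℕ} (D : Causal Ω 𝒳) (Q : Measure Ω) (w : ℝ → ℝ → ℝ)
    (f : ℝ → ℝ → (Fin q → ℝ) → ℝ) (η : Fin q → ℝ) : Prop :=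
  D.objective Q w f η < ⊤ ∧ ∀ η', η' ≠ η → D.objective Q w f η < D.objective Q w f η'

/-- `H = E(w(S₁, S₀) [ḟ ḟᵀ - {τ(S₁, S₀) - f} f̈])`, with `f` and its derivatives taken at
`(S₁, S₀; η)`. -/
def H {q : ℕ} (D : Causal Ω 𝒳) (Q : Measure Ω) (w : ℝ → ℝ → ℝ)
    (f : ℝ → ℝ → (Fin q → ℝ) → ℝ) (η : Fin q → ℝ) : Matrix (Fin q) (Fin q) ℝ :=
  Matrix.of fun i j => ∫ ω, w (D.S true ω) (D.S false ω) *
    (grad (f (D.S true ω) (D.S false ω)) η i * grad (f (D.S true ω) (D.S false ω)) η j -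
      (D.tau Q ω - f (D.S true ω) (D.S false ω) η) *
        hess (f (D.S true ω) (D.S false ω)) η i j) ∂Q

end Causal

/-! ## Nuisance functions of an observed law -/

variable {𝒳 : Type*}

/-- The treatment probability `π(x)`, the conditional densities `p_z(s, x)` and the outcome means
`μ_z(s, x)`. -/
structure Nuisance (𝒳 : Type*) where
  π : 𝒳 → ℝ
  p : Bool → ℝ → 𝒳 → ℝ
  μ : Bool → ℝ → 𝒳 → ℝ

/-- The marginal law of `X`. -/
def lawX [MeasurableSpace 𝒳] (P : Measure (Obs 𝒳)) : Measure 𝒳 := P.map fun v => v.2.2.2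

/-- `m z s x` is a version of `E{h(Y) ∣ S = s, Z = z, X = x}` under `P`. -/
def IsCondMean [MeasurableSpace 𝒳] (P : Measure (Obs 𝒳)) (h : ℝ → ℝ)
    (m : Bool → ℝ → 𝒳 → ℝ) : Prop :=
  (∀ z, Measurable (Function.uncurry (m z))) ∧ Integrable (fun v : Obs 𝒳 => h v.1) P ∧
    P[fun v : Obs 𝒳 => h v.1 | MeasurableSpace.comap (fun v : Obs 𝒳 => v.2) inferInstance]
      =ᵐ[P] fun v => m v.2.2.1 v.2.1 v.2.2.2

namespace Nuisance

/-- `P(Z = z ∣ X = x)`. -/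
def prob (N : Nuisance 𝒳) (z : Bool) (x : 𝒳) : ℝ := if z then N.π x else 1 - N.π x

/-- `F_z(s, x)`. -/
def F (N : Nuisance 𝒳) (z : Bool) (s : ℝ) (x : 𝒳) : ℝ := ∫ t in Iic s, N.p z t x

/-- The principal density `e(s₁, s₀, x) = c(F₁(s₁, x), F₀(s₀, x)) p₁(s₁, x) p₀(s₀, x)`. -/
def e (N : Nuisance 𝒳) (c : ℝ → ℝ → ℝ) (s₁ s₀ : ℝ) (x : 𝒳) : ℝ :=
  c (N.F true s₁ x) (N.F false s₀ x) * N.p true s₁ x * N.p false s₀ x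

end Nuisance

variable [MeasurableSpace 𝒳]

/-- `N` consists of versions of the nuisance functions of the observed law `P`; in particular
`0 < π(X) < 1` almost surely. -/
structure IsNuisance (P : Measure (Obs 𝒳)) (N : Nuisance 𝒳) : Prop where
  measurable_π : Measurable N.π
  overlap : ∀ᵐ x ∂lawX P, 0 < N.π x ∧ N.π x < 1
  treatment : P⟦{v : Obs 𝒳 | v.2.2.1 = true} |
    MeasurableSpace.comap (fun v : Obs 𝒳 => v.2.2.2) inferInstance⟧ =ᵐ[P] fun v => N.π v.2.2.2
  measurable_p : ∀ z, Measurable (Function.uncurry (N.p z))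
  nonneg_p : ∀ z s x, 0 ≤ N.p z s x
  density : ∀ z, ∀ A : Set 𝒳, MeasurableSet A → ∀ B : Set ℝ, MeasurableSet B →
    P {v | v.2.1 ∈ B ∧ v.2.2.1 = z ∧ v.2.2.2 ∈ A} =
      ∫⁻ x in A, (ENNReal.ofReal (N.prob z x) *
        ∫⁻ s in B, ENNReal.ofReal (N.p z s x)) ∂lawX P
  outcome : IsCondMean P (fun y => y) N.μ

/-! ## The projection parameter of an observed law -/

/-- The marginal principal density `e(s₁, s₀) = E{e(s₁, s₀, X)}`. -/
def eMarg (P : Measure (Obs 𝒳)) (N : Nuisance 𝒳) (c : ℝ → ℝ → ℝ) (s₁ s₀ : ℝ) : ℝ :=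
  ∫ x, N.e c s₁ s₀ x ∂lawX P

/-- The identified principal causal effect surface
`τ(s₁, s₀) = E[{e(s₁, s₀, X) / e(s₁, s₀)} {μ₁(s₁, X) - μ₀(s₀, X)}]`. -/
def tauObs (P : Measure (Obs 𝒳)) (N : Nuisance 𝒳) (c : ℝ → ℝ → ℝ) (s₁ s₀ : ℝ) : ℝ :=
  ∫ x, N.e c s₁ s₀ x / eMarg P N c s₁ s₀ * (N.μ true s₁ x - N.μ false s₀ x) ∂lawX P

/-- `∬ w(s₁, s₀) {τ(s₁, s₀) - f(s₁, s₀; η)}² e(s₁, s₀) ds₁ ds₀`, with values in `[0, ∞]`. -/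
def objectiveObs {q : ℕ} (P : Measure (Obs 𝒳)) (N : Nuisance 𝒳) (c w : ℝ → ℝ → ℝ)
    (f : ℝ → ℝ → (Fin q → ℝ) → ℝ) (η : Fin q → ℝ) : ENNReal :=
  ∫⁻ r : ℝ × ℝ, ENNReal.ofReal
    (w r.1 r.2 * (tauObs P N c r.1 r.2 - f r.1 r.2 η) ^ 2 * eMarg P N c r.1 r.2)

/-- `η` is the unique minimizer over `B` of the objective of the observed law `P`. For `B = univ`
it is the projection parameter of `P`. -/
def IsProjectionOn {q : ℕ} (c w : ℝ → ℝ → ℝ) (f : ℝ → ℝ → (Fin q → ℝ) → ℝ)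
    (B : Set (Fin q → ℝ)) (P : Measure (Obs 𝒳)) (η : Fin q → ℝ) : Prop :=
  ∃ N : Nuisance 𝒳, IsNuisance P N ∧ η ∈ B ∧ objectiveObs P N c w f η < ⊤ ∧
    ∀ η' ∈ B, η' ≠ η → objectiveObs P N c w f η < objectiveObs P N c w f η'

/-! ## Submodels, tangent space and efficient influence function -/

/-- `θ ↦ Pθ θ` is, for `θ` near `0`, a one-dimensional submodel through `P` at `θ = 0` with density
ratios `g θ = dPθ / dP` that are differentiable in `θ` at `0`, with bounded difference quotients
there, and `s` is its score. As `g 0 = 1`, the score `∂ log g / ∂θ` at `θ = 0` is `∂g / ∂θ`. -/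
def IsSubmodel (P : Measure (Obs 𝒳)) (Pθ : ℝ → Measure (Obs 𝒳)) (s : Obs 𝒳 → ℝ) : Prop :=
  Measurable s ∧ ∃ (g : ℝ → Obs 𝒳 → ℝ) (K : ℝ),
    (∀ θ, Measurable (g θ)) ∧
    (∀ᶠ θ in 𝓝 (0 : ℝ), IsProbabilityMeasure (Pθ θ) ∧
      Pθ θ = P.withDensity (fun v => ENNReal.ofReal (g θ v)) ∧
      ∀ᵐ v ∂P, |g θ v - 1| ≤ K * |θ|) ∧
    ∀ᵐ v ∂P, HasDerivAt (fun θ => g θ v) (s v) 0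

/-- The tangent space at `P` of the nonparametric model: the closed linear span in `L²(P)` of the
scores of all submodels. -/
def tangentSpace (P : Measure (Obs 𝒳)) : Submodule ℝ (Lp ℝ 2 P) :=
  (Submodule.span ℝ {h : Lp ℝ 2 P | ∃ Pθ s, IsSubmodel P Pθ s ∧ h =ᵐ[P] s}).topologicalClosure

/-- `θ ↦ ηθ θ` is a curve through `η` at `θ = 0`, continuous there, of projection parameters of the
laws `Pθ θ`. The minimization runs over a fixed neighbourhood `B` of `η`, such as `B = univ`. -/
def IsProjectionCurve {q : ℕ} (c w : ℝ → ℝ → ℝ) (f : ℝ → ℝ → (Fin q → ℝ) → ℝ)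
    (η : Fin q → ℝ) (Pθ : ℝ → Measure (Obs 𝒳)) (ηθ : ℝ → Fin q → ℝ) : Prop :=
  ηθ 0 = η ∧ ContinuousAt ηθ 0 ∧
    ∃ B ∈ 𝓝 η, ∀ᶠ θ in 𝓝 (0 : ℝ), IsProjectionOn c w f B (Pθ θ) (ηθ θ)

/-- `φ` is an efficient influence function at `P` of the projection parameter: its components
belong to the tangent space, and along every submodel the projection parameter is defined and has
derivative `E{φ(V) s(V)}` at `θ = 0`. -/
structure IsEIF {q : ℕ} (c w : ℝ → ℝ → ℝ) (f : ℝ → ℝ → (Fin q → ℝ) → ℝ)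
    (P : Measure (Obs 𝒳)) (η : Fin q → ℝ) (φ : Obs 𝒳 → Fin q → ℝ) : Prop where
  mem_tangentSpace : ∀ i, ∃ h ∈ tangentSpace P, h =ᵐ[P] fun v => φ v i
  exists_curve : ∀ Pθ s, IsSubmodel P Pθ s → ∃ ηθ, IsProjectionCurve c w f η Pθ ηθ
  hasDerivAt : ∀ Pθ s, IsSubmodel P Pθ s → ∀ ηθ, IsProjectionCurve c w f η Pθ ηθ →
    HasDerivAt ηθ (fun i => ∫ v, φ v i * s v ∂P) 0

/-! ## Regularity -/

/-- Smoothness of the working model near `η`, and finiteness of second moments under a local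
envelope `K` of the copula density and its first derivatives, `b` of the working model and its first
two derivatives, and `m z s x = E(Y² ∣ S = s, Z = z, X = x)`. -/
structure IsRegular {q : ℕ} (c w : ℝ → ℝ → ℝ) (f : ℝ → ℝ → (Fin q → ℝ) → ℝ)
    (P : Measure (Obs 𝒳)) (N : Nuisance 𝒳) (η : Fin q → ℝ) : Prop where
  measurable_w : Measurable (Function.uncurry w)
  nonneg_w : ∀ s₁ s₀, 0 ≤ w s₁ s₀
  measurable_f : ∀ η', Measurable fun r : ℝ × ℝ => f r.1 r.2 η'
  envelope : ∃ (ρ : ℝ) (K b : ℝ → ℝ → ℝ) (m : Bool → ℝ → 𝒳 → ℝ),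
    0 < ρ ∧ ρ < 1 ∧
    Measurable (Function.uncurry K) ∧ Measurable (Function.uncurry b) ∧
    (∀ s₁ s₀, ContDiffOn ℝ 2 (f s₁ s₀) (Metric.ball η ρ)) ∧
    (∀ s₁ s₀, ∀ η' ∈ Metric.ball η ρ, |f s₁ s₀ η'| ≤ b s₁ s₀ ∧
      (∀ i, |grad (f s₁ s₀) η' i| ≤ b s₁ s₀) ∧ ∀ i j, |hess (f s₁ s₀) η' i j| ≤ b s₁ s₀) ∧
    (∀ u ∈ Ioo (0 : ℝ) 1, ∀ v ∈ Ioo (0 : ℝ) 1, ∀ u' v' : ℝ,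
      |u' - u| ≤ ρ * (u * (1 - u)) → |v' - v| ≤ ρ * (v * (1 - v)) →
      c u' v' ≤ K u v ∧ u * (1 - u) * |cu c u' v'| ≤ K u v ∧
        v * (1 - v) * |cv c u' v'| ≤ K u v) ∧
    IsCondMean P (fun y => y ^ 2) m ∧
    Integrable (fun a : 𝒳 × ℝ × ℝ => w a.2.1 a.2.2 *
      (b a.2.1 a.2.2 ^ 2 + m true a.2.1 a.1 + m false a.2.2 a.1) *
      K (N.F true a.2.1 a.1) (N.F false a.2.2 a.1) *
      N.p true a.2.1 a.1 * N.p false a.2.2 a.1) ((lawX P).prod volume)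

/-! ## The terms of the efficient influence function -/

section Terms

variable {q : ℕ} (c w : ℝ → ℝ → ℝ) (f : ℝ → ℝ → (Fin q → ℝ) → ℝ) (N : Nuisance 𝒳) (η : Fin q → ℝ)

/-- `ν(s₁, s₀, x) = w ḟ e(s₁, s₀, x) {μ₁(s₁, x) - μ₀(s₀, x) - f}`. -/
def nu (s₁ s₀ : ℝ) (x : 𝒳) (i : Fin q) : ℝ :=
  w s₁ s₀ * grad (f s₁ s₀) η i * N.e c s₁ s₀ x *
    (N.μ true s₁ x - N.μ false s₀ x - f s₁ s₀ η)

/-- `r_u(s₁, s₀, s, x) = 1 - (ċ_u / c) {1(s ≤ s₁) - F₁(s₁, x)}`. -/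
def ru (s₁ s₀ s : ℝ) (x : 𝒳) : ℝ :=
  1 - cu c (N.F true s₁ x) (N.F false s₀ x) / c (N.F true s₁ x) (N.F false s₀ x) *
    ((if s ≤ s₁ then 1 else 0) - N.F true s₁ x)

/-- `r_v(s₁, s₀, s, x) = 1 - (ċ_v / c) {1(s ≤ s₀) - F₀(s₀, x)}`. -/
def rv (s₁ s₀ s : ℝ) (x : 𝒳) : ℝ :=
  1 - cv c (N.F true s₁ x) (N.F false s₀ x) / c (N.F true s₁ x) (N.F false s₀ x) *
    ((if s ≤ s₀ then 1 else 0) - N.F false s₀ x)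

/-- The weight `Z / π(X)`. -/
def ipw1 (z : Bool) (x : 𝒳) : ℝ := (if z then 1 else 0) / N.π x

/-- The weight `(1 - Z) / {1 - π(X)}`. -/
def ipw0 (z : Bool) (x : 𝒳) : ℝ := (if z then 0 else 1) / (1 - N.π x)

/-- `t₁(X)`. -/
def t1 (x : 𝒳) (i : Fin q) : ℝ := ∫ r : ℝ × ℝ, nu c w f N η r.1 r.2 x i

/-- `t₂(S, Z, X)`. -/
def t2 (s : ℝ) (z : Bool) (x : 𝒳) (i : Fin q) : ℝ :=
  ipw1 N z x * ((∫ s₀, nu c w f N η s s₀ x i) / N.p true s x -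
      ∫ r : ℝ × ℝ, nu c w f N η r.1 r.2 x i * ru c N r.1 r.2 s x) +
    ipw0 N z x * ((∫ s₁, nu c w f N η s₁ s x i) / N.p false s x -
      ∫ r : ℝ × ℝ, nu c w f N η r.1 r.2 x i * rv c N r.1 r.2 s x)

/-- `t₃(Y, S, Z, X)`. -/
def t3 (y s : ℝ) (z : Bool) (x : 𝒳) (i : Fin q) : ℝ :=
  ipw1 N z x * ((∫ s₀, w s s₀ * grad (f s s₀) η i * N.e c s s₀ x) / N.p true s x) *
      (y - N.μ true s x) -
    ipw0 N z x * ((∫ s₁, w s₁ s * grad (f s₁ s) η i * N.e c s₁ s x) / N.p false s x) *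
      (y - N.μ false s x)

/-- `t₁(X) + t₂(S, Z, X) + t₃(Y, S, Z, X)` at `v = (y, s, z, x)`. -/
def tSum (v : Obs 𝒳) (i : Fin q) : ℝ :=
  t1 c w f N η v.2.2.2 i + t2 c w f N η v.2.1 v.2.2.1 v.2.2.2 i +
    t3 c w f N η v.1 v.2.1 v.2.2.1 v.2.2.2 i

end Terms

end PCE

end

/-! Expanding the square in the objective of an observed law leaves a term free of `η` and a part in
which the effect surface occurs only linearly. Multiplied by the marginal principal density, that
surface is an average over `X` of `e` times the contrast `μ₁ - μ₀`, so the quotient in its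
definition disappears. Up to an affine change the objective is therefore a weighted least squares
functional `∫ (f² a / 2 - f d)` with weights explicit in the nuisance functions (`objectiveObs_eq`).
For a law with density ratio `g` relative to `P` the nuisance functions are those of `P` reweighted
by conditional means of `g` (`IsNuisance.tilt`), and all objectives along a submodel become
integrals against the one measure `T P N`, with weights `wA` and `wD` (`objectiveObs_tilt`).

The analytic core is the domination of these weights. A bounded reweighting of a density changes the
mass `F` below a point and the mass `1 - F` above it each in proportion to itself, so the normalized
distribution function moves by at most a multiple of `|θ| F (1 - F)` (`RatioPath.abs_F_sub_le`).
This is the rate that the local envelope `K` of the copula density tolerates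
(`IsCopulaDensity.pathBound`). `PathBound` carries Lipschitz bounds relative to an envelope through
products, and the moment condition makes the resulting envelope integrable
(`Envelope.leastSquares`).

A dominated least squares family has Hessians jointly continuous at `(0, η)`. The limit is
semidefinite because `η` is a minimizer and definite because it is invertible, so the gradients are
strongly monotone near `η`. Hence local minimizers exist, are unique and converge to `η`
(`SmoothFamily.exists_curve`), and linearizing the equation "gradient = 0" gives their derivative
`A⁻¹ g'` (`SmoothFamily.hasDerivAt_of_isLocalMin`).

The vector `g'` has to be written as a mean of `tSum` times the score. Differentiating the weights
produces conditional means of the score, the derivatives `Fdot` of the distribution functions and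
conditional covariances of `Y` with the score; inverse probability weighting and Fubini's theorem
express each as an integral against `P` (`Envelope.sameIntegral_tSum_mul`). The tangent space
contains every centred square integrable function, so it contains the candidate, and scores separate
its elements, which gives uniqueness.

The causal assumptions enter through identification: treatment ignorability gives the law of `(X,
S_z)`, the copula then gives the law of `(X, S₁, S₀)` (`map_XU`), and principal ignorability gives
the outcome means (`condExp_Y`). The causal objective and `H` thereby agree with those of the
observed law. -/

namespace PCE

/-! ## Curves of minimizers of a smooth family of functions -/

/-- The linear functional `x ↦ g ⬝ᵥ x`. -/
noncomputable def dotL {q : ℕ} (g : Fin q → ℝ) : (Fin q → ℝ) →L[ℝ] ℝ :=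
  ∑ i, g i • ContinuousLinearMap.proj (R := ℝ) (φ := fun _ : Fin q => ℝ) i

lemma dotL_apply {q : ℕ} (g x : Fin q → ℝ) : dotL g x = g ⬝ᵥ x := by
  simp [dotL, dotProduct]

lemma abs_dotProduct_le {q : ℕ} (g x : Fin q → ℝ) : |g ⬝ᵥ x| ≤ q * (‖g‖ * ‖x‖) := by
  calc |g ⬝ᵥ x| ≤ ∑ i, |g i * x i| := Finset.abs_sum_le_sum_abs _ _
    _ ≤ ∑ _i : Fin q, ‖g‖ * ‖x‖ := by
        refine Finset.sum_le_sum fun i _ => ?_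
        rw [abs_mul]
        exact mul_le_mul (norm_le_pi_norm g i) (norm_le_pi_norm x i) (abs_nonneg _) (norm_nonneg _)
    _ = q * (‖g‖ * ‖x‖) := by simp

lemma norm_dotL_le {q : ℕ} (g : Fin q → ℝ) : ‖dotL g‖ ≤ q * ‖g‖ := by
  refine ContinuousLinearMap.opNorm_le_bound _ (by positivity) fun x => ?_
  rw [dotL_apply, Real.norm_eq_abs, mul_assoc]
  exact abs_dotProduct_le g x

/-- A family of functions `L θ` with gradients `G θ` and Hessians `DG θ` near `η`, jointly
continuous at `(0, η)` with limit `A`; the gradient at `η` has derivative `-g'` in `θ`. -/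
structure SmoothFamily {q : ℕ} (L : ℝ → (Fin q → ℝ) → ℝ) (G : ℝ → (Fin q → ℝ) → Fin q → ℝ)
    (DG : ℝ → (Fin q → ℝ) → Matrix (Fin q) (Fin q) ℝ) (η : Fin q → ℝ)
    (A : Matrix (Fin q) (Fin q) ℝ) (g' : Fin q → ℝ) (r : ℝ) : Prop where
  pos : 0 < r
  deriv_L : ∀ θ : ℝ, |θ| < r → ∀ x ∈ Metric.ball η r, HasFDerivAt (L θ) (dotL (G θ x)) x
  deriv_G : ∀ θ : ℝ, |θ| < r → ∀ x ∈ Metric.ball η r, ∀ j,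
    HasFDerivAt (fun y => G θ y j) (dotL fun i => DG θ x i j) x
  tendsto_DG : ∀ i j, Tendsto (fun p : ℝ × (Fin q → ℝ) => DG p.1 p.2 i j) (𝓝 (0, η)) (𝓝 (A i j))
  symm : A.IsSymm
  deriv_score : HasDerivAt (fun θ => G θ η) (-g') 0
  isLocalMin : IsLocalMin (L 0) η

namespace SmoothFamily

variable {q : ℕ} {L : ℝ → (Fin q → ℝ) → ℝ} {G : ℝ → (Fin q → ℝ) → Fin q → ℝ}
  {DG : ℝ → (Fin q → ℝ) → Matrix (Fin q) (Fin q) ℝ} {η : Fin q → ℝ}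
  {A : Matrix (Fin q) (Fin q) ℝ} {g' : Fin q → ℝ} {r : ℝ}

/-- The mean value inequality on a ball where all Hessians are entrywise close to `A`: the gradients
are strictly differentiable at `η`, uniformly in small `θ`. Monotonicity and the derivative of the
curve both rest on this estimate. -/
lemma strict (h : SmoothFamily L G DG η A g' r) {ε : ℝ} (hε : 0 < ε) :
    ∃ δ > 0, δ ≤ r ∧ ∀ θ : ℝ, |θ| < δ → ∀ x ∈ Metric.ball η δ, ∀ y ∈ Metric.ball η δ,
      ‖G θ y - G θ x - A.mulVec (y - x)‖ ≤ ε * ‖y - x‖ := by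
  have hq : (0 : ℝ) < q + 1 := by positivity
  -- `norm_dotL_le` loses a factor `q` in passing from entries to the operator norm; division by `q
  -- + 1` absorbs it and makes sense for `q = 0`.
  have h1 : ∀ᶠ p : ℝ × (Fin q → ℝ) in 𝓝 (0, η), ∀ i j, |DG p.1 p.2 i j - A i j| < ε / (q + 1) := by
    rw [eventually_all]; intro i
    rw [eventually_all]; intro j
    have := (h.tendsto_DG i j).eventually (Metric.ball_mem_nhds _ (div_pos hε hq))
    filter_upwards [this] with p hp
    simpa [Real.dist_eq] using hp
  obtain ⟨δ, hδ, hb⟩ := Metric.eventually_nhds_iff_ball.1 h1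
  refine ⟨min δ r, lt_min hδ h.pos, min_le_right _ _, fun θ hθ x hx y hy => ?_⟩
  rw [pi_norm_le_iff_of_nonneg (by positivity)]
  intro j
  have hconv : Convex ℝ (Metric.ball η (min δ r)) := convex_ball _ _
  have key := hconv.norm_image_sub_le_of_norm_hasFDerivWithin_le'
    (f := fun y => G θ y j) (f' := fun x => dotL fun i => DG θ x i j)
    (φ := dotL fun i => A i j) (C := ε) (x := x) (y := y)
    (fun z hz => (h.deriv_G θ (hθ.trans_le (min_le_right _ _)) z
      (Metric.ball_subset_ball (min_le_right _ _) hz) j).hasFDerivWithinAt)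
    (fun z hz => by
      have e1 : (dotL fun i => DG θ z i j) - (dotL fun i => A i j) =
          dotL fun i => DG θ z i j - A i j := by
        ext v; simp [dotL_apply, dotProduct, sub_mul]
      rw [e1]
      refine (norm_dotL_le _).trans ?_
      have : ‖fun i => DG θ z i j - A i j‖ ≤ ε / (q + 1) := by
        rw [pi_norm_le_iff_of_nonneg (by positivity)]
        intro i
        refine (hb (θ, z) ?_ i j).le
        rw [Metric.mem_ball, Prod.dist_eq]
        refine max_lt ?_ ?_
        · simpa [Real.dist_eq] using hθ.trans_le (min_le_left _ _)
        · exact (Metric.mem_ball.1 hz).trans_le (min_le_left _ _)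
      calc (q : ℝ) * _ ≤ q * (ε / (q + 1)) := by gcongr
        _ ≤ ε := by rw [mul_div_assoc', div_le_iff₀ hq]; nlinarith) hx hy
  -- Component `j` of the gradient is differentiated into column `j` of `A`; symmetry exchanges it
  -- for the row used by `mulVec`.
  have e2 : (dotL fun i => A i j) (y - x) = A.mulVec (y - x) j := by
    rw [dotL_apply, Matrix.mulVec]
    congr 1
    ext i; exact h.symm.apply _ _
  rw [e2] at key
  simpa using key

lemma score_zero (h : SmoothFamily L G DG η A g' r) : G 0 η = 0 := by
  have := h.isLocalMin.hasFDerivAt_eq_zero (h.deriv_L 0 (by simpa using h.pos) η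
    (Metric.mem_ball_self h.pos))
  ext i
  have h2 := congrArg (fun l => l (Pi.single i 1)) this
  simpa [dotL_apply] using h2

/-- If `v ⬝ᵥ A v < 0`, the gradient at `η + u v` is close to `u A v`, so its pairing with `v` is
negative for all small `u > 0`; but minimality and the mean value theorem produce a small `u` at
which it is nonnegative. -/
lemma posSemidef (h : SmoothFamily L G DG η A g' r) (v : Fin q → ℝ) :
    0 ≤ v ⬝ᵥ A.mulVec v := by
  by_contra! hneg
  set B := -(v ⬝ᵥ A.mulVec v) with hB
  have hBpos : 0 < B := by linarith
  -- Makes the linearization error, paired with `v`, at most `u B / 2`.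
  set ε := B / (2 * (q * (‖v‖ * ‖v‖) + 1)) with hεd
  have hε : 0 < ε := by positivity
  obtain ⟨δ, hδ, hδr, hs⟩ := h.strict hε
  have hcont : Tendsto (fun t : ℝ => η + t • v) (𝓝 0) (𝓝 η) := by
    have : Continuous fun t : ℝ => η + t • v := by fun_prop
    simpa using this.tendsto 0
  have hev : ∀ᶠ t : ℝ in 𝓝 0, L 0 η ≤ L 0 (η + t • v) ∧ η + t • v ∈ Metric.ball η δ :=
    (hcont.eventually h.isLocalMin).and (hcont.eventually (Metric.ball_mem_nhds _ hδ))
  obtain ⟨t₀, ht₀, hb⟩ := Metric.eventually_nhds_iff_ball.1 hev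
  set t := t₀ / 2
  have htpos : 0 < t := by positivity
  have hmem : ∀ u ∈ Icc (0 : ℝ) t, u ∈ Metric.ball (0 : ℝ) t₀ := by
    intro u hu
    rw [Metric.mem_ball, Real.dist_eq, sub_zero, abs_of_nonneg hu.1]
    have : t < t₀ := half_lt_self ht₀
    linarith [hu.2]
  have hd : ∀ u ∈ Icc (0 : ℝ) t, HasDerivAt (fun u : ℝ => L 0 (η + u • v))
      (G 0 (η + u • v) ⬝ᵥ v) u := by
    intro u hu
    have h1 := h.deriv_L 0 (by simpa using h.pos) (η + u • v)
      (Metric.ball_subset_ball hδr (hb u (hmem u hu)).2)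
    have h2 : HasDerivAt (fun u : ℝ => η + u • v) v u := by
      simpa using ((hasDerivAt_id u).smul_const v).const_add η
    have h3 := h1.comp_hasDerivAt u h2
    rw [dotL_apply] at h3
    exact h3
  obtain ⟨u, hu, hslope⟩ := exists_hasDerivAt_eq_slope (fun u : ℝ => L 0 (η + u • v)) _ htpos
    (fun u hu => (hd u hu).continuousAt.continuousWithinAt)
    (fun u hu => hd u ⟨hu.1.le, hu.2.le⟩)
  have hge : 0 ≤ G 0 (η + u • v) ⬝ᵥ v := by
    rw [hslope]
    apply div_nonneg _ (by linarith)
    have := (hb t (hmem t ⟨htpos.le, le_rfl⟩)).1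
    simpa using this
  have hu' : u ∈ Icc (0 : ℝ) t := ⟨hu.1.le, hu.2.le⟩
  have h4 := hs 0 (by simpa using hδ) η (Metric.mem_ball_self hδ) (η + u • v) (hb u (hmem u hu')).2
  rw [h.score_zero] at h4
  simp only [sub_zero, add_sub_cancel_left] at h4
  have h5 := abs_dotProduct_le (G 0 (η + u • v) - A.mulVec (u • v)) v
  have h6 : (q : ℝ) * (‖G 0 (η + u • v) - A.mulVec (u • v)‖ * ‖v‖) ≤ u * (B / 2) := by
    calc (q : ℝ) * (‖G 0 (η + u • v) - A.mulVec (u • v)‖ * ‖v‖) ≤ q * ((ε * ‖u • v‖) * ‖v‖) := by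
          gcongr
      _ = u * (ε * (q * (‖v‖ * ‖v‖))) := by
          rw [norm_smul, Real.norm_eq_abs, abs_of_pos hu.1]; ring
      _ ≤ u * (B / 2) := by
          gcongr
          · exact hu.1.le
          rw [hεd, div_mul_eq_mul_div, div_le_iff₀ (by positivity)]
          nlinarith
  have h7 := (abs_le.1 (h5.trans h6)).2
  rw [sub_dotProduct, Matrix.mulVec_smul, smul_dotProduct, dotProduct_comm _ v, smul_eq_mul,
    dotProduct_comm _ v] at h7
  rw [dotProduct_comm] at hge
  nlinarith [hu.1, mul_pos hu.1 hBpos]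

/-- An invertible semidefinite matrix is definite, and compactness of the unit sphere of the
supremum norm turns this into a coercivity constant. For `q = 0` the sphere is empty, hence the
separate case. -/
lemma posDef (h : SmoothFamily L G DG η A g' r) (hA : IsUnit A.det) :
    ∃ l > 0, ∀ v : Fin q → ℝ, l * ‖v‖ ^ 2 ≤ v ⬝ᵥ A.mulVec v := by
  have hpsd : A.PosSemidef := by
    refine Matrix.PosSemidef.of_dotProduct_mulVec_nonneg ?_ fun v => ?_
    · ext i j; simpa using h.symm.apply i j
    · simpa using h.posSemidef v
  have hpd : A.PosDef := by
    have : IsUnit A := (Matrix.isUnit_iff_isUnit_det A).2 hA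
    exact hpsd.posDef_iff_isUnit.2 this
  rcases Nat.eq_zero_or_pos q with hq | hq
  · subst hq
    exact ⟨1, one_pos, fun v => by simp [Subsingleton.elim v 0]⟩
  · have : Nonempty (Fin q) := ⟨⟨0, hq⟩⟩
    have hne : (Metric.sphere (0 : Fin q → ℝ) 1).Nonempty := by
      refine ⟨fun _ => 1, ?_⟩
      simp [pi_norm_const]
    have hc : Continuous fun v : Fin q → ℝ => v ⬝ᵥ A.mulVec v := by
      simp only [dotProduct, Matrix.mulVec]
      fun_prop
    obtain ⟨v₀, hv₀, hmin⟩ := (isCompact_sphere (0 : Fin q → ℝ) 1).exists_isMinOn hne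
      hc.continuousOn
    have hv₀0 : v₀ ≠ 0 := by
      rintro rfl; simp at hv₀
    refine ⟨v₀ ⬝ᵥ A.mulVec v₀, by simpa using hpd.dotProduct_mulVec_pos hv₀0, fun v => ?_⟩
    by_cases hv : v = 0
    · simp [hv]
    have hn : 0 < ‖v‖ := norm_pos_iff.2 hv
    have := hmin (show (‖v‖⁻¹ • v) ∈ Metric.sphere (0 : Fin q → ℝ) 1 by
      simp [norm_smul, hn.ne'])
    simp only [mem_ofPred_eq, Matrix.mulVec_smul, smul_dotProduct, dotProduct_smul,
      smul_eq_mul] at this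
    calc v₀ ⬝ᵥ A.mulVec v₀ * ‖v‖ ^ 2 ≤ (‖v‖⁻¹ * (‖v‖⁻¹ * (v ⬝ᵥ A.mulVec v))) * ‖v‖ ^ 2 := by
          gcongr
      _ = v ⬝ᵥ A.mulVec v := by field_simp

/-- Strong monotonicity of the gradients near `(0, η)`. -/
lemma strong_mono (h : SmoothFamily L G DG η A g' r) (hA : IsUnit A.det) :
    ∃ l > 0, ∃ δ > 0, δ ≤ r ∧ ∀ θ : ℝ, |θ| < δ → ∀ x ∈ Metric.ball η δ, ∀ y ∈ Metric.ball η δ,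
      l * ‖y - x‖ ^ 2 ≤ (G θ y - G θ x) ⬝ᵥ (y - x) := by
  obtain ⟨l, hl, hpd⟩ := h.posDef hA
  -- With this `ε` the linearization error uses up at most half of the coercivity constant.
  obtain ⟨δ, hδ, hδr, hs⟩ := h.strict (ε := l / (2 * (q + 1))) (by positivity)
  refine ⟨l / 2, by positivity, δ, hδ, hδr, fun θ hθ x hx y hy => ?_⟩
  have h1 := hs θ hθ x hx y hy
  have h2 := abs_dotProduct_le (G θ y - G θ x - A.mulVec (y - x)) (y - x)
  have h3 : (q : ℝ) * (‖G θ y - G θ x - A.mulVec (y - x)‖ * ‖y - x‖) ≤ l / 2 * ‖y - x‖ ^ 2 := by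
    calc _ ≤ (q : ℝ) * ((l / (2 * (q + 1)) * ‖y - x‖) * ‖y - x‖) := by gcongr
      _ = (q / (q + 1)) * (l / 2 * ‖y - x‖ ^ 2) := by field_simp
      _ ≤ 1 * (l / 2 * ‖y - x‖ ^ 2) := by
          gcongr
          rw [div_le_one (by positivity)]; linarith
      _ = _ := one_mul _
  have h4 := (abs_le.1 (h2.trans h3)).1
  rw [sub_dotProduct, dotProduct_comm (A.mulVec _)] at h4
  have := hpd (y - x)
  linarith

/-- A curve of local minimizers that is continuous at `0` is differentiable there. -/
theorem hasDerivAt_of_isLocalMin (h : SmoothFamily L G DG η A g' r) (hA : IsUnit A.det)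
    {ηθ : ℝ → Fin q → ℝ} (h0 : ηθ 0 = η) (hc : ContinuousAt ηθ 0)
    (hmin : ∀ᶠ θ in 𝓝 (0 : ℝ), IsLocalMin (L θ) (ηθ θ)) :
    HasDerivAt ηθ (A⁻¹.mulVec g') 0 := by
  set M : (Fin q → ℝ) →L[ℝ] (Fin q → ℝ) := LinearMap.toContinuousLinearMap (Matrix.mulVecLin A⁻¹)
    with hM
  have hMa : ∀ v, M v = A⁻¹.mulVec v := fun v => by simp [hM]
  have hinv : ∀ v, A⁻¹.mulVec (A.mulVec v) = v := fun v => by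
    rw [Matrix.mulVec_mulVec, Matrix.nonsing_inv_mul _ hA, Matrix.one_mulVec]
  have hzero : ∀ᶠ θ in 𝓝 (0 : ℝ), G θ (ηθ θ) = 0 := by
    have e1 : ∀ᶠ θ in 𝓝 (0 : ℝ), ηθ θ ∈ Metric.ball η r :=
      (h0 ▸ hc.tendsto).eventually (Metric.ball_mem_nhds _ h.pos)
    have e2 : ∀ᶠ θ in 𝓝 (0 : ℝ), |θ| < r := by
      filter_upwards [Metric.ball_mem_nhds (0 : ℝ) h.pos] with θ hθ
      simpa [Real.dist_eq] using hθ
    filter_upwards [hmin, e1, e2] with θ hθ hb hr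
    have := hθ.hasFDerivAt_eq_zero (h.deriv_L θ hr _ hb)
    ext i
    have h2 := congrArg (fun l => l (Pi.single i 1)) this
    simpa [dotL_apply] using h2
  have hsc := h.deriv_score
  rw [hasDerivAt_iff_isLittleO] at hsc ⊢
  simp only [sub_zero, h.score_zero] at hsc ⊢
  rw [h0]
  -- Expansion in the parameter with `θ` moving too; it is legitimate because `strict` is uniform in
  -- `θ`.
  have hoG : (fun θ => G θ (ηθ θ) - G θ η - A.mulVec (ηθ θ - η)) =o[𝓝 0]
      fun θ => ηθ θ - η := by
    rw [Asymptotics.isLittleO_iff]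
    intro ε hε
    obtain ⟨δ, hδ, -, hs⟩ := h.strict hε
    have e1 : ∀ᶠ θ in 𝓝 (0 : ℝ), ηθ θ ∈ Metric.ball η δ :=
      (h0 ▸ hc.tendsto).eventually (Metric.ball_mem_nhds _ hδ)
    filter_upwards [e1, Metric.ball_mem_nhds (0 : ℝ) hδ] with θ hθ hθ'
    exact hs θ (by simpa [Real.dist_eq] using hθ') η (Metric.mem_ball_self hδ) _ hθ
  -- The gradient vanishes along the curve, so the expansions in the parameter and in `θ` add up to
  -- `A (ηθ - η) - θ g'`, of smaller order than `‖ηθ - η‖ + |θ|`.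
  have hsum : (fun θ => M (A.mulVec (ηθ θ - η) - θ • g')) =o[𝓝 0]
      fun θ => ‖ηθ θ - η‖ + ‖θ‖ := by
    have h1 : (fun θ => A.mulVec (ηθ θ - η) - θ • g') =o[𝓝 0] fun θ => ‖ηθ θ - η‖ + ‖θ‖ := by
      have a1 := hoG.trans_isBigO (g := fun θ => ηθ θ - η) (k := fun θ => ‖ηθ θ - η‖ + ‖θ‖)
        (Asymptotics.IsBigO.of_bound 1 (Eventually.of_forall fun θ => by
          rw [one_mul, Real.norm_of_nonneg (by positivity)]; linarith [norm_nonneg θ]))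
      have a2 := hsc.trans_isBigO (k := fun θ => ‖ηθ θ - η‖ + ‖θ‖)
        (Asymptotics.IsBigO.of_bound 1 (Eventually.of_forall fun θ => by
          rw [one_mul, Real.norm_of_nonneg (r := ‖ηθ θ - η‖ + ‖θ‖) (by positivity)]
          linarith [norm_nonneg (ηθ θ - η)]))
      refine ((a1.add a2).neg_left).congr' ?_ EventuallyEq.rfl
      filter_upwards [hzero] with θ hθ
      rw [hθ]
      simp only [smul_neg]; abel
    exact (M.isBigO_comp _ _).trans_isLittleO h1
  have hsum' : (fun θ => ηθ θ - η - θ • A⁻¹.mulVec g') =o[𝓝 0] fun θ => ‖ηθ θ - η‖ + ‖θ‖ := by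
    refine hsum.congr' (Eventually.of_forall fun θ => ?_) EventuallyEq.rfl
    simp only [hMa, Matrix.mulVec_sub, Matrix.mulVec_smul, hinv]
  -- The size of `ηθ - η` is not known beforehand. Taking the remainder with constant `1 / 2` and
  -- absorbing it on the left gives `ηθ - η = O(θ)`, after which the remainder is `o(θ)`.
  have hbig : (fun θ => ηθ θ - η) =O[𝓝 0] fun θ : ℝ => θ := by
    have h1 := (Asymptotics.isLittleO_iff.1 hsum') (c := 1 / 2) (by norm_num)
    refine Asymptotics.IsBigO.of_bound (2 * (‖A⁻¹.mulVec g'‖ + 1 / 2)) ?_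
    filter_upwards [h1] with θ hθ
    rw [Real.norm_of_nonneg (r := ‖ηθ θ - η‖ + ‖θ‖) (by positivity)] at hθ
    have h2 := norm_sub_norm_le (ηθ θ - η) (θ • A⁻¹.mulVec g')
    rw [norm_smul] at h2
    linarith
  refine hsum'.trans_isBigO ?_
  exact hbig.norm_left.add (Asymptotics.isBigO_refl _ _).norm_left

/-- A curve of unique minimizers over a fixed neighbourhood exists and is continuous at `0`. -/
theorem exists_curve (h : SmoothFamily L G DG η A g' r) (hA : IsUnit A.det) {ρ : ℝ}
    (hρ : 0 < ρ) : ∃ B ∈ 𝓝 η, B ⊆ Metric.ball η ρ ∧ ∃ ηθ : ℝ → Fin q → ℝ, ηθ 0 = η ∧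
      ContinuousAt ηθ 0 ∧ ∀ᶠ θ in 𝓝 (0 : ℝ), ηθ θ ∈ B ∧
        ∀ x ∈ B, x ≠ ηθ θ → L θ (ηθ θ) < L θ x := by
  obtain ⟨l, hl, δ, hδ, hδr, hmono⟩ := h.strong_mono hA
  set δ' := min δ ρ / 2 with hδ'
  have hmin : 0 < min δ ρ := lt_min hδ hρ
  have hδ'pos : 0 < δ' := by positivity
  set B := Metric.closedBall η δ' with hB
  have hBδ : B ⊆ Metric.ball η δ := Metric.closedBall_subset_ball
    ((half_lt_self hmin).trans_le (min_le_left _ _))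
  have hBρ : B ⊆ Metric.ball η ρ := Metric.closedBall_subset_ball
    ((half_lt_self hmin).trans_le (min_le_right _ _))
  have hconv : Convex ℝ B := convex_closedBall _ _
  have hηB : η ∈ B := Metric.mem_closedBall_self hδ'pos.le
  have hex : ∀ θ : ℝ, |θ| < δ → ∃ x ∈ B, IsMinOn (L θ) B x := fun θ hθ =>
    (isCompact_closedBall η δ').exists_isMinOn ⟨η, hηB⟩ fun x hx =>
      (h.deriv_L θ (hθ.trans_le hδr) x
        (Metric.ball_subset_ball hδr (hBδ hx))).continuousAt.continuousWithinAt
  -- A minimizer over the closed ball may lie on its boundary, so the first-order condition is a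
  -- variational inequality rather than a vanishing gradient.
  have hvar : ∀ θ : ℝ, |θ| < δ → ∀ x ∈ B, IsMinOn (L θ) B x → ∀ y ∈ B,
      0 ≤ G θ x ⬝ᵥ (y - x) := by
    intro θ hθ x hx hm y hy
    have h1 := (h.deriv_L θ (hθ.trans_le hδr) x
      (Metric.ball_subset_ball hδr (hBδ hx))).hasFDerivWithinAt (s := B)
    have h2 := hm.localize.hasFDerivWithinAt_nonneg h1
      (sub_mem_posTangentConeAt_of_segment_subset (hconv.segment_subset hx hy))
    rwa [dotL_apply] at h2
  -- The variational inequalities at two minimizers add up to a contradiction with strong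
  -- monotonicity unless the two coincide.
  have huniq : ∀ θ : ℝ, |θ| < δ → ∀ x ∈ B, IsMinOn (L θ) B x → ∀ y ∈ B,
      IsMinOn (L θ) B y → y = x := by
    intro θ hθ x hx hmx y hy hmy
    have h1 := hvar θ hθ x hx hmx y hy
    have h2 := hvar θ hθ y hy hmy x hx
    have h3 := hmono θ hθ x (hBδ hx) y (hBδ hy)
    rw [sub_dotProduct] at h3
    have h4 : G θ y ⬝ᵥ (x - y) = - (G θ y ⬝ᵥ (y - x)) := by
      rw [← dotProduct_neg, neg_sub]
    have h5 : l * ‖y - x‖ ^ 2 ≤ 0 := by linarith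
    have h6 : ‖y - x‖ ^ 2 ≤ 0 := by
      by_contra! hh
      nlinarith
    have h7 : ‖y - x‖ = 0 := by nlinarith [norm_nonneg (y - x)]
    exact sub_eq_zero.1 (norm_eq_zero.1 h7)
  classical
  let ηθ : ℝ → Fin q → ℝ := fun θ => if hθ : |θ| < δ then (hex θ hθ).choose else η
  have hηθ : ∀ θ, |θ| < δ → ηθ θ ∈ B ∧ IsMinOn (L θ) B (ηθ θ) := by
    intro θ hθ
    simp only [ηθ, hθ, dif_pos]
    exact (hex θ hθ).choose_spec
  -- The variational inequality tested at `η`, with strong monotonicity, bounds the distance to `η`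
  -- by the gradient at `η`, which tends to `0`. Both `ηθ 0 = η` and continuity at `0` follow,
  -- although the minimizers are chosen separately for each `θ`.
  have hest : ∀ θ, |θ| < δ → ‖ηθ θ - η‖ ≤ q / l * ‖G θ η‖ := by
    intro θ hθ
    obtain ⟨hx, hm⟩ := hηθ θ hθ
    have h1 := hvar θ hθ _ hx hm η hηB
    have h3 := hmono θ hθ _ (hBδ hx) η (hBδ hηB)
    rw [sub_dotProduct] at h3
    have h4 := (le_abs_self _).trans (abs_dotProduct_le (G θ η) (η - ηθ θ))
    rw [norm_sub_rev]
    have h5 : l * ‖η - ηθ θ‖ ^ 2 ≤ q * ‖G θ η‖ * ‖η - ηθ θ‖ := by linarith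
    rcases (norm_nonneg (η - ηθ θ)).eq_or_lt with h6 | h6
    · rw [← h6]; positivity
    · rw [div_mul_eq_mul_div, le_div_iff₀ hl]
      have : ‖η - ηθ θ‖ * l * ‖η - ηθ θ‖ ≤ q * ‖G θ η‖ * ‖η - ηθ θ‖ := by linarith [h5]
      exact le_of_mul_le_mul_right this h6
  have hev : ∀ᶠ θ in 𝓝 (0 : ℝ), |θ| < δ := by
    filter_upwards [Metric.ball_mem_nhds (0 : ℝ) hδ] with θ hθ
    simpa [Real.dist_eq] using hθ
  have h00 : ηθ 0 = η := by
    have := hest 0 (by simpa using hδ)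
    rw [h.score_zero, norm_zero, mul_zero] at this
    exact sub_eq_zero.1 (norm_le_zero_iff.1 this)
  refine ⟨B, Metric.closedBall_mem_nhds _ hδ'pos, hBρ, ηθ, h00, ?_, ?_⟩
  · rw [ContinuousAt, h00, tendsto_iff_norm_sub_tendsto_zero]
    have hG : Tendsto (fun θ => q / l * ‖G θ η‖) (𝓝 0) (𝓝 0) := by
      have := (h.deriv_score.continuousAt.tendsto.norm).const_mul (q / l)
      simpa [h.score_zero] using this
    refine squeeze_zero' (Eventually.of_forall fun _ => norm_nonneg _) ?_ hG
    filter_upwards [hev] with θ hθ using hest θ hθ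
  · filter_upwards [hev] with θ hθ
    obtain ⟨hx, hm⟩ := hηθ θ hθ
    refine ⟨hx, fun x hxB hne => ?_⟩
    refine lt_of_le_of_ne (hm hxB) fun heq => hne ?_
    refine huniq θ hθ _ hx hm x hxB fun y hy => ?_
    rw [mem_ofPred_eq, ← heq]; exact hm hy

end SmoothFamily

end PCE

namespace PCE

/-! ## Differentiation of integrals -/

/-- Differentiation of an integral at `0` under a Lipschitz bound at `0`. -/
theorem hasDerivAt_integral_zero {Γ : Type*} [MeasurableSpace Γ] {μ : Measure Γ}
    {F : ℝ → Γ → ℝ} {F' bound : Γ → ℝ} {δ : ℝ} (hδ : 0 < δ)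
    (hmeas : ∀ θ, |θ| < δ → AEStronglyMeasurable (F θ) μ) (hint : Integrable (F 0) μ)
    (hlip : ∀ᵐ a ∂μ, ∀ θ, |θ| < δ → |F θ a - F 0 a| ≤ bound a * |θ|)
    (hbound : Integrable bound μ) (hdiff : ∀ᵐ a ∂μ, HasDerivAt (fun θ => F θ a) (F' a) 0) :
    Integrable F' μ ∧ HasDerivAt (fun θ => ∫ a, F θ a ∂μ) (∫ a, F' a ∂μ) 0 := by
  have hball : ∀ θ, θ ∈ Metric.ball (0 : ℝ) δ ↔ |θ| < δ := fun θ => by simp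
  have hF'm : AEStronglyMeasurable F' μ := by
    -- `F'` is an almost everywhere limit of difference quotients along a sequence; the `+ 2` keeps
    -- its points strictly inside `(-δ, δ)`.
    refine aestronglyMeasurable_of_tendsto_ae (u := atTop)
      (f := fun n : ℕ => fun a => ((δ / (n + 2)))⁻¹ * (F (δ / (n + 2)) a - F 0 a)) ?_ ?_
    · intro n
      refine AEStronglyMeasurable.const_mul ((hmeas _ ?_).sub (hmeas 0 (by simpa using hδ))) _
      rw [abs_of_pos (by positivity)]
      exact div_lt_self hδ (by have : (0 : ℝ) ≤ n := n.cast_nonneg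
                               linarith)
    · filter_upwards [hdiff] with a ha
      rw [hasDerivAt_iff_tendsto_slope] at ha
      have hseq : Tendsto (fun n : ℕ => δ / ((n : ℝ) + 2)) atTop (𝓝[≠] 0) := by
        rw [tendsto_nhdsWithin_iff]
        constructor
        · refine Tendsto.div_atTop tendsto_const_nhds ?_
          exact tendsto_atTop_add_const_right _ _ tendsto_natCast_atTop_atTop
        · exact Eventually.of_forall fun n => by
            have : δ / ((n : ℝ) + 2) ≠ 0 := by positivity
            exact this
      refine (ha.comp hseq).congr fun n => ?_
      simp [slope, vsub_eq_sub]
  have h := hasFDerivAt_integral_of_dominated_loc_of_lip' (𝕜 := ℝ) (F := F)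
    (F' := fun a => ContinuousLinearMap.smulRight (1 : ℝ →L[ℝ] ℝ) (F' a))
    (x₀ := 0) (bound := bound) (Metric.ball_mem_nhds 0 hδ)
    (fun θ hθ => hmeas θ ((hball θ).1 hθ)) hint
    ((ContinuousLinearMap.smulRightL ℝ ℝ ℝ (1 : ℝ →L[ℝ] ℝ)).continuous.comp_aestronglyMeasurable
      hF'm)
    (by
      filter_upwards [hlip] with a ha θ hθ
      simpa using ha θ ((hball θ).1 hθ)) hbound
    (by
      filter_upwards [hdiff] with a ha
      exact ha.hasFDerivAt)
  have hint' : Integrable F' μ := by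
    have := h.1.apply_continuousLinearMap 1
    simpa using this
  refine ⟨hint', ?_⟩
  have h2 := h.2.hasDerivAt
  rw [ContinuousLinearMap.integral_apply h.1] at h2
  simpa using h2

lemma integral_dotL {Γ : Type*} [MeasurableSpace Γ] {μ : Measure Γ} {q : ℕ} {g : Γ → Fin q → ℝ}
    (hg : ∀ i, Integrable (fun a => g a i) μ) :
    ∫ a, dotL (g a) ∂μ = dotL fun i => ∫ a, g a i ∂μ := by
  unfold dotL
  rw [integral_finsetSum _ fun i _ => (hg i).smul_const _]
  refine Finset.sum_congr rfl fun i _ => ?_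
  rw [integral_smul_const]

lemma aestronglyMeasurable_dotL {Γ : Type*} [MeasurableSpace Γ] {μ : Measure Γ} {q : ℕ}
    {g : Γ → Fin q → ℝ} (hg : ∀ i, AEStronglyMeasurable (fun a => g a i) μ) :
    AEStronglyMeasurable (fun a => dotL (g a)) μ := by
  unfold dotL
  exact Finset.aestronglyMeasurable_fun_sum _ fun i _ => (hg i).smul_const _

/-! ## Gradients and Hessians -/

lemma hasFDerivAt_dotL_grad {q : ℕ} {f : (Fin q → ℝ) → ℝ} {x : Fin q → ℝ}
    (hf : DifferentiableAt ℝ f x) : HasFDerivAt f (dotL (grad f x)) x := by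
  have : dotL (grad f x) = fderiv ℝ f x := by
    refine ContinuousLinearMap.coe_injective (LinearMap.pi_ext' fun i => ?_)
    ext
    simp [dotL_apply, grad]
  rw [this]; exact hf.hasFDerivAt

lemma contDiffOn_grad {q : ℕ} {f : (Fin q → ℝ) → ℝ} {η : Fin q → ℝ} {ρ : ℝ}
    (hf : ContDiffOn ℝ 2 f (Metric.ball η ρ)) (j : Fin q) :
    ContDiffOn ℝ 1 (fun y => grad f y j) (Metric.ball η ρ) :=
  (hf.fderiv_of_isOpen Metric.isOpen_ball (m := 1) (by norm_num)).clm_apply contDiffOn_const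

lemma differentiableAt_grad {q : ℕ} {f : (Fin q → ℝ) → ℝ} {η x : Fin q → ℝ} {ρ : ℝ}
    (hf : ContDiffOn ℝ 2 f (Metric.ball η ρ)) (hx : x ∈ Metric.ball η ρ) (j : Fin q) :
    DifferentiableAt ℝ (fun y => grad f y j) x :=
  ((contDiffOn_grad hf j).differentiableOn (by norm_num)).differentiableAt
    (Metric.isOpen_ball.mem_nhds hx)

lemma continuousAt_hess {q : ℕ} {f : (Fin q → ℝ) → ℝ} {η x : Fin q → ℝ} {ρ : ℝ}
    (hf : ContDiffOn ℝ 2 f (Metric.ball η ρ)) (hx : x ∈ Metric.ball η ρ) (i j : Fin q) :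
    ContinuousAt (fun y => hess f y i j) x := by
  have h := ((contDiffOn_grad hf j).continuousOn_fderiv_of_isOpen Metric.isOpen_ball
    le_rfl).continuousAt (Metric.isOpen_ball.mem_nhds hx)
  exact h.clm_apply continuousAt_const

lemma hess_symm {q : ℕ} {f : (Fin q → ℝ) → ℝ} {η x : Fin q → ℝ} {ρ : ℝ}
    (hf : ContDiffOn ℝ 2 f (Metric.ball η ρ)) (hx : x ∈ Metric.ball η ρ) (i j : Fin q) :
    hess f x i j = hess f x j i := by
  have hx' := Metric.isOpen_ball.mem_nhds hx
  have hs := (hf.contDiffAt hx').isSymmSndFDerivAt (by simp)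
  have hd : DifferentiableAt ℝ (fderiv ℝ f) x :=
    ((hf.fderiv_of_isOpen Metric.isOpen_ball (m := 1) (by norm_num)).differentiableOn
      (by norm_num)).differentiableAt hx'
  have h1 : ∀ i j, hess f x i j = fderiv ℝ (fderiv ℝ f) x (Pi.single i 1) (Pi.single j 1) := by
    intro i j
    unfold hess grad
    rw [fderiv_clm_apply hd (differentiableAt_const _)]
    simp
  rw [h1, h1]; exact hs _ _

/-- Partial derivatives are limits of difference quotients, hence measurable in a parameter. -/
lemma measurable_grad {Γ : Type*} [MeasurableSpace Γ] {q : ℕ} {f : Γ → (Fin q → ℝ) → ℝ}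
    {η x : Fin q → ℝ} {ρ : ℝ} (hx : x ∈ Metric.ball η ρ)
    (hm : ∀ y ∈ Metric.ball η ρ, Measurable fun a => f a y)
    (hd : ∀ a, DifferentiableAt ℝ (f a) x) (i : Fin q) :
    Measurable fun a => grad (f a) x i := by
  obtain ⟨δ, hδ, hb⟩ := Metric.isOpen_iff.1 Metric.isOpen_ball x hx
  have hmem : ∀ n : ℕ, x + (δ / (n + 2)) • (Pi.single i 1 : Fin q → ℝ) ∈ Metric.ball η ρ := by
    intro n
    apply hb
    rw [Metric.mem_ball, dist_eq_norm, add_sub_cancel_left, norm_smul, Pi.norm_single, norm_one,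
      mul_one, Real.norm_of_nonneg (by positivity)]
    have : (0 : ℝ) ≤ n := n.cast_nonneg
    exact div_lt_self hδ (by linarith)
  refine measurable_of_tendsto_metrizable (f := fun n : ℕ => fun a =>
    (δ / (n + 2))⁻¹ * (f a (x + (δ / (n + 2)) • (Pi.single i 1 : Fin q → ℝ)) - f a x))
    (fun n => ((hm _ (hmem n)).sub (hm x hx)).const_mul _) ?_
  rw [tendsto_pi_nhds]
  intro a
  have h2 : HasDerivAt (fun u : ℝ => x + u • (Pi.single i 1 : Fin q → ℝ)) (Pi.single i 1) 0 := by
    simpa using ((hasDerivAt_id (0 : ℝ)).smul_const (Pi.single i 1 : Fin q → ℝ)).const_add x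
  have h1 : HasFDerivAt (f a) (fderiv ℝ (f a) x) (x + (0 : ℝ) • (Pi.single i 1 : Fin q → ℝ)) := by
    simpa using (hd a).hasFDerivAt
  have h3 := h1.comp_hasDerivAt (0 : ℝ) h2
  rw [hasDerivAt_iff_tendsto_slope] at h3
  have hseq : Tendsto (fun n : ℕ => δ / ((n : ℝ) + 2)) atTop (𝓝[≠] 0) := by
    rw [tendsto_nhdsWithin_iff]
    constructor
    · refine Tendsto.div_atTop tendsto_const_nhds ?_
      exact tendsto_atTop_add_const_right _ _ tendsto_natCast_atTop_atTop
    · exact Eventually.of_forall fun n => by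
        have : δ / ((n : ℝ) + 2) ≠ 0 := by positivity
        exact this
  refine (h3.comp hseq).congr fun n => ?_
  simp [slope, vsub_eq_sub]

/-! ## Weighted least squares families -/

/-- Dominated families of weights `a θ`, `d θ` and a `C²` model `f` for the objectives
`∫ (f² a θ / 2 - f d θ)`. -/
structure LeastSquares {Γ : Type*} [MeasurableSpace Γ] (T : Measure Γ) {q : ℕ}
    (f : Γ → (Fin q → ℝ) → ℝ) (η : Fin q → ℝ) (a d : ℝ → Γ → ℝ) (a' d' as ds b : Γ → ℝ)
    (C δ : ℝ) : Prop where
  pos : 0 < δ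
  measurable_f : ∀ x, Measurable fun s => f s x
  contDiffOn : ∀ s, ContDiffOn ℝ 2 (f s) (Metric.ball η δ)
  bound : ∀ s, ∀ x ∈ Metric.ball η δ, |f s x| ≤ b s ∧ (∀ i, |grad (f s) x i| ≤ b s) ∧
    ∀ i j, |hess (f s) x i j| ≤ b s
  meas_a : ∀ θ, |θ| < δ → AEStronglyMeasurable (a θ) T
  meas_d : ∀ θ, |θ| < δ → AEStronglyMeasurable (d θ) T
  bound_a : ∀ᵐ s ∂T, ∀ θ, |θ| < δ → |a θ s| ≤ as s ∧ |a θ s - a 0 s| ≤ C * as s * |θ|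
  bound_d : ∀ᵐ s ∂T, ∀ θ, |θ| < δ → |d θ s| ≤ ds s ∧ |d θ s - d 0 s| ≤ C * ds s * |θ|
  deriv_a : ∀ᵐ s ∂T, HasDerivAt (fun θ => a θ s) (a' s) 0
  deriv_d : ∀ᵐ s ∂T, HasDerivAt (fun θ => d θ s) (d' s) 0
  int_a : Integrable (fun s => as s * b s ^ 2) T
  int_d : Integrable (fun s => ds s * b s) T

namespace LeastSquares

variable {Γ : Type*} [MeasurableSpace Γ] {T : Measure Γ} {q : ℕ}
    {f : Γ → (Fin q → ℝ) → ℝ} {η : Fin q → ℝ} {a d : ℝ → Γ → ℝ} {a' d' as ds b : Γ → ℝ}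
    {C δ : ℝ}

lemma meas_f' (h : LeastSquares T f η a d a' d' as ds b C δ) {x : Fin q → ℝ}
    (hx : x ∈ Metric.ball η δ) (j : Fin q) : Measurable fun s => grad (f s) x j :=
  measurable_grad hx (fun y _ => h.measurable_f y) (fun s =>
    ((h.contDiffOn s).differentiableOn (by norm_num)).differentiableAt
      (Metric.isOpen_ball.mem_nhds hx)) j

lemma meas_f'' (h : LeastSquares T f η a d a' d' as ds b C δ) {x : Fin q → ℝ}
    (hx : x ∈ Metric.ball η δ) (i j : Fin q) : Measurable fun s => hess (f s) x i j :=
  measurable_grad (f := fun s y => grad (f s) y j) hx (fun _ hy => h.meas_f' hy j)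
    (fun s => differentiableAt_grad (h.contDiffOn s) hx j) i

lemma int_bound (h : LeastSquares T f η a d a' d' as ds b C δ) :
    Integrable (fun s => 2 * (as s * b s ^ 2 + ds s * b s)) T :=
  (h.int_a.add h.int_d).const_mul 2

/-- One envelope serves integrand, gradient and Hessian: each consists of at most two pieces bounded
by `as b² + ds b`, whence the factor `2`. -/
lemma abs_le (h : LeastSquares T f η a d a' d' as ds b C δ) {s : Γ} {θ : ℝ} {x : Fin q → ℝ}
    (ha : |a θ s| ≤ as s) (hd : |d θ s| ≤ ds s) (hx : x ∈ Metric.ball η δ) :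
    |f s x ^ 2 / 2 * a θ s - f s x * d θ s| ≤ 2 * (as s * b s ^ 2 + ds s * b s) ∧
    (∀ j, |grad (f s) x j * (f s x * a θ s - d θ s)| ≤ 2 * (as s * b s ^ 2 + ds s * b s)) ∧
    ∀ i j, |grad (f s) x i * grad (f s) x j * a θ s + hess (f s) x i j *
      (f s x * a θ s - d θ s)| ≤ 2 * (as s * b s ^ 2 + ds s * b s) := by
  obtain ⟨hf, hg, hh⟩ := h.bound s x hx
  have hb : 0 ≤ b s := (abs_nonneg _).trans hf
  have ha0 : 0 ≤ as s := (abs_nonneg _).trans ha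
  have hd0 : 0 ≤ ds s := (abs_nonneg _).trans hd
  have hfa : |f s x * a θ s - d θ s| ≤ b s * as s + ds s := by
    refine (abs_sub _ _).trans ?_
    rw [abs_mul]; gcongr
  have hp : 0 ≤ as s * b s ^ 2 := by positivity
  have hp' : 0 ≤ ds s * b s := by positivity
  have key : ∀ t, |t| ≤ b s → |t * (f s x * a θ s - d θ s)| ≤ as s * b s ^ 2 + ds s * b s := by
    intro t ht
    rw [abs_mul]
    calc _ ≤ b s * (b s * as s + ds s) := by gcongr
      _ = _ := by ring
  refine ⟨?_, fun j => (key _ (hg j)).trans (by linarith), fun i j => ?_⟩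
  · have : f s x ^ 2 / 2 * a θ s - f s x * d θ s =
        f s x * (f s x * a θ s - d θ s) - 1 / 2 * (f s x * (f s x * a θ s)) := by ring
    rw [this]
    refine (abs_sub _ _).trans ?_
    have h2 : |1 / 2 * (f s x * (f s x * a θ s))| ≤ as s * b s ^ 2 := by
      rw [abs_mul, abs_mul, abs_mul]
      calc _ ≤ |(1 / 2 : ℝ)| * (b s * (b s * as s)) := by gcongr
        _ ≤ 1 * (b s * (b s * as s)) := by
            gcongr
            norm_num [abs_of_pos]
        _ = _ := by ring
    linarith [key _ hf]
  · refine (abs_add_le _ _).trans ?_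
    have h2 : |grad (f s) x i * grad (f s) x j * a θ s| ≤ as s * b s ^ 2 := by
      rw [abs_mul, abs_mul]
      calc _ ≤ b s * b s * as s := by
            gcongr
            · exact hg i
            · exact hg j
        _ = _ := by ring
    linarith [key _ (hh i j)]

lemma int_L (h : LeastSquares T f η a d a' d' as ds b C δ) {θ : ℝ} (hθ : |θ| < δ)
    {x : Fin q → ℝ} (hx : x ∈ Metric.ball η δ) :
    Integrable (fun s => f s x ^ 2 / 2 * a θ s - f s x * d θ s) T := by
  refine h.int_bound.mono' ?_ ?_
  · exact ((((h.measurable_f x).pow_const 2).div_const 2).aestronglyMeasurable.mul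
      (h.meas_a θ hθ)).sub ((h.measurable_f x).aestronglyMeasurable.mul (h.meas_d θ hθ))
  · filter_upwards [h.bound_a, h.bound_d] with s ha hd
    exact (h.abs_le (ha θ hθ).1 (hd θ hθ).1 hx).1

lemma int_G (h : LeastSquares T f η a d a' d' as ds b C δ) {θ : ℝ} (hθ : |θ| < δ)
    {x : Fin q → ℝ} (hx : x ∈ Metric.ball η δ) (j : Fin q) :
    Integrable (fun s => grad (f s) x j * (f s x * a θ s - d θ s)) T := by
  refine h.int_bound.mono' ?_ ?_
  · exact (h.meas_f' hx j).aestronglyMeasurable.mul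
      (((h.measurable_f x).aestronglyMeasurable.mul (h.meas_a θ hθ)).sub (h.meas_d θ hθ))
  · filter_upwards [h.bound_a, h.bound_d] with s ha hd
    exact (h.abs_le (ha θ hθ).1 (hd θ hθ).1 hx).2.1 j

lemma meas_DG (h : LeastSquares T f η a d a' d' as ds b C δ) {θ : ℝ} (hθ : |θ| < δ)
    {x : Fin q → ℝ} (hx : x ∈ Metric.ball η δ) (i j : Fin q) :
    AEStronglyMeasurable (fun s => grad (f s) x i * grad (f s) x j * a θ s +
      hess (f s) x i j * (f s x * a θ s - d θ s)) T :=
  (((h.meas_f' hx i).mul (h.meas_f' hx j)).aestronglyMeasurable.mul (h.meas_a θ hθ)).add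
    ((h.meas_f'' hx i j).aestronglyMeasurable.mul
      (((h.measurable_f x).aestronglyMeasurable.mul (h.meas_a θ hθ)).sub (h.meas_d θ hθ)))

lemma int_DG (h : LeastSquares T f η a d a' d' as ds b C δ) {θ : ℝ} (hθ : |θ| < δ)
    {x : Fin q → ℝ} (hx : x ∈ Metric.ball η δ) (i j : Fin q) :
    Integrable (fun s => grad (f s) x i * grad (f s) x j * a θ s +
      hess (f s) x i j * (f s x * a θ s - d θ s)) T := by
  refine h.int_bound.mono' (h.meas_DG hθ hx i j) ?_
  filter_upwards [h.bound_a, h.bound_d] with s ha hd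
  exact (h.abs_le (ha θ hθ).1 (hd θ hθ).1 hx).2.2 i j

/-- The objectives of a least squares family are smooth. -/
theorem smoothFamily (h : LeastSquares T f η a d a' d' as ds b C δ)
    (hmin : IsLocalMin (fun x => ∫ s, f s x ^ 2 / 2 * a 0 s - f s x * d 0 s ∂T) η) :
    SmoothFamily (fun θ x => ∫ s, f s x ^ 2 / 2 * a θ s - f s x * d θ s ∂T)
      (fun θ x j => ∫ s, grad (f s) x j * (f s x * a θ s - d θ s) ∂T)
      (fun θ x => Matrix.of fun i j => ∫ s, grad (f s) x i * grad (f s) x j * a θ s +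
        hess (f s) x i j * (f s x * a θ s - d θ s) ∂T) η
      (Matrix.of fun i j => ∫ s, grad (f s) η i * grad (f s) η j * a 0 s +
        hess (f s) η i j * (f s η * a 0 s - d 0 s) ∂T)
      (fun j => ∫ s, grad (f s) η j * (d' s - f s η * a' s) ∂T) δ := by
  have hfd : ∀ s, ∀ x ∈ Metric.ball η δ, HasFDerivAt (f s) (dotL (grad (f s) x)) x :=
    fun s x hx => hasFDerivAt_dotL_grad
      (((h.contDiffOn s).differentiableOn (by norm_num)).differentiableAt
        (Metric.isOpen_ball.mem_nhds hx))
  have hgd : ∀ s, ∀ x ∈ Metric.ball η δ, ∀ j, HasFDerivAt (fun y => grad (f s) y j)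
      (dotL fun i => hess (f s) x i j) x :=
    fun s x hx j => hasFDerivAt_dotL_grad (f := fun y => grad (f s) y j)
      (differentiableAt_grad (h.contDiffOn s) hx j)
  have h0 : |(0 : ℝ)| < δ := by simpa using h.pos
  have hη : η ∈ Metric.ball η δ := Metric.mem_ball_self h.pos
  refine ⟨h.pos, fun θ hθ x hx => ?_, fun θ hθ x hx j => ?_, fun i j => ?_, ?_, ?_, hmin⟩
  · have hx' := Metric.isOpen_ball.mem_nhds hx
    have key := hasFDerivAt_integral_of_dominated_of_fderiv_le (μ := T) (𝕜 := ℝ)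
      (F := fun x s => f s x ^ 2 / 2 * a θ s - f s x * d θ s)
      (F' := fun x s => dotL fun j => grad (f s) x j * (f s x * a θ s - d θ s))
      (bound := fun s => q * (2 * (as s * b s ^ 2 + ds s * b s)))
      hx' (by filter_upwards [hx'] with y hy using (h.int_L hθ hy).aestronglyMeasurable)
      (h.int_L hθ hx) (aestronglyMeasurable_dotL fun j => (h.int_G hθ hx j).aestronglyMeasurable)
      (by
        filter_upwards [h.bound_a, h.bound_d] with s ha hd y hy
        have hk := (h.abs_le (ha θ hθ).1 (hd θ hθ).1 hy)
        refine (norm_dotL_le _).trans ?_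
        gcongr
        rw [pi_norm_le_iff_of_nonneg ((abs_nonneg _).trans hk.1)]
        exact hk.2.1)
      (h.int_bound.const_mul _)
      (Eventually.of_forall fun s y hy => by
        have h1 := hfd s y hy
        have h2 := (((h1.pow 2).mul_const (a θ s / 2)).sub (h1.mul_const (d θ s)))
        have e1 : (fun y => f s y ^ 2 / 2 * a θ s - f s y * d θ s) =
            (fun y => f s y ^ 2 * (a θ s / 2) - f s y * d θ s) := by ext; ring
        rw [e1]
        refine h2.congr_fderiv ?_
        ext v
        simp only [sub_apply, smul_apply, dotL_apply,
          dotProduct, smul_eq_mul, Finset.mul_sum, ← Finset.sum_sub_distrib]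
        refine Finset.sum_congr rfl fun i _ => ?_
        simp; ring)
    rwa [integral_dotL fun j => h.int_G hθ hx j] at key
  · have hx' := Metric.isOpen_ball.mem_nhds hx
    have key := hasFDerivAt_integral_of_dominated_of_fderiv_le (μ := T) (𝕜 := ℝ)
      (F := fun x s => grad (f s) x j * (f s x * a θ s - d θ s))
      (F' := fun x s => dotL fun i => grad (f s) x i * grad (f s) x j * a θ s +
        hess (f s) x i j * (f s x * a θ s - d θ s))
      (bound := fun s => q * (2 * (as s * b s ^ 2 + ds s * b s)))
      hx' (by filter_upwards [hx'] with y hy using (h.int_G hθ hy j).aestronglyMeasurable)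
      (h.int_G hθ hx j) (aestronglyMeasurable_dotL fun i => h.meas_DG hθ hx i j)
      (by
        filter_upwards [h.bound_a, h.bound_d] with s ha hd y hy
        have hk := (h.abs_le (ha θ hθ).1 (hd θ hθ).1 hy)
        refine (norm_dotL_le _).trans ?_
        gcongr
        rw [pi_norm_le_iff_of_nonneg ((abs_nonneg _).trans hk.1)]
        exact fun i => hk.2.2 i j)
      (h.int_bound.const_mul _)
      (Eventually.of_forall fun s y hy => by
        have h2 := (hgd s y hy j).mul (((hfd s y hy).mul_const (a θ s)).sub_const (d θ s))
        refine h2.congr_fderiv ?_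
        ext v
        simp only [add_apply, smul_apply, dotL_apply,
          dotProduct, smul_eq_mul, Finset.mul_sum, ← Finset.sum_add_distrib]
        refine Finset.sum_congr rfl fun i _ => ?_
        ring)
    rwa [integral_dotL fun i => h.int_DG hθ hx i j] at key
  -- Joint continuity of the Hessian at `(0, η)`: the weights are continuous in `θ` at `0` because
  -- they are differentiable there, and the common envelope permits dominated convergence.
  · have hnhds : ∀ᶠ p : ℝ × (Fin q → ℝ) in 𝓝 (0, η), |p.1| < δ ∧ p.2 ∈ Metric.ball η δ := by
      filter_upwards [Metric.ball_mem_nhds ((0 : ℝ), η) h.pos] with p hp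
      rw [Metric.mem_ball, Prod.dist_eq, max_lt_iff] at hp
      exact ⟨by simpa [Real.dist_eq] using hp.1, hp.2⟩
    refine tendsto_integral_filter_of_dominated_convergence
      (fun s => 2 * (as s * b s ^ 2 + ds s * b s)) ?_ ?_ h.int_bound ?_
    · filter_upwards [hnhds] with p hp using h.meas_DG hp.1 hp.2 i j
    · filter_upwards [hnhds] with p hp
      filter_upwards [h.bound_a, h.bound_d] with s ha hd
      exact (h.abs_le (ha p.1 hp.1).1 (hd p.1 hp.1).1 hp.2).2.2 i j
    · filter_upwards [h.deriv_a, h.deriv_d] with s ha hd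
      have c1 : Tendsto (fun p : ℝ × (Fin q → ℝ) => a p.1 s) (𝓝 (0, η)) (𝓝 (a 0 s)) :=
        ha.continuousAt.tendsto.comp (continuous_fst.tendsto' _ _ rfl)
      have c2 : Tendsto (fun p : ℝ × (Fin q → ℝ) => d p.1 s) (𝓝 (0, η)) (𝓝 (d 0 s)) :=
        hd.continuousAt.tendsto.comp (continuous_fst.tendsto' _ _ rfl)
      have snd : Tendsto (fun p : ℝ × (Fin q → ℝ) => p.2) (𝓝 (0, η)) (𝓝 η) :=
        continuous_snd.tendsto' _ _ rfl
      have c3 := (hfd s η hη).continuousAt.tendsto.comp snd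
      have c4 := fun k => (hgd s η hη k).continuousAt.tendsto.comp snd
      have c5 := (continuousAt_hess (h.contDiffOn s) hη i j).tendsto.comp snd
      exact (((c4 i).mul (c4 j)).mul c1).add (c5.mul ((c3.mul c1).sub c2))
  · ext i j
    simp only [Matrix.transpose_apply, Matrix.of_apply]
    refine integral_congr_ae (Eventually.of_forall fun s => ?_)
    simp only
    rw [hess_symm (h.contDiffOn s) hη i j]; ring
  · rw [hasDerivAt_pi]
    intro j
    -- At fixed `η` only the weights move, and their Lipschitz bounds at `0` dominate the difference
    -- quotients. `|C|` replaces `C` because the sign of `C` is not prescribed.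
    have key := hasDerivAt_integral_zero (μ := T) h.pos
      (F := fun θ s => grad (f s) η j * (f s η * a θ s - d θ s))
      (F' := fun s => -(grad (f s) η j * (d' s - f s η * a' s)))
      (bound := fun s => |C| * (2 * (as s * b s ^ 2 + ds s * b s)))
      (fun θ hθ => (h.int_G hθ hη j).aestronglyMeasurable) (h.int_G h0 hη j)
      (by
        filter_upwards [h.bound_a, h.bound_d] with s ha hd θ hθ
        obtain ⟨hf, hg, -⟩ := h.bound s η hη
        have hb : 0 ≤ b s := (abs_nonneg _).trans hf
        have ha0 : 0 ≤ as s := (abs_nonneg _).trans (ha θ hθ).1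
        have hd0 : 0 ≤ ds s := (abs_nonneg _).trans (hd θ hθ).1
        have e : grad (f s) η j * (f s η * a θ s - d θ s) -
            grad (f s) η j * (f s η * a 0 s - d 0 s) =
            grad (f s) η j * (f s η * (a θ s - a 0 s) - (d θ s - d 0 s)) := by ring
        rw [e, abs_mul]
        have h1 : |f s η * (a θ s - a 0 s) - (d θ s - d 0 s)| ≤
            b s * (|C| * as s * |θ|) + |C| * ds s * |θ| := by
          refine (abs_sub _ _).trans ?_
          rw [abs_mul]
          gcongr
          · exact (ha θ hθ).2.trans (by gcongr; exact le_abs_self C)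
          · exact (hd θ hθ).2.trans (by gcongr; exact le_abs_self C)
        calc _ ≤ b s * (b s * (|C| * as s * |θ|) + |C| * ds s * |θ|) := by
              gcongr; exact hg j
          _ = |C| * (1 * (as s * b s ^ 2 + ds s * b s)) * |θ| := by ring
          _ ≤ _ := by gcongr; norm_num)
      (h.int_bound.const_mul _)
      (by
        filter_upwards [h.deriv_a, h.deriv_d] with s ha hd
        refine (((ha.const_mul (f s η)).sub hd).const_mul (grad (f s) η j)).congr_deriv ?_
        ring)
    have := key.2
    rwa [integral_neg] at this

end LeastSquares

end PCE

namespace PCE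

/-! ## Densities -/

section Density

variable {Γ : Type*} [MeasurableSpace Γ] {μ : Measure Γ} {g : Γ → ℝ}

lemma integrable_withDensity_ofReal (hg : Measurable g) (h0 : ∀ᵐ a ∂μ, 0 ≤ g a) {φ : Γ → ℝ} :
    Integrable φ (μ.withDensity fun a => ENNReal.ofReal (g a)) ↔
      Integrable (fun a => g a * φ a) μ := by
  rw [integrable_withDensity_iff_integrable_smul' hg.ennreal_ofReal
    (Eventually.of_forall fun _ => ENNReal.ofReal_lt_top)]
  refine integrable_congr ?_
  filter_upwards [h0] with a ha
  rw [ENNReal.toReal_ofReal ha, smul_eq_mul]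

lemma integral_withDensity_ofReal (hg : Measurable g) (h0 : ∀ᵐ a ∂μ, 0 ≤ g a) (φ : Γ → ℝ) :
    ∫ a, φ a ∂(μ.withDensity fun a => ENNReal.ofReal (g a)) = ∫ a, g a * φ a ∂μ := by
  rw [integral_withDensity_eq_integral_toReal_smul hg.ennreal_ofReal
    (Eventually.of_forall fun _ => ENNReal.ofReal_lt_top)]
  refine integral_congr_ae ?_
  filter_upwards [h0] with a ha
  rw [ENNReal.toReal_ofReal ha, smul_eq_mul]

lemma ae_withDensity_ofReal (hg : Measurable g) (h0 : ∀ᵐ a ∂μ, 0 ≤ g a) {p : Γ → Prop} :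
    (∀ᵐ a ∂(μ.withDensity fun a => ENNReal.ofReal (g a)), p a) ↔ ∀ᵐ a ∂μ, g a ≠ 0 → p a := by
  rw [ae_withDensity_iff hg.ennreal_ofReal]
  refine eventually_congr ?_
  filter_upwards [h0] with a ha
  simp only [ne_eq, ENNReal.ofReal_eq_zero, not_le]
  exact ⟨fun h h' => h (lt_of_le_of_ne ha (Ne.symm h')), fun h h' => h h'.ne'⟩

end Density

variable {𝒳 : Type*} [MeasurableSpace 𝒳]

/-! ## Disintegration of an observed law -/

lemma measurable_lawX_map : Measurable fun v : Obs 𝒳 => v.2.2.2 :=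
  measurable_snd.comp (measurable_snd.comp measurable_snd)

instance (P : Measure (Obs 𝒳)) [IsProbabilityMeasure P] : IsProbabilityMeasure (lawX P) :=
  Measure.isProbabilityMeasure_map measurable_lawX_map.aemeasurable

omit [MeasurableSpace 𝒳] in
lemma Nuisance.prob_true (N : Nuisance 𝒳) (x : 𝒳) : N.prob true x = N.π x := rfl

omit [MeasurableSpace 𝒳] in
lemma Nuisance.prob_false (N : Nuisance 𝒳) (x : 𝒳) : N.prob false x = 1 - N.π x := rfl

/-- The density of `(X, S)` on `{Z = z}`. -/
noncomputable def armLaw (P : Measure (Obs 𝒳)) (N : Nuisance 𝒳) (z : Bool) : Measure (𝒳 × ℝ) :=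
  ((lawX P).prod volume).withDensity fun a => ENNReal.ofReal (N.prob z a.1 * N.p z a.2 a.1)

/-- The point `(s, z, x)`. -/
def pt (z : Bool) (a : 𝒳 × ℝ) : ℝ × Bool × 𝒳 := (a.2, z, a.1)

lemma measurable_pt (z : Bool) : Measurable (pt (𝒳 := 𝒳) z) :=
  measurable_snd.prodMk (measurable_const.prodMk measurable_fst)

/-- The coordinate `s_z` of `(s₁, s₀)`. -/
def coord (z : Bool) (r : ℝ × ℝ) : ℝ := if z then r.1 else r.2

lemma measurable_coord (z : Bool) : Measurable (coord z) := by
  cases z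
  · exact measurable_snd
  · exact measurable_fst

@[simp] lemma coord_true (r : ℝ × ℝ) : coord true r = r.1 := rfl

@[simp] lemma coord_false (r : ℝ × ℝ) : coord false r = r.2 := rfl

/-- The law under which `X ∼ P` and `S₁, S₀` are conditionally independent given `X` with densities
`p₁` and `p₀`. -/
noncomputable def T (P : Measure (Obs 𝒳)) (N : Nuisance 𝒳) : Measure (𝒳 × ℝ × ℝ) :=
  ((lawX P).prod volume).withDensity fun a =>
    ENNReal.ofReal (N.p true a.2.1 a.1 * N.p false a.2.2 a.1)

/-- The conditional law of `Y` given `(S, Z, X)`. -/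
noncomputable def kap (P : Measure (Obs 𝒳)) [IsFiniteMeasure P] : Kernel (ℝ × Bool × 𝒳) ℝ :=
  condDistrib (fun v : Obs 𝒳 => v.1) (fun v => v.2) P

instance (P : Measure (Obs 𝒳)) [IsFiniteMeasure P] : IsMarkovKernel (kap P) := by
  unfold kap; infer_instance

/-- The conditional mean of `k(V)` given `(S, Z, X)`. -/
noncomputable def kbar (P : Measure (Obs 𝒳)) [IsFiniteMeasure P] (k : Obs 𝒳 → ℝ)
    (u : ℝ × Bool × 𝒳) : ℝ := ∫ y, k (y, u) ∂kap P u

lemma measurable_kbar (P : Measure (Obs 𝒳)) [IsFiniteMeasure P] {k : Obs 𝒳 → ℝ}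
    (hk : Measurable k) : Measurable (kbar P k) := by
  have : StronglyMeasurable (Function.uncurry fun (u : ℝ × Bool × 𝒳) (y : ℝ) => k (y, u)) :=
    (hk.comp measurable_swap).stronglyMeasurable
  exact (StronglyMeasurable.integral_kernel_prod_right (κ := kap P) this).measurable

namespace IsNuisance

variable {P : Measure (Obs 𝒳)} {N : Nuisance 𝒳}

lemma measurable_prob (h : IsNuisance P N) (z : Bool) : Measurable (N.prob z) := by
  cases z
  · exact measurable_const.sub h.measurable_π
  · exact h.measurable_π

lemma measurable_p' (h : IsNuisance P N) (z : Bool) :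
    Measurable fun a : 𝒳 × ℝ => N.p z a.2 a.1 :=
  (h.measurable_p z).comp measurable_swap

lemma measurable_p_coord (h : IsNuisance P N) (z : Bool) :
    Measurable fun a : 𝒳 × ℝ × ℝ => N.p z (coord z a.2) a.1 :=
  (h.measurable_p z).comp (((measurable_coord z).comp measurable_snd).prodMk measurable_fst)

lemma measurable_dens (h : IsNuisance P N) :
    Measurable fun a : 𝒳 × ℝ × ℝ => N.p true a.2.1 a.1 * N.p false a.2.2 a.1 :=
  (h.measurable_p_coord true).mul (h.measurable_p_coord false)

lemma dens_nonneg (h : IsNuisance P N) (a : 𝒳 × ℝ × ℝ) :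
    0 ≤ N.p true a.2.1 a.1 * N.p false a.2.2 a.1 :=
  mul_nonneg (h.nonneg_p _ _ _) (h.nonneg_p _ _ _)

lemma measurable_p_x (h : IsNuisance P N) (z : Bool) (x : 𝒳) : Measurable fun s => N.p z s x :=
  (h.measurable_p z).comp (measurable_id.prodMk measurable_const)

lemma prob_pos (h : IsNuisance P N) : ∀ᵐ x ∂lawX P, ∀ z, 0 < N.prob z x := by
  filter_upwards [h.overlap] with x hx z
  cases z
  · exact sub_pos.2 hx.2
  · exact hx.1

lemma integrable_T (h : IsNuisance P N) {φ : 𝒳 × ℝ × ℝ → ℝ} : Integrable φ (T P N) ↔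
    Integrable (fun a => N.p true a.2.1 a.1 * N.p false a.2.2 a.1 * φ a)
      ((lawX P).prod volume) :=
  integrable_withDensity_ofReal h.measurable_dens (Eventually.of_forall h.dens_nonneg)

lemma integral_T (h : IsNuisance P N) (φ : 𝒳 × ℝ × ℝ → ℝ) : ∫ a, φ a ∂T P N =
    ∫ a, N.p true a.2.1 a.1 * N.p false a.2.2 a.1 * φ a ∂(lawX P).prod volume :=
  integral_withDensity_ofReal h.measurable_dens (Eventually.of_forall h.dens_nonneg) φ

lemma ae_T (h : IsNuisance P N) {p : 𝒳 × ℝ × ℝ → Prop} : (∀ᵐ a ∂T P N, p a) ↔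
    ∀ᵐ a ∂(lawX P).prod volume, N.p true a.2.1 a.1 * N.p false a.2.2 a.1 ≠ 0 → p a :=
  ae_withDensity_ofReal h.measurable_dens (Eventually.of_forall h.dens_nonneg)

variable [IsProbabilityMeasure P]

/-- `π` is a conditional expectation over `σ(X)`, which settles the treatment arm; the control arm
follows by complement. -/
lemma measure_treatment (h : IsNuisance P N) (z : Bool) {A : Set 𝒳} (hA : MeasurableSet A) :
    P {v | v.2.2.1 = z ∧ v.2.2.2 ∈ A} = ∫⁻ x in A, ENNReal.ofReal (N.prob z x) ∂lawX P := by
  have hm := measurable_lawX_map (𝒳 := 𝒳)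
  have hZ : Measurable fun v : Obs 𝒳 => v.2.2.1 :=
    measurable_fst.comp (measurable_snd.comp measurable_snd)
  have hπint : Integrable N.π (lawX P) := by
    refine Integrable.of_bound h.measurable_π.aestronglyMeasurable 1 ?_
    filter_upwards [h.overlap] with x hx
    rw [Real.norm_eq_abs, abs_of_pos hx.1]; exact hx.2.le
  have hprobint : ∀ z, Integrable (N.prob z) (lawX P) := by
    intro z
    cases z
    · exact (integrable_const 1).sub hπint
    · exact hπint
  have key : ∀ z, P.real {v | v.2.2.1 = z ∧ v.2.2.2 ∈ A} = ∫ x in A, N.prob z x ∂lawX P := by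
    have htrue : P.real {v | v.2.2.1 = true ∧ v.2.2.2 ∈ A} = ∫ x in A, N.π x ∂lawX P := by
      have hset : MeasurableSet {v : Obs 𝒳 | v.2.2.1 = true} :=
        hZ (measurableSet_singleton true)
      have e1 := setIntegral_condExp (m := MeasurableSpace.comap (fun v : Obs 𝒳 => v.2.2.2)
        inferInstance) (μ := P) (f := {v : Obs 𝒳 | v.2.2.1 = true}.indicator fun _ => (1 : ℝ))
        hm.comap_le ((integrable_const 1).indicator hset)
        (s := (fun v : Obs 𝒳 => v.2.2.2) ⁻¹' A) ⟨A, hA, rfl⟩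
      rw [setIntegral_congr_ae (g := fun v => N.π v.2.2.2) (hm hA)
        (by filter_upwards [h.treatment] with v hv _ using hv),
        setIntegral_indicator hset, setIntegral_const, smul_eq_mul, mul_one] at e1
      rw [lawX, setIntegral_map hA h.measurable_π.aestronglyMeasurable hm.aemeasurable, e1]
      congr 1; ext v; simp [and_comm]
    intro z
    cases z
    · have e2 : P.real {v | v.2.2.1 = true ∧ v.2.2.2 ∈ A} +
          P.real {v | v.2.2.1 = false ∧ v.2.2.2 ∈ A} = (lawX P).real A := by
        rw [← measureReal_union]
        · rw [lawX, map_measureReal_apply hm hA]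
          congr 1; ext v; cases hv : v.2.2.1 <;> simp [hv]
        · rw [Set.disjoint_left]
          rintro v ⟨h1, -⟩ ⟨h2, -⟩
          rw [h1] at h2; exact absurd h2 (by decide)
        · exact (hZ (measurableSet_singleton false)).inter (hm hA)
      simp only [Nuisance.prob_false]
      rw [integral_sub (integrable_const 1) hπint.integrableOn, setIntegral_const, smul_eq_mul,
        mul_one, ← htrue]
      linarith
    · exact htrue
  rw [← ofReal_integral_eq_lintegral_ofReal (hprobint z).integrableOn
    (ae_restrict_of_ae (by filter_upwards [h.prob_pos] with x hx using (hx z).le)), ← key,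
    ofReal_measureReal]

/-- Normalization is not among the fields of `IsNuisance`. It follows on comparing `density` for `B
= univ` with the treatment probabilities and cancelling `prob z`, which overlap makes positive. -/
lemma lintegral_p (h : IsNuisance P N) :
    ∀ᵐ x ∂lawX P, ∀ z, ∫⁻ s, ENNReal.ofReal (N.p z s x) = 1 := by
  rw [ae_all_iff]
  intro z
  have hI : Measurable fun x => ∫⁻ s, ENNReal.ofReal (N.p z s x) :=
    (h.measurable_p' z).ennreal_ofReal.lintegral_prod_right
  have hp := (h.measurable_prob z).ennreal_ofReal
  have := ae_eq_of_forall_setLIntegral_eq_of_sigmaFinite (μ := lawX P)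
    (hp.mul hI) hp (fun A hA _ => by
      rw [← h.measure_treatment z hA]
      have h2 := h.density z A hA univ MeasurableSet.univ
      simp only [mem_univ, true_and, Measure.restrict_univ] at h2
      rw [h2]; rfl)
  filter_upwards [this, h.prob_pos] with x hx hpos
  have h0 : ENNReal.ofReal (N.prob z x) ≠ 0 := by simpa using hpos z
  have hx' : ENNReal.ofReal (N.prob z x) * ∫⁻ s, ENNReal.ofReal (N.p z s x) =
      ENNReal.ofReal (N.prob z x) * 1 := by rw [mul_one]; exact hx
  exact (ENNReal.mul_right_inj h0 ENNReal.ofReal_ne_top).1 hx'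

lemma integrable_p (h : IsNuisance P N) :
    ∀ᵐ x ∂lawX P, ∀ z, Integrable (fun s => N.p z s x) ∧ ∫ s, N.p z s x = 1 := by
  filter_upwards [h.lintegral_p] with x hx z
  have hi : Integrable (fun s => N.p z s x) := by
    refine ⟨(h.measurable_p_x z x).aestronglyMeasurable, ?_⟩
    rw [hasFiniteIntegral_iff_ofReal (Eventually.of_forall fun s => h.nonneg_p z s x), hx z]
    exact ENNReal.one_lt_top
  refine ⟨hi, ?_⟩
  rw [integral_eq_lintegral_of_nonneg_ae (Eventually.of_forall fun s => h.nonneg_p z s x)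
    hi.aestronglyMeasurable, hx z, ENNReal.toReal_one]

lemma armLaw_apply (h : IsNuisance P N) (z : Bool) {A : Set 𝒳} {B : Set ℝ} (hA : MeasurableSet A)
    (hB : MeasurableSet B) : armLaw P N z (A ×ˢ B) = ∫⁻ x in A, (ENNReal.ofReal (N.prob z x) *
        ∫⁻ s in B, ENNReal.ofReal (N.p z s x)) ∂lawX P := by
  have hm : Measurable fun a : 𝒳 × ℝ => ENNReal.ofReal (N.prob z a.1 * N.p z a.2 a.1) :=
    (((h.measurable_prob z).comp measurable_fst).mul (h.measurable_p' z)).ennreal_ofReal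
  rw [armLaw, withDensity_apply _ (hA.prod hB), ← Measure.prod_restrict, lintegral_prod _ hm.aemeasurable]
  refine lintegral_congr_ae ?_
  filter_upwards [ae_restrict_of_ae h.prob_pos] with x hx
  rw [← lintegral_const_mul _ (h.measurable_p_x z x).ennreal_ofReal]
  refine lintegral_congr fun s => ?_
  rw [ENNReal.ofReal_mul (hx z).le]

lemma map_restrict (h : IsNuisance P N) (z : Bool) :
    (P.restrict {v | v.2.2.1 = z}).map (fun v => (v.2.2.2, v.2.1)) = armLaw P N z := by
  have hm : Measurable fun v : Obs 𝒳 => (v.2.2.2, v.2.1) :=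
    measurable_lawX_map.prodMk (measurable_fst.comp measurable_snd)
  have := Measure.isFiniteMeasure_map (P.restrict {v | v.2.2.1 = z})
    (fun v : Obs 𝒳 => (v.2.2.2, v.2.1))
  refine Measure.ext_prod fun {A B} hA hB => ?_
  rw [Measure.map_apply hm (hA.prod hB), h.armLaw_apply z hA hB,
    Measure.restrict_apply (hm (hA.prod hB)), ← h.density z A hA B hB]
  congr 1; ext v; simp; tauto

lemma map_snd (h : IsNuisance P N) :
    P.map (fun v => v.2) = ∑ z, (armLaw P N z).map (pt z) := by
  have hZ : Measurable fun v : Obs 𝒳 => v.2.2.1 :=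
    measurable_fst.comp (measurable_snd.comp measurable_snd)
  have hm : Measurable fun v : Obs 𝒳 => (v.2.2.2, v.2.1) :=
    measurable_lawX_map.prodMk (measurable_fst.comp measurable_snd)
  have e : ∀ z, (armLaw P N z).map (pt z) = (P.restrict {v | v.2.2.1 = z}).map (fun v => v.2) := by
    intro z
    rw [← h.map_restrict z, Measure.map_map (measurable_pt z) hm]
    refine Measure.map_congr ?_
    filter_upwards [ae_restrict_mem (hZ (measurableSet_singleton z))] with v hv
    have hv' : v.2.2.1 = z := hv
    simp [pt, ← hv']
  simp only [e, Fintype.sum_bool]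
  rw [← Measure.map_add _ _ measurable_snd]
  have hc : {v : Obs 𝒳 | v.2.2.1 = false} = {v : Obs 𝒳 | v.2.2.1 = true}ᶜ := by
    ext v; simp
  have hs : MeasurableSet {v : Obs 𝒳 | v.2.2.1 = true} := hZ (measurableSet_singleton true)
  rw [hc, Measure.restrict_add_restrict_compl hs]

/-- Null sets pass from the observed law to `(X, S_z)` only where `p z` does not vanish. Overlap is
what makes this work: the density on arm `z` is `prob z * p z`, which must vanish only together with
`p z`. -/
lemma ae_snd (h : IsNuisance P N) {p : ℝ × Bool × 𝒳 → Prop} (hpm : MeasurableSet {u | p u})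
    (hp : ∀ᵐ v ∂P, p v.2) (z : Bool) :
    ∀ᵐ a ∂(lawX P).prod volume, N.p z a.2 a.1 ≠ 0 → p (pt z a) := by
  have h1 : ∀ᵐ a ∂(armLaw P N z), p (pt z a) := by
    have h2 : ∀ᵐ u ∂P.map (fun v => v.2), p u := (ae_map_iff measurable_snd.aemeasurable hpm).2 hp
    rw [h.map_snd, Fintype.sum_bool, ae_add_measure_iff] at h2
    have h3 : ∀ᵐ u ∂(armLaw P N z).map (pt z), p u := by
      cases z
      · exact h2.2
      · exact h2.1
    exact (ae_map_iff (measurable_pt z).aemeasurable hpm).1 h3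
  have hpp : ∀ᵐ a ∂(lawX P).prod (volume : Measure ℝ), ∀ z, 0 < N.prob z a.1 :=
    Measure.quasiMeasurePreserving_fst.ae h.prob_pos
  unfold armLaw at h1
  rw [ae_withDensity_ofReal (g := fun a : 𝒳 × ℝ => N.prob z a.1 * N.p z a.2 a.1)
    (((h.measurable_prob z).comp measurable_fst).mul (h.measurable_p' z))
    (by filter_upwards [hpp] with a ha using mul_nonneg (ha z).le (h.nonneg_p _ _ _))] at h1
  filter_upwards [h1, hpp] with a ha hpos hne
  exact ha (mul_ne_zero (hpos z).ne' hne)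

lemma quasiMeasurePreserving_coord (z : Bool) : Measure.QuasiMeasurePreserving
    (fun a : 𝒳 × ℝ × ℝ => (a.1, coord z a.2)) ((lawX P).prod volume) ((lawX P).prod volume) := by
  have hc : Measure.QuasiMeasurePreserving (coord z) (volume : Measure (ℝ × ℝ)) volume := by
    cases z
    · exact Measure.quasiMeasurePreserving_snd
    · exact Measure.quasiMeasurePreserving_fst
  exact MeasureTheory.QuasiMeasurePreserving.prodMap (Measure.QuasiMeasurePreserving.id (lawX P)) hc

/-- `T` gives no mass to points where one of the two densities vanishes, so the proviso `p z ≠ 0`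
disappears under `T`. -/
lemma ae_T_of_ae_prod (h : IsNuisance P N) {z : Bool} {p : 𝒳 × ℝ → Prop}
    (hp : ∀ᵐ a ∂(lawX P).prod volume, N.p z a.2 a.1 ≠ 0 → p a) :
    ∀ᵐ a ∂T P N, p (a.1, coord z a.2) := by
  rw [h.ae_T]
  filter_upwards [(quasiMeasurePreserving_coord (P := P) z).ae hp] with a ha hne
  refine ha ?_
  cases z
  · exact right_ne_zero_of_mul hne
  · exact left_ne_zero_of_mul hne

lemma ae_T_of_ae (h : IsNuisance P N) {p : ℝ × Bool × 𝒳 → Prop} (hpm : MeasurableSet {u | p u})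
    (hp : ∀ᵐ v ∂P, p v.2) (z : Bool) : ∀ᵐ a ∂T P N, p (pt z (a.1, coord z a.2)) :=
  h.ae_T_of_ae_prod (p := fun a => p (pt z a)) (h.ae_snd hpm hp z)

omit [IsProbabilityMeasure P] in
lemma ae_T_of_ae_volume {p : 𝒳 × ℝ × ℝ → Prop} (hp : ∀ᵐ a ∂(lawX P).prod volume, p a) :
    ∀ᵐ a ∂T P N, p a :=
  hp.filter_mono (withDensity_absolutelyContinuous _ _).ae_le

omit [IsProbabilityMeasure P] in
lemma ae_T_of_ae_x {p : 𝒳 → Prop} (hp : ∀ᵐ x ∂lawX P, p x) : ∀ᵐ a ∂T P N, p a.1 :=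
  ae_T_of_ae_volume (p := fun a => p a.1)
    ((Measure.quasiMeasurePreserving_fst (μ := lawX P) (ν := (volume : Measure (ℝ × ℝ)))).ae hp)

lemma ae_map_snd (h : IsNuisance P N) {p : ℝ × Bool × 𝒳 → Prop} (hpm : MeasurableSet {u | p u})
    (hp : ∀ z, ∀ᵐ a ∂(lawX P).prod volume, N.p z a.2 a.1 ≠ 0 → p (pt z a)) :
    ∀ᵐ u ∂P.map (fun v => v.2), p u := by
  have hpp : ∀ᵐ a ∂(lawX P).prod (volume : Measure ℝ), ∀ z, 0 < N.prob z a.1 :=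
    Measure.quasiMeasurePreserving_fst.ae h.prob_pos
  have h3 : ∀ z, ∀ᵐ u ∂(armLaw P N z).map (pt z), p u := by
    intro z
    rw [ae_map_iff (measurable_pt z).aemeasurable hpm]
    unfold armLaw
    rw [ae_withDensity_ofReal (g := fun a : 𝒳 × ℝ => N.prob z a.1 * N.p z a.2 a.1)
      (((h.measurable_prob z).comp measurable_fst).mul (h.measurable_p' z))
      (by filter_upwards [hpp] with a ha using mul_nonneg (ha z).le (h.nonneg_p _ _ _))]
    filter_upwards [hp z] with a ha hne using ha (right_ne_zero_of_mul hne)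
  rw [h.map_snd, Fintype.sum_bool, ae_add_measure_iff]
  exact ⟨h3 true, h3 false⟩

lemma integral_map_snd (h : IsNuisance P N) {φ : ℝ × Bool × 𝒳 → ℝ} (hφ : Measurable φ) :
    (Integrable φ (P.map fun v => v.2) ↔ ∀ z, Integrable (fun a => N.prob z a.1 * N.p z a.2 a.1 *
      φ (pt z a)) ((lawX P).prod volume)) ∧
    (Integrable φ (P.map fun v => v.2) → ∫ u, φ u ∂(P.map fun v => v.2) =
      ∑ z, ∫ a, N.prob z a.1 * N.p z a.2 a.1 * φ (pt z a) ∂(lawX P).prod volume) := by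
  have hpp : ∀ᵐ a ∂(lawX P).prod (volume : Measure ℝ), ∀ z, 0 < N.prob z a.1 :=
    Measure.quasiMeasurePreserving_fst.ae h.prob_pos
  have h0 : ∀ z, ∀ᵐ a ∂(lawX P).prod (volume : Measure ℝ), 0 ≤ N.prob z a.1 * N.p z a.2 a.1 :=
    fun z => by filter_upwards [hpp] with a ha using mul_nonneg (ha z).le (h.nonneg_p _ _ _)
  have hm : ∀ z, Measurable fun a : 𝒳 × ℝ => N.prob z a.1 * N.p z a.2 a.1 := fun z =>
    ((h.measurable_prob z).comp measurable_fst).mul (h.measurable_p' z)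
  have e1 : ∀ z, Integrable φ ((armLaw P N z).map (pt z)) ↔ Integrable (fun a => N.prob z a.1 *
      N.p z a.2 a.1 * φ (pt z a)) ((lawX P).prod volume) := by
    intro z
    rw [integrable_map_measure hφ.aestronglyMeasurable (measurable_pt z).aemeasurable, armLaw,
      integrable_withDensity_ofReal (hm z) (h0 z)]
    rfl
  have e2 : Integrable φ (P.map fun v => v.2) ↔ ∀ z, Integrable φ ((armLaw P N z).map (pt z)) := by
    rw [h.map_snd, Fintype.sum_bool, integrable_add_measure, Bool.forall_bool, and_comm]
  refine ⟨by rw [e2]; exact forall_congr' e1, fun hi => ?_⟩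
  have hi' := e2.1 hi
  rw [h.map_snd, Fintype.sum_bool, integral_add_measure (hi' true) (hi' false), Fintype.sum_bool]
  congr 1 <;>
  rw [integral_map (measurable_pt _).aemeasurable hφ.aestronglyMeasurable, armLaw,
      integral_withDensity_ofReal (hm _) (h0 _)]

omit [IsProbabilityMeasure P] in
-- Disintegration of `P` over `(S, Z, X)`. The swap only reorders coordinates, since the composition
-- product places the conditioning variable first.
lemma integral_kbar [IsFiniteMeasure P] {k : Obs 𝒳 → ℝ} (hk : Integrable k P) :
    Integrable (kbar P k) (P.map fun v => v.2) ∧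
      ∫ v, k v ∂P = ∫ u, kbar P k u ∂(P.map fun v => v.2) := by
  have hc : (P.map fun v => v.2) ⊗ₘ kap P = P.map Prod.swap :=
    compProd_map_condDistrib measurable_fst.aemeasurable
  have hk' : Integrable (k ∘ Prod.swap) (P.map Prod.swap) := by
    have hsw : P.map Prod.swap = P.map (MeasurableEquiv.prodComm : Obs 𝒳 ≃ᵐ _) := rfl
    rw [hsw, integrable_map_equiv]
    exact hk
  have e : ∫ v, k v ∂P = ∫ w, (k ∘ Prod.swap) w ∂(P.map Prod.swap) := by
    have hsw : P.map Prod.swap = P.map (MeasurableEquiv.prodComm : Obs 𝒳 ≃ᵐ _) := rfl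
    rw [hsw, integral_map_equiv]
    rfl
  rw [e]
  rw [← hc] at hk' ⊢
  refine ⟨?_, Measure.integral_compProd hk'⟩
  have h2 := hk'
  rw [Measure.compProd] at h2
  have h3 := h2.integral_compProd
  simp only [Kernel.const_apply, Kernel.prodMkLeft_apply] at h3
  exact h3

/-- Integration against `P` in terms of the nuisance functions and the law of `Y` given the rest. -/
lemma integral_eq (h : IsNuisance P N) {k : Obs 𝒳 → ℝ} (hk : Measurable k)
    (hkk : ∀ z, ∀ᵐ a ∂(lawX P).prod volume, N.p z a.2 a.1 ≠ 0 →
      Integrable (fun y => k (y, pt z a)) (kap P (pt z a)))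
    (hint : ∀ z, Integrable (fun a => N.prob z a.1 * N.p z a.2 a.1 *
      kbar P (fun v => |k v|) (pt z a)) ((lawX P).prod volume)) :
    Integrable k P ∧ ∫ v, k v ∂P = ∑ z, ∫ a, N.prob z a.1 * N.p z a.2 a.1 * kbar P k (pt z a)
      ∂(lawX P).prod volume := by
  have hc : (P.map fun v => v.2) ⊗ₘ kap P = P.map Prod.swap :=
    compProd_map_condDistrib measurable_fst.aemeasurable
  have hks : Measurable fun w : (ℝ × Bool × 𝒳) × ℝ => k (w.2, w.1) := hk.comp measurable_swap
  have hi : Integrable k P := by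
    have : Integrable (k ∘ Prod.swap) (P.map Prod.swap) := by
      rw [← hc]
      refine (Measure.integrable_compProd_iff hks.aestronglyMeasurable).2 ?_
      refine ⟨?_, ?_⟩
      · refine h.ae_map_snd ?_ hkk
        exact ProbabilityTheory.measurableSet_kernel_integrable (κ := kap P)
          hks.stronglyMeasurable
      · exact ((h.integral_map_snd (measurable_kbar P hk.abs)).1).2 hint
    have hsw : P.map Prod.swap = P.map (MeasurableEquiv.prodComm : Obs 𝒳 ≃ᵐ _) := rfl
    rw [hsw, integrable_map_equiv] at this
    exact this
  obtain ⟨h1, h2⟩ := integral_kbar hi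
  exact ⟨hi, h2.trans ((h.integral_map_snd (measurable_kbar P hk)).2 h1)⟩

end IsNuisance

end PCE

namespace PCE

/-! ## The probability integral transform -/

section Transform

variable {p : ℝ → ℝ}

lemma continuous_setIntegral_Iic (hp : Integrable p) : Continuous fun s => ∫ t in Iic s, p t := by
  have h : (fun s => ∫ t in Iic s, p t) = fun s => (∫ t in Iic (0 : ℝ), p t) + ∫ t in (0)..s, p t := by
    ext s
    rw [← intervalIntegral.integral_Iic_sub_Iic hp.integrableOn hp.integrableOn]; ring
  rw [h]
  exact continuous_const.add (intervalIntegral.continuous_primitive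
    (fun a b => hp.intervalIntegrable) 0)

lemma withDensity_Iic (hp : Integrable p) (h0 : ∀ s, 0 ≤ p s) (s : ℝ) :
    (volume.withDensity fun t => ENNReal.ofReal (p t)) (Iic s) =
      ENNReal.ofReal (∫ t in Iic s, p t) := by
  rw [withDensity_apply _ measurableSet_Iic,
    ofReal_integral_eq_lintegral_ofReal hp.integrableOn (Eventually.of_forall h0)]

lemma setIntegral_Iic_le_one (hp : Integrable p) (h0 : ∀ s, 0 ≤ p s) (h1 : ∫ t, p t = 1) (s : ℝ) :
    ∫ t in Iic s, p t ≤ 1 :=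
  h1 ▸ setIntegral_le_integral hp (Eventually.of_forall h0)

lemma isProbabilityMeasure_density (hp : Integrable p) (h0 : ∀ s, 0 ≤ p s) (h1 : ∫ t, p t = 1) :
    IsProbabilityMeasure (volume.withDensity fun t => ENNReal.ofReal (p t)) := by
  constructor
  rw [withDensity_apply _ MeasurableSet.univ, Measure.restrict_univ,
    ← ofReal_integral_eq_lintegral_ofReal hp (Eventually.of_forall h0), h1, ENNReal.ofReal_one]

lemma exists_setIntegral_Iic_eq (hp : Integrable p) (h1 : ∫ t, p t = 1) {u : ℝ}
    (hu : u ∈ Ioo (0 : ℝ) 1) : ∃ s, ∫ t in Iic s, p t = u := by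
  have hc := continuous_setIntegral_Iic hp
  have hbot : Tendsto (fun s => ∫ t in Iic s, p t) atBot (𝓝 0) := by
    have h := intervalIntegral_tendsto_integral_Iic (0 : ℝ) hp.integrableOn tendsto_id
    have h2 := h.const_sub (∫ t in Iic (0 : ℝ), p t)
    rw [sub_self] at h2
    refine h2.congr fun s => ?_
    rw [id, ← intervalIntegral.integral_Iic_sub_Iic hp.integrableOn hp.integrableOn]; ring
  have htop : Tendsto (fun s => ∫ t in Iic s, p t) atTop (𝓝 1) := by
    have h := intervalIntegral_tendsto_integral_Ioi (0 : ℝ) hp.integrableOn tendsto_id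
    have h2 := h.const_add (∫ t in Iic (0 : ℝ), p t)
    rw [intervalIntegral.integral_Iic_add_Ioi hp.integrableOn hp.integrableOn, h1] at h2
    refine h2.congr fun s => ?_
    rw [id, ← intervalIntegral.integral_Iic_sub_Iic hp.integrableOn hp.integrableOn]; ring
  obtain ⟨a, ha⟩ := (hbot.eventually (gt_mem_nhds hu.1)).exists
  obtain ⟨b, hb⟩ := (htop.eventually (lt_mem_nhds hu.2)).exists
  exact mem_range_of_exists_le_of_exists_ge hc ⟨a, ha.le⟩ ⟨b, hb.le⟩

/-- The distribution function of a density maps its law to the uniform distribution. -/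
theorem map_setIntegral_Iic (hp : Integrable p) (h0 : ∀ s, 0 ≤ p s) (h1 : ∫ t, p t = 1) :
    (volume.withDensity fun t => ENNReal.ofReal (p t)).map (fun s => ∫ t in Iic s, p t) =
      volume.restrict (Ioc 0 1) := by
  have := isProbabilityMeasure_density hp h0 h1
  set ρ := volume.withDensity fun t => ENNReal.ofReal (p t)
  have hc := continuous_setIntegral_Iic hp
  have hmono : Monotone fun s => ∫ t in Iic s, p t := fun a b hab =>
    setIntegral_mono_set hp.integrableOn (Eventually.of_forall h0)
      (Iic_subset_Iic.2 hab).eventuallyLE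
  have hprob : IsProbabilityMeasure (ρ.map fun s => ∫ t in Iic s, p t) :=
    Measure.isProbabilityMeasure_map hc.measurable.aemeasurable
  refine Measure.ext_of_Iic _ _ fun u => ?_
  rw [Measure.map_apply hc.measurable measurableSet_Iic,
    Measure.restrict_apply measurableSet_Iic]
  rcases le_or_gt 1 u with hu | hu
  · have e1 : (fun s => ∫ t in Iic s, p t) ⁻¹' Iic u = univ := by
      ext s; simpa using (setIntegral_Iic_le_one hp h0 h1 s).trans hu
    have e2 : Iic u ∩ Ioc (0 : ℝ) 1 = Ioc 0 1 :=
      inter_eq_right.2 fun x hx => hx.2.trans hu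
    rw [e1, e2, measure_univ]; simp
  · have e2 : Iic u ∩ Ioc (0 : ℝ) 1 = Ioc 0 u := by
      ext x; simp only [mem_inter_iff, mem_Iic, mem_Ioc]
      constructor
      · rintro ⟨a, b, -⟩; exact ⟨b, a⟩
      · rintro ⟨a, b⟩; exact ⟨b, a, b.trans hu.le⟩
    rw [e2, Real.volume_Ioc, sub_zero]
    apply le_antisymm
    -- The distribution function may be flat at level `u`, so a point at that level need not bound
    -- the preimage of `Iic u`. Points at levels `v > u` do, and `v` decreases to `u`; the maximum
    -- with `0` covers `u ≤ 0`, where a point at level `u` may not exist.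
    · have hle : ∀ v ∈ Ioo (max u 0) 1, ρ ((fun s => ∫ t in Iic s, p t) ⁻¹' Iic u) ≤
          ENNReal.ofReal v := by
        intro v hv
        obtain ⟨b, hb⟩ := exists_setIntegral_Iic_eq hp h1 (u := v)
          ⟨(le_max_right _ _).trans_lt hv.1, hv.2⟩
        rw [← hb, ← withDensity_Iic hp h0]
        refine measure_mono fun s hs => ?_
        by_contra hsb
        rw [mem_Iic, not_le] at hsb
        have h3 := hmono hsb.le
        simp only [hb] at h3
        have h4 : ∫ t in Iic s, p t ≤ u := hs
        have h5 := (le_max_left u 0).trans_lt hv.1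
        linarith
      have hlim : Tendsto (fun v => ENNReal.ofReal v) (𝓝[>] (max u 0)) (𝓝 (ENNReal.ofReal u)) := by
        have : Tendsto (fun v => ENNReal.ofReal v) (𝓝[>] (max u 0))
            (𝓝 (ENNReal.ofReal (max u 0))) :=
          (ENNReal.continuous_ofReal.tendsto _).mono_left nhdsWithin_le_nhds
        have e : ENNReal.ofReal (max u 0) = ENNReal.ofReal u := by
          rcases le_total u 0 with h | h
          · rw [max_eq_right h, ENNReal.ofReal_zero, ENNReal.ofReal_of_nonpos h]
          · rw [max_eq_left h]
        rwa [e] at this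
      refine ge_of_tendsto hlim ?_
      filter_upwards [Ioo_mem_nhdsGT (show max u 0 < 1 from max_lt hu one_pos)] with v hv
        using hle v hv
    · rcases le_or_gt u 0 with hu0 | hu0
      · rw [ENNReal.ofReal_of_nonpos hu0]; exact zero_le
      obtain ⟨a, ha⟩ := exists_setIntegral_Iic_eq hp h1 (u := u) ⟨hu0, hu⟩
      calc ENNReal.ofReal u = ρ (Iic a) := by rw [withDensity_Iic hp h0, ha]
        _ ≤ _ := measure_mono fun s hs => by
            have := hmono (mem_Iic.1 hs)
            simp only [ha] at this
            exact this

/-- The preimage contains `Iic a` and, by uniformity of the transform, has the same mass; the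
difference is a stretch on which the distribution function is constant. -/
lemma Iic_ae_eq (hp : Integrable p) (h0 : ∀ s, 0 ≤ p s) (h1 : ∫ t, p t = 1) (a : ℝ) :
    (fun s => ∫ t in Iic s, p t) ⁻¹' Iic (∫ t in Iic a, p t)
      =ᵐ[volume.withDensity fun t => ENNReal.ofReal (p t)] Iic a := by
  have := isProbabilityMeasure_density hp h0 h1
  have hc := continuous_setIntegral_Iic hp
  have hmono : Monotone fun s => ∫ t in Iic s, p t := fun a b hab =>
    setIntegral_mono_set hp.integrableOn (Eventually.of_forall h0)
      (Iic_subset_Iic.2 hab).eventuallyLE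
  symm
  refine ae_eq_of_subset_of_measure_ge (fun s hs => hmono (mem_Iic.1 hs)) ?_
    measurableSet_Iic.nullMeasurableSet (measure_ne_top _ _)
  rw [← Measure.map_apply hc.measurable measurableSet_Iic, map_setIntegral_Iic hp h0 h1,
    withDensity_Iic hp h0, Measure.restrict_apply measurableSet_Iic]
  have e2 : Iic (∫ t in Iic a, p t) ∩ Ioc (0 : ℝ) 1 = Ioc 0 (∫ t in Iic a, p t) := by
    have := setIntegral_Iic_le_one hp h0 h1 a
    ext x; simp only [mem_inter_iff, mem_Iic, mem_Ioc]
    constructor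
    · rintro ⟨a, b, -⟩; exact ⟨b, a⟩
    · rintro ⟨a, b⟩; exact ⟨b, a, by linarith⟩
  rw [e2, Real.volume_Ioc, sub_zero]

lemma ae_setIntegral_Iic_mem (hp : Integrable p) (h0 : ∀ s, 0 ≤ p s) (h1 : ∫ t, p t = 1) :
    ∀ᵐ s ∂(volume.withDensity fun t => ENNReal.ofReal (p t)),
      (∫ t in Iic s, p t) ∈ Ioo (0 : ℝ) 1 := by
  have h : ∀ᵐ u ∂(volume.restrict (Ioc (0 : ℝ) 1)), u ∈ Ioo (0 : ℝ) 1 := by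
    rw [← restrict_Ioo_eq_restrict_Ioc]
    exact ae_restrict_mem measurableSet_Ioo
  rw [← map_setIntegral_Iic hp h0 h1] at h
  exact ae_of_ae_map (continuous_setIntegral_Iic hp).measurable.aemeasurable h

end Transform

/-- The copula gives the joint distribution function of its density. -/
lemma setIntegral_copula {c : ℝ → ℝ → ℝ} (hc : IsCopulaDensity c) {p₁ p₀ : ℝ → ℝ}
    (hp₁ : Integrable p₁) (h₁ : ∀ s, 0 ≤ p₁ s) (h₁' : ∫ t, p₁ t = 1)
    (hp₀ : Integrable p₀) (h₀ : ∀ s, 0 ≤ p₀ s) (h₀' : ∫ t, p₀ t = 1) (a b : ℝ) :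
    ∫ r in Iic a ×ˢ Iic b, c (∫ t in Iic r.1, p₁ t) (∫ t in Iic r.2, p₀ t)
      ∂((volume.withDensity fun t => ENNReal.ofReal (p₁ t)).prod
        (volume.withDensity fun t => ENNReal.ofReal (p₀ t))) =
      copula c (∫ t in Iic a, p₁ t) (∫ t in Iic b, p₀ t) := by
  have := isProbabilityMeasure_density hp₁ h₁ h₁'
  have := isProbabilityMeasure_density hp₀ h₀ h₀'
  have m₁ := (continuous_setIntegral_Iic hp₁).measurable
  have m₀ := (continuous_setIntegral_Iic hp₀).measurable
  -- Half-lines are replaced by preimages of half-lines, so that the change of variables to the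
  -- uniform square applies.
  rw [← setIntegral_congr_set (Measure.set_prod_ae_eq (Iic_ae_eq hp₁ h₁ h₁' a)
    (Iic_ae_eq hp₀ h₀ h₀' b))]
  have e := Measure.map_prod_map (volume.withDensity fun t => ENNReal.ofReal (p₁ t))
    (volume.withDensity fun t => ENNReal.ofReal (p₀ t)) m₁ m₀
  rw [map_setIntegral_Iic hp₁ h₁ h₁', map_setIntegral_Iic hp₀ h₀ h₀', Measure.prod_restrict] at e
  have h2 := setIntegral_map (μ := (volume.withDensity fun t => ENNReal.ofReal (p₁ t)).prod
      (volume.withDensity fun t => ENNReal.ofReal (p₀ t)))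
    (g := Prod.map (fun s => ∫ t in Iic s, p₁ t) fun s => ∫ t in Iic s, p₀ t)
    (f := Function.uncurry c) (s := Iic (∫ t in Iic a, p₁ t) ×ˢ Iic (∫ t in Iic b, p₀ t))
    (measurableSet_Iic.prod measurableSet_Iic) hc.measurable.aestronglyMeasurable
    (m₁.prodMap m₀).aemeasurable
  rw [← e, Measure.restrict_restrict (measurableSet_Iic.prod measurableSet_Iic),
    prod_inter_prod] at h2
  have e3 : ∀ u ≤ (1 : ℝ), Iic u ∩ Ioc (0 : ℝ) 1 = Ioc 0 u := by
    intro u hu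
    ext x; simp only [mem_inter_iff, mem_Iic, mem_Ioc]
    constructor
    · rintro ⟨a, b, -⟩; exact ⟨b, a⟩
    · rintro ⟨a, b⟩; exact ⟨b, a, by linarith⟩
  rw [e3 _ (setIntegral_Iic_le_one hp₁ h₁ h₁' a), e3 _ (setIntegral_Iic_le_one hp₀ h₀ h₀' b)] at h2
  rw [copula]
  exact h2.symm

/-- The same change of variables over the whole plane; the total mass one comes from the margin at
`1`. The extended-valued form yields integrability of the principal density instead of presupposing
it. -/
lemma lintegral_copula {c : ℝ → ℝ → ℝ} (hc : IsCopulaDensity c) {p₁ p₀ : ℝ → ℝ}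
    (hp₁ : Integrable p₁) (h₁ : ∀ s, 0 ≤ p₁ s) (h₁' : ∫ t, p₁ t = 1)
    (hp₀ : Integrable p₀) (h₀ : ∀ s, 0 ≤ p₀ s) (h₀' : ∫ t, p₀ t = 1) :
    ∫⁻ r, ENNReal.ofReal (c (∫ t in Iic r.1, p₁ t) (∫ t in Iic r.2, p₀ t))
      ∂((volume.withDensity fun t => ENNReal.ofReal (p₁ t)).prod
        (volume.withDensity fun t => ENNReal.ofReal (p₀ t))) = 1 := by
  have := isProbabilityMeasure_density hp₁ h₁ h₁'
  have := isProbabilityMeasure_density hp₀ h₀ h₀'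
  have m₁ := (continuous_setIntegral_Iic hp₁).measurable
  have m₀ := (continuous_setIntegral_Iic hp₀).measurable
  have e := Measure.map_prod_map (volume.withDensity fun t => ENNReal.ofReal (p₁ t))
    (volume.withDensity fun t => ENNReal.ofReal (p₀ t)) m₁ m₀
  rw [map_setIntegral_Iic hp₁ h₁ h₁', map_setIntegral_Iic hp₀ h₀ h₀', Measure.prod_restrict] at e
  have h2 := lintegral_map (μ := (volume.withDensity fun t => ENNReal.ofReal (p₁ t)).prod
      (volume.withDensity fun t => ENNReal.ofReal (p₀ t)))
    (g := Prod.map (fun s => ∫ t in Iic s, p₁ t) fun s => ∫ t in Iic s, p₀ t)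
    (f := fun r => ENNReal.ofReal (Function.uncurry c r)) hc.measurable.ennreal_ofReal
    (m₁.prodMap m₀)
  rw [← e] at h2
  refine h2.symm.trans ?_
  rw [← Measure.volume_eq_prod, ← ofReal_integral_eq_lintegral_ofReal hc.integrable]
  · have := hc.margin_fst 1 ⟨zero_le_one, le_rfl⟩
    rw [copula] at this
    rw [ENNReal.ofReal_eq_one]
    exact this
  -- Nonnegativity of `c` is known on the open square only; the added boundary is null.
  · have : (Ioo (0 : ℝ) 1 ×ˢ Ioo (0 : ℝ) 1 : Set (ℝ × ℝ)) =ᵐ[volume] Ioc 0 1 ×ˢ Ioc 0 1 :=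
      Measure.set_prod_ae_eq Ioo_ae_eq_Ioc Ioo_ae_eq_Ioc
    rw [← Measure.restrict_congr_set this]
    filter_upwards [ae_restrict_mem (measurableSet_Ioo.prod measurableSet_Ioo)] with r hr
    exact hc.nonneg _ hr.1 _ hr.2

/-! ## The principal density -/

variable {𝒳 : Type*} [MeasurableSpace 𝒳]

/-- The copula density at the conditional distribution functions. -/
noncomputable def cF (c : ℝ → ℝ → ℝ) (N : Nuisance 𝒳) (a : 𝒳 × ℝ × ℝ) : ℝ :=
  c (N.F true a.2.1 a.1) (N.F false a.2.2 a.1)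

omit [MeasurableSpace 𝒳] in
lemma e_eq (c : ℝ → ℝ → ℝ) (N : Nuisance 𝒳) (a : 𝒳 × ℝ × ℝ) :
    N.e c a.2.1 a.2.2 a.1 = N.p true a.2.1 a.1 * N.p false a.2.2 a.1 * cF c N a := by
  unfold Nuisance.e cF; ring

lemma measurable_setIntegral_Iic {k : 𝒳 → ℝ → ℝ} (hk : Measurable (Function.uncurry k)) :
    Measurable fun a : 𝒳 × ℝ => ∫ t in Iic a.2, k a.1 t := by
  have e : (fun a : 𝒳 × ℝ => ∫ t in Iic a.2, k a.1 t) =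
      fun a : 𝒳 × ℝ => ∫ t, ({b : (𝒳 × ℝ) × ℝ | b.2 ≤ b.1.2}.indicator
        (fun b => k b.1.1 b.2)) (a, t) := by
    ext a
    rw [← integral_indicator measurableSet_Iic]
    rfl
  rw [e]
  refine (StronglyMeasurable.integral_prod_right' (ν := volume) ?_).measurable
  refine (Measurable.indicator ?_ ?_).stronglyMeasurable
  · exact hk.comp ((measurable_fst.comp measurable_fst).prodMk measurable_snd)
  · exact measurableSet_le measurable_snd (measurable_snd.comp measurable_fst)

namespace IsNuisance

variable {P : Measure (Obs 𝒳)} {N : Nuisance 𝒳} {c : ℝ → ℝ → ℝ}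

lemma measurable_F (h : IsNuisance P N) (z : Bool) :
    Measurable fun a : 𝒳 × ℝ => N.F z a.2 a.1 :=
  measurable_setIntegral_Iic (k := fun x t => N.p z t x) (h.measurable_p' z)

lemma measurable_F_coord (h : IsNuisance P N) (z : Bool) :
    Measurable fun a : 𝒳 × ℝ × ℝ => N.F z (coord z a.2) a.1 :=
  (h.measurable_F z).comp (measurable_fst.prodMk ((measurable_coord z).comp measurable_snd))

lemma measurable_cF (h : IsNuisance P N) (hc : IsCopulaDensity c) : Measurable (cF c N) :=
  hc.measurable.comp ((h.measurable_F_coord true).prodMk (h.measurable_F_coord false))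

variable [IsProbabilityMeasure P]

/-- Under the density `p z` the variable `F_z` is uniform and so avoids `0` and `1`. Up to null
sets, `c` and its derivatives are therefore evaluated in the open square only. -/
lemma ae_F (h : IsNuisance P N) (z : Bool) :
    ∀ᵐ a ∂(lawX P).prod volume, N.p z a.2 a.1 ≠ 0 → N.F z a.2 a.1 ∈ Ioo (0 : ℝ) 1 := by
  have hms : MeasurableSet {a : 𝒳 × ℝ | N.p z a.2 a.1 ≠ 0 → N.F z a.2 a.1 ∈ Ioo (0 : ℝ) 1} := by
    have e : {a : 𝒳 × ℝ | N.p z a.2 a.1 ≠ 0 → N.F z a.2 a.1 ∈ Ioo (0 : ℝ) 1} =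
        ((fun a : 𝒳 × ℝ => N.p z a.2 a.1) ⁻¹' {0}) ∪
          ((fun a : 𝒳 × ℝ => N.F z a.2 a.1) ⁻¹' Ioo 0 1) := by
      ext a
      exact Classical.or_iff_not_imp_left.symm
    rw [e]
    exact ((h.measurable_p' z) (measurableSet_singleton 0)).union
      ((h.measurable_F z) measurableSet_Ioo)
  rw [Measure.ae_prod_iff_ae_ae hms]
  filter_upwards [h.integrable_p] with x hx
  exact (ae_withDensity_ofReal (h.measurable_p_x z x)
    (Eventually.of_forall fun s => h.nonneg_p z s x)).1
    (ae_setIntegral_Iic_mem (hx z).1 (fun s => h.nonneg_p z s x) (hx z).2)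

lemma ae_T_F (h : IsNuisance P N) :
    ∀ᵐ a ∂T P N, ∀ z, N.F z (coord z a.2) a.1 ∈ Ioo (0 : ℝ) 1 :=
  ae_all_iff.2 fun z => h.ae_T_of_ae_prod (p := fun a => N.F z a.2 a.1 ∈ Ioo (0 : ℝ) 1) (h.ae_F z)

lemma ae_T_cF_nonneg (h : IsNuisance P N) (hc : IsCopulaDensity c) :
    ∀ᵐ a ∂T P N, 0 ≤ cF c N a := by
  filter_upwards [h.ae_T_F] with a ha
  exact hc.nonneg _ (ha true) _ (ha false)

omit [IsProbabilityMeasure P] in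
lemma prod_density (h : IsNuisance P N) (x : 𝒳) :
    (volume.withDensity fun t => ENNReal.ofReal (N.p true t x)).prod
        (volume.withDensity fun t => ENNReal.ofReal (N.p false t x)) =
      (volume : Measure (ℝ × ℝ)).withDensity
        fun r => ENNReal.ofReal (N.p true r.1 x * N.p false r.2 x) := by
  rw [prod_withDensity (h.measurable_p_x true x).ennreal_ofReal
    (h.measurable_p_x false x).ennreal_ofReal, Measure.volume_eq_prod]
  congr 1
  ext r
  rw [ENNReal.ofReal_mul (h.nonneg_p _ _ _)]

omit [IsProbabilityMeasure P] in
lemma lintegral_T (h : IsNuisance P N) {φ : 𝒳 × ℝ × ℝ → ENNReal} (hφ : Measurable φ) :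
    ∫⁻ a, φ a ∂T P N = ∫⁻ x, ∫⁻ r, φ (x, r)
      ∂((volume.withDensity fun t => ENNReal.ofReal (N.p true t x)).prod
        (volume.withDensity fun t => ENNReal.ofReal (N.p false t x))) ∂lawX P := by
  rw [T, lintegral_withDensity_eq_lintegral_mul _ h.measurable_dens.ennreal_ofReal hφ,
    lintegral_prod _ (h.measurable_dens.ennreal_ofReal.mul hφ).aemeasurable]
  refine lintegral_congr fun x => ?_
  have hm : Measurable fun r : ℝ × ℝ => ENNReal.ofReal (N.p true r.1 x * N.p false r.2 x) :=
    (h.measurable_dens.comp (measurable_const.prodMk measurable_id)).ennreal_ofReal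
  have hφ' : Measurable fun r : ℝ × ℝ => φ (x, r) := hφ.comp (measurable_const.prodMk measurable_id)
  rw [h.prod_density, lintegral_withDensity_eq_lintegral_mul _ hm hφ']
  rfl

lemma lintegral_cF (h : IsNuisance P N) (hc : IsCopulaDensity c) :
    ∫⁻ a, ENNReal.ofReal (cF c N a) ∂T P N = 1 := by
  rw [h.lintegral_T (h.measurable_cF hc).ennreal_ofReal]
  rw [lintegral_congr_ae (g := fun _ => 1)]
  · simp
  filter_upwards [h.integrable_p] with x hx
  exact lintegral_copula hc (hx true).1 (fun s => h.nonneg_p true s x) (hx true).2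
    (hx false).1 (fun s => h.nonneg_p false s x) (hx false).2

lemma integrable_cF (h : IsNuisance P N) (hc : IsCopulaDensity c) :
    Integrable (cF c N) (T P N) := by
  refine ⟨(h.measurable_cF hc).aestronglyMeasurable, ?_⟩
  rw [hasFiniteIntegral_iff_ofReal (h.ae_T_cF_nonneg hc), h.lintegral_cF hc]
  exact ENNReal.one_lt_top

/-- Fibrewise in `x` this is `setIntegral_copula`; nonnegativity and integrability on the fibre link
the two kinds of integral. It serves to recognise the law of `(X, S₁, S₀)` by its distribution
functions. -/
lemma setLIntegral_cF (h : IsNuisance P N) (hc : IsCopulaDensity c) {A : Set 𝒳}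
    (hA : MeasurableSet A) (s₁ s₀ : ℝ) :
    ∫⁻ a in A ×ˢ Iic s₁ ×ˢ Iic s₀, ENNReal.ofReal (cF c N a) ∂T P N =
      ∫⁻ x in A, ENNReal.ofReal (copula c (N.F true s₁ x) (N.F false s₀ x)) ∂lawX P := by
  have hs : MeasurableSet (A ×ˢ Iic s₁ ×ˢ Iic s₀) :=
    hA.prod (measurableSet_Iic.prod measurableSet_Iic)
  rw [← lintegral_indicator hs, h.lintegral_T ((h.measurable_cF hc).ennreal_ofReal.indicator hs),
    ← lintegral_indicator hA]
  refine lintegral_congr_ae ?_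
  have hae : ∀ᵐ x ∂lawX P, ∀ᵐ r ∂((volume.withDensity fun t => ENNReal.ofReal (N.p true t x)).prod
        (volume.withDensity fun t => ENNReal.ofReal (N.p false t x))), 0 ≤ cF c N (x, r) := by
    have h1 := h.ae_T.1 (h.ae_T_cF_nonneg hc)
    have h2 := Measure.ae_ae_of_ae_prod h1
    filter_upwards [h2] with x hx
    rw [h.prod_density]
    refine (ae_withDensity_ofReal (g := fun r : ℝ × ℝ => N.p true r.1 x * N.p false r.2 x)
      (h.measurable_dens.comp (measurable_const.prodMk measurable_id))
      (Eventually.of_forall fun r => mul_nonneg (h.nonneg_p _ _ _) (h.nonneg_p _ _ _))).2 ?_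
    exact hx
  filter_upwards [h.integrable_p, hae] with x hx hx0
  by_cases hxA : x ∈ A
  · rw [indicator_of_mem hxA]
    have := isProbabilityMeasure_density (hx true).1 (fun s => h.nonneg_p true s x) (hx true).2
    have := isProbabilityMeasure_density (hx false).1 (fun s => h.nonneg_p false s x) (hx false).2
    have hint : Integrable (fun r : ℝ × ℝ => cF c N (x, r))
        ((volume.withDensity fun t => ENNReal.ofReal (N.p true t x)).prod
        (volume.withDensity fun t => ENNReal.ofReal (N.p false t x))) := by
      refine ⟨((h.measurable_cF hc).comp
        (measurable_const.prodMk measurable_id)).aestronglyMeasurable, ?_⟩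
      rw [hasFiniteIntegral_iff_ofReal hx0]
      have e := lintegral_copula hc (hx true).1 (fun s => h.nonneg_p true s x) (hx true).2
        (hx false).1 (fun s => h.nonneg_p false s x) (hx false).2
      calc _ = (1 : ENNReal) := e
        _ < ⊤ := ENNReal.one_lt_top
    have e := setIntegral_copula hc (hx true).1 (fun s => h.nonneg_p true s x) (hx true).2
      (hx false).1 (fun s => h.nonneg_p false s x) (hx false).2 s₁ s₀
    have e' : copula c (N.F true s₁ x) (N.F false s₀ x) = ∫ r in Iic s₁ ×ˢ Iic s₀, cF c N (x, r)
      ∂((volume.withDensity fun t => ENNReal.ofReal (N.p true t x)).prod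
        (volume.withDensity fun t => ENNReal.ofReal (N.p false t x))) := e.symm
    rw [e', ofReal_integral_eq_lintegral_ofReal hint.integrableOn (ae_restrict_of_ae hx0),
      ← lintegral_indicator (measurableSet_Iic.prod measurableSet_Iic)]
    refine lintegral_congr fun r => ?_
    by_cases hr : r ∈ Iic s₁ ×ˢ Iic s₀
    · rw [indicator_of_mem hr, indicator_of_mem (show (x, r) ∈ A ×ˢ Iic s₁ ×ˢ Iic s₀ from ⟨hxA, hr⟩)]
    · rw [indicator_of_notMem hr, indicator_of_notMem fun hh => hr hh.2]
  · rw [indicator_of_notMem hxA]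
    rw [lintegral_congr (g := fun _ => 0), lintegral_zero]
    intro r
    rw [indicator_of_notMem fun hh => hxA hh.1]

end IsNuisance

end PCE

/-! ### Marginal principal density, effect surface and objective of an observed law -/

namespace PCE

variable {𝒳 : Type*} [MeasurableSpace 𝒳]

/-- The contrast `μ₁(s₁, x) - μ₀(s₀, x)`. -/
def Nuisance.contrast (N : Nuisance 𝒳) (a : 𝒳 × ℝ × ℝ) : ℝ :=
  N.μ true a.2.1 a.1 - N.μ false a.2.2 a.1

namespace IsNuisance

variable {P : Measure (Obs 𝒳)} {N : Nuisance 𝒳} {c : ℝ → ℝ → ℝ}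

lemma measurable_μ (h : IsNuisance P N) (z : Bool) :
    Measurable fun a : 𝒳 × ℝ => N.μ z a.2 a.1 :=
  (h.outcome.1 z).comp measurable_swap

lemma measurable_μ_coord (h : IsNuisance P N) (z : Bool) :
    Measurable fun a : 𝒳 × ℝ × ℝ => N.μ z (coord z a.2) a.1 :=
  (h.measurable_μ z).comp (measurable_fst.prodMk ((measurable_coord z).comp measurable_snd))

lemma measurable_contrast (h : IsNuisance P N) : Measurable N.contrast :=
  (h.measurable_μ_coord true).sub (h.measurable_μ_coord false)

lemma measurable_e (h : IsNuisance P N) (hc : IsCopulaDensity c) :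
    Measurable fun a : 𝒳 × ℝ × ℝ => N.e c a.2.1 a.2.2 a.1 := by
  simp only [e_eq]
  exact h.measurable_dens.mul (h.measurable_cF hc)

variable [IsProbabilityMeasure P]

omit [IsProbabilityMeasure P] in
lemma integrable_e_mul (h : IsNuisance P N) {k : 𝒳 × ℝ × ℝ → ℝ} :
    Integrable (fun a => cF c N a * k a) (T P N) ↔
      Integrable (fun a => N.e c a.2.1 a.2.2 a.1 * k a) ((lawX P).prod volume) := by
  rw [h.integrable_T]
  refine integrable_congr (Eventually.of_forall fun a => ?_)
  simp only [e_eq]; ring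

omit [IsProbabilityMeasure P] in
lemma integral_e_mul (h : IsNuisance P N) (k : 𝒳 × ℝ × ℝ → ℝ) :
    ∫ a, cF c N a * k a ∂T P N =
      ∫ a, N.e c a.2.1 a.2.2 a.1 * k a ∂(lawX P).prod volume := by
  rw [h.integral_T]
  refine integral_congr_ae (Eventually.of_forall fun a => ?_)
  simp only [e_eq]; ring

lemma ae_e_nonneg (h : IsNuisance P N) (hc : IsCopulaDensity c) :
    ∀ᵐ a : 𝒳 × ℝ × ℝ ∂(lawX P).prod volume, 0 ≤ N.e c a.2.1 a.2.2 a.1 := by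
  filter_upwards [h.ae_T.1 (h.ae_T_cF_nonneg hc)] with a ha
  rw [e_eq]
  by_cases h0 : N.p true a.2.1 a.1 * N.p false a.2.2 a.1 = 0
  · rw [h0, zero_mul]
  · exact mul_nonneg (h.dens_nonneg a) (ha h0)

lemma ae_ae_e_nonneg (h : IsNuisance P N) (hc : IsCopulaDensity c) :
    ∀ᵐ r : ℝ × ℝ, ∀ᵐ x ∂lawX P, 0 ≤ N.e c r.1 r.2 x := by
  have h1 : ∀ᵐ b ∂(volume : Measure (ℝ × ℝ)).prod (lawX P), 0 ≤ N.e c b.1.1 b.1.2 b.2 :=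
    (Measure.measurePreserving_swap (μ := (volume : Measure (ℝ × ℝ)))
      (ν := lawX P)).quasiMeasurePreserving.ae (h.ae_e_nonneg hc)
  exact Measure.ae_ae_of_ae_prod h1

lemma integrable_e (h : IsNuisance P N) (hc : IsCopulaDensity c) :
    Integrable (fun a : 𝒳 × ℝ × ℝ => N.e c a.2.1 a.2.2 a.1) ((lawX P).prod volume) := by
  have := (h.integrable_e_mul (c := c) (k := fun _ => 1)).1 (by simpa using h.integrable_cF hc)
  simpa using this

lemma ae_integrable_e (h : IsNuisance P N) (hc : IsCopulaDensity c) :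
    ∀ᵐ r : ℝ × ℝ, Integrable (fun x => N.e c r.1 r.2 x) (lawX P) :=
  (h.integrable_e hc).prod_left_ae

lemma ae_eMarg_nonneg (h : IsNuisance P N) (hc : IsCopulaDensity c) :
    ∀ᵐ r : ℝ × ℝ, 0 ≤ eMarg P N c r.1 r.2 := by
  filter_upwards [h.ae_ae_e_nonneg hc] with r hr using integral_nonneg_of_ae hr

/-- The identified effect surface times the marginal principal density. -/
lemma eMarg_mul_tauObs (h : IsNuisance P N) (hc : IsCopulaDensity c) :
    ∀ᵐ r : ℝ × ℝ, eMarg P N c r.1 r.2 * tauObs P N c r.1 r.2 =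
      ∫ x, N.e c r.1 r.2 x * N.contrast (x, r) ∂lawX P := by
  filter_upwards [h.ae_ae_e_nonneg hc, h.ae_integrable_e hc] with r hr hi
  -- Where the marginal density vanishes, `e` vanishes for almost every `x`; both sides are `0` and
  -- the value of the quotient is irrelevant.
  by_cases h0 : eMarg P N c r.1 r.2 = 0
  · rw [h0, zero_mul]
    have := (integral_eq_zero_iff_of_nonneg_ae hr hi).1 h0
    rw [integral_eq_zero_of_ae]
    filter_upwards [this] with x hx
    simp [hx]
  · rw [tauObs, ← integral_const_mul]
    refine integral_congr_ae (Eventually.of_forall fun x => ?_)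
    simp only [Nuisance.contrast]
    field_simp

lemma measurable_eMarg (h : IsNuisance P N) (hc : IsCopulaDensity c) :
    Measurable fun r : ℝ × ℝ => eMarg P N c r.1 r.2 :=
  (StronglyMeasurable.integral_prod_left' (μ := lawX P)
    (f := fun a : 𝒳 × ℝ × ℝ => N.e c a.2.1 a.2.2 a.1) (h.measurable_e hc).stronglyMeasurable).measurable

lemma measurable_tauObs (h : IsNuisance P N) (hc : IsCopulaDensity c) :
    Measurable fun r : ℝ × ℝ => tauObs P N c r.1 r.2 :=
  (StronglyMeasurable.integral_prod_left' (μ := lawX P)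
    (f := fun a : 𝒳 × ℝ × ℝ => N.e c a.2.1 a.2.2 a.1 / eMarg P N c a.2.1 a.2.2 * N.contrast a)
    (((h.measurable_e hc).div ((h.measurable_eMarg hc).comp measurable_snd)).mul
      h.measurable_contrast).stronglyMeasurable).measurable

/-- Integration of a function of `(S₁, S₀)` times `cF k`. -/
lemma integral_cF_mul (h : IsNuisance P N) {k : 𝒳 × ℝ × ℝ → ℝ}
    (hk : Integrable (fun a => cF c N a * k a) (T P N)) :
    Integrable (fun r : ℝ × ℝ => ∫ x, N.e c r.1 r.2 x * k (x, r) ∂lawX P) ∧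
    ∫ a, cF c N a * k a ∂T P N = ∫ r : ℝ × ℝ, ∫ x, N.e c r.1 r.2 x * k (x, r) ∂lawX P := by
  have h1 := h.integrable_e_mul.1 hk
  exact ⟨h1.integral_prod_right, by rw [h.integral_e_mul, integral_prod_symm _ h1]⟩

lemma integral_cF_mul_eMarg (h : IsNuisance P N) {k : ℝ × ℝ → ℝ}
    (hk : Integrable (fun a => cF c N a * k a.2) (T P N)) :
    Integrable (fun r : ℝ × ℝ => eMarg P N c r.1 r.2 * k r) ∧
    ∫ a, cF c N a * k a.2 ∂T P N = ∫ r : ℝ × ℝ, eMarg P N c r.1 r.2 * k r := by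
  have h1 := h.integral_cF_mul hk
  simp only [integral_mul_const] at h1
  exact h1

lemma integral_cF_mul_tauObs (h : IsNuisance P N) (hc : IsCopulaDensity c) {k : ℝ × ℝ → ℝ}
    (hk : Integrable (fun a => cF c N a * (k a.2 * N.contrast a)) (T P N)) :
    Integrable (fun r : ℝ × ℝ => eMarg P N c r.1 r.2 * (k r * tauObs P N c r.1 r.2)) ∧
    ∫ a, cF c N a * (k a.2 * N.contrast a) ∂T P N =
      ∫ r : ℝ × ℝ, eMarg P N c r.1 r.2 * (k r * tauObs P N c r.1 r.2) := by
  have h1 := h.integral_cF_mul hk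
  have e : (fun r : ℝ × ℝ => ∫ x, N.e c r.1 r.2 x * (k r * N.contrast (x, r)) ∂lawX P) =ᵐ[volume]
      fun r => eMarg P N c r.1 r.2 * (k r * tauObs P N c r.1 r.2) := by
    filter_upwards [h.eMarg_mul_tauObs hc] with r hr
    rw [mul_left_comm, hr, ← integral_const_mul]
    refine integral_congr_ae (Eventually.of_forall fun x => ?_)
    simp only; ring
  exact ⟨h1.1.congr e, h1.2.trans (integral_congr_ae e)⟩

/-- The objective of an observed law, up to a term that is free of the parameter. -/
theorem objectiveObs_eq (h : IsNuisance P N) (hc : IsCopulaDensity c) {w : ℝ → ℝ → ℝ}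
    (hw : Measurable (Function.uncurry w)) (hw0 : ∀ s₁ s₀, 0 ≤ w s₁ s₀)
    (h2 : Integrable (fun a => cF c N a * (w a.2.1 a.2.2 * N.contrast a ^ 2)) (T P N)) :
    ∃ C : ℝ, ∀ {q : ℕ} (f : ℝ → ℝ → (Fin q → ℝ) → ℝ) (η : Fin q → ℝ),
      Measurable (fun r : ℝ × ℝ => f r.1 r.2 η) →
      Integrable (fun a => cF c N a * (w a.2.1 a.2.2 * f a.2.1 a.2.2 η ^ 2)) (T P N) →
      Integrable (fun a => cF c N a * (w a.2.1 a.2.2 * f a.2.1 a.2.2 η * N.contrast a)) (T P N) →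
      0 ≤ C + 2 * ∫ a, f a.2.1 a.2.2 η ^ 2 / 2 * (w a.2.1 a.2.2 * cF c N a) -
        f a.2.1 a.2.2 η * (w a.2.1 a.2.2 * cF c N a * N.contrast a) ∂T P N ∧
      objectiveObs P N c w f η = ENNReal.ofReal
        (C + 2 * ∫ a, f a.2.1 a.2.2 η ^ 2 / 2 * (w a.2.1 a.2.2 * cF c N a) -
          f a.2.1 a.2.2 η * (w a.2.1 a.2.2 * cF c N a * N.contrast a) ∂T P N) := by
  have hwm : Measurable fun r : ℝ × ℝ => w r.1 r.2 := hw
  -- Jensen's inequality: `eMarg * τ²` is at most the integral over `x` of `e (μ₁ - μ₀)²`, as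
  -- expanding the squared deviation of the contrast from `τ` shows. It makes the term free of the
  -- parameter finite.
  have hsq : Integrable fun r : ℝ × ℝ => eMarg P N c r.1 r.2 *
      (w r.1 r.2 * tauObs P N c r.1 r.2 ^ 2) := by
    refine (h.integral_cF_mul h2).1.mono' ((h.measurable_eMarg hc).mul
      (hwm.mul ((h.measurable_tauObs hc).pow_const 2))).aestronglyMeasurable ?_
    have hi2 := (h.integrable_e_mul.1 h2).prod_left_ae
    filter_upwards [h.ae_ae_e_nonneg hc, h.ae_integrable_e hc, h.eMarg_mul_tauObs hc,
      h.ae_eMarg_nonneg hc, hi2] with r hr hi ht h0 hi2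
    rw [Real.norm_of_nonneg (mul_nonneg h0 (mul_nonneg (hw0 _ _) (sq_nonneg _)))]
    -- The second moment is controlled only after multiplication by `w`; where `w > 0` the weight
    -- can be divided out.
    rcases (hw0 r.1 r.2).eq_or_lt with hw' | hw'
    · simp [← hw']
    have hi2' : Integrable (fun x => N.e c r.1 r.2 x * N.contrast (x, r) ^ 2) (lawX P) := by
      have := hi2.const_mul (w r.1 r.2)⁻¹
      refine this.congr (Eventually.of_forall fun x => ?_)
      simp only
      field_simp
    -- `|t| ≤ 1 + t²` bounds the first moment by the mass and the second moment.
    have hi1 : Integrable (fun x => N.e c r.1 r.2 x * N.contrast (x, r)) (lawX P) := by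
      refine (hi.add hi2').mono' (((h.measurable_e hc).comp (measurable_id.prodMk
        measurable_const)).mul (h.measurable_contrast.comp (measurable_id.prodMk
        measurable_const))).aestronglyMeasurable ?_
      filter_upwards [hr] with x hx
      rw [Real.norm_eq_abs, abs_mul, abs_of_nonneg hx, Pi.add_apply]
      nlinarith [sq_nonneg (|N.contrast (x, r)| - 1), sq_abs (N.contrast (x, r)),
        abs_nonneg (N.contrast (x, r))]
    set t := tauObs P N c r.1 r.2
    have key : 0 ≤ ∫ x, N.e c r.1 r.2 x * (N.contrast (x, r) - t) ^ 2 ∂lawX P :=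
      integral_nonneg_of_ae (by filter_upwards [hr] with x hx using mul_nonneg hx (sq_nonneg _))
    have e1 : ∫ x, N.e c r.1 r.2 x * (N.contrast (x, r) - t) ^ 2 ∂lawX P =
        (∫ x, N.e c r.1 r.2 x * N.contrast (x, r) ^ 2 ∂lawX P) -
          2 * t * (∫ x, N.e c r.1 r.2 x * N.contrast (x, r) ∂lawX P) +
          t ^ 2 * eMarg P N c r.1 r.2 := by
      have hs : Integrable (fun x => N.e c r.1 r.2 x * N.contrast (x, r) ^ 2 -
          2 * t * (N.e c r.1 r.2 x * N.contrast (x, r))) (lawX P) := hi2'.sub (hi1.const_mul _)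
      rw [eMarg, ← integral_const_mul, ← integral_const_mul, ← integral_sub hi2' (hi1.const_mul _),
        ← integral_add hs (hi.const_mul _)]
      refine integral_congr_ae (Eventually.of_forall fun x => ?_)
      simp only; ring
    rw [e1, ← ht] at key
    have e2 : ∫ x, N.e c r.1 r.2 x * (w r.1 r.2 * N.contrast (x, r) ^ 2) ∂lawX P =
        w r.1 r.2 * ∫ x, N.e c r.1 r.2 x * N.contrast (x, r) ^ 2 ∂lawX P := by
      rw [← integral_const_mul]
      refine integral_congr_ae (Eventually.of_forall fun x => ?_)
      simp only; ring
    rw [e2]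
    calc _ = w r.1 r.2 * (eMarg P N c r.1 r.2 * t ^ 2) := by ring
      _ ≤ _ := by gcongr; nlinarith
  -- The constant is the `τ²` term of the expanded square, which involves neither `f` nor `η`.
  refine ⟨∫ r : ℝ × ℝ, eMarg P N c r.1 r.2 * (w r.1 r.2 * tauObs P N c r.1 r.2 ^ 2), ?_⟩
  intro q f η hfm hf hfd
  obtain ⟨j1, j2⟩ := h.integral_cF_mul_eMarg (k := fun r => w r.1 r.2 * f r.1 r.2 η ^ 2) hf
  obtain ⟨j3, j4⟩ := h.integral_cF_mul_tauObs hc (k := fun r => w r.1 r.2 * f r.1 r.2 η) hfd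
  have e1 : 2 * ∫ a, f a.2.1 a.2.2 η ^ 2 / 2 * (w a.2.1 a.2.2 * cF c N a) -
        f a.2.1 a.2.2 η * (w a.2.1 a.2.2 * cF c N a * N.contrast a) ∂T P N =
      (∫ a, cF c N a * (w a.2.1 a.2.2 * f a.2.1 a.2.2 η ^ 2) ∂T P N) -
        2 * ∫ a, cF c N a * (w a.2.1 a.2.2 * f a.2.1 a.2.2 η * N.contrast a) ∂T P N := by
    rw [← integral_const_mul, ← integral_const_mul, ← integral_sub hf (hfd.const_mul _)]
    refine integral_congr_ae (Eventually.of_forall fun a => ?_)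
    simp only; ring
  have e2 : (∫ r : ℝ × ℝ, eMarg P N c r.1 r.2 * (w r.1 r.2 * tauObs P N c r.1 r.2 ^ 2)) +
      2 * ∫ a, f a.2.1 a.2.2 η ^ 2 / 2 * (w a.2.1 a.2.2 * cF c N a) -
        f a.2.1 a.2.2 η * (w a.2.1 a.2.2 * cF c N a * N.contrast a) ∂T P N =
      ∫ r : ℝ × ℝ, w r.1 r.2 * (tauObs P N c r.1 r.2 - f r.1 r.2 η) ^ 2 * eMarg P N c r.1 r.2 := by
    have hs : Integrable (fun r : ℝ × ℝ => eMarg P N c r.1 r.2 * (w r.1 r.2 * f r.1 r.2 η ^ 2) -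
        2 * (eMarg P N c r.1 r.2 * (w r.1 r.2 * f r.1 r.2 η * tauObs P N c r.1 r.2))) :=
      j1.sub (j3.const_mul _)
    rw [e1, j2, j4, ← integral_const_mul, ← integral_sub j1 (j3.const_mul _),
      ← integral_add hsq hs]
    refine integral_congr_ae (Eventually.of_forall fun a => ?_)
    simp only; ring
  have hnn : ∀ᵐ r : ℝ × ℝ, 0 ≤ w r.1 r.2 * (tauObs P N c r.1 r.2 - f r.1 r.2 η) ^ 2 *
      eMarg P N c r.1 r.2 := by
    filter_upwards [h.ae_eMarg_nonneg hc] with r hr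
    exact mul_nonneg (mul_nonneg (hw0 _ _) (sq_nonneg _)) hr
  have hint : Integrable fun r : ℝ × ℝ => w r.1 r.2 * (tauObs P N c r.1 r.2 - f r.1 r.2 η) ^ 2 *
      eMarg P N c r.1 r.2 := by
    refine (hsq.add (j1.sub (j3.const_mul 2))).congr (Eventually.of_forall fun r => ?_)
    simp only [Pi.add_apply, Pi.sub_apply]; ring
  rw [e2]
  refine ⟨integral_nonneg_of_ae hnn, ?_⟩
  rw [objectiveObs, ofReal_integral_eq_lintegral_ofReal hint hnn]

end IsNuisance

end PCE

namespace PCE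

/-! ## Identification -/

variable {Ω 𝒳 : Type*} [MeasurableSpace Ω] [StandardBorelSpace Ω] [MeasurableSpace 𝒳]

namespace Causal

/-- The covariates and the principal stratum. -/
def XU (D : Causal Ω 𝒳) (ω : Ω) : 𝒳 × ℝ × ℝ := (D.X ω, D.U ω)

/-- The covariates and the potential variables. -/
def XW (D : Causal Ω 𝒳) (ω : Ω) : 𝒳 × ℝ × ℝ × ℝ × ℝ :=
  (D.X ω, D.S false ω, D.S true ω, D.Y false ω, D.Y true ω)

end Causal

namespace Causal.IsModel

variable {Q : Measure Ω} [IsProbabilityMeasure Q] {D : Causal Ω 𝒳} {c : ℝ → ℝ → ℝ}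

lemma measurable_U (hD : D.IsModel Q c) : Measurable D.U :=
  (hD.measurable_S true).prodMk (hD.measurable_S false)

lemma measurable_XU (hD : D.IsModel Q c) : Measurable D.XU :=
  hD.measurable_X.prodMk hD.measurable_U

lemma measurable_XW (hD : D.IsModel Q c) : Measurable D.XW :=
  hD.measurable_X.prodMk ((hD.measurable_S false).prodMk ((hD.measurable_S true).prodMk
    ((hD.measurable_Y false).prodMk (hD.measurable_Y true))))

lemma measurable_select (hD : D.IsModel Q c) {k : Bool → Ω → ℝ} (hk : ∀ z, Measurable (k z)) :
    Measurable fun ω => k (D.Z ω) ω := by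
  have : (fun ω => k (D.Z ω) ω) = fun ω => if D.Z ω = true then k true ω else k false ω := by
    ext ω; cases D.Z ω <;> simp
  rw [this]
  exact Measurable.ite (hD.measurable_Z (measurableSet_singleton true)) (hk true) (hk false)

lemma measurable_obs (hD : D.IsModel Q c) : Measurable D.obs :=
  (hD.measurable_select hD.measurable_Y).prodMk ((hD.measurable_select hD.measurable_S).prodMk
    (hD.measurable_Z.prodMk hD.measurable_X))

lemma isProbabilityMeasure_obsLaw (hD : D.IsModel Q c) : IsProbabilityMeasure (D.obsLaw Q) :=
  Measure.isProbabilityMeasure_map hD.measurable_obs.aemeasurable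

lemma lawX_obsLaw (hD : D.IsModel Q c) : lawX (D.obsLaw Q) = Q.map D.X := by
  rw [lawX, obsLaw, Measure.map_map measurable_lawX_map hD.measurable_obs]
  rfl

variable {N : Nuisance 𝒳}

/-- `π` lives on the space of observations; here it is recognised as a conditional probability on
`Ω`, where ignorability is stated. -/
lemma condExp_treatment (hD : D.IsModel Q c) (hN : IsNuisance (D.obsLaw Q) N) (z : Bool) :
    Q⟦D.Z ⁻¹' {z} | D.sigmaX⟧ =ᵐ[Q] fun ω => N.prob z (D.X ω) := by
  have := hD.isProbabilityMeasure_obsLaw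
  have hZs : MeasurableSet (D.Z ⁻¹' {z}) := hD.measurable_Z (measurableSet_singleton z)
  have hpi : Integrable (fun ω => N.prob z (D.X ω)) Q := by
    have : ∀ᵐ ω ∂Q, ∀ z, 0 < N.prob z (D.X ω) := by
      have := hN.prob_pos
      rw [hD.lawX_obsLaw] at this
      exact ae_of_ae_map hD.measurable_X.aemeasurable this
    refine Integrable.of_bound
      ((hN.measurable_prob z).comp hD.measurable_X).aestronglyMeasurable 1 ?_
    filter_upwards [this] with ω hω
    rw [Real.norm_eq_abs, abs_of_pos (hω z)]
    have h1 := hω true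
    have h2 := hω false
    rw [Nuisance.prob_true] at h1
    rw [Nuisance.prob_false] at h2
    cases z
    · rw [Nuisance.prob_false]; linarith
    · rw [Nuisance.prob_true]; linarith
  symm
  refine ae_eq_condExp_of_forall_setIntegral_eq hD.measurable_X.comap_le
    ((integrable_const 1).indicator hZs) (fun s _ _ => hpi.integrableOn) ?_ ?_
  · rintro s ⟨A, hA, rfl⟩ -
    rw [setIntegral_indicator hZs, setIntegral_const, smul_eq_mul, mul_one]
    have h1 := hN.measure_treatment z hA
    have hm : MeasurableSet {v : Obs 𝒳 | v.2.2.1 = z ∧ v.2.2.2 ∈ A} :=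
      ((measurable_fst.comp (measurable_snd.comp measurable_snd))
        (measurableSet_singleton z)).inter (measurable_lawX_map hA)
    have hset : D.X ⁻¹' A ∩ D.Z ⁻¹' {z} = D.obs ⁻¹' {v : Obs 𝒳 | v.2.2.1 = z ∧ v.2.2.2 ∈ A} := by
      ext ω; simp [Causal.obs, and_comm]
    rw [obsLaw, Measure.map_apply hD.measurable_obs hm, ← hset] at h1
    have hnn : ∀ᵐ x ∂lawX (D.obsLaw Q), 0 ≤ N.prob z x := by
      filter_upwards [hN.prob_pos] with x hx using (hx z).le
    rw [Measure.real, h1, ← integral_toReal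
      (hN.measurable_prob z).ennreal_ofReal.aemeasurable
      (Eventually.of_forall fun _ => ENNReal.ofReal_lt_top)]
    rw [integral_congr_ae (g := fun x => N.prob z x) (ae_restrict_of_ae (by
      filter_upwards [hnn] with x hx using ENNReal.toReal_ofReal hx))]
    rw [← obsLaw, hD.lawX_obsLaw, setIntegral_map hA (hN.measurable_prob z).aestronglyMeasurable
      hD.measurable_X.aemeasurable]
  · exact ((hN.measurable_prob z).comp (comap_measurable D.X)).aestronglyMeasurable

lemma integrable_prob (hD : D.IsModel Q c) (hN : IsNuisance (D.obsLaw Q) N) (z : Bool) :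
    Integrable (fun ω => N.prob z (D.X ω)) Q :=
  integrable_condExp.congr (hD.condExp_treatment hN z)

lemma ae_prob_pos (hD : D.IsModel Q c) (hN : IsNuisance (D.obsLaw Q) N) :
    ∀ᵐ ω ∂Q, ∀ z, 0 < N.prob z (D.X ω) := by
  have := hD.isProbabilityMeasure_obsLaw
  have := hN.prob_pos
  rw [hD.lawX_obsLaw] at this
  exact ae_of_ae_map hD.measurable_X.aemeasurable this

/-- By treatment ignorability, the law of covariates and potential variables on `{Z = z}` has
density `P(Z = z ∣ X)`. -/
lemma map_XW_restrict (hD : D.IsModel Q c) (hN : IsNuisance (D.obsLaw Q) N) (z : Bool) :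
    (Q.restrict (D.Z ⁻¹' {z})).map D.XW =
      (Q.map D.XW).withDensity fun a => ENNReal.ofReal (N.prob z a.1) := by
  have := Measure.isFiniteMeasure_map (Q.restrict (D.Z ⁻¹' {z})) D.XW
  have hZs : MeasurableSet (D.Z ⁻¹' {z}) := hD.measurable_Z (measurableSet_singleton z)
  set W : Ω → ℝ × ℝ × ℝ × ℝ := fun ω => (D.S false ω, D.S true ω, D.Y false ω, D.Y true ω) with hWd
  have hW : Measurable W := (hD.measurable_S false).prodMk ((hD.measurable_S true).prodMk
    ((hD.measurable_Y false).prodMk (hD.measurable_Y true)))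
  refine Measure.ext_prod fun {A B} hA hB => ?_
  have hXA := hD.measurable_X hA
  have hWB : MeasurableSet (W ⁻¹' B) := hW hB
  have hpre : D.XW ⁻¹' (A ×ˢ B) = D.X ⁻¹' A ∩ W ⁻¹' B := rfl
  have hpm : Measurable fun a : 𝒳 × ℝ × ℝ × ℝ × ℝ => ENNReal.ofReal (N.prob z a.1) :=
    ((hN.measurable_prob z).comp measurable_fst).ennreal_ofReal
  rw [Measure.map_apply hD.measurable_XW (hA.prod hB), withDensity_apply _ (hA.prod hB),
    setLIntegral_map (hA.prod hB) hpm hD.measurable_XW,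
    Measure.restrict_apply (hD.measurable_XW (hA.prod hB)), hpre]
  -- Conditional independence factors the conditional probability of `{Z = z} ∩ W ⁻¹' B`. The first
  -- factor is `prob z (X)`; it is moved inside the conditional expectation of the second, and the
  -- conditioning is then integrated away.
  have hci := (condIndepFun_iff_condExp_inter_preimage_eq_mul hD.measurable_Z hW).1
    hD.treatment_ignorability {z} B (measurableSet_singleton z) hB
  have hprob := hD.condExp_treatment hN z
  have hmX := hD.measurable_X.comap_le
  have hint : Integrable ((fun ω => N.prob z (D.X ω)) * (W ⁻¹' B).indicator fun _ => (1 : ℝ)) Q := by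
    refine ((hD.integrable_prob hN z).indicator hWB).congr (Eventually.of_forall fun ω => ?_)
    simp only [Pi.mul_apply, indicator]; split_ifs <;> simp
  have hpull := condExp_mul_of_stronglyMeasurable_left (m := D.sigmaX) (μ := Q)
    (f := fun ω => N.prob z (D.X ω)) (g := (W ⁻¹' B).indicator fun _ => (1 : ℝ))
    ((hN.measurable_prob z).comp (comap_measurable D.X)).stronglyMeasurable hint
    ((integrable_const 1).indicator hWB)
  have e1 : Q.real (D.X ⁻¹' A ∩ (D.Z ⁻¹' {z} ∩ W ⁻¹' B)) =
      ∫ ω in D.X ⁻¹' A ∩ W ⁻¹' B, N.prob z (D.X ω) ∂Q := by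
    calc Q.real (D.X ⁻¹' A ∩ (D.Z ⁻¹' {z} ∩ W ⁻¹' B))
        = ∫ ω in D.X ⁻¹' A, (D.Z ⁻¹' {z} ∩ W ⁻¹' B).indicator (fun _ => (1 : ℝ)) ω ∂Q := by
          rw [setIntegral_indicator (hZs.inter hWB), setIntegral_const, smul_eq_mul, mul_one]
      _ = ∫ ω in D.X ⁻¹' A, (Q⟦D.Z ⁻¹' {z} ∩ W ⁻¹' B | D.sigmaX⟧) ω ∂Q :=
          (setIntegral_condExp hmX ((integrable_const 1).indicator (hZs.inter hWB))
            ⟨A, hA, rfl⟩).symm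
      _ = ∫ ω in D.X ⁻¹' A, (Q[(fun ω => N.prob z (D.X ω)) *
            (W ⁻¹' B).indicator fun _ => (1 : ℝ) | D.sigmaX]) ω ∂Q := by
          refine integral_congr_ae (ae_restrict_of_ae ?_)
          filter_upwards [hci, hprob, hpull] with ω h1 h2 h3
          rw [h1, h2, h3]; rfl
      _ = ∫ ω in D.X ⁻¹' A, ((fun ω => N.prob z (D.X ω)) *
            (W ⁻¹' B).indicator fun _ => (1 : ℝ)) ω ∂Q := setIntegral_condExp hmX hint ⟨A, hA, rfl⟩
      _ = ∫ ω in D.X ⁻¹' A, (W ⁻¹' B).indicator (fun ω => N.prob z (D.X ω)) ω ∂Q := by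
          refine integral_congr_ae (Eventually.of_forall fun ω => ?_)
          simp only [Pi.mul_apply, indicator]; split_ifs <;> simp
      _ = _ := setIntegral_indicator hWB
  have e2 : D.X ⁻¹' A ∩ W ⁻¹' B ∩ D.Z ⁻¹' {z} = D.X ⁻¹' A ∩ (D.Z ⁻¹' {z} ∩ W ⁻¹' B) := by
    ext; simp; tauto
  have e3 : ∫⁻ ω in D.X ⁻¹' A ∩ W ⁻¹' B, ENNReal.ofReal (N.prob z (D.XW ω).1) ∂Q =
      ENNReal.ofReal (∫ ω in D.X ⁻¹' A ∩ W ⁻¹' B, N.prob z (D.X ω) ∂Q) := by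
    rw [ofReal_integral_eq_lintegral_ofReal (hD.integrable_prob hN z).integrableOn
      (ae_restrict_of_ae (by filter_upwards [hD.ae_prob_pos hN] with ω hω using (hω z).le))]
    rfl
  rw [e2, e3, ← e1, ofReal_measureReal]

lemma setIntegral_arm (hD : D.IsModel Q c) (hN : IsNuisance (D.obsLaw Q) N) (z : Bool)
    {k : 𝒳 × ℝ × ℝ × ℝ × ℝ → ℝ} (hk : Measurable k) :
    ∫ ω in D.Z ⁻¹' {z}, k (D.XW ω) ∂Q = ∫ ω, N.prob z (D.X ω) * k (D.XW ω) ∂Q := by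
  have hpos : ∀ᵐ a ∂Q.map D.XW, 0 ≤ N.prob z a.1 := by
    have hm : MeasurableSet {a : 𝒳 × ℝ × ℝ × ℝ × ℝ | 0 ≤ N.prob z a.1} :=
      ((hN.measurable_prob z).comp measurable_fst) measurableSet_Ici
    rw [ae_map_iff hD.measurable_XW.aemeasurable hm]
    filter_upwards [hD.ae_prob_pos hN] with ω hω using (hω z).le
  rw [← integral_map hD.measurable_XW.aemeasurable hk.aestronglyMeasurable,
    hD.map_XW_restrict hN z,
    integral_withDensity_ofReal (g := fun a : 𝒳 × ℝ × ℝ × ℝ × ℝ => N.prob z a.1)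
      ((hN.measurable_prob z).comp measurable_fst) hpos,
    integral_map hD.measurable_XW.aemeasurable]
  · rfl
  · exact (((hN.measurable_prob z).comp measurable_fst).mul hk).aestronglyMeasurable

/-- The function of `(X, W)` that picks out `(X, S_z)`. -/
def xs (z : Bool) (a : 𝒳 × ℝ × ℝ × ℝ × ℝ) : 𝒳 × ℝ := (a.1, if z then a.2.2.1 else a.2.1)

/-- The function of `(X, W)` that picks out `Y_z`. -/
def yy (z : Bool) (a : 𝒳 × ℝ × ℝ × ℝ × ℝ) : ℝ := if z then a.2.2.2.2 else a.2.2.2.1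

omit [StandardBorelSpace Ω] [MeasurableSpace Ω] [MeasurableSpace 𝒳] in
lemma xs_XW (D : Causal Ω 𝒳) (z : Bool) (ω : Ω) : xs z (D.XW ω) = (D.X ω, D.S z ω) := by
  cases z <;> rfl

omit [StandardBorelSpace Ω] [MeasurableSpace Ω] [MeasurableSpace 𝒳] in
lemma yy_XW (D : Causal Ω 𝒳) (z : Bool) (ω : Ω) : yy z (D.XW ω) = D.Y z ω := by
  cases z <;> rfl

omit [StandardBorelSpace Ω] [MeasurableSpace Ω] in
lemma measurable_xs (z : Bool) : Measurable (xs (𝒳 := 𝒳) z) := by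
  unfold xs
  cases z <;> simp <;> fun_prop

omit [StandardBorelSpace Ω] [MeasurableSpace Ω] in
lemma measurable_yy (z : Bool) : Measurable (yy (𝒳 := 𝒳) z) := by
  unfold yy
  cases z <;> simp <;> fun_prop

/-- The law of `(X, S_z)`. -/
lemma map_xs (hD : D.IsModel Q c) (hN : IsNuisance (D.obsLaw Q) N) (z : Bool) :
    Q.map (fun ω => (D.X ω, D.S z ω)) = ((lawX (D.obsLaw Q)).prod volume).withDensity
      fun a => ENNReal.ofReal (N.p z a.2 a.1) := by
  have := hD.isProbabilityMeasure_obsLaw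
  set g : 𝒳 × ℝ → ENNReal := fun a => ENNReal.ofReal (N.prob z a.1) with hg
  have hgm : Measurable g := ((hN.measurable_prob z).comp measurable_fst).ennreal_ofReal
  have hXS : Measurable fun ω => (D.X ω, D.S z ω) := hD.measurable_X.prodMk (hD.measurable_S z)
  have hpp : ∀ᵐ a ∂(lawX (D.obsLaw Q)).prod (volume : Measure ℝ), ∀ z, 0 < N.prob z a.1 :=
    Measure.quasiMeasurePreserving_fst.ae hN.prob_pos
  have hZs : MeasurableSet (D.Z ⁻¹' {z}) := hD.measurable_Z (measurableSet_singleton z)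
  -- `S_z` is seen only when `Z = z`. The two measures are compared after multiplication by `prob
  -- z`, that is, on arm `z`; overlap makes this factor invertible.
  have key : (Q.map fun ω => (D.X ω, D.S z ω)).withDensity g =
      (((lawX (D.obsLaw Q)).prod volume).withDensity
        fun a => ENNReal.ofReal (N.p z a.2 a.1)).withDensity g := by
    have e1 : armLaw (D.obsLaw Q) N z = (((lawX (D.obsLaw Q)).prod volume).withDensity
        fun a => ENNReal.ofReal (N.p z a.2 a.1)).withDensity g := by
      rw [← withDensity_mul _ (hN.measurable_p' z).ennreal_ofReal hgm, armLaw]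
      refine withDensity_congr_ae ?_
      filter_upwards [hpp] with a ha
      rw [ENNReal.ofReal_mul (ha z).le, mul_comm]; rfl
    rw [← e1, ← hN.map_restrict z]
    have hm : Measurable fun v : Obs 𝒳 => (v.2.2.2, v.2.1) :=
      measurable_lawX_map.prodMk (measurable_fst.comp measurable_snd)
    have hzs : MeasurableSet {v : Obs 𝒳 | v.2.2.1 = z} :=
      (measurable_fst.comp (measurable_snd.comp measurable_snd)) (measurableSet_singleton z)
    rw [obsLaw, Measure.restrict_map hD.measurable_obs hzs,
      Measure.map_map hm hD.measurable_obs]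
    have e2 : D.obs ⁻¹' {v : Obs 𝒳 | v.2.2.1 = z} = D.Z ⁻¹' {z} := rfl
    rw [e2]
    have e3 : (Q.restrict (D.Z ⁻¹' {z})).map ((fun v : Obs 𝒳 => (v.2.2.2, v.2.1)) ∘ D.obs) =
        (Q.restrict (D.Z ⁻¹' {z})).map (xs z ∘ D.XW) := by
      refine Measure.map_congr ?_
      filter_upwards [ae_restrict_mem hZs] with ω hω
      have hω' : D.Z ω = z := hω
      simp only [Function.comp_apply, xs_XW]
      simp [Causal.obs, hω']
    rw [e3, ← Measure.map_map (measurable_xs z) hD.measurable_XW, hD.map_XW_restrict hN z]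
    ext C hC
    have hgm' : Measurable fun a : 𝒳 × ℝ × ℝ × ℝ × ℝ => ENNReal.ofReal (N.prob z a.1) :=
      ((hN.measurable_prob z).comp measurable_fst).ennreal_ofReal
    rw [withDensity_apply _ hC, setLIntegral_map hC hgm hXS,
      Measure.map_apply (measurable_xs z) hC, withDensity_apply _ (measurable_xs z hC),
      setLIntegral_map (measurable_xs z hC) hgm' hD.measurable_XW]
    have e4 : D.XW ⁻¹' (xs z ⁻¹' C) = (fun ω => (D.X ω, D.S z ω)) ⁻¹' C := by
      ext ω; simp only [mem_preimage, xs_XW]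
    rw [e4]; rfl
  have hne : ∀ m : Measure (𝒳 × ℝ), (∀ᵐ a ∂m, 0 < N.prob z a.1) →
      (m.withDensity g).withDensity (fun a => (g a)⁻¹) = m := fun m hm =>
    withDensity_inv_same hgm (by filter_upwards [hm] with a ha; simpa [hg] using ha)
      (Eventually.of_forall fun _ => ENNReal.ofReal_ne_top)
  have hm1 : ∀ᵐ a ∂(Q.map fun ω => (D.X ω, D.S z ω)), 0 < N.prob z a.1 := by
    have hms : MeasurableSet {a : 𝒳 × ℝ | 0 < N.prob z a.1} :=
      ((hN.measurable_prob z).comp measurable_fst) measurableSet_Ioi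
    rw [ae_map_iff hXS.aemeasurable hms]
    filter_upwards [hD.ae_prob_pos hN] with ω hω using hω z
  rw [← hne _ hm1, key, hne]
  refine hpp.filter_mono (withDensity_absolutelyContinuous _ _).ae_le |>.mono fun a ha => ha z

end Causal.IsModel

end PCE

/-! ### Identification of the principal stratum, the outcome means and the objective -/

namespace PCE

variable {Ω 𝒳 : Type*} [MeasurableSpace Ω] [StandardBorelSpace Ω] [MeasurableSpace 𝒳]

/-- Finite measures on a product with `ℝ × ℝ` are determined by distribution functions. -/
lemma ext_prod_Iic {μ ν : Measure (𝒳 × ℝ × ℝ)} [IsFiniteMeasure μ] [IsFiniteMeasure ν]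
    (h : ∀ A, MeasurableSet A → ∀ a b : ℝ, μ (A ×ˢ Iic a ×ˢ Iic b) = ν (A ×ˢ Iic a ×ˢ Iic b)) :
    μ = ν := by
  have m1 : Measurable fun a : 𝒳 × ℝ × ℝ => a.2.1 := measurable_fst.comp measurable_snd
  have m2 : Measurable fun a : 𝒳 × ℝ × ℝ => a.2.2 := measurable_snd.comp measurable_snd
  -- Half-lines are upgraded to Borel sets one coordinate at a time: with the other two sets fixed,
  -- each side is a finite measure on `ℝ`.
  have h2 : ∀ A, MeasurableSet A → ∀ (a : ℝ) (B : Set ℝ), MeasurableSet B →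
      μ (A ×ˢ Iic a ×ˢ B) = ν (A ×ˢ Iic a ×ˢ B) := by
    intro A hA a B hB
    have hs : MeasurableSet (A ×ˢ Iic a ×ˢ (univ : Set ℝ)) :=
      hA.prod (measurableSet_Iic.prod MeasurableSet.univ)
    have e : ∀ (m : Measure (𝒳 × ℝ × ℝ)) (C : Set ℝ), MeasurableSet C →
        ((m.restrict (A ×ˢ Iic a ×ˢ univ)).map fun a => a.2.2) C = m (A ×ˢ Iic a ×ˢ C) := by
      intro m C hC
      rw [Measure.map_apply m2 hC, Measure.restrict_apply (m2 hC)]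
      congr 1; ext x; simp; tauto
    have : (μ.restrict (A ×ˢ Iic a ×ˢ univ)).map (fun a => a.2.2) =
        (ν.restrict (A ×ˢ Iic a ×ˢ univ)).map fun a => a.2.2 := by
      have := Measure.isFiniteMeasure_map (μ.restrict (A ×ˢ Iic a ×ˢ univ)) fun a => a.2.2
      refine Measure.ext_of_Iic _ _ fun b => ?_
      rw [e _ _ measurableSet_Iic, e _ _ measurableSet_Iic, h A hA]
    rw [← e μ B hB, this, e ν B hB]
  refine Measure.ext_prod₃ fun {A B C} hA hB hC => ?_
  have e : ∀ (m : Measure (𝒳 × ℝ × ℝ)) (B : Set ℝ), MeasurableSet B →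
      ((m.restrict (A ×ˢ univ ×ˢ C)).map fun a => a.2.1) B = m (A ×ˢ B ×ˢ C) := by
    intro m B hB
    rw [Measure.map_apply m1 hB, Measure.restrict_apply (m1 hB)]
    congr 1; ext x; simp; tauto
  have : (μ.restrict (A ×ˢ univ ×ˢ C)).map (fun a => a.2.1) =
      (ν.restrict (A ×ˢ univ ×ˢ C)).map fun a => a.2.1 := by
    have := Measure.isFiniteMeasure_map (μ.restrict (A ×ˢ univ ×ˢ C)) fun a => a.2.1
    refine Measure.ext_of_Iic _ _ fun b => ?_
    rw [e _ _ measurableSet_Iic, e _ _ measurableSet_Iic, h2 A hA b C hC]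
  rw [← e μ B hB, this, e ν B hB]

lemma measurable_copula {c : ℝ → ℝ → ℝ} (hc : IsCopulaDensity c) :
    Measurable fun p : ℝ × ℝ => copula c p.1 p.2 := by
  have e : (fun p : ℝ × ℝ => copula c p.1 p.2) = fun p : ℝ × ℝ => ∫ r : ℝ × ℝ,
      ({b : (ℝ × ℝ) × ℝ × ℝ | (0 < b.2.1 ∧ b.2.1 ≤ b.1.1) ∧ 0 < b.2.2 ∧ b.2.2 ≤ b.1.2}.indicator
        (fun b => c b.2.1 b.2.2)) (p, r) := by
    ext p
    rw [copula, ← integral_indicator (measurableSet_Ioc.prod measurableSet_Ioc)]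
    rfl
  rw [e]
  refine (StronglyMeasurable.integral_prod_right' (ν := volume) ?_).measurable
  refine ((hc.measurable.comp measurable_snd).indicator ?_).stronglyMeasurable
  have a1 : Measurable fun b : (ℝ × ℝ) × ℝ × ℝ => b.2.1 := by fun_prop
  have a2 : Measurable fun b : (ℝ × ℝ) × ℝ × ℝ => b.2.2 := by fun_prop
  have a3 : Measurable fun b : (ℝ × ℝ) × ℝ × ℝ => b.1.1 := by fun_prop
  have a4 : Measurable fun b : (ℝ × ℝ) × ℝ × ℝ => b.1.2 := by fun_prop
  exact ((measurableSet_lt measurable_const a1).inter (measurableSet_le a1 a3)).inter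
    ((measurableSet_lt measurable_const a2).inter (measurableSet_le a2 a4))

namespace Causal.IsModel

variable {Q : Measure Ω} [IsProbabilityMeasure Q] {D : Causal Ω 𝒳} {c : ℝ → ℝ → ℝ}
  {N : Nuisance 𝒳}

/-- The observed density `p z` is also the density of the potential `S_z` given `X`, by `map_xs`.
This lets the copula model be read in terms of the nuisance functions. -/
lemma condExp_S (hD : D.IsModel Q c) (hN : IsNuisance (D.obsLaw Q) N) (z : Bool) (s : ℝ) :
    Q⟦{ω | D.S z ω ≤ s} | D.sigmaX⟧ =ᵐ[Q] fun ω => N.F z s (D.X ω) := by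
  have := hD.isProbabilityMeasure_obsLaw
  have hSs : MeasurableSet {ω | D.S z ω ≤ s} := hD.measurable_S z measurableSet_Iic
  have hXS : Measurable fun ω => (D.X ω, D.S z ω) := hD.measurable_X.prodMk (hD.measurable_S z)
  have hFm : Measurable (N.F z s) := (hN.measurable_F z).comp (measurable_id.prodMk measurable_const)
  have hp : ∀ᵐ x ∂lawX (D.obsLaw Q), 0 ≤ N.F z s x ∧ N.F z s x ≤ 1 ∧
      Integrable (fun t => N.p z t x) := by
    filter_upwards [hN.integrable_p] with x hx
    exact ⟨integral_nonneg fun t => hN.nonneg_p z t x,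
      setIntegral_Iic_le_one (hx z).1 (fun t => hN.nonneg_p z t x) (hx z).2 s, (hx z).1⟩
  have hFi : Integrable (N.F z s) (lawX (D.obsLaw Q)) := by
    refine Integrable.of_bound hFm.aestronglyMeasurable 1 ?_
    filter_upwards [hp] with x hx
    rw [Real.norm_of_nonneg hx.1]; exact hx.2.1
  have hFi' : Integrable (fun ω => N.F z s (D.X ω)) Q := by
    rw [hD.lawX_obsLaw] at hFi
    exact hFi.comp_measurable hD.measurable_X
  symm
  refine ae_eq_condExp_of_forall_setIntegral_eq hD.measurable_X.comap_le
    ((integrable_const 1).indicator hSs) (fun s _ _ => hFi'.integrableOn) ?_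
    (hFm.comp (comap_measurable D.X)).aestronglyMeasurable
  rintro _ ⟨A, hA, rfl⟩ -
  rw [setIntegral_indicator hSs, setIntegral_const, smul_eq_mul, mul_one]
  have e1 : Q (D.X ⁻¹' A ∩ {ω | D.S z ω ≤ s}) =
      ∫⁻ x in A, ENNReal.ofReal (N.F z s x) ∂lawX (D.obsLaw Q) := by
    have e2 : D.X ⁻¹' A ∩ {ω | D.S z ω ≤ s} = (fun ω => (D.X ω, D.S z ω)) ⁻¹' (A ×ˢ Iic s) := rfl
    rw [e2, ← Measure.map_apply hXS (hA.prod measurableSet_Iic), hD.map_xs hN z,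
      withDensity_apply _ (hA.prod measurableSet_Iic), ← Measure.prod_restrict,
      lintegral_prod _ (hN.measurable_p' z).ennreal_ofReal.aemeasurable]
    refine lintegral_congr_ae (ae_restrict_of_ae ?_)
    filter_upwards [hp] with x hx
    exact (ofReal_integral_eq_lintegral_ofReal hx.2.2.integrableOn
      (Eventually.of_forall fun t => hN.nonneg_p z t x)).symm
  rw [← ofReal_integral_eq_lintegral_ofReal hFi.integrableOn (ae_restrict_of_ae (by
    filter_upwards [hp] with x hx using hx.1))] at e1
  rw [Measure.real, e1, ENNReal.toReal_ofReal (integral_nonneg_of_ae (ae_restrict_of_ae (by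
    filter_upwards [hp] with x hx using hx.1))), hD.lawX_obsLaw,
    setIntegral_map hA hFm.aestronglyMeasurable hD.measurable_X.aemeasurable]

/-- The law of the covariates and the principal stratum. -/
theorem map_XU (hD : D.IsModel Q c) (hc : IsCopulaDensity c) (hN : IsNuisance (D.obsLaw Q) N) :
    Q.map D.XU = (T (D.obsLaw Q) N).withDensity fun a => ENNReal.ofReal (cF c N a) := by
  have := hD.isProbabilityMeasure_obsLaw
  have : IsProbabilityMeasure (Q.map D.XU) :=
    Measure.isProbabilityMeasure_map hD.measurable_XU.aemeasurable
  have : IsProbabilityMeasure ((T (D.obsLaw Q) N).withDensity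
      fun a => ENNReal.ofReal (cF c N a)) := by
    constructor
    rw [withDensity_apply _ MeasurableSet.univ, Measure.restrict_univ, hN.lintegral_cF hc]
  refine ext_prod_Iic fun A hA s₁ s₀ => ?_
  have hs : MeasurableSet (A ×ˢ Iic s₁ ×ˢ Iic s₀) :=
    hA.prod (measurableSet_Iic.prod measurableSet_Iic)
  have hSs : MeasurableSet {ω | D.S true ω ≤ s₁ ∧ D.S false ω ≤ s₀} :=
    (hD.measurable_S true measurableSet_Iic).inter (hD.measurable_S false measurableSet_Iic)
  rw [withDensity_apply _ hs, hN.setLIntegral_cF hc hA, Measure.map_apply hD.measurable_XU hs]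
  set k : 𝒳 → ℝ := fun x => copula c (N.F true s₁ x) (N.F false s₀ x) with hk
  have hce : Q⟦{ω | D.S true ω ≤ s₁ ∧ D.S false ω ≤ s₀} | D.sigmaX⟧ =ᵐ[Q] fun ω => k (D.X ω) := by
    filter_upwards [hD.copula_model s₁ s₀, hD.condExp_S hN true s₁, hD.condExp_S hN false s₀]
      with ω h1 h2 h3
    rw [h1, h2, h3]
  have hki : Integrable (fun ω => k (D.X ω)) Q := integrable_condExp.congr hce
  have hk0 : ∀ᵐ ω ∂Q, 0 ≤ k (D.X ω) := by
    have := condExp_nonneg (m := D.sigmaX) (μ := Q)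
      (f := {ω | D.S true ω ≤ s₁ ∧ D.S false ω ≤ s₀}.indicator fun _ => (1 : ℝ))
      (Eventually.of_forall fun ω => indicator_nonneg (fun _ _ => zero_le_one) _)
    filter_upwards [this, hce] with ω h1 h2
    rw [← h2]; exact h1
  have e1 : Q.real (D.X ⁻¹' A ∩ {ω | D.S true ω ≤ s₁ ∧ D.S false ω ≤ s₀}) =
      ∫ ω in D.X ⁻¹' A, k (D.X ω) ∂Q := by
    rw [← integral_congr_ae (ae_restrict_of_ae hce), setIntegral_condExp hD.measurable_X.comap_le
      ((integrable_const 1).indicator hSs) ⟨A, hA, rfl⟩, setIntegral_indicator hSs,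
      setIntegral_const, smul_eq_mul, mul_one]
  have e2 : D.XU ⁻¹' (A ×ˢ Iic s₁ ×ˢ Iic s₀) =
      D.X ⁻¹' A ∩ {ω | D.S true ω ≤ s₁ ∧ D.S false ω ≤ s₀} := rfl
  have e3 : ∫⁻ x in A, ENNReal.ofReal (k x) ∂lawX (D.obsLaw Q) =
      ∫⁻ ω in D.X ⁻¹' A, ENNReal.ofReal (k (D.X ω)) ∂Q := by
    have hkm : Measurable k := (measurable_copula hc).comp
      (((hN.measurable_F true).comp (measurable_id.prodMk measurable_const)).prodMk
        ((hN.measurable_F false).comp (measurable_id.prodMk measurable_const)))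
    rw [hD.lawX_obsLaw, setLIntegral_map hA hkm.ennreal_ofReal hD.measurable_X]
  rw [e2, e3, ← ofReal_integral_eq_lintegral_ofReal hki.integrableOn (ae_restrict_of_ae hk0), ← e1,
    ofReal_measureReal]

lemma integrable_XU (hD : D.IsModel Q c) (hc : IsCopulaDensity c) (hN : IsNuisance (D.obsLaw Q) N)
    {k : 𝒳 × ℝ × ℝ → ℝ} (hk : Measurable k) : Integrable (fun ω => k (D.XU ω)) Q ↔
      Integrable (fun a => cF c N a * k a) (T (D.obsLaw Q) N) := by
  have := hD.isProbabilityMeasure_obsLaw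
  rw [← integrable_withDensity_ofReal (hN.measurable_cF hc) (hN.ae_T_cF_nonneg hc),
    ← hD.map_XU hc hN, integrable_map_measure hk.aestronglyMeasurable
      hD.measurable_XU.aemeasurable]
  rfl

lemma integral_XU (hD : D.IsModel Q c) (hc : IsCopulaDensity c) (hN : IsNuisance (D.obsLaw Q) N)
    {k : 𝒳 × ℝ × ℝ → ℝ} (hk : Measurable k) : ∫ ω, k (D.XU ω) ∂Q =
      ∫ a, cF c N a * k a ∂T (D.obsLaw Q) N := by
  have := hD.isProbabilityMeasure_obsLaw
  rw [← integral_withDensity_ofReal (hN.measurable_cF hc) (hN.ae_T_cF_nonneg hc),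
    ← hD.map_XU hc hN, integral_map hD.measurable_XU.aemeasurable hk.aestronglyMeasurable]

/-- The law of the principal stratum. -/
lemma map_U (hD : D.IsModel Q c) (hc : IsCopulaDensity c) (hN : IsNuisance (D.obsLaw Q) N) :
    Q.map D.U = volume.withDensity
      fun r : ℝ × ℝ => ENNReal.ofReal (eMarg (D.obsLaw Q) N c r.1 r.2) := by
  have := hD.isProbabilityMeasure_obsLaw
  ext B hB
  have hB' : MeasurableSet ((univ : Set 𝒳) ×ˢ B) := MeasurableSet.univ.prod hB
  have e1 : D.U ⁻¹' B = D.XU ⁻¹' (univ ×ˢ B) := by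
    ext ω; simp [Causal.XU]
  have hem := (hN.measurable_e hc).ennreal_ofReal
  rw [Measure.map_apply hD.measurable_U hB, e1, ← Measure.map_apply hD.measurable_XU hB',
    hD.map_XU hc hN, withDensity_apply _ hB', withDensity_apply _ hB,
    T, ← lintegral_indicator hB', lintegral_withDensity_eq_lintegral_mul _
      hN.measurable_dens.ennreal_ofReal
      ((hN.measurable_cF hc).ennreal_ofReal.indicator hB'), ← lintegral_indicator hB]
  have e2 : ((fun a : 𝒳 × ℝ × ℝ => ENNReal.ofReal (N.p true a.2.1 a.1 * N.p false a.2.2 a.1)) *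
      (univ ×ˢ B).indicator fun a => ENNReal.ofReal (cF c N a)) =
      (univ ×ˢ B).indicator fun a => ENNReal.ofReal (N.e c a.2.1 a.2.2 a.1) := by
    ext a
    simp only [Pi.mul_apply, indicator]
    split_ifs
    · rw [e_eq, ENNReal.ofReal_mul (hN.dens_nonneg a)]
    · simp
  rw [e2, lintegral_prod_symm _ (hem.indicator hB').aemeasurable]
  refine lintegral_congr_ae ?_
  filter_upwards [hN.ae_ae_e_nonneg hc, hN.ae_integrable_e hc] with r hr hi
  by_cases hrB : r ∈ B
  · simp only [indicator, mem_prod, mem_univ, true_and, hrB, if_true]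
    rw [eMarg, ofReal_integral_eq_lintegral_ofReal hi hr]
  · simp only [indicator, mem_prod, mem_univ, true_and, hrB, if_false, lintegral_zero]

/-- Under principal ignorability, `E(Y_z ∣ U, X)` is the observed outcome mean. -/
theorem condExp_Y (hD : D.IsModel Q c) (hN : IsNuisance (D.obsLaw Q) N) (z : Bool) :
    Q[D.Y z | MeasurableSpace.comap (fun ω => (D.U ω, D.X ω)) inferInstance] =ᵐ[Q]
      fun ω => N.μ z (D.S z ω) (D.X ω) := by
  have := hD.isProbabilityMeasure_obsLaw
  obtain ⟨m, hm, hce⟩ := hD.principal_ignorability z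
  refine hce.trans ?_
  have hUX : Measurable fun ω => (D.U ω, D.X ω) := hD.measurable_U.prodMk hD.measurable_X
  have hXS : Measurable fun ω => (D.X ω, D.S z ω) := hD.measurable_X.prodMk (hD.measurable_S z)
  have hZs : MeasurableSet (D.Z ⁻¹' {z}) := hD.measurable_Z (measurableSet_singleton z)
  have hpos := hD.ae_prob_pos hN
  have hμ := hN.measurable_μ z
  have hmi : Integrable (fun ω => m (D.S z ω) (D.X ω)) Q := integrable_condExp.congr hce
  have hpb : ∀ᵐ ω ∂Q, ‖N.prob z (D.X ω)‖ ≤ 1 := by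
    filter_upwards [hpos] with ω hω
    rw [Real.norm_of_nonneg (hω z).le]
    have h1 := hω true
    have h2 := hω false
    rw [Nuisance.prob_true] at h1
    rw [Nuisance.prob_false] at h2
    cases z
    · rw [Nuisance.prob_false]; linarith
    · rw [Nuisance.prob_true]; linarith
  have hpm : Measurable fun ω => N.prob z (D.X ω) := (hN.measurable_prob z).comp hD.measurable_X
  have hi1 : Integrable (fun ω => N.prob z (D.X ω) * m (D.S z ω) (D.X ω)) Q :=
    hmi.bdd_mul hpm.aestronglyMeasurable hpb
  have hiY : Integrable (fun ω => N.prob z (D.X ω) * D.Y z ω) Q :=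
    (hD.integrable_Y z).bdd_mul hpm.aestronglyMeasurable hpb
  -- A priori `N.μ z` at `(S_z, X)` is integrable on arm `z` only, which amounts to integrability on
  -- `Ω` after weighting by `prob z`.
  have hi2 : Integrable (fun ω => N.prob z (D.X ω) * N.μ z (D.S z ω) (D.X ω)) Q := by
    have h1 : Integrable (fun v : Obs 𝒳 => N.μ v.2.2.1 v.2.1 v.2.2.2) (D.obsLaw Q) :=
      integrable_condExp.congr hN.outcome.2.2
    have h2 : Integrable (fun ω => N.μ (D.Z ω) (D.S (D.Z ω) ω) (D.X ω)) Q :=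
      h1.comp_measurable hD.measurable_obs
    have h3 : Integrable (fun ω => N.μ z (D.S z ω) (D.X ω)) (Q.restrict (D.Z ⁻¹' {z})) := by
      refine h2.integrableOn.congr ?_
      filter_upwards [ae_restrict_mem hZs] with ω hω
      have hω' : D.Z ω = z := hω
      simp [hω']
    have hk : Measurable fun a : 𝒳 × ℝ × ℝ × ℝ × ℝ => N.μ z (xs z a).2 (xs z a).1 :=
      hμ.comp (measurable_xs z)
    have h4 : Integrable (fun a : 𝒳 × ℝ × ℝ × ℝ × ℝ => N.μ z (xs z a).2 (xs z a).1)
        ((Q.restrict (D.Z ⁻¹' {z})).map D.XW) := by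
      rw [integrable_map_measure hk.aestronglyMeasurable hD.measurable_XW.aemeasurable]
      refine h3.congr (Eventually.of_forall fun ω => ?_)
      simp only [Function.comp_apply, xs_XW]
    have hpos' : ∀ᵐ a ∂Q.map D.XW, 0 ≤ N.prob z a.1 := by
      have hm : MeasurableSet {a : 𝒳 × ℝ × ℝ × ℝ × ℝ | 0 ≤ N.prob z a.1} :=
        ((hN.measurable_prob z).comp measurable_fst) measurableSet_Ici
      rw [ae_map_iff hD.measurable_XW.aemeasurable hm]
      filter_upwards [hpos] with ω hω using (hω z).le
    rw [hD.map_XW_restrict hN z, integrable_withDensity_ofReal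
      (g := fun a : 𝒳 × ℝ × ℝ × ℝ × ℝ => N.prob z a.1)
      ((hN.measurable_prob z).comp measurable_fst) hpos'] at h4
    refine (h4.comp_measurable hD.measurable_XW).congr (Eventually.of_forall fun ω => ?_)
    simp only [Function.comp_apply, xs_XW]; rfl
  -- By principal ignorability both sides are functions of `(X, S_z)`, so integrals over sets `E`
  -- determined by `(X, S_z)` decide. The weight `prob z` turns them into integrals over arm `z`,
  -- where `Y = Y_z`.
  have key : (fun a : 𝒳 × ℝ => N.prob z a.1 * m a.2 a.1)
      =ᵐ[Q.map fun ω => (D.X ω, D.S z ω)] fun a => N.prob z a.1 * N.μ z a.2 a.1 := by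
    have hm' : Measurable fun a : 𝒳 × ℝ => N.prob z a.1 * m a.2 a.1 :=
      ((hN.measurable_prob z).comp measurable_fst).mul (hm.comp measurable_swap)
    have hμ' : Measurable fun a : 𝒳 × ℝ => N.prob z a.1 * N.μ z a.2 a.1 :=
      ((hN.measurable_prob z).comp measurable_fst).mul hμ
    refine Integrable.ae_eq_of_forall_setIntegral_eq _ _
      ((integrable_map_measure hm'.aestronglyMeasurable hXS.aemeasurable).2 hi1)
      ((integrable_map_measure hμ'.aestronglyMeasurable hXS.aemeasurable).2 hi2) fun C hC _ => ?_
    rw [setIntegral_map hC hm'.aestronglyMeasurable hXS.aemeasurable,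
      setIntegral_map hC hμ'.aestronglyMeasurable hXS.aemeasurable]
    set E := (fun ω => (D.X ω, D.S z ω)) ⁻¹' C with hE
    have hEm : MeasurableSet E := hXS hC
    have hEx : ∀ ω, D.XW ω ∈ xs z ⁻¹' C ↔ ω ∈ E := fun ω => by
      simp only [mem_preimage, xs_XW, hE]
    have hxC : MeasurableSet (xs z ⁻¹' C : Set (𝒳 × ℝ × ℝ × ℝ × ℝ)) := measurable_xs z hC
    have arm : ∀ (k : 𝒳 × ℝ × ℝ × ℝ × ℝ → ℝ) (k' : Ω → ℝ), Measurable k →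
        (∀ ω, k (D.XW ω) = k' ω) →
        ∫ ω in D.Z ⁻¹' {z}, E.indicator k' ω ∂Q = ∫ ω in E, N.prob z (D.X ω) * k' ω ∂Q := by
      intro k k' hk hkk'
      have h1 := hD.setIntegral_arm hN z (hk.indicator hxC)
      have h2 : ∀ ω, (xs z ⁻¹' C).indicator k (D.XW ω) = E.indicator k' ω := by
        intro ω
        by_cases hω : ω ∈ E
        · rw [indicator_of_mem hω, indicator_of_mem ((hEx ω).2 hω), hkk']
        · rw [indicator_of_notMem hω, indicator_of_notMem fun h => hω ((hEx ω).1 h)]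
      simp only [h2] at h1
      rw [h1, ← integral_indicator hEm]
      refine integral_congr_ae (Eventually.of_forall fun ω => ?_)
      simp only [indicator]; split_ifs <;> simp
    have e1 := arm (yy z) (D.Y z) (measurable_yy z) fun ω => yy_XW D z ω
    have e2 := arm (fun a => N.μ z (xs z a).2 (xs z a).1) (fun ω => N.μ z (D.S z ω) (D.X ω))
      (hμ.comp (measurable_xs z)) fun ω => by simp only [xs_XW]
    -- `E` belongs to `σ(U, X)`, so `Y_z` may be replaced by its conditional mean `m`.
    have e3 : ∫ ω in E, N.prob z (D.X ω) * D.Y z ω ∂Q =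
        ∫ ω in E, N.prob z (D.X ω) * m (D.S z ω) (D.X ω) ∂Q := by
      have hcm : Measurable[MeasurableSpace.comap (fun ω => (D.U ω, D.X ω)) inferInstance]
          fun ω => (D.U ω, D.X ω) := comap_measurable _
      have hEm' : MeasurableSet[MeasurableSpace.comap (fun ω => (D.U ω, D.X ω)) inferInstance] E := by
        refine ⟨(fun b : (ℝ × ℝ) × 𝒳 => (b.2, coord z b.1)) ⁻¹' C,
          (measurable_snd.prodMk ((measurable_coord z).comp measurable_fst)) hC, ?_⟩
        ext ω; cases z <;> simp [hE, Causal.U]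
      have hpull := condExp_mul_of_stronglyMeasurable_left (μ := Q)
        (m := MeasurableSpace.comap (fun ω => (D.U ω, D.X ω)) inferInstance)
        (f := fun ω => N.prob z (D.X ω)) (g := D.Y z)
        (((hN.measurable_prob z).comp measurable_snd).comp hcm).stronglyMeasurable hiY
        (hD.integrable_Y z)
      rw [← setIntegral_condExp hUX.comap_le hiY hEm']
      refine integral_congr_ae (ae_restrict_of_ae ?_)
      filter_upwards [hpull, hce] with ω h1 h2
      have h1' : (Q[fun ω => N.prob z (D.X ω) * D.Y z ω |
          MeasurableSpace.comap (fun ω => (D.U ω, D.X ω)) inferInstance]) ω = _ := h1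
      rw [h1', Pi.mul_apply, h2]
    -- On arm `z` the observed outcome is `Y_z`; this is the defining property of the observed mean,
    -- tested on `{Z = z} ∩ E`.
    have e4 : ∫ ω in D.Z ⁻¹' {z}, E.indicator (D.Y z) ω ∂Q =
        ∫ ω in D.Z ⁻¹' {z}, E.indicator (fun ω => N.μ z (D.S z ω) (D.X ω)) ω ∂Q := by
      have hCz : MeasurableSet {u : ℝ × Bool × 𝒳 | u.2.1 = z ∧ (u.2.2, u.1) ∈ C} :=
        ((measurable_fst.comp measurable_snd) (measurableSet_singleton z)).inter
          (((measurable_snd.comp measurable_snd).prodMk measurable_fst) hC)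
      have h1 := setIntegral_condExp (m := MeasurableSpace.comap (fun v : Obs 𝒳 => v.2)
        inferInstance) (μ := D.obsLaw Q) (f := fun v : Obs 𝒳 => v.1) measurable_snd.comap_le
        hN.outcome.2.1 ⟨_, hCz, rfl⟩
      rw [integral_congr_ae (ae_restrict_of_ae hN.outcome.2.2)] at h1
      have hCz' : MeasurableSet (Prod.snd ⁻¹' {u : ℝ × Bool × 𝒳 | u.2.1 = z ∧ (u.2.2, u.1) ∈ C} :
          Set (Obs 𝒳)) := measurable_snd hCz
      have hμm : Measurable fun v : Obs 𝒳 => N.μ v.2.2.1 v.2.1 v.2.2.2 := by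
        have : (fun v : Obs 𝒳 => N.μ v.2.2.1 v.2.1 v.2.2.2) = fun v : Obs 𝒳 =>
            if v.2.2.1 = true then N.μ true v.2.1 v.2.2.2 else N.μ false v.2.1 v.2.2.2 := by
          ext v; cases v.2.2.1 <;> simp
        rw [this]
        have hsx : Measurable fun v : Obs 𝒳 => (v.2.1, v.2.2.2) :=
          (measurable_fst.comp measurable_snd).prodMk measurable_lawX_map
        exact Measurable.ite ((measurable_fst.comp (measurable_snd.comp measurable_snd))
          (measurableSet_singleton true)) ((hN.outcome.1 true).comp hsx)
          ((hN.outcome.1 false).comp hsx)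
      rw [obsLaw, setIntegral_map hCz' hμm.aestronglyMeasurable hD.measurable_obs.aemeasurable,
        setIntegral_map hCz' measurable_fst.aestronglyMeasurable
          hD.measurable_obs.aemeasurable] at h1
      have hset : D.obs ⁻¹' (Prod.snd ⁻¹' {u : ℝ × Bool × 𝒳 | u.2.1 = z ∧ (u.2.2, u.1) ∈ C}) =
          D.Z ⁻¹' {z} ∩ E := by
        ext ω
        simp only [mem_preimage, mem_ofPred_eq, Causal.obs, mem_inter_iff, mem_singleton_iff, hE]
        constructor
        · rintro ⟨a, b⟩; rw [a] at b; exact ⟨a, b⟩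
        · rintro ⟨a, b⟩; rw [a]; exact ⟨rfl, b⟩
      rw [hset] at h1
      rw [setIntegral_indicator hEm, setIntegral_indicator hEm]
      have c1 : ∫ ω in D.Z ⁻¹' {z} ∩ E, (D.obs ω).1 ∂Q = ∫ ω in D.Z ⁻¹' {z} ∩ E, D.Y z ω ∂Q := by
        refine setIntegral_congr_fun (hZs.inter hEm) fun ω hω => ?_
        have hω' : D.Z ω = z := hω.1
        simp [Causal.obs, hω']
      have c2 : ∫ ω in D.Z ⁻¹' {z} ∩ E, N.μ (D.obs ω).2.2.1 (D.obs ω).2.1 (D.obs ω).2.2.2 ∂Q =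
          ∫ ω in D.Z ⁻¹' {z} ∩ E, N.μ z (D.S z ω) (D.X ω) ∂Q := by
        refine setIntegral_congr_fun (hZs.inter hEm) fun ω hω => ?_
        have hω' : D.Z ω = z := hω.1
        simp [Causal.obs, hω']
      rw [← c1, ← c2]; exact h1.symm
    rw [← e3, ← e1, e4, e2]
  filter_upwards [ae_of_ae_map hXS.aemeasurable key, hpos] with ω h1 h2
  exact mul_left_cancel₀ (h2 z).ne' h1

lemma integrable_contrast (hD : D.IsModel Q c) (hN : IsNuisance (D.obsLaw Q) N) :
    Integrable (fun ω => N.contrast (D.XU ω)) Q :=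
  (integrable_condExp.congr (hD.condExp_Y hN true)).sub
    (integrable_condExp.congr (hD.condExp_Y hN false))

/-- Tower property from `σ(U, X)` down to `σ(U)`, with the inner conditional means supplied by
`condExp_Y`. -/
lemma tau_eq_condExp (hD : D.IsModel Q c) (hN : IsNuisance (D.obsLaw Q) N) :
    D.tau Q =ᵐ[Q] Q[fun ω => N.contrast (D.XU ω) | MeasurableSpace.comap D.U inferInstance] := by
  have hUX : Measurable fun ω => (D.U ω, D.X ω) := hD.measurable_U.prodMk hD.measurable_X
  have hle : MeasurableSpace.comap D.U inferInstance ≤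
      MeasurableSpace.comap (fun ω => (D.U ω, D.X ω)) inferInstance := by
    rintro _ ⟨B, hB, rfl⟩
    exact ⟨Prod.fst ⁻¹' B, measurable_fst hB, rfl⟩
  have h1 := condExp_condExp_of_le (μ := Q) (f := fun ω => D.Y true ω - D.Y false ω) hle
    hUX.comap_le
  refine h1.symm.trans (condExp_congr_ae ?_)
  have h2 := condExp_sub (μ := Q) (hD.integrable_Y true) (hD.integrable_Y false)
    (MeasurableSpace.comap (fun ω => (D.U ω, D.X ω)) inferInstance)
  filter_upwards [h2, hD.condExp_Y hN true, hD.condExp_Y hN false] with ω a1 a2 a3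
  have a1' : (Q[fun ω => D.Y true ω - D.Y false ω |
      MeasurableSpace.comap (fun ω => (D.U ω, D.X ω)) inferInstance]) ω = _ := a1
  rw [a1', Pi.sub_apply, a2, a3]; rfl

/-- The principal causal effect is identified. -/
theorem tau_eq_tauObs (hD : D.IsModel Q c) (hc : IsCopulaDensity c)
    (hN : IsNuisance (D.obsLaw Q) N) :
    D.tau Q =ᵐ[Q] fun ω => tauObs (D.obsLaw Q) N c (D.U ω).1 (D.U ω).2 := by
  have := hD.isProbabilityMeasure_obsLaw
  refine (hD.tau_eq_condExp hN).trans (EventuallyEq.symm ?_)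
  have hci := (hD.integrable_XU hc hN hN.measurable_contrast).1 (hD.integrable_contrast hN)
  have hmap : ∀ k : ℝ × ℝ → ℝ, Measurable k → (Integrable (fun ω => k (D.U ω)) Q ↔
      Integrable fun r : ℝ × ℝ => eMarg (D.obsLaw Q) N c r.1 r.2 * k r) := by
    intro k hk
    rw [← integrable_withDensity_ofReal (hN.measurable_eMarg hc) (hN.ae_eMarg_nonneg hc),
      ← hD.map_U hc hN, integrable_map_measure hk.aestronglyMeasurable
        hD.measurable_U.aemeasurable]
    rfl
  have hti : Integrable (fun ω => tauObs (D.obsLaw Q) N c (D.U ω).1 (D.U ω).2) Q := by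
    refine (hmap (fun r => tauObs (D.obsLaw Q) N c r.1 r.2) (hN.measurable_tauObs hc)).2 ?_
    have := (hN.integral_cF_mul_tauObs hc (k := fun _ => 1) (by simpa using hci)).1
    simpa using this
  refine ae_eq_condExp_of_forall_setIntegral_eq hD.measurable_U.comap_le
    (hD.integrable_contrast hN) (fun s _ _ => hti.integrableOn) ?_
    ((hN.measurable_tauObs hc).comp (comap_measurable D.U)).aestronglyMeasurable
  rintro _ ⟨B, hB, rfl⟩ -
  have hUB := hD.measurable_U hB
  have hci' : Integrable (fun a => cF c N a * (B.indicator (fun _ => (1 : ℝ)) a.2 *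
      N.contrast a)) (T (D.obsLaw Q) N) := by
    refine (hci.indicator (measurable_snd hB)).congr (Eventually.of_forall fun a => ?_)
    by_cases ha : a.2 ∈ B
    · have ha' : a ∈ Prod.snd ⁻¹' B := ha
      simp [indicator_of_mem ha, indicator_of_mem ha']
    · have ha' : a ∉ Prod.snd ⁻¹' B := ha
      simp [indicator_of_notMem ha, indicator_of_notMem ha']
  have e1 := (hN.integral_cF_mul_tauObs hc (k := B.indicator fun _ => 1) hci').2
  have hm1 : Measurable fun r : ℝ × ℝ => B.indicator (fun _ => (1 : ℝ)) r *
      tauObs (D.obsLaw Q) N c r.1 r.2 :=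
    (measurable_const.indicator hB).mul (hN.measurable_tauObs hc)
  have hkm : Measurable fun a : 𝒳 × ℝ × ℝ => B.indicator (fun _ => (1 : ℝ)) a.2 *
      N.contrast a :=
    ((measurable_const.indicator hB).comp measurable_snd).mul hN.measurable_contrast
  rw [← integral_withDensity_ofReal (hN.measurable_eMarg hc) (hN.ae_eMarg_nonneg hc),
      ← hD.map_U hc hN, integral_map hD.measurable_U.aemeasurable hm1.aestronglyMeasurable,
      ← hD.integral_XU hc hN (k := fun a => B.indicator (fun _ => (1 : ℝ)) a.2 * N.contrast a)
        hkm] at e1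
  rw [← integral_indicator hUB, ← integral_indicator hUB]
  have c1 : ∀ k : Ω → ℝ, (fun ω => (D.U ⁻¹' B).indicator k ω) =
      fun ω => B.indicator (fun _ => (1 : ℝ)) (D.U ω) * k ω := by
    intro k; ext ω
    by_cases hω : D.U ω ∈ B
    · have hω' : ω ∈ D.U ⁻¹' B := hω
      simp [indicator_of_mem hω, indicator_of_mem hω']
    · have hω' : ω ∉ D.U ⁻¹' B := hω
      simp [indicator_of_notMem hω, indicator_of_notMem hω']
  rw [c1, c1]
  exact e1.symm

/-- The projection objective is identified. -/
theorem objective_eq_objectiveObs (hD : D.IsModel Q c) (hc : IsCopulaDensity c)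
    (hN : IsNuisance (D.obsLaw Q) N) {w : ℝ → ℝ → ℝ} (hw : Measurable (Function.uncurry w))
    (hw0 : ∀ s₁ s₀, 0 ≤ w s₁ s₀) {q : ℕ} {f : ℝ → ℝ → (Fin q → ℝ) → ℝ} {η : Fin q → ℝ}
    (hf : Measurable fun r : ℝ × ℝ => f r.1 r.2 η) :
    D.objective Q w f η = objectiveObs (D.obsLaw Q) N c w f η := by
  have := hD.isProbabilityMeasure_obsLaw
  have hwm : Measurable fun r : ℝ × ℝ => w r.1 r.2 := hw
  have hk : Measurable fun r : ℝ × ℝ => ENNReal.ofReal (w r.1 r.2 *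
      (tauObs (D.obsLaw Q) N c r.1 r.2 - f r.1 r.2 η) ^ 2) :=
    (hwm.mul (((hN.measurable_tauObs hc).sub hf).pow_const 2)).ennreal_ofReal
  have e1 : D.objective Q w f η = ∫⁻ ω, ENNReal.ofReal (w (D.U ω).1 (D.U ω).2 *
      (tauObs (D.obsLaw Q) N c (D.U ω).1 (D.U ω).2 - f (D.U ω).1 (D.U ω).2 η) ^ 2) ∂Q := by
    refine lintegral_congr_ae ?_
    filter_upwards [hD.tau_eq_tauObs hc hN] with ω hω
    rw [hω]; rfl
  rw [e1, ← lintegral_map hk hD.measurable_U, hD.map_U hc hN,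
    lintegral_withDensity_eq_lintegral_mul _ (hN.measurable_eMarg hc).ennreal_ofReal hk,
    objectiveObs]
  refine lintegral_congr fun r => ?_
  rw [ENNReal.ofReal_mul (mul_nonneg (hw0 _ _) (sq_nonneg _)), mul_comm]; rfl

/-- Expectations that are linear in the principal causal effect are identified. -/
lemma integral_mul_tau (hD : D.IsModel Q c) (hc : IsCopulaDensity c)
    (hN : IsNuisance (D.obsLaw Q) N) {k : ℝ × ℝ → ℝ} (hk : Measurable k)
    (hki : Integrable (fun a => cF c N a * (k a.2 * N.contrast a)) (T (D.obsLaw Q) N)) :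
    Integrable (fun ω => k (D.U ω) * D.tau Q ω) Q ∧
    ∫ ω, k (D.U ω) * D.tau Q ω ∂Q = ∫ a, cF c N a * (k a.2 * N.contrast a) ∂T (D.obsLaw Q) N := by
  have hkm : Measurable fun a : 𝒳 × ℝ × ℝ => k a.2 * N.contrast a :=
    (hk.comp measurable_snd).mul hN.measurable_contrast
  have hi : Integrable ((fun ω => k (D.U ω)) * fun ω => N.contrast (D.XU ω)) Q :=
    (hD.integrable_XU hc hN hkm).2 hki
  have hpull := condExp_mul_of_stronglyMeasurable_left (μ := Q)
    (m := MeasurableSpace.comap D.U inferInstance) (f := fun ω => k (D.U ω))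
    (hk.comp (comap_measurable D.U)).stronglyMeasurable hi (hD.integrable_contrast hN)
  have e : (fun ω => k (D.U ω) * D.tau Q ω) =ᵐ[Q]
      Q[(fun ω => k (D.U ω)) * fun ω => N.contrast (D.XU ω) |
        MeasurableSpace.comap D.U inferInstance] := by
    filter_upwards [hpull, hD.tau_eq_condExp hN] with ω h1 h2
    rw [h1, h2]; rfl
  refine ⟨integrable_condExp.congr e.symm, ?_⟩
  rw [integral_congr_ae e, integral_condExp hD.measurable_U.comap_le, ← hD.integral_XU hc hN hkm]
  rfl

end Causal.IsModel

end PCE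

namespace PCE

/-! ## Uniqueness of the nuisance functions -/

variable {𝒳 : Type*} [MeasurableSpace 𝒳]

namespace IsNuisance

variable {P : Measure (Obs 𝒳)} {N N' : Nuisance 𝒳}

lemma prob_unique (h : IsNuisance P N) (h' : IsNuisance P N') :
    ∀ᵐ x ∂lawX P, ∀ z, N.prob z x = N'.prob z x := by
  have hm : MeasurableSet {x | N.π x = N'.π x} :=
    measurableSet_eq_fun h.measurable_π h'.measurable_π
  have : ∀ᵐ x ∂lawX P, N.π x = N'.π x := by
    refine (ae_map_iff measurable_lawX_map.aemeasurable hm).2 ?_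
    filter_upwards [h.treatment, h'.treatment] with v h1 h2
    exact h1.symm.trans h2
  filter_upwards [this] with x hx z
  cases z <;> simp [Nuisance.prob, hx]

variable [IsProbabilityMeasure P]

/-- Two densities of the same arm law agree almost everywhere, and the positive factor `prob z`
cancels. -/
lemma p_unique (h : IsNuisance P N) (h' : IsNuisance P N') (z : Bool) :
    ∀ᵐ a ∂(lawX P).prod volume, N.p z a.2 a.1 = N'.p z a.2 a.1 := by
  have hw : armLaw P N z = armLaw P N' z := by rw [← h.map_restrict, ← h'.map_restrict]
  have hm : ∀ {N : Nuisance 𝒳}, IsNuisance P N →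
      Measurable fun a : 𝒳 × ℝ => ENNReal.ofReal (N.prob z a.1 * N.p z a.2 a.1) := fun h =>
    (((h.measurable_prob z).comp measurable_fst).mul (h.measurable_p' z)).ennreal_ofReal
  have he := (withDensity_eq_iff_of_sigmaFinite (hm h).aemeasurable (hm h').aemeasurable).1 hw
  have hx : ∀ᵐ x ∂lawX P, 0 < N.prob z x ∧ N.prob z x = N'.prob z x := by
    filter_upwards [h.prob_pos, h.prob_unique h'] with x h1 h2 using ⟨h1 z, h2 z⟩
  filter_upwards [he, Measure.quasiMeasurePreserving_fst.ae hx] with a h1 h2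
  rw [← h2.2, ENNReal.ofReal_eq_ofReal_iff (mul_nonneg h2.1.le (h.nonneg_p _ _ _))
    (mul_nonneg h2.1.le (h'.nonneg_p _ _ _))] at h1
  exact mul_left_cancel₀ h2.1.ne' h1

lemma F_unique (h : IsNuisance P N) (h' : IsNuisance P N') (z : Bool) :
    ∀ᵐ x ∂lawX P, ∀ s, N.F z s x = N'.F z s x := by
  filter_upwards [Measure.ae_ae_of_ae_prod (h.p_unique h' z)] with x hx s
  exact integral_congr_ae (ae_restrict_of_ae hx)

/-- Conditional means are determined only where arm `z` has mass. Elsewhere `e` vanishes, so the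
objective does not feel the ambiguity. -/
lemma μ_unique (h : IsNuisance P N) (h' : IsNuisance P N') (z : Bool) :
    ∀ᵐ a ∂(lawX P).prod volume, N.p z a.2 a.1 ≠ 0 → N.μ z a.2 a.1 = N'.μ z a.2 a.1 := by
  have hμ : ∀ {N : Nuisance 𝒳}, IsNuisance P N →
      Measurable fun u : ℝ × Bool × 𝒳 => N.μ u.2.1 u.1 u.2.2 := by
    intro N h
    have : (fun u : ℝ × Bool × 𝒳 => N.μ u.2.1 u.1 u.2.2) = fun u =>
        if u.2.1 = true then N.μ true u.1 u.2.2 else N.μ false u.1 u.2.2 := by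
      ext u; cases u.2.1 <;> simp
    rw [this]
    have hsx : Measurable fun u : ℝ × Bool × 𝒳 => (u.1, u.2.2) :=
      measurable_fst.prodMk (measurable_snd.comp measurable_snd)
    exact Measurable.ite ((measurable_fst.comp measurable_snd) (measurableSet_singleton true))
      ((h.outcome.1 true).comp hsx) ((h.outcome.1 false).comp hsx)
  refine h.ae_snd (p := fun u => N.μ u.2.1 u.1 u.2.2 = N'.μ u.2.1 u.1 u.2.2)
    (measurableSet_eq_fun (hμ h) (hμ h')) ?_ z
  filter_upwards [h.outcome.2.2, h'.outcome.2.2] with v h1 h2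
  exact h1.symm.trans h2

/-- The objective of an observed law does not depend on the versions of its nuisance functions. -/
theorem objectiveObs_unique (h : IsNuisance P N) (h' : IsNuisance P N') (c w : ℝ → ℝ → ℝ) {q : ℕ}
    (f : ℝ → ℝ → (Fin q → ℝ) → ℝ) (η : Fin q → ℝ) :
    objectiveObs P N c w f η = objectiveObs P N' c w f η := by
  have hall : ∀ᵐ a ∂(lawX P).prod (volume : Measure (ℝ × ℝ)),
      N.e c a.2.1 a.2.2 a.1 = N'.e c a.2.1 a.2.2 a.1 ∧
      N.e c a.2.1 a.2.2 a.1 * N.contrast a = N'.e c a.2.1 a.2.2 a.1 * N'.contrast a := by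
    have q1 := (quasiMeasurePreserving_coord (P := P) true).ae (h.p_unique h' true)
    have q0 := (quasiMeasurePreserving_coord (P := P) false).ae (h.p_unique h' false)
    have m1 := (quasiMeasurePreserving_coord (P := P) true).ae (h.μ_unique h' true)
    have m0 := (quasiMeasurePreserving_coord (P := P) false).ae (h.μ_unique h' false)
    have hx : ∀ᵐ x ∂lawX P, ∀ z s, N.F z s x = N'.F z s x := by
      filter_upwards [h.F_unique h' true, h.F_unique h' false] with x h1 h0 z
      cases z
      · exact h0
      · exact h1
    filter_upwards [q1, q0, m1, m0, Measure.quasiMeasurePreserving_fst.ae hx] with a q1 q0 m1 m0 hF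
    simp only [coord_true, coord_false] at q1 q0 m1 m0
    have he : N.e c a.2.1 a.2.2 a.1 = N'.e c a.2.1 a.2.2 a.1 := by
      simp only [Nuisance.e, hF, q1, q0]
    refine ⟨he, ?_⟩
    rw [← he]
    by_cases h1 : N.p true a.2.1 a.1 = 0
    · simp [Nuisance.e, h1]
    by_cases h0 : N.p false a.2.2 a.1 = 0
    · simp [Nuisance.e, h0]
    simp only [Nuisance.contrast, m1 h1, m0 h0]
  have hr : ∀ᵐ r : ℝ × ℝ, ∀ᵐ x ∂lawX P, N.e c r.1 r.2 x = N'.e c r.1 r.2 x ∧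
      N.e c r.1 r.2 x * N.contrast (x, r) = N'.e c r.1 r.2 x * N'.contrast (x, r) :=
    Measure.ae_ae_of_ae_prod (p := fun b : (ℝ × ℝ) × 𝒳 => N.e c b.1.1 b.1.2 b.2 =
      N'.e c b.1.1 b.1.2 b.2 ∧ N.e c b.1.1 b.1.2 b.2 * N.contrast (b.2, b.1) =
        N'.e c b.1.1 b.1.2 b.2 * N'.contrast (b.2, b.1))
      ((Measure.measurePreserving_swap (μ := volume) (ν := lawX P)).quasiMeasurePreserving.ae hall)
  refine lintegral_congr_ae ?_
  filter_upwards [hr] with r hr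
  have h1 : eMarg P N c r.1 r.2 = eMarg P N' c r.1 r.2 :=
    integral_congr_ae (hr.mono fun x hx => hx.1)
  have h2 : tauObs P N c r.1 r.2 = tauObs P N' c r.1 r.2 := by
    refine integral_congr_ae (hr.mono fun x hx => ?_)
    have := hx.2
    simp only [Nuisance.contrast] at this
    simp only [← h1, div_mul_eq_mul_div, this]
  rw [h1, h2]

end IsNuisance

end PCE

namespace PCE

/-! ## Nuisance functions of a law with a bounded density ratio -/

variable {𝒳 : Type*} [MeasurableSpace 𝒳]

/-- The law with density ratio `g` relative to `P`. -/
noncomputable def tiltLaw (P : Measure (Obs 𝒳)) (g : Obs 𝒳 → ℝ) : Measure (Obs 𝒳) :=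
  P.withDensity fun v => ENNReal.ofReal (g v)

/-- The conditional mean of `g(V)` given `Z = z` and `X = x`. -/
noncomputable def armMean (P : Measure (Obs 𝒳)) [IsFiniteMeasure P] (N : Nuisance 𝒳)
    (g : Obs 𝒳 → ℝ) (z : Bool) (x : 𝒳) : ℝ :=
  ∫ s, N.p z s x * kbar P g (s, z, x)

/-- The conditional mean of `g(V)` given `X = x`. -/
noncomputable def covMean (P : Measure (Obs 𝒳)) [IsFiniteMeasure P] (N : Nuisance 𝒳)
    (g : Obs 𝒳 → ℝ) (x : 𝒳) : ℝ :=
  N.prob true x * armMean P N g true x + N.prob false x * armMean P N g false x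

/-- The nuisance functions of the law with density ratio `g`. -/
noncomputable def Nuisance.tilt (P : Measure (Obs 𝒳)) [IsFiniteMeasure P] (N : Nuisance 𝒳)
    (g : Obs 𝒳 → ℝ) : Nuisance 𝒳 where
  π x := N.π x * armMean P N g true x / covMean P N g x
  p z s x := N.p z s x * kbar P g (s, z, x) / armMean P N g z x
  μ z s x := kbar P (fun v => v.1 * g v) (s, z, x) / kbar P g (s, z, x)

section KernelMean

variable {P : Measure (Obs 𝒳)} [IsFiniteMeasure P] {g : Obs 𝒳 → ℝ} {ε : ℝ}

lemma integrable_kap_of_bound (hg : Measurable g) (hb : ∀ v, |g v - 1| ≤ ε)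
    (u : ℝ × Bool × 𝒳) : Integrable (fun y => g (y, u)) (kap P u) := by
  refine Integrable.of_bound (hg.comp (measurable_id.prodMk measurable_const)).aestronglyMeasurable
    (ε + 1) (Eventually.of_forall fun y => ?_)
  have := abs_le.1 (hb (y, u))
  rw [Real.norm_eq_abs, abs_le]; constructor <;> linarith

lemma abs_kbar_sub_one_le (hg : Measurable g) (hb : ∀ v, |g v - 1| ≤ ε) (u : ℝ × Bool × 𝒳) :
    |kbar P g u - 1| ≤ ε := by
  have h1 : kbar P g u - 1 = ∫ y, (g (y, u) - 1) ∂kap P u := by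
    rw [integral_sub (integrable_kap_of_bound hg hb u) (integrable_const _)]
    simp [kbar]
  rw [h1, ← Real.norm_eq_abs]
  refine (norm_integral_le_of_norm_le_const (Eventually.of_forall fun y => hb _)).trans ?_
  simp

end KernelMean

namespace IsNuisance

variable {P : Measure (Obs 𝒳)} {N : Nuisance 𝒳} [IsProbabilityMeasure P]

lemma lintegral_map_snd (h : IsNuisance P N) {k : ℝ × Bool × 𝒳 → ENNReal} (hk : Measurable k) :
    ∫⁻ u, k u ∂(P.map fun v => v.2) = ∑ z, ∫⁻ a, ENNReal.ofReal (N.prob z a.1 * N.p z a.2 a.1) *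
      k (pt z a) ∂(lawX P).prod volume := by
  rw [h.map_snd, Fintype.sum_bool, lintegral_add_measure, Fintype.sum_bool]
  have e : ∀ z, ∫⁻ u, k u ∂((armLaw P N z).map (pt z)) =
      ∫⁻ a, ENNReal.ofReal (N.prob z a.1 * N.p z a.2 a.1) * k (pt z a) ∂(lawX P).prod volume := by
    intro z
    have hkm : Measurable fun a => k (pt z a) := hk.comp (measurable_pt z)
    have hdm : Measurable fun a : 𝒳 × ℝ => ENNReal.ofReal (N.prob z a.1 * N.p z a.2 a.1) :=
      (((h.measurable_prob z).comp measurable_fst).mul (h.measurable_p' z)).ennreal_ofReal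
    rw [lintegral_map hk (measurable_pt z), armLaw, lintegral_withDensity_eq_lintegral_mul _
      hdm hkm]
    rfl
  rw [e, e]

lemma measurable_arm_kbar (h : IsNuisance P N) {g : Obs 𝒳 → ℝ} (hg : Measurable g) (z : Bool) :
    Measurable fun a : 𝒳 × ℝ => N.p z a.2 a.1 * kbar P g (a.2, z, a.1) :=
  (h.measurable_p' z).mul ((measurable_kbar P hg).comp (measurable_pt z))

lemma measurable_armMean (h : IsNuisance P N) {g : Obs 𝒳 → ℝ} (hg : Measurable g) (z : Bool) :
    Measurable (armMean P N g z) :=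
  ((h.measurable_arm_kbar hg z).stronglyMeasurable.integral_prod_right
    (ν := (volume : Measure ℝ))).measurable

lemma measurable_covMean (h : IsNuisance P N) {g : Obs 𝒳 → ℝ} (hg : Measurable g) :
    Measurable (covMean P N g) :=
  ((h.measurable_prob _).mul (h.measurable_armMean hg _)).add
    ((h.measurable_prob _).mul (h.measurable_armMean hg _))

variable {g : Obs 𝒳 → ℝ} {ε : ℝ}

lemma integrable_arm_kbar (h : IsNuisance P N) (hg : Measurable g) (hb : ∀ v, |g v - 1| ≤ ε) :
    ∀ᵐ x ∂lawX P, ∀ z, Integrable fun s => N.p z s x * kbar P g (s, z, x) := by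
  filter_upwards [h.integrable_p] with x hx z
  refine (hx z).1.mul_bdd (c := ε + 1) ((measurable_kbar P hg).comp
    (measurable_id.prodMk measurable_const)).aestronglyMeasurable (Eventually.of_forall fun s => ?_)
  have := abs_le.1 (abs_kbar_sub_one_le (P := P) hg hb (s, z, x))
  rw [Real.norm_eq_abs, abs_le]; constructor <;> linarith

lemma abs_armMean_sub_one_le (h : IsNuisance P N) (hg : Measurable g) (hb : ∀ v, |g v - 1| ≤ ε) :
    ∀ᵐ x ∂lawX P, ∀ z, |armMean P N g z x - 1| ≤ ε := by
  filter_upwards [h.integrable_p, h.integrable_arm_kbar hg hb] with x hx hi z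
  have h1 : armMean P N g z x - 1 = ∫ s, N.p z s x * (kbar P g (s, z, x) - 1) := by
    simp only [mul_sub, mul_one]
    rw [integral_sub (hi z) (hx z).1, (hx z).2]; rfl
  rw [h1, ← Real.norm_eq_abs]
  refine (norm_integral_le_of_norm_le ((hx z).1.mul_const ε) (Eventually.of_forall fun s => ?_)).trans
    ?_
  · rw [norm_mul, Real.norm_eq_abs, abs_of_nonneg (h.nonneg_p _ _ _)]
    exact mul_le_mul_of_nonneg_left (abs_kbar_sub_one_le hg hb _) (h.nonneg_p _ _ _)
  · rw [integral_mul_const, (hx z).2, one_mul]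

lemma abs_covMean_sub_one_le (h : IsNuisance P N) (hg : Measurable g) (hb : ∀ v, |g v - 1| ≤ ε) :
    ∀ᵐ x ∂lawX P, |covMean P N g x - 1| ≤ ε := by
  filter_upwards [h.prob_pos, h.abs_armMean_sub_one_le hg hb] with x hp hx
  have h1 : covMean P N g x - 1 = N.prob true x * (armMean P N g true x - 1) +
      N.prob false x * (armMean P N g false x - 1) := by
    simp only [covMean, Nuisance.prob_true, Nuisance.prob_false]; ring
  have t := abs_le.1 (hx true)
  have f := abs_le.1 (hx false)
  have s : N.prob true x + N.prob false x = 1 := by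
    simp only [Nuisance.prob_true, Nuisance.prob_false]; ring
  rw [h1, abs_le]
  constructor <;> nlinarith [hp true, hp false]

/-- Integrating out `y` replaces the ratio by its conditional mean given `(S, Z, X)`. -/
lemma map_snd_tiltLaw (hg : Measurable g) (h0 : ∀ v, 0 ≤ g v) (hb : ∀ v, |g v - 1| ≤ ε) :
    (tiltLaw P g).map (fun v => v.2) =
      (P.map fun v => v.2).withDensity fun u => ENNReal.ofReal (kbar P g u) := by
  have hgi : Integrable g P := by
    refine Integrable.of_bound hg.aestronglyMeasurable (ε + 1) (Eventually.of_forall fun v => ?_)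
    have := abs_le.1 (hb v)
    rw [Real.norm_eq_abs, abs_le]; constructor <;> linarith
  have hk0 : ∀ u, 0 ≤ kbar P g u := fun u => integral_nonneg fun y => h0 _
  ext C hC
  have hCs : MeasurableSet ((fun v : Obs 𝒳 => v.2) ⁻¹' C) := measurable_snd hC
  rw [Measure.map_apply measurable_snd hC, tiltLaw, withDensity_apply _ hCs, withDensity_apply _ hC,
    ← ofReal_integral_eq_lintegral_ofReal hgi.integrableOn (Eventually.of_forall h0),
    ← ofReal_integral_eq_lintegral_ofReal (integral_kbar hgi).1.integrableOn
      (Eventually.of_forall hk0), ← integral_indicator hC, ← integral_indicator hCs,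
    (integral_kbar (hgi.indicator hCs)).2]
  congr 2
  ext u
  by_cases hu : u ∈ C
  · rw [indicator_of_mem hu]
    refine integral_congr_ae (Eventually.of_forall fun y => ?_)
    exact indicator_of_mem (show (y, u) ∈ (fun v : Obs 𝒳 => v.2) ⁻¹' C from hu) g
  · rw [indicator_of_notMem hu]
    refine integral_eq_zero_of_ae (Eventually.of_forall fun y => ?_)
    exact indicator_of_notMem (show (y, u) ∉ (fun v : Obs 𝒳 => v.2) ⁻¹' C from hu) g

lemma tiltLaw_arm (h : IsNuisance P N) (hg : Measurable g) (h0 : ∀ v, 0 ≤ g v)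
    (hb : ∀ v, |g v - 1| ≤ ε) (z : Bool) {A : Set 𝒳} (hA : MeasurableSet A) {B : Set ℝ}
    (hB : MeasurableSet B) : tiltLaw P g {v | v.2.1 ∈ B ∧ v.2.2.1 = z ∧ v.2.2.2 ∈ A} =
      ∫⁻ x in A, (ENNReal.ofReal (N.prob z x) *
        ∫⁻ s in B, ENNReal.ofReal (N.p z s x * kbar P g (s, z, x))) ∂lawX P := by
  have hE : MeasurableSet {u : ℝ × Bool × 𝒳 | u.1 ∈ B ∧ u.2.1 = z ∧ u.2.2 ∈ A} :=
    (measurable_fst hB).inter (((measurable_fst.comp measurable_snd) (measurableSet_singleton z)).inter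
      ((measurable_snd.comp measurable_snd) hA))
  have hGm : Measurable fun u : ℝ × Bool × 𝒳 => ENNReal.ofReal (kbar P g u) :=
    (measurable_kbar P hg).ennreal_ofReal
  have h1 : tiltLaw P g {v | v.2.1 ∈ B ∧ v.2.2.1 = z ∧ v.2.2.2 ∈ A} =
      (tiltLaw P g).map (fun v => v.2) {u | u.1 ∈ B ∧ u.2.1 = z ∧ u.2.2 ∈ A} := by
    rw [Measure.map_apply measurable_snd hE]; rfl
  rw [h1, map_snd_tiltLaw hg h0 hb, withDensity_apply _ hE, ← lintegral_indicator hE,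
    h.lintegral_map_snd (hGm.indicator hE)]
  have hne : ∫⁻ a, ENNReal.ofReal (N.prob (!z) a.1 * N.p (!z) a.2 a.1) *
      {u : ℝ × Bool × 𝒳 | u.1 ∈ B ∧ u.2.1 = z ∧ u.2.2 ∈ A}.indicator
        (fun u => ENNReal.ofReal (kbar P g u)) (pt (!z) a) ∂(lawX P).prod volume = 0 := by
    refine (lintegral_congr fun a => ?_).trans lintegral_zero
    rw [indicator_of_notMem, mul_zero]
    rintro ⟨-, h2, -⟩
    cases z <;> simp [pt] at h2
  have hsum : ∀ k : Bool → ENNReal, ∑ z', k z' = k z + k (!z) := by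
    intro k; cases z
    · simp [add_comm]
    · simp
  rw [hsum, hne, add_zero]
  have hm : Measurable fun a : 𝒳 × ℝ => ENNReal.ofReal (N.prob z a.1) *
      ENNReal.ofReal (N.p z a.2 a.1 * kbar P g (a.2, z, a.1)) :=
    ((h.measurable_prob z).comp measurable_fst).ennreal_ofReal.mul
      (h.measurable_arm_kbar hg z).ennreal_ofReal
  have e : ∫⁻ a, ENNReal.ofReal (N.prob z a.1 * N.p z a.2 a.1) *
      {u : ℝ × Bool × 𝒳 | u.1 ∈ B ∧ u.2.1 = z ∧ u.2.2 ∈ A}.indicator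
        (fun u => ENNReal.ofReal (kbar P g u)) (pt z a) ∂(lawX P).prod volume =
      ∫⁻ a in A ×ˢ B, ENNReal.ofReal (N.prob z a.1) *
        ENNReal.ofReal (N.p z a.2 a.1 * kbar P g (a.2, z, a.1)) ∂(lawX P).prod volume := by
    rw [← lintegral_indicator (hA.prod hB)]
    refine lintegral_congr_ae ?_
    filter_upwards [Measure.quasiMeasurePreserving_fst.ae h.prob_pos] with a ha
    by_cases hab : a ∈ A ×ˢ B
    · rw [indicator_of_mem hab, indicator_of_mem (show pt z a ∈
        {u : ℝ × Bool × 𝒳 | u.1 ∈ B ∧ u.2.1 = z ∧ u.2.2 ∈ A} from ⟨hab.2, rfl, hab.1⟩),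
        ENNReal.ofReal_mul (ha z).le, ENNReal.ofReal_mul (h.nonneg_p _ _ _), mul_assoc]
      rfl
    · rw [indicator_of_notMem hab, indicator_of_notMem, mul_zero]
      exact fun h2 => hab ⟨h2.2.2, h2.1⟩
  rw [e, ← Measure.prod_restrict, lintegral_prod _ hm.aemeasurable]
  refine lintegral_congr fun x => ?_
  have hxm : Measurable fun s => ENNReal.ofReal (N.p z s x * kbar P g (s, z, x)) :=
    ((h.measurable_arm_kbar hg z).comp (measurable_const.prodMk measurable_id)).ennreal_ofReal
  exact lintegral_const_mul (ENNReal.ofReal (N.prob z x)) hxm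

/-- Integrating out `s` in each arm and adding the arms leaves the conditional mean of the ratio
given `X`. -/
lemma lawX_tiltLaw (h : IsNuisance P N) (hg : Measurable g) (h0 : ∀ v, 0 ≤ g v)
    (hb : ∀ v, |g v - 1| ≤ ε) :
    lawX (tiltLaw P g) = (lawX P).withDensity fun x => ENNReal.ofReal (covMean P N g x) := by
  ext A hA
  have hz : ∀ z, MeasurableSet {v : Obs 𝒳 | v.2.1 ∈ univ ∧ v.2.2.1 = z ∧ v.2.2.2 ∈ A} := fun z =>
    (measurable_fst.comp measurable_snd MeasurableSet.univ).inter
      (((measurable_fst.comp (measurable_snd.comp measurable_snd)) (measurableSet_singleton z)).inter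
      (measurable_lawX_map hA))
  have hset : (fun v : Obs 𝒳 => v.2.2.2) ⁻¹' A =
      {v | v.2.1 ∈ univ ∧ v.2.2.1 = true ∧ v.2.2.2 ∈ A} ∪
      {v | v.2.1 ∈ univ ∧ v.2.2.1 = false ∧ v.2.2.2 ∈ A} := by
    ext v
    simp only [mem_preimage, mem_univ, true_and, mem_union, mem_ofPred_eq]
    cases v.2.2.1 <;> simp
  have hdis : Disjoint {v : Obs 𝒳 | v.2.1 ∈ univ ∧ v.2.2.1 = true ∧ v.2.2.2 ∈ A}
      {v | v.2.1 ∈ univ ∧ v.2.2.1 = false ∧ v.2.2.2 ∈ A} := by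
    rw [Set.disjoint_left]
    rintro v ⟨-, h1, -⟩ ⟨-, h2, -⟩
    rw [h1] at h2; simp at h2
  have harm : ∀ z, tiltLaw P g {v | v.2.1 ∈ univ ∧ v.2.2.1 = z ∧ v.2.2.2 ∈ A} =
      ∫⁻ x in A, ENNReal.ofReal (N.prob z x * armMean P N g z x) ∂lawX P := by
    intro z
    rw [h.tiltLaw_arm hg h0 hb z hA MeasurableSet.univ]
    refine lintegral_congr_ae (ae_restrict_of_ae ?_)
    filter_upwards [h.prob_pos, h.integrable_arm_kbar hg hb] with x hp hi
    rw [Measure.restrict_univ, ENNReal.ofReal_mul (hp z).le, armMean,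
      ofReal_integral_eq_lintegral_ofReal (hi z) (Eventually.of_forall fun s =>
        mul_nonneg (h.nonneg_p _ _ _) (integral_nonneg fun y => h0 _))]
  have htm : Measurable fun x => ENNReal.ofReal (N.prob true x * armMean P N g true x) :=
    ((h.measurable_prob true).mul (h.measurable_armMean hg true)).ennreal_ofReal
  rw [lawX, Measure.map_apply measurable_lawX_map hA, hset, measure_union hdis (hz false), harm,
    harm, withDensity_apply _ hA, ← lintegral_add_left htm]
  refine lintegral_congr_ae (ae_restrict_of_ae ?_)
  filter_upwards [h.prob_pos] with x hp
  have hm : ∀ z, 0 ≤ N.prob z x * armMean P N g z x := fun z => mul_nonneg (hp z).le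
    (integral_nonneg fun s => mul_nonneg (h.nonneg_p _ _ _) (integral_nonneg fun y => h0 _))
  rw [← ENNReal.ofReal_add (hm _) (hm _)]; rfl

/-- The density determines the treatment probability. -/
lemma of_density (hπ : Measurable N.π) (ho : ∀ᵐ x ∂lawX P, 0 < N.π x ∧ N.π x < 1)
    (hp : ∀ z, Measurable (Function.uncurry (N.p z))) (hp0 : ∀ z s x, 0 ≤ N.p z s x)
    (hp1 : ∀ᵐ x ∂lawX P, ∀ z, ∫⁻ s, ENNReal.ofReal (N.p z s x) = 1)
    (hd : ∀ z, ∀ A : Set 𝒳, MeasurableSet A → ∀ B : Set ℝ, MeasurableSet B →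
      P {v | v.2.1 ∈ B ∧ v.2.2.1 = z ∧ v.2.2.2 ∈ A} = ∫⁻ x in A, (ENNReal.ofReal (N.prob z x) *
        ∫⁻ s in B, ENNReal.ofReal (N.p z s x)) ∂lawX P)
    (hμ : IsCondMean P (fun y => y) N.μ) : IsNuisance P N := by
  refine ⟨hπ, ho, ?_, hp, hp0, hd, hμ⟩
  have hTm : MeasurableSet {v : Obs 𝒳 | v.2.2.1 = true} :=
    (measurable_fst.comp (measurable_snd.comp measurable_snd)) (measurableSet_singleton true)
  have hπi : Integrable N.π (lawX P) := by
    refine Integrable.of_bound hπ.aestronglyMeasurable 1 ?_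
    filter_upwards [ho] with x hx
    rw [Real.norm_eq_abs, abs_of_pos hx.1]; exact hx.2.le
  have hπi' : Integrable (fun v : Obs 𝒳 => N.π v.2.2.2) P :=
    (integrable_map_measure hπ.aestronglyMeasurable measurable_lawX_map.aemeasurable).1 hπi
  refine (ae_eq_condExp_of_forall_setIntegral_eq measurable_lawX_map.comap_le
    ((integrable_const (1 : ℝ)).indicator hTm) (fun s _ _ => hπi'.integrableOn) ?_
    (hπ.comp (comap_measurable _)).aestronglyMeasurable).symm
  rintro _ ⟨A, hA, rfl⟩ -
  have hAm : MeasurableSet ((fun v : Obs 𝒳 => v.2.2.2) ⁻¹' A) := measurable_lawX_map hA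
  have e1 : ∫ v in (fun v : Obs 𝒳 => v.2.2.2) ⁻¹' A, N.π v.2.2.2 ∂P = ∫ x in A, N.π x ∂lawX P :=
    (setIntegral_map hA hπ.aestronglyMeasurable measurable_lawX_map.aemeasurable).symm
  have e2 : P {v | v.2.1 ∈ univ ∧ v.2.2.1 = true ∧ v.2.2.2 ∈ A} =
      ENNReal.ofReal (∫ x in A, N.π x ∂lawX P) := by
    rw [hd true A hA univ MeasurableSet.univ, ofReal_integral_eq_lintegral_ofReal hπi.integrableOn
      (ae_restrict_of_ae (ho.mono fun x hx => hx.1.le))]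
    refine lintegral_congr_ae (ae_restrict_of_ae ?_)
    filter_upwards [hp1] with x hx
    rw [Measure.restrict_univ, hx, mul_one, Nuisance.prob_true]
  have h0 : 0 ≤ ∫ x in A, N.π x ∂lawX P :=
    integral_nonneg_of_ae (ae_restrict_of_ae (ho.mono fun x hx => hx.1.le))
  rw [e1, setIntegral_indicator hTm, setIntegral_const, smul_eq_mul, mul_one, measureReal_def]
  have hset : (fun v : Obs 𝒳 => v.2.2.2) ⁻¹' A ∩ {v : Obs 𝒳 | v.2.2.1 = true} =
      {v | v.2.1 ∈ univ ∧ v.2.2.1 = true ∧ v.2.2.2 ∈ A} := by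
    ext v; simp [and_comm]
  rw [hset, e2, ENNReal.toReal_ofReal h0]

section Tilt

variable (h : IsNuisance P N) (hg : Measurable g) (hb : ∀ v, |g v - 1| ≤ 1 / 2)

omit [MeasurableSpace 𝒳] in
include hb in
lemma ratio_pos (v : Obs 𝒳) : 0 < g v := by
  have := (abs_le.1 (hb v)).1; linarith

include hg hb in
lemma kbar_pos (u : ℝ × Bool × 𝒳) : 0 < kbar P g u := by
  have := (abs_le.1 (abs_kbar_sub_one_le (P := P) hg hb u)).1; linarith

include h hg hb in
lemma mean_pos : ∀ᵐ x ∂lawX P, (∀ z, 0 < armMean P N g z x) ∧ 0 < covMean P N g x := by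
  filter_upwards [h.abs_armMean_sub_one_le hg hb, h.abs_covMean_sub_one_le hg hb] with x h1 h2
  refine ⟨fun z => ?_, ?_⟩
  · have := (abs_le.1 (h1 z)).1; linarith
  · have := (abs_le.1 h2).1; linarith

include h hg hb in
-- `tilt` prescribes only `π`; the formula holds in the control arm too because `covMean` is the sum
-- of the contributions of the two arms.
lemma prob_tilt : ∀ᵐ x ∂lawX P, ∀ z,
    (N.tilt P g).prob z x = N.prob z x * armMean P N g z x / covMean P N g x := by
  filter_upwards [h.mean_pos hg hb] with x hx z
  cases z
  · rw [Nuisance.prob_false, eq_div_iff hx.2.ne', sub_mul, one_mul]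
    simp only [Nuisance.tilt]
    rw [div_mul_cancel₀ _ hx.2.ne', covMean, Nuisance.prob_true]; ring
  · rfl

include h hg in
lemma measurable_tilt_p (z : Bool) : Measurable fun a : 𝒳 × ℝ => (N.tilt P g).p z a.2 a.1 :=
  (h.measurable_arm_kbar hg z).div ((h.measurable_armMean hg z).comp measurable_fst)

include h hg hb in
/-- The nuisance functions of the law with density ratio `g`. -/
theorem tilt [IsProbabilityMeasure (tiltLaw P g)] : IsNuisance (tiltLaw P g) (N.tilt P g) := by
  have h0 : ∀ v, 0 ≤ g v := fun v => (ratio_pos hb v).le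
  have hG0 : ∀ u, 0 < kbar P g u := fun u => kbar_pos hg hb u
  have hlaw := h.lawX_tiltLaw hg h0 hb
  have hac : lawX (tiltLaw P g) ≪ lawX P := by
    rw [hlaw]; exact withDensity_absolutelyContinuous _ _
  have hpm := h.measurable_tilt_p (g := g) hg
  have hm0 : ∀ z x, 0 ≤ armMean P N g z x := fun z x => integral_nonneg fun s =>
    mul_nonneg (h.nonneg_p _ _ _) (hG0 _).le
  have hgi : Integrable g P := by
    refine Integrable.of_bound hg.aestronglyMeasurable (1 / 2 + 1) (Eventually.of_forall fun v => ?_)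
    have := abs_le.1 (hb v)
    rw [Real.norm_eq_abs, abs_le]; constructor <;> linarith
  have hygi : Integrable (fun v : Obs 𝒳 => v.1 * g v) P := by
    refine h.outcome.2.1.mul_bdd (c := 1 / 2 + 1) hg.aestronglyMeasurable
      (Eventually.of_forall fun v => ?_)
    have := abs_le.1 (hb v)
    rw [Real.norm_eq_abs, abs_le]; constructor <;> linarith
  refine of_density ?_ ?_ ?_ ?_ ?_ ?_ ?_
  · exact (h.measurable_π.mul (h.measurable_armMean hg true)).div (h.measurable_covMean hg)
  · refine hac.ae_le ?_
    filter_upwards [h.mean_pos hg hb, h.prob_pos, h.prob_tilt hg hb] with x hx hp ht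
    have e0 : 0 < (N.tilt P g).prob false x := by
      rw [ht]; exact div_pos (mul_pos (hp _) (hx.1 _)) hx.2
    have e1 : 0 < (N.tilt P g).prob true x := by
      rw [ht]; exact div_pos (mul_pos (hp _) (hx.1 _)) hx.2
    rw [Nuisance.prob_false] at e0
    exact ⟨e1, by linarith⟩
  · exact fun z => (hpm z).comp measurable_swap
  · exact fun z s x => div_nonneg (mul_nonneg (h.nonneg_p _ _ _) (hG0 _).le) (hm0 z x)
  · refine hac.ae_le ?_
    filter_upwards [h.mean_pos hg hb, h.integrable_arm_kbar hg hb] with x hx hi z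
    have : ∀ s, (N.tilt P g).p z s x = N.p z s x * kbar P g (s, z, x) / armMean P N g z x :=
      fun s => rfl
    simp only [this]
    rw [← ofReal_integral_eq_lintegral_ofReal ((hi z).div_const _) (Eventually.of_forall fun s =>
      div_nonneg (mul_nonneg (h.nonneg_p _ _ _) (hG0 _).le) (hm0 z x)), integral_div]
    change ENNReal.ofReal (armMean P N g z x / armMean P N g z x) = 1
    rw [div_self (hx.1 z).ne', ENNReal.ofReal_one]
  · intro z A hA B hB
    rw [h.tiltLaw_arm hg h0 hb z hA hB, hlaw]
    have hπm : Measurable ((N.tilt P g).prob z) := by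
      have : Measurable (N.tilt P g).π :=
        (h.measurable_π.mul (h.measurable_armMean hg true)).div (h.measurable_covMean hg)
      cases z
      · exact measurable_const.sub this
      · exact this
    have hkm : Measurable fun x => ENNReal.ofReal ((N.tilt P g).prob z x) *
        ∫⁻ s in B, ENNReal.ofReal ((N.tilt P g).p z s x) :=
      hπm.ennreal_ofReal.mul (hpm z).ennreal_ofReal.lintegral_prod_right'
    rw [setLIntegral_withDensity_eq_setLIntegral_mul _ (h.measurable_covMean hg).ennreal_ofReal
      hkm hA]
    refine lintegral_congr_ae (ae_restrict_of_ae ?_)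
    filter_upwards [h.mean_pos hg hb, h.prob_pos, h.prob_tilt hg hb] with x hx hp ht
    have e : ∀ s, ENNReal.ofReal ((N.tilt P g).p z s x) =
        ENNReal.ofReal (armMean P N g z x)⁻¹ * ENNReal.ofReal (N.p z s x * kbar P g (s, z, x)) := by
      intro s
      rw [← ENNReal.ofReal_mul (inv_nonneg.2 (hm0 z x)), inv_mul_eq_div]; rfl
    have hxm : Measurable fun s => ENNReal.ofReal (N.p z s x * kbar P g (s, z, x)) :=
      ((h.measurable_arm_kbar hg z).comp (measurable_const.prodMk measurable_id)).ennreal_ofReal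
    simp only [Pi.mul_apply, e]
    rw [lintegral_const_mul _ hxm, ht, ← mul_assoc, ← mul_assoc, ← ENNReal.ofReal_mul hx.2.le,
      ← ENNReal.ofReal_mul (mul_nonneg hx.2.le (div_nonneg (mul_nonneg (hp z).le (hm0 z x))
        hx.2.le))]
    congr 2
    have := hx.2.ne'
    have := (hx.1 z).ne'
    field_simp
  -- Bayes' formula for the outcome mean: `φ` times `kbar P g` is the conditional mean of `y g`, so
  -- integrals over sets determined by `(S, Z, X)` agree.
  · have hyb : Measurable fun v : Obs 𝒳 => v.1 * g v := measurable_fst.mul hg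
    have hμm : ∀ z, Measurable fun a : 𝒳 × ℝ => (N.tilt P g).μ z a.2 a.1 := fun z =>
      ((measurable_kbar P hyb).comp (measurable_pt z)).div
        ((measurable_kbar P hg).comp (measurable_pt z))
    have hint : ∀ φ : Obs 𝒳 → ℝ, Integrable φ (tiltLaw P g) ↔ Integrable (fun v => g v * φ v) P :=
      fun φ => integrable_withDensity_ofReal hg (Eventually.of_forall h0)
    have hval : ∀ φ : Obs 𝒳 → ℝ, ∫ v, φ v ∂tiltLaw P g = ∫ v, g v * φ v ∂P :=
      fun φ => integral_withDensity_ofReal hg (Eventually.of_forall h0) φ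
    have hyi : Integrable (fun v : Obs 𝒳 => v.1) (tiltLaw P g) := by
      rw [hint]; simpa only [mul_comm] using hygi
    let φ : ℝ × Bool × 𝒳 → ℝ := fun u => kbar P (fun v => v.1 * g v) u / kbar P g u
    have hφm : Measurable φ := (measurable_kbar P hyb).div (measurable_kbar P hg)
    have hkφ : ∀ u, kbar P (fun v => g v * φ v.2) u = kbar P (fun v => v.1 * g v) u := by
      intro u
      have : kbar P (fun v => g v * φ v.2) u = kbar P g u * φ u :=
        integral_mul_const (μ := kap P u) (φ u) fun y => g (y, u)
      rw [this, mul_div_cancel₀ _ (hG0 u).ne']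
    have hφi : Integrable (fun v : Obs 𝒳 => φ v.2) (tiltLaw P g) := by
      have h1 : Integrable φ ((tiltLaw P g).map fun v => v.2) := by
        rw [map_snd_tiltLaw hg h0 hb, integrable_withDensity_ofReal (measurable_kbar P hg)
          (Eventually.of_forall fun u => (hG0 u).le)]
        refine (integral_kbar hygi).1.congr (Eventually.of_forall fun u => ?_)
        simp only [φ]; rw [mul_div_cancel₀ _ (hG0 u).ne']
      exact (integrable_map_measure hφm.aestronglyMeasurable measurable_snd.aemeasurable).1 h1
    refine ⟨fun z => (hμm z).comp measurable_swap, hyi, ?_⟩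
    change _ =ᵐ[tiltLaw P g] fun v : Obs 𝒳 => φ v.2
    refine (ae_eq_condExp_of_forall_setIntegral_eq measurable_snd.comap_le hyi
      (fun s _ _ => hφi.integrableOn) ?_
      (hφm.comp (comap_measurable _)).aestronglyMeasurable).symm
    rintro _ ⟨C, hC, rfl⟩ -
    have hCm : MeasurableSet ((fun v : Obs 𝒳 => v.2) ⁻¹' C) := measurable_snd hC
    have key : ∀ k : Obs 𝒳 → ℝ, Integrable k (tiltLaw P g) →
        ∫ v in (fun v : Obs 𝒳 => v.2) ⁻¹' C, k v ∂tiltLaw P g =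
          ∫ u, C.indicator (kbar P fun v => g v * k v) u ∂(P.map fun v => v.2) := by
      intro k hk
      rw [← integral_indicator hCm, hval, (integral_kbar ((hint _).1 (hk.indicator hCm))).2]
      refine integral_congr_ae (Eventually.of_forall fun u => ?_)
      by_cases hu : u ∈ C
      · rw [indicator_of_mem hu]
        refine integral_congr_ae (Eventually.of_forall fun y => ?_)
        exact congrArg (g (y, u) * ·)
          (indicator_of_mem (show (y, u) ∈ (fun v : Obs 𝒳 => v.2) ⁻¹' C from hu) k)
      · rw [indicator_of_notMem hu]
        refine integral_eq_zero_of_ae (Eventually.of_forall fun y => ?_)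
        simp only [indicator_of_notMem (show (y, u) ∉ (fun v : Obs 𝒳 => v.2) ⁻¹' C from hu) k,
          mul_zero, Pi.zero_apply]
    rw [key _ hφi, key _ hyi]
    have hkk : (kbar P fun v => g v * φ v.2) = kbar P fun v => g v * v.1 := by
      ext u
      rw [hkφ]; simp only [mul_comm]
    rw [hkk]

end Tilt

end IsNuisance

end PCE

namespace PCE

/-! ## Density ratios of a submodel -/

variable {𝒳 : Type*} [MeasurableSpace 𝒳]

/-- A path of density ratios through `1` with difference quotients bounded by `K` and score `s`. -/
structure RatioPath (g : ℝ → Obs 𝒳 → ℝ) (s : Obs 𝒳 → ℝ) (K : ℝ) : Prop where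
  pos : 0 < K
  measurable : ∀ θ, Measurable (g θ)
  measurable_score : Measurable s
  bound : ∀ θ v, |g θ v - 1| ≤ K * |θ|
  deriv : ∀ v, HasDerivAt (fun θ => g θ v) (s v) 0

namespace RatioPath

variable {g : ℝ → Obs 𝒳 → ℝ} {s : Obs 𝒳 → ℝ} {K : ℝ}

lemma zero (h : RatioPath g s K) : g 0 = fun _ => 1 := by
  ext v
  have := h.bound 0 v
  rw [abs_zero, mul_zero] at this
  exact sub_eq_zero.1 (abs_eq_zero.1 (le_antisymm this (abs_nonneg _)))

lemma abs_score_le (h : RatioPath g s K) (v : Obs 𝒳) : |s v| ≤ K := by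
  rw [← Real.norm_eq_abs]
  refine (h.deriv v).le_of_lip' h.pos.le (Eventually.of_forall fun θ => ?_)
  have := h.bound θ v
  simpa [h.zero] using this

lemma bound_le (h : RatioPath g s K) {θ ε : ℝ} (hθ : K * |θ| ≤ ε) (v : Obs 𝒳) :
    |g θ v - 1| ≤ ε :=
  (h.bound θ v).trans hθ

end RatioPath

/-- Truncation to `[-K, K]`. -/
noncomputable def clip (K t : ℝ) : ℝ := max (-K) (min K t)

lemma abs_clip_le {K : ℝ} (hK : 0 ≤ K) (t : ℝ) : |clip K t| ≤ K :=
  abs_le.2 ⟨le_max_left _ _, max_le (by linarith) (min_le_left _ _)⟩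

lemma clip_of_abs_le {K t : ℝ} (h : |t| ≤ K) : clip K t = t := by
  have := abs_le.1 h
  rw [clip, min_eq_right this.2, max_eq_right this.1]

lemma continuous_clip (K : ℝ) : Continuous (clip K) :=
  continuous_const.max (continuous_const.min continuous_id)

/-- The density ratios of a submodel, after modification on a null set. -/
theorem IsSubmodel.exists_ratioPath {P : Measure (Obs 𝒳)} {Pθ : ℝ → Measure (Obs 𝒳)}
    {s : Obs 𝒳 → ℝ} (h : IsSubmodel P Pθ s) :
    ∃ (g : ℝ → Obs 𝒳 → ℝ) (s' : Obs 𝒳 → ℝ) (K : ℝ), RatioPath g s' K ∧ s =ᵐ[P] s' ∧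
      ∀ᶠ θ in 𝓝 (0 : ℝ), Pθ θ = tiltLaw P (g θ) ∧ IsProbabilityMeasure (tiltLaw P (g θ)) := by
  obtain ⟨hs, g, K₀, hg, hev, hder⟩ := h
  set K := |K₀| + 1 with hKdef
  have hK : 0 < K := by positivity
  have hKK : K₀ ≤ K := (le_abs_self K₀).trans (by linarith)
  have hev' : ∀ᶠ θ in 𝓝 (0 : ℝ), ∀ᵐ v ∂P, |g θ v - 1| ≤ K * |θ| := by
    filter_upwards [hev] with θ hθ
    filter_upwards [hθ.2.2] with v hv
    exact hv.trans (mul_le_mul_of_nonneg_right hKK (abs_nonneg _))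
  obtain ⟨δ, hδ, hδ'⟩ := Metric.eventually_nhds_iff.1 hev'
  -- The bound holds off a null set that depends on `θ`. A sequence tending to `0` involves
  -- countably many null sets only, and suffices to bound the derivative.
  have hseq : Tendsto (fun n : ℕ => δ / ((n : ℝ) + 2)) atTop (𝓝[≠] 0) := by
    rw [tendsto_nhdsWithin_iff]
    refine ⟨Tendsto.div_atTop tendsto_const_nhds
      (tendsto_atTop_add_const_right _ _ tendsto_natCast_atTop_atTop),
      Eventually.of_forall fun n => ?_⟩
    have : δ / ((n : ℝ) + 2) ≠ 0 := by positivity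
    exact this
  have hall : ∀ᵐ v ∂P, HasDerivAt (fun θ => g θ v) (s v) 0 ∧ g 0 v = 1 ∧ |s v| ≤ K := by
    have hn : ∀ᵐ v ∂P, ∀ n : ℕ, |g (δ / (n + 2)) v - 1| ≤ K * |δ / ((n : ℝ) + 2)| := by
      refine ae_all_iff.2 fun n => hδ' ?_
      rw [Real.dist_eq, sub_zero, abs_of_pos (by positivity)]
      exact div_lt_self hδ (by have : (0 : ℝ) ≤ n := n.cast_nonneg
                               linarith)
    filter_upwards [hder, hev'.self_of_nhds, hn] with v h1 h2 h3
    have h0 : g 0 v = 1 := by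
      rw [abs_zero, mul_zero] at h2
      exact sub_eq_zero.1 (abs_eq_zero.1 (le_antisymm h2 (abs_nonneg _)))
    refine ⟨h1, h0, ?_⟩
    have h4 := (hasDerivAt_iff_tendsto_slope.1 h1).comp hseq
    refine le_of_tendsto h4.abs (Eventually.of_forall fun n => ?_)
    have hp : 0 < |δ / ((n : ℝ) + 2)| := by positivity
    rw [Function.comp_apply, slope_def_field, sub_zero, h0, abs_div, div_le_iff₀ hp]
    exact h3 n
  -- A measurable set of full measure on which the pointwise properties hold, so that the modified
  -- ratios remain measurable.
  obtain ⟨E, hEs, hEm, hEP⟩ : ∃ E : Set (Obs 𝒳), E ⊆ {v | HasDerivAt (fun θ => g θ v) (s v) 0 ∧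
      g 0 v = 1 ∧ |s v| ≤ K} ∧ MeasurableSet E ∧ ∀ᵐ v ∂P, v ∈ E := by
    obtain ⟨t, ht, htm, ht0⟩ := exists_measurable_superset_of_null (ae_iff.1 hall)
    refine ⟨tᶜ, fun v hv => ?_, htm.compl, compl_mem_ae_iff.2 ht0⟩
    by_contra hne
    exact hv (ht hne)
  -- Clipping the difference quotient at `±K` enforces the bound at every `θ` on `E`; off `E` the
  -- ratio is set to `1`. The derivative survives because `clip K` is continuous and fixes the
  -- score. At `θ = 0` the outer factor makes the ratio `1` whatever the value of `θ⁻¹`.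
  let g' : ℝ → Obs 𝒳 → ℝ := fun θ v =>
    1 + E.indicator (fun v => θ * clip K (θ⁻¹ * (g θ v - 1))) v
  have hg' : ∀ θ, ∀ v ∈ E, g' θ v = 1 + θ * clip K (θ⁻¹ * (g θ v - 1)) := fun θ v hv => by
    simp only [g', indicator_of_mem hv]
  have hg'' : ∀ θ, ∀ v ∉ E, g' θ v = 1 := fun θ v hv => by
    simp only [g', indicator_of_notMem hv, add_zero]
  have hgae : ∀ᶠ θ in 𝓝 (0 : ℝ), g' θ =ᵐ[P] g θ := by
    filter_upwards [hev'] with θ hθ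
    filter_upwards [hθ, hEP] with v hv hvE
    rw [hg' θ v hvE]
    by_cases h0 : θ = 0
    · rw [h0, zero_mul, add_zero, (hEs hvE).2.1]
    · rw [clip_of_abs_le, mul_inv_cancel_left₀ h0, add_sub_cancel]
      rw [abs_mul, abs_inv, inv_mul_le_iff₀ (abs_pos.2 h0), mul_comm]; exact hv
  refine ⟨g', E.indicator s, K, ⟨hK, ?_, hs.indicator hEm, ?_, ?_⟩, ?_, ?_⟩
  · intro θ
    exact measurable_const.add ((measurable_const.mul ((continuous_clip K).measurable.comp
      (((hg θ).sub_const 1).const_mul _))).indicator hEm)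
  · intro θ v
    by_cases hv : v ∈ E
    · rw [hg' θ v hv, add_sub_cancel_left, abs_mul, mul_comm]
      exact mul_le_mul_of_nonneg_right (abs_clip_le hK.le _) (abs_nonneg _)
    · rw [hg'' θ v hv, sub_self, abs_zero]; positivity
  · intro v
    by_cases hv : v ∈ E
    · obtain ⟨h1, h2, h3⟩ := hEs hv
      rw [indicator_of_mem hv, hasDerivAt_iff_tendsto_slope]
      have h4 := hasDerivAt_iff_tendsto_slope.1 h1
      have h5 := ((continuous_clip K).tendsto (s v)).comp h4
      rw [clip_of_abs_le h3] at h5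
      refine h5.congr' ?_
      filter_upwards [self_mem_nhdsWithin] with θ hθ
      have hθ' : θ ≠ 0 := hθ
      simp only [Function.comp_apply, slope_def_field, sub_zero, h2, hg' θ v hv, hg' 0 v hv,
        zero_mul, add_zero, add_sub_cancel_left]
      rw [mul_div_cancel_left₀ _ hθ', div_eq_inv_mul]
    · rw [indicator_of_notMem hv]
      have : (fun θ => g' θ v) = fun _ => 1 := by ext θ; exact hg'' θ v hv
      rw [this]; exact hasDerivAt_const _ _
  · filter_upwards [hEP] with v hv
    rw [indicator_of_mem hv]
  · filter_upwards [hev, hgae] with θ h1 h2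
    have : Pθ θ = tiltLaw P (g' θ) := by
      rw [h1.2.1, tiltLaw]
      refine withDensity_congr_ae ?_
      filter_upwards [h2] with v hv
      rw [hv]
    exact ⟨this, this ▸ h1.1⟩

/-! ## Relative Lipschitz bounds along a path -/

/-- On `|θ| < δ` the function `a` is bounded by `B`, and it differs from its value at `0` by at most
`C B |θ|`; its derivative at `0` is `a'`. -/
structure PathBound (δ : ℝ) (a : ℝ → ℝ) (a' B C : ℝ) : Prop where
  deriv : HasDerivAt a a' 0
  bound : ∀ θ, |θ| < δ → |a θ| ≤ B
  lip : ∀ θ, |θ| < δ → |a θ - a 0| ≤ C * B * |θ|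

namespace PathBound

variable {δ a' b' A B C C₁ C₂ : ℝ} {a b : ℝ → ℝ}

/-- `a b - a₀ b₀ = a (b - b₀) + (a - a₀) b₀`. Since increments are measured relative to the
envelopes, envelopes multiply and rates add. -/
lemma mul (ha : PathBound δ a a' A C₁) (hb : PathBound δ b b' B C₂) (hδ : 0 < δ) :
    PathBound δ (fun θ => a θ * b θ) (a' * b 0 + a 0 * b') (A * B) (C₁ + C₂) := by
  have h0 : |(0 : ℝ)| < δ := by simpa using hδ
  refine ⟨ha.deriv.mul hb.deriv, fun θ hθ => ?_, fun θ hθ => ?_⟩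
  · rw [abs_mul]
    exact mul_le_mul (ha.bound θ hθ) (hb.bound θ hθ) (abs_nonneg _)
      ((abs_nonneg _).trans (ha.bound θ hθ))
  · have e : a θ * b θ - a 0 * b 0 = a θ * (b θ - b 0) + (a θ - a 0) * b 0 := by ring
    rw [e]
    refine (abs_add_le _ _).trans ?_
    rw [abs_mul, abs_mul]
    have h1 := mul_le_mul (ha.bound θ hθ) (hb.lip θ hθ) (abs_nonneg _)
      ((abs_nonneg _).trans (ha.bound θ hθ))
    have h2 := mul_le_mul (ha.lip θ hθ) (hb.bound 0 h0) (abs_nonneg _)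
      ((abs_nonneg _).trans (ha.lip θ hθ))
    linarith

lemma sub (ha : PathBound δ a a' A C) (hb : PathBound δ b b' B C) :
    PathBound δ (fun θ => a θ - b θ) (a' - b') (A + B) C := by
  refine ⟨ha.deriv.sub hb.deriv, fun θ hθ => ?_, fun θ hθ => ?_⟩
  · exact (abs_sub _ _).trans (add_le_add (ha.bound θ hθ) (hb.bound θ hθ))
  · have e : a θ - b θ - (a 0 - b 0) = (a θ - a 0) - (b θ - b 0) := by ring
    rw [e]
    refine (abs_sub _ _).trans ?_
    have h1 := ha.lip θ hθ
    have h2 := hb.lip θ hθ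
    linarith

lemma const_mul (ha : PathBound δ a a' A C) {k : ℝ} (hk : 0 ≤ k) :
    PathBound δ (fun θ => k * a θ) (k * a') (k * A) C := by
  refine ⟨ha.deriv.const_mul k, fun θ hθ => ?_, fun θ hθ => ?_⟩
  · rw [abs_mul, abs_of_nonneg hk]
    exact mul_le_mul_of_nonneg_left (ha.bound θ hθ) hk
  · rw [← mul_sub, abs_mul, abs_of_nonneg hk]
    have := mul_le_mul_of_nonneg_left (ha.lip θ hθ) hk
    linarith

/-- A path within `C |θ| ≤ 1 / 2` of its value `1` at `0`. -/
lemma of_sub_one (ha : HasDerivAt a a' 0) (h0 : a 0 = 1) (hC : 0 ≤ C) (hδ : C * δ ≤ 1 / 2)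
    (hb : ∀ θ, |θ| < δ → |a θ - 1| ≤ C * |θ|) : PathBound δ a a' 2 C := by
  have hs : ∀ θ, |θ| < δ → C * |θ| ≤ 1 / 2 := fun θ hθ =>
    (mul_le_mul_of_nonneg_left hθ.le hC).trans hδ
  refine ⟨ha, fun θ hθ => ?_, fun θ hθ => ?_⟩
  · have h1 := abs_le.1 (hb θ hθ)
    have h2 := hs θ hθ
    rw [abs_le]; constructor <;> linarith
  · rw [h0]
    have h1 := hb θ hθ
    nlinarith [mul_nonneg hC (abs_nonneg θ)]

/-- `a⁻¹ - 1 = a⁻¹ (1 - a)` with `a ≥ 1 / 2`, so inversion keeps the rate relative to the envelope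
`2`. -/
lemma inv_of_sub_one (ha : HasDerivAt a a' 0) (h0 : a 0 = 1) (hC : 0 ≤ C) (hδ : C * δ ≤ 1 / 2)
    (hb : ∀ θ, |θ| < δ → |a θ - 1| ≤ C * |θ|) :
    PathBound δ (fun θ => (a θ)⁻¹) (-a') 2 C := by
  have hs : ∀ θ, |θ| < δ → C * |θ| ≤ 1 / 2 := fun θ hθ =>
    (mul_le_mul_of_nonneg_left hθ.le hC).trans hδ
  have hpos : ∀ θ, |θ| < δ → 1 / 2 ≤ a θ := fun θ hθ => by
    have h1 := abs_le.1 (hb θ hθ)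
    have h2 := hs θ hθ
    linarith
  have hinv : ∀ θ, |θ| < δ → (a θ)⁻¹ ≤ 2 := fun θ hθ => by
    have := inv_anti₀ (by norm_num) (hpos θ hθ)
    norm_num at this; exact this
  refine ⟨?_, fun θ hθ => ?_, fun θ hθ => ?_⟩
  · refine (ha.fun_inv (by rw [h0]; exact one_ne_zero)).congr_deriv ?_
    simp [h0]
  · have h2 : 0 < a θ := by linarith [hpos θ hθ]
    rw [abs_of_pos (inv_pos.2 h2)]; exact hinv θ hθ
  · have h2 : 0 < a θ := by linarith [hpos θ hθ]
    have e : (a θ)⁻¹ - (a 0)⁻¹ = (a θ)⁻¹ * (1 - a θ) := by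
      rw [h0]; field_simp
    rw [e, abs_mul, abs_of_pos (inv_pos.2 h2), abs_sub_comm]
    calc _ ≤ 2 * (C * |θ|) := mul_le_mul (hinv θ hθ) (hb θ hθ) (abs_nonneg _) (by norm_num)
      _ = _ := by ring

lemma mono (ha : PathBound δ a a' A C₁) (h : C₁ ≤ C₂) : PathBound δ a a' A C₂ := by
  refine ⟨ha.deriv, ha.bound, fun θ hθ => (ha.lip θ hθ).trans ?_⟩
  have hA : 0 ≤ A := (abs_nonneg _).trans (ha.bound θ hθ)
  have := mul_nonneg hA (abs_nonneg θ)
  nlinarith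

end PathBound

end PCE

namespace PCE

/-! ## The copula density along a path -/

section CopulaPath

variable {c K : ℝ → ℝ → ℝ} {ρ : ℝ}

/-- A displacement smaller than `u (1 - u)` reaches neither end of the interval, as `u (1 - u)` is
below both `u` and `1 - u`. -/
lemma mem_Ioo_of_abs_sub_le {u u' ρ : ℝ} (hρ : ρ < 1) (hu : u ∈ Ioo (0 : ℝ) 1)
    (h : |u' - u| ≤ ρ * (u * (1 - u))) : u' ∈ Ioo (0 : ℝ) 1 := by
  obtain ⟨h0, h1⟩ := hu
  have h2 := abs_le.1 h
  have h3 : ρ * (u * (1 - u)) < u * (1 - u) := by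
    have : 0 < u * (1 - u) := mul_pos h0 (by linarith)
    nlinarith
  constructor
  · nlinarith [mul_pos h0 h0]
  · nlinarith [mul_pos (sub_pos.2 h1) (sub_pos.2 h1)]

lemma IsCopulaDensity.differentiableAt (hc : IsCopulaDensity c) {u v : ℝ}
    (hu : u ∈ Ioo (0 : ℝ) 1) (hv : v ∈ Ioo (0 : ℝ) 1) :
    DifferentiableAt ℝ (Function.uncurry c) (u, v) :=
  (hc.contDiffOn.differentiableOn (by norm_num)).differentiableAt
    ((isOpen_Ioo.prod isOpen_Ioo).mem_nhds ⟨hu, hv⟩)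

lemma IsCopulaDensity.hasDerivAt_fst (hc : IsCopulaDensity c) {u v : ℝ}
    (hu : u ∈ Ioo (0 : ℝ) 1) (hv : v ∈ Ioo (0 : ℝ) 1) :
    HasDerivAt (fun u' => c u' v) (cu c u v) u := by
  have h : DifferentiableAt ℝ (fun u' => c u' v) u :=
    (hc.differentiableAt hu hv).fun_comp' (f := fun u' => (u', v)) u
      (differentiableAt_fun_id.prodMk (differentiableAt_const v))
  exact h.hasDerivAt

lemma IsCopulaDensity.hasDerivAt_snd (hc : IsCopulaDensity c) {u v : ℝ}
    (hu : u ∈ Ioo (0 : ℝ) 1) (hv : v ∈ Ioo (0 : ℝ) 1) :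
    HasDerivAt (fun v' => c u v') (cv c u v) v := by
  have h : DifferentiableAt ℝ (fun v' => c u v') v :=
    (hc.differentiableAt hu hv).fun_comp' (f := fun v' => (u, v')) v
      ((differentiableAt_const u).prodMk differentiableAt_fun_id)
  exact h.hasDerivAt

lemma IsCopulaDensity.hasDerivAt_comp (hc : IsCopulaDensity c) {U V : ℝ → ℝ} {U' V' : ℝ}
    (hu : U 0 ∈ Ioo (0 : ℝ) 1) (hv : V 0 ∈ Ioo (0 : ℝ) 1) (hU : HasDerivAt U U' 0)
    (hV : HasDerivAt V V' 0) :
    HasDerivAt (fun θ => c (U θ) (V θ)) (cu c (U 0) (V 0) * U' + cv c (U 0) (V 0) * V') 0 := by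
  have hd := (hc.differentiableAt hu hv).hasFDerivAt
  have h1 := hd.comp_hasDerivAt (0 : ℝ) (hU.prodMk hV)
  refine h1.congr_deriv ?_
  have e : ((U', V') : ℝ × ℝ) = U' • (1, 0) + V' • (0, 1) := by simp
  have eu : fderiv ℝ (Function.uncurry c) (U 0, V 0) (1, 0) = cu c (U 0) (V 0) := by
    have := hd.comp_hasDerivAt (U 0) ((hasDerivAt_id (U 0)).prodMk (hasDerivAt_const _ (V 0)))
    exact this.unique (hc.hasDerivAt_fst hu hv)
  have ev : fderiv ℝ (Function.uncurry c) (U 0, V 0) (0, 1) = cv c (U 0) (V 0) := by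
    have := hd.comp_hasDerivAt (V 0) ((hasDerivAt_const _ (U 0)).prodMk (hasDerivAt_id (V 0)))
    exact this.unique (hc.hasDerivAt_snd hu hv)
  rw [e, map_add, map_smul, map_smul, eu, ev]
  simp only [smul_eq_mul]; ring

lemma abs_sub_le_of_hasDerivAt {φ φ' : ℝ → ℝ} {x y r B : ℝ}
    (hd : ∀ t, |t - x| ≤ r → HasDerivAt φ (φ' t) t) (hb : ∀ t, |t - x| ≤ r → |φ' t| ≤ B)
    (hy : |y - x| ≤ r) : |φ y - φ x| ≤ B * |y - x| := by
  have hconv : Convex ℝ (Metric.closedBall x r) := convex_closedBall x r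
  have hmem : ∀ t, t ∈ Metric.closedBall x r ↔ |t - x| ≤ r := fun t => by
    rw [Metric.mem_closedBall, Real.dist_eq]
  have := hconv.norm_image_sub_le_of_norm_hasDerivWithin_le (f := φ) (f' := φ') (C := B) (x := x)
    (y := y) (fun t ht => (hd t ((hmem t).1 ht)).hasDerivWithinAt)
    (fun t ht => hb t ((hmem t).1 ht)) ((hmem x).2 (by rw [sub_self, abs_zero]; exact (abs_nonneg _).trans hy))
    ((hmem y).2 hy)
  simpa [Real.norm_eq_abs] using this

/-- The copula density along a path of arguments that moves at a rate proportional to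
`u (1 - u)` and `v (1 - v)`. -/
lemma IsCopulaDensity.pathBound (hc : IsCopulaDensity c) (hρ : ρ < 1)
    (henv : ∀ u ∈ Ioo (0 : ℝ) 1, ∀ v ∈ Ioo (0 : ℝ) 1, ∀ u' v' : ℝ,
      |u' - u| ≤ ρ * (u * (1 - u)) → |v' - v| ≤ ρ * (v * (1 - v)) →
      c u' v' ≤ K u v ∧ u * (1 - u) * |cu c u' v'| ≤ K u v ∧
        v * (1 - v) * |cv c u' v'| ≤ K u v)
    {U V : ℝ → ℝ} {U' V' L δ : ℝ} (hL : 0 ≤ L) (hLδ : L * δ ≤ ρ)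
    (hu : U 0 ∈ Ioo (0 : ℝ) 1) (hv : V 0 ∈ Ioo (0 : ℝ) 1)
    (hU : HasDerivAt U U' 0) (hV : HasDerivAt V V' 0)
    (hUb : ∀ θ, |θ| < δ → |U θ - U 0| ≤ L * |θ| * (U 0 * (1 - U 0)))
    (hVb : ∀ θ, |θ| < δ → |V θ - V 0| ≤ L * |θ| * (V 0 * (1 - V 0))) :
    PathBound δ (fun θ => c (U θ) (V θ)) (cu c (U 0) (V 0) * U' + cv c (U 0) (V 0) * V')
      (K (U 0) (V 0)) (2 * L) := by
  set u := U 0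
  set v := V 0
  have hu' : 0 < u * (1 - u) := mul_pos hu.1 (sub_pos.2 hu.2)
  have hv' : 0 < v * (1 - v) := mul_pos hv.1 (sub_pos.2 hv.2)
  have hLθ : ∀ θ, |θ| < δ → L * |θ| ≤ ρ := fun θ hθ =>
    (mul_le_mul_of_nonneg_left hθ.le hL).trans hLδ
  have hUρ : ∀ θ, |θ| < δ → |U θ - u| ≤ ρ * (u * (1 - u)) := fun θ hθ =>
    (hUb θ hθ).trans (mul_le_mul_of_nonneg_right (hLθ θ hθ) hu'.le)
  have hVρ : ∀ θ, |θ| < δ → |V θ - v| ≤ ρ * (v * (1 - v)) := fun θ hθ =>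
    (hVb θ hθ).trans (mul_le_mul_of_nonneg_right (hLθ θ hθ) hv'.le)
  refine ⟨hc.hasDerivAt_comp hu hv hU hV, fun θ hθ => ?_, fun θ hθ => ?_⟩
  · have := hc.nonneg _ (mem_Ioo_of_abs_sub_le hρ hu (hUρ θ hθ)) _
      (mem_Ioo_of_abs_sub_le hρ hv (hVρ θ hθ))
    rw [abs_of_nonneg this]
    exact (henv u hu v hv _ _ (hUρ θ hθ) (hVρ θ hθ)).1
  · have hρ0 : 0 ≤ ρ := (mul_nonneg hL (abs_nonneg θ)).trans (hLθ θ hθ)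
    have hVm := mem_Ioo_of_abs_sub_le hρ hv (hVρ θ hθ)
    have hvv : |v - v| ≤ ρ * (v * (1 - v)) := by
      rw [sub_self, abs_zero]; exact mul_nonneg hρ0 hv'.le
    have huu : |u - u| ≤ ρ * (u * (1 - u)) := by
      rw [sub_self, abs_zero]; exact mul_nonneg hρ0 hu'.le
    have hKn : 0 ≤ K u v := (hc.nonneg u hu v hv).trans (henv u hu v hv u v huu hvv).1
    -- The arguments move one at a time, through `(u, V θ)`; the envelope holds on the whole
    -- relative neighbourhood of `(u, v)`, hence along both segments.
    have h1 : |c (U θ) (V θ) - c u (V θ)| ≤ K u v / (u * (1 - u)) * |U θ - u| := by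
      refine abs_sub_le_of_hasDerivAt (φ := fun u' => c u' (V θ)) (φ' := fun u' => cu c u' (V θ))
        (r := ρ * (u * (1 - u)))
        (fun t ht => hc.hasDerivAt_fst (mem_Ioo_of_abs_sub_le hρ hu ht) hVm) (fun t ht => ?_)
        (hUρ θ hθ)
      rw [le_div_iff₀ hu', mul_comm]
      exact (henv u hu v hv _ _ ht (hVρ θ hθ)).2.1
    have h2 : |c u (V θ) - c u v| ≤ K u v / (v * (1 - v)) * |V θ - v| := by
      refine abs_sub_le_of_hasDerivAt (φ := fun v' => c u v') (φ' := fun v' => cv c u v')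
        (r := ρ * (v * (1 - v)))
        (fun t ht => hc.hasDerivAt_snd hu (mem_Ioo_of_abs_sub_le hρ hv ht)) (fun t ht => ?_)
        (hVρ θ hθ)
      rw [le_div_iff₀ hv', mul_comm]
      exact (henv u hu v hv _ _ huu ht).2.2
    -- The singular factor `1 / (u (1 - u))` of the derivative bound cancels against the rate at
    -- which `U` moves. Each argument contributes `L`, hence `2 L`.
    have h3 : K u v / (u * (1 - u)) * |U θ - u| ≤ L * K u v * |θ| := by
      calc _ ≤ K u v / (u * (1 - u)) * (L * |θ| * (u * (1 - u))) :=
            mul_le_mul_of_nonneg_left (hUb θ hθ) (div_nonneg hKn hu'.le)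
        _ = K u v / (u * (1 - u)) * (u * (1 - u)) * (L * |θ|) := by ring
        _ = _ := by rw [div_mul_cancel₀ _ hu'.ne']; ring
    have h4 : K u v / (v * (1 - v)) * |V θ - v| ≤ L * K u v * |θ| := by
      calc _ ≤ K u v / (v * (1 - v)) * (L * |θ| * (v * (1 - v))) :=
            mul_le_mul_of_nonneg_left (hVb θ hθ) (div_nonneg hKn hv'.le)
        _ = K u v / (v * (1 - v)) * (v * (1 - v)) * (L * |θ|) := by ring
        _ = _ := by rw [div_mul_cancel₀ _ hv'.ne']; ring
    have h5 := abs_sub_le (c (U θ) (V θ)) (c u (V θ)) (c u v)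
    linarith

end CopulaPath

/-! ## The nuisance functions along a path -/

variable {𝒳 : Type*} [MeasurableSpace 𝒳]

section Paths

variable {P : Measure (Obs 𝒳)} [IsFiniteMeasure P] {g : ℝ → Obs 𝒳 → ℝ} {s : Obs 𝒳 → ℝ}
  {K δ : ℝ}

lemma measurable_section {k : Obs 𝒳 → ℝ} (hk : Measurable k) (u : ℝ × Bool × 𝒳) :
    Measurable fun y => k (y, u) :=
  hk.comp (measurable_id.prodMk measurable_const)

lemma kbar_one (u : ℝ × Bool × 𝒳) : kbar P (fun _ => 1) u = 1 := by simp [kbar]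

lemma abs_kbar_le {k : Obs 𝒳 → ℝ} {B : ℝ} (hb : ∀ v, |k v| ≤ B) (u : ℝ × Bool × 𝒳) :
    |kbar P k u| ≤ B := by
  rw [← Real.norm_eq_abs]
  refine (norm_integral_le_of_norm_le_const (Eventually.of_forall fun y => hb _)).trans ?_
  simp

lemma RatioPath.hasDerivAt_kbar (h : RatioPath g s K) (u : ℝ × Bool × 𝒳) :
    HasDerivAt (fun θ => kbar P (g θ) u) (kbar P s u) 0 := by
  refine (hasDerivAt_integral_zero (δ := 1) (bound := fun _ => K) one_pos
    (F := fun θ y => g θ (y, u)) (F' := fun y => s (y, u))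
    (fun θ _ => (measurable_section (h.measurable θ) u).aestronglyMeasurable)
    (integrable_kap_of_bound (h.measurable 0) (h.bound 0) u)
    (Eventually.of_forall fun y θ _ => ?_) (integrable_const _)
    (Eventually.of_forall fun y => h.deriv _)).2
  rw [h.zero]; exact h.bound θ _

lemma RatioPath.abs_kbar_sub_one_le (h : RatioPath g s K) (θ : ℝ) (u : ℝ × Bool × 𝒳) :
    |kbar P (g θ) u - 1| ≤ K * |θ| :=
  PCE.abs_kbar_sub_one_le (h.measurable θ) (h.bound θ) u

lemma RatioPath.pathBound_kbar (h : RatioPath g s K) (hδ : K * δ ≤ 1 / 2) (u : ℝ × Bool × 𝒳) :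
    PathBound δ (fun θ => kbar P (g θ) u) (kbar P s u) 2 K :=
  PathBound.of_sub_one (h.hasDerivAt_kbar u) (by simp [h.zero, kbar_one]) h.pos.le hδ
    fun θ _ => h.abs_kbar_sub_one_le θ u

lemma integrable_fst_mul_kap {k : Obs 𝒳 → ℝ} (hk : Measurable k) {B : ℝ} (hb : ∀ v, |k v| ≤ B)
    {u : ℝ × Bool × 𝒳} (hy : Integrable (fun y : ℝ => y) (kap P u)) :
    Integrable (fun y => y * k (y, u)) (kap P u) :=
  hy.mul_bdd (c := B) (measurable_section hk u).aestronglyMeasurable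
    (Eventually.of_forall fun _ => hb _)

lemma abs_kbar_fst_mul_le {k : Obs 𝒳 → ℝ} {B : ℝ} (hb : ∀ v, |k v| ≤ B) {u : ℝ × Bool × 𝒳}
    (hy : Integrable (fun y : ℝ => y) (kap P u)) :
    |kbar P (fun v => v.1 * k v) u| ≤ B * kbar P (fun v => |v.1|) u := by
  rw [← Real.norm_eq_abs]
  refine (norm_integral_le_of_norm_le (hy.abs.const_mul B) (Eventually.of_forall fun y => ?_)).trans
    (le_of_eq (integral_const_mul _ _))
  rw [Real.norm_eq_abs, abs_mul, mul_comm]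
  exact mul_le_mul_of_nonneg_right (hb _) (abs_nonneg _)

lemma RatioPath.pathBound_kbar_fst (h : RatioPath g s K) (hδ0 : 0 < δ) (hδ : K * δ ≤ 1 / 2)
    {u : ℝ × Bool × 𝒳} (hy : Integrable (fun y : ℝ => y) (kap P u)) :
    PathBound δ (fun θ => kbar P (fun v => v.1 * g θ v) u) (kbar P (fun v => v.1 * s v) u)
      (2 * kbar P (fun v => |v.1|) u) K := by
  have hgb : ∀ θ, |θ| < δ → ∀ v, |g θ v| ≤ 2 := by
    intro θ hθ v
    have h1 := abs_le.1 (h.bound θ v)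
    have h2 : K * |θ| ≤ 1 / 2 := (mul_le_mul_of_nonneg_left hθ.le h.pos.le).trans hδ
    rw [abs_le]; constructor <;> linarith
  have h00 : |(0 : ℝ)| < δ := by simpa using hδ0
  have hm0 : 0 ≤ kbar P (fun v => |v.1|) u := integral_nonneg fun y => abs_nonneg _
  refine ⟨?_, fun θ hθ => abs_kbar_fst_mul_le (hgb θ hθ) hy, fun θ hθ => ?_⟩
  · refine (hasDerivAt_integral_zero (bound := fun y => K * |y|) hδ0
      (F := fun θ y => y * g θ (y, u)) (F' := fun y => y * s (y, u))
      (fun θ _ => (measurable_id.mul (measurable_section (h.measurable θ) u)).aestronglyMeasurable)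
      (integrable_fst_mul_kap (h.measurable 0) (hgb 0 h00) hy)
      (Eventually.of_forall fun y θ _ => ?_) (hy.abs.const_mul K)
      (Eventually.of_forall fun y => (h.deriv _).const_mul y)).2
    rw [h.zero, ← mul_sub, abs_mul]
    have := mul_le_mul_of_nonneg_left (h.bound θ (y, u)) (abs_nonneg y)
    linarith
  · have e : kbar P (fun v => v.1 * g θ v) u - kbar P (fun v => v.1 * g 0 v) u =
        kbar P (fun v => v.1 * (g θ v - 1)) u := by
      unfold kbar
      rw [← integral_sub (integrable_fst_mul_kap (h.measurable θ) (hgb θ hθ) hy)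
        (integrable_fst_mul_kap (h.measurable 0) (hgb 0 h00) hy)]
      simp only [h.zero, mul_sub]
    rw [e]
    refine (abs_kbar_fst_mul_le (h.bound θ) hy).trans ?_
    have := mul_nonneg h.pos.le (mul_nonneg (abs_nonneg θ) hm0)
    linarith

end Paths

section ArmPaths

variable {P : Measure (Obs 𝒳)} [IsProbabilityMeasure P] {N : Nuisance 𝒳} {g : ℝ → Obs 𝒳 → ℝ}
  {s : Obs 𝒳 → ℝ} {K δ : ℝ} {z : Bool} {x : 𝒳}

/-- The derivative of the conditional distribution function along a path with score `s`. -/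
noncomputable def Fdot (P : Measure (Obs 𝒳)) [IsFiniteMeasure P] (N : Nuisance 𝒳)
    (s : Obs 𝒳 → ℝ) (z : Bool) (t : ℝ) (x : 𝒳) : ℝ :=
  (∫ r in Iic t, N.p z r x * kbar P s (r, z, x)) - N.F z t x * armMean P N s z x

lemma measurable_kbar_section {k : Obs 𝒳 → ℝ} (hk : Measurable k) (z : Bool) (x : 𝒳) :
    Measurable fun r => kbar P k (r, z, x) :=
  (measurable_kbar P hk).comp (measurable_id.prodMk measurable_const)

lemma integrable_p_mul_kbar (hp : Integrable fun r => N.p z r x) {k : Obs 𝒳 → ℝ}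
    (hk : Measurable k) {B : ℝ} (hb : ∀ v, |k v| ≤ B) :
    Integrable fun r => N.p z r x * kbar P k (r, z, x) :=
  hp.mul_bdd (c := B) (measurable_kbar_section hk z x).aestronglyMeasurable
    (Eventually.of_forall fun _ => abs_kbar_le hb _)

lemma RatioPath.abs_le (h : RatioPath g s K) (θ : ℝ) (v : Obs 𝒳) : |g θ v| ≤ K * |θ| + 1 := by
  have h1 := _root_.abs_le.1 (h.bound θ v)
  rw [_root_.abs_le]; constructor <;> linarith

lemma RatioPath.hasDerivAt_setIntegral (h : RatioPath g s K) (hp : Integrable fun r => N.p z r x)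
    (hp0 : ∀ r, 0 ≤ N.p z r x) (B : Set ℝ) :
    HasDerivAt (fun θ => ∫ r in B, N.p z r x * kbar P (g θ) (r, z, x))
      (∫ r in B, N.p z r x * kbar P s (r, z, x)) 0 := by
  refine (hasDerivAt_integral_zero (μ := volume.restrict B) (bound := fun r => K * N.p z r x)
    one_pos (F := fun θ r => N.p z r x * kbar P (g θ) (r, z, x))
    (F' := fun r => N.p z r x * kbar P s (r, z, x))
    (fun θ _ => (integrable_p_mul_kbar hp (h.measurable θ) (h.abs_le θ)).aestronglyMeasurable.restrict)
    (integrable_p_mul_kbar hp (h.measurable 0) (h.abs_le 0)).restrict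
    (Eventually.of_forall fun r θ _ => ?_) (hp.const_mul K).restrict
    (Eventually.of_forall fun r => (h.hasDerivAt_kbar _).const_mul _)).2
  rw [← mul_sub, abs_mul, abs_of_nonneg (hp0 r), h.zero, kbar_one]
  have := mul_le_mul_of_nonneg_left (h.abs_kbar_sub_one_le (P := P) θ (r, z, x)) (hp0 r)
  linarith

lemma RatioPath.hasDerivAt_armMean (h : RatioPath g s K) (hp : Integrable fun r => N.p z r x)
    (hp0 : ∀ r, 0 ≤ N.p z r x) :
    HasDerivAt (fun θ => armMean P N (g θ) z x) (armMean P N s z x) 0 := by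
  have := h.hasDerivAt_setIntegral (P := P) hp hp0 univ
  simp only [Measure.restrict_univ] at this
  exact this

lemma armMean_one (hp1 : ∫ r, N.p z r x = 1) : armMean P N (fun _ => 1) z x = 1 := by
  simp [armMean, kbar_one, hp1]

lemma RatioPath.abs_setIntegral_le (h : RatioPath g s K) (hp : Integrable fun r => N.p z r x)
    (hp0 : ∀ r, 0 ≤ N.p z r x) (θ : ℝ) {B : Set ℝ} :
    |(∫ r in B, N.p z r x * kbar P (g θ) (r, z, x)) - ∫ r in B, N.p z r x| ≤
      K * |θ| * ∫ r in B, N.p z r x := by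
  rw [← integral_sub (integrable_p_mul_kbar hp (h.measurable θ) (h.abs_le θ)).restrict hp.restrict,
    ← Real.norm_eq_abs, ← integral_const_mul]
  refine norm_integral_le_of_norm_le (hp.const_mul _).restrict (Eventually.of_forall fun r => ?_)
  rw [← mul_sub_one, Real.norm_eq_abs, abs_mul, abs_of_nonneg (hp0 r)]
  have := mul_le_mul_of_nonneg_left (h.abs_kbar_sub_one_le (P := P) θ (r, z, x)) (hp0 r)
  linarith

lemma RatioPath.abs_armMean_sub_one_le (h : RatioPath g s K) (hp : Integrable fun r => N.p z r x)
    (hp0 : ∀ r, 0 ≤ N.p z r x) (hp1 : ∫ r, N.p z r x = 1) (θ : ℝ) :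
    |armMean P N (g θ) z x - 1| ≤ K * |θ| := by
  have := h.abs_setIntegral_le (P := P) hp hp0 θ (B := univ)
  simp only [Measure.restrict_univ, hp1, mul_one] at this
  exact this

lemma tilt_F (g : Obs 𝒳 → ℝ) (z : Bool) (t : ℝ) (x : 𝒳) : (N.tilt P g).F z t x =
    (∫ r in Iic t, N.p z r x * kbar P g (r, z, x)) / armMean P N g z x :=
  integral_div _ _

lemma RatioPath.tilt_F_zero (h : RatioPath g s K) (hp1 : ∫ r, N.p z r x = 1) (t : ℝ) :
    (N.tilt P (g 0)).F z t x = N.F z t x := by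
  rw [tilt_F, h.zero, armMean_one hp1, div_one]
  simp only [kbar_one, mul_one]; rfl

lemma RatioPath.hasDerivAt_F (h : RatioPath g s K) (hp : Integrable fun r => N.p z r x)
    (hp0 : ∀ r, 0 ≤ N.p z r x) (hp1 : ∫ r, N.p z r x = 1) (t : ℝ) :
    HasDerivAt (fun θ => (N.tilt P (g θ)).F z t x) (Fdot P N s z t x) 0 := by
  have h1 : armMean P N (g 0) z x = 1 := by rw [h.zero, armMean_one hp1]
  have := (h.hasDerivAt_setIntegral (P := P) hp hp0 (Iic t)).fun_div (h.hasDerivAt_armMean hp hp0)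
    (by rw [h1]; exact one_ne_zero)
  simp only [tilt_F]
  refine this.congr_deriv ?_
  rw [h1, h.zero]
  simp [kbar_one, Fdot, Nuisance.F]

/-- With `I` and `J` the reweighted masses below and above `t`, and `H = I + J`, one has `I / H - F
= ((I - F) (1 - F) - F (J - (1 - F))) / H`. Here `I` deviates from `F` by at most `K |θ| F` and `J`
from `1 - F` by at most `K |θ| (1 - F)`, so both terms carry the factor `F (1 - F)`. The constant
`4` is `2` for the two terms times `2` for `1 / H`. -/
lemma RatioPath.abs_F_sub_le (h : RatioPath g s K) (hp : Integrable fun r => N.p z r x)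
    (hp0 : ∀ r, 0 ≤ N.p z r x) (hp1 : ∫ r, N.p z r x = 1) (t : ℝ) {θ : ℝ}
    (hθ : K * |θ| ≤ 1 / 2) :
    |(N.tilt P (g θ)).F z t x - N.F z t x| ≤ 4 * K * |θ| * (N.F z t x * (1 - N.F z t x)) := by
  have hpg := integrable_p_mul_kbar (P := P) hp (h.measurable θ) (h.abs_le θ)
  have hA := h.abs_setIntegral_le (P := P) hp hp0 θ (B := Iic t)
  have hB := h.abs_setIntegral_le (P := P) hp hp0 θ (B := (Iic t)ᶜ)
  have s1 := integral_add_compl (measurableSet_Iic (a := t)) hpg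
  have s2 := integral_add_compl (measurableSet_Iic (a := t)) hp
  rw [hp1] at s2
  have hh := _root_.abs_le.1 (h.abs_armMean_sub_one_le (P := P) hp hp0 hp1 θ)
  rw [tilt_F]
  have eF : N.F z t x = ∫ r in Iic t, N.p z r x := rfl
  have eh : armMean P N (g θ) z x = ∫ r, N.p z r x * kbar P (g θ) (r, z, x) := rfl
  rw [← eF] at hA s2
  have hF0 : 0 ≤ N.F z t x := integral_nonneg fun r => hp0 r
  have hF1 : ∫ r in (Iic t)ᶜ, N.p z r x = 1 - N.F z t x := by linarith
  have hF1' : 0 ≤ 1 - N.F z t x := by rw [← hF1]; exact integral_nonneg fun r => hp0 r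
  rw [hF1] at hB
  rw [← eh] at s1
  generalize armMean P N (g θ) z x = H at *
  generalize (∫ r in Iic t, N.p z r x * kbar P (g θ) (r, z, x)) = I at *
  generalize (∫ r in (Iic t)ᶜ, N.p z r x * kbar P (g θ) (r, z, x)) = J at *
  generalize N.F z t x = F at *
  have hH : 1 / 2 ≤ H := by linarith
  have hHp : 0 < H := by linarith
  have e : I / H - F = ((I - F) * (1 - F) - F * (J - (1 - F))) / H := by
    rw [← s1]
    rw [← s1] at hHp
    field_simp; ring
  have hn : |(I - F) * (1 - F) - F * (J - (1 - F))| ≤ 2 * (K * |θ|) * (F * (1 - F)) := by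
    refine (abs_sub _ _).trans ?_
    rw [abs_mul, abs_mul, abs_of_nonneg hF0, abs_of_nonneg hF1']
    have h1 := mul_le_mul_of_nonneg_right hA hF1'
    have h2 := mul_le_mul_of_nonneg_left hB hF0
    linarith
  rw [e, abs_div, abs_of_pos hHp, div_le_iff₀ hHp]
  refine hn.trans ?_
  have hq : 0 ≤ K * |θ| * (F * (1 - F)) :=
    mul_nonneg (mul_nonneg h.pos.le (abs_nonneg _)) (mul_nonneg hF0 hF1')
  nlinarith

end ArmPaths

end PCE

namespace PCE

/-! ## The weights of the objective along a path -/

variable {𝒳 : Type*} [MeasurableSpace 𝒳]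

/-- The conditional mean of `k(V)` given `(S, Z, X) = (s_z, z, x)`, at `(x, s₁, s₀)`. -/
noncomputable def kT (P : Measure (Obs 𝒳)) [IsFiniteMeasure P] (k : Obs 𝒳 → ℝ) (z : Bool)
    (a : 𝒳 × ℝ × ℝ) : ℝ :=
  kbar P k (pt z (a.1, coord z a.2))

lemma measurable_kT (P : Measure (Obs 𝒳)) [IsFiniteMeasure P] {k : Obs 𝒳 → ℝ} (hk : Measurable k)
    (z : Bool) : Measurable (kT P k z) :=
  (measurable_kbar P hk).comp ((measurable_pt z).comp
    (measurable_fst.prodMk ((measurable_coord z).comp measurable_snd)))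

/-- The common factor of the weights `wA` and `wD`. -/
noncomputable def wN (c w : ℝ → ℝ → ℝ) (P : Measure (Obs 𝒳)) [IsFiniteMeasure P] (N : Nuisance 𝒳)
    (g : Obs 𝒳 → ℝ) (a : 𝒳 × ℝ × ℝ) : ℝ :=
  w a.2.1 a.2.2 * (cF c (N.tilt P g) a * (covMean P N g a.1 *
    ((armMean P N g true a.1)⁻¹ * (armMean P N g false a.1)⁻¹)))

/-- `w e / (p₁ p₀)` for the law with density ratio `g`, relative to `T P N`. -/
noncomputable def wA (c w : ℝ → ℝ → ℝ) (P : Measure (Obs 𝒳)) [IsFiniteMeasure P] (N : Nuisance 𝒳)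
    (g : Obs 𝒳 → ℝ) (a : 𝒳 × ℝ × ℝ) : ℝ :=
  wN c w P N g a * (kT P g true a * kT P g false a)

/-- `w e (μ₁ - μ₀) / (p₁ p₀)` for the law with density ratio `g`, relative to `T P N`. -/
noncomputable def wD (c w : ℝ → ℝ → ℝ) (P : Measure (Obs 𝒳)) [IsFiniteMeasure P] (N : Nuisance 𝒳)
    (g : Obs 𝒳 → ℝ) (a : 𝒳 × ℝ × ℝ) : ℝ :=
  wN c w P N g a * (kT P (fun v => v.1 * g v) true a * kT P g false a -
    kT P (fun v => v.1 * g v) false a * kT P g true a)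

/-- The derivative of `wN` along a path with score `s`. -/
noncomputable def wNdot (c w : ℝ → ℝ → ℝ) (P : Measure (Obs 𝒳)) [IsFiniteMeasure P]
    (N : Nuisance 𝒳) (s : Obs 𝒳 → ℝ) (a : 𝒳 × ℝ × ℝ) : ℝ :=
  w a.2.1 a.2.2 *
    (cu c (N.F true a.2.1 a.1) (N.F false a.2.2 a.1) * Fdot P N s true a.2.1 a.1 +
      cv c (N.F true a.2.1 a.1) (N.F false a.2.2 a.1) * Fdot P N s false a.2.2 a.1 +
      cF c N a * (covMean P N s a.1 - (armMean P N s true a.1 + armMean P N s false a.1)))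

/-- The derivative of `wA` along a path with score `s`. -/
noncomputable def wAdot (c w : ℝ → ℝ → ℝ) (P : Measure (Obs 𝒳)) [IsFiniteMeasure P]
    (N : Nuisance 𝒳) (s : Obs 𝒳 → ℝ) (a : 𝒳 × ℝ × ℝ) : ℝ :=
  wNdot c w P N s a + w a.2.1 a.2.2 * cF c N a * (kT P s true a + kT P s false a)

/-- The derivative of `wD` along a path with score `s`. -/
noncomputable def wDdot (c w : ℝ → ℝ → ℝ) (P : Measure (Obs 𝒳)) [IsFiniteMeasure P]
    (N : Nuisance 𝒳) (s : Obs 𝒳 → ℝ) (a : 𝒳 × ℝ × ℝ) : ℝ :=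
  wNdot c w P N s a * (kT P (fun v => v.1) true a - kT P (fun v => v.1) false a) +
    w a.2.1 a.2.2 * cF c N a *
      (kT P (fun v => v.1 * s v) true a + kT P (fun v => v.1) true a * kT P s false a -
        (kT P (fun v => v.1 * s v) false a + kT P (fun v => v.1) false a * kT P s true a))

section Ratio

variable {P : Measure (Obs 𝒳)} [IsProbabilityMeasure P] {N : Nuisance 𝒳}

/-- The points at which the conditional densities and means are finite. -/
structure RegularPt (P : Measure (Obs 𝒳)) [IsFiniteMeasure P] (N : Nuisance 𝒳)
    (a : 𝒳 × ℝ × ℝ) : Prop where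
  F_mem : ∀ z, N.F z (coord z a.2) a.1 ∈ Ioo (0 : ℝ) 1
  integrable_p : ∀ z, Integrable (fun r => N.p z r a.1) ∧ ∫ r, N.p z r a.1 = 1
  prob_pos : ∀ z, 0 < N.prob z a.1
  integrable_y : ∀ z, Integrable (fun y : ℝ => y) (kap P (pt z (a.1, coord z a.2)))

namespace IsNuisance

lemma measurableSet_integrable_kap {k : ℝ → ℝ} (hk : Measurable k) :
    MeasurableSet {u : ℝ × Bool × 𝒳 | Integrable k (kap P u)} :=
  measurableSet_kernel_integrable (κ := kap P) (f := fun (_ : ℝ × Bool × 𝒳) y => k y)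
    (hk.comp measurable_snd).stronglyMeasurable

lemma ae_integrable_kap {k : ℝ → ℝ} (hk : Measurable k)
    (hi : Integrable (fun v : Obs 𝒳 => k v.1) P) : ∀ᵐ v ∂P, Integrable k (kap P v.2) := by
  have h1 := Integrable.condDistrib_ae_map (f := fun w : (ℝ × Bool × 𝒳) × ℝ => k w.2)
    (μ := P) (X := fun v : Obs 𝒳 => v.2) (Y := fun v : Obs 𝒳 => v.1) measurable_fst.aemeasurable
    ((integrable_map_measure (hk.comp measurable_snd).aestronglyMeasurable
      (measurable_snd.prodMk measurable_fst).aemeasurable).2 hi)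
  exact ae_of_ae_map measurable_snd.aemeasurable h1

/-- A version of the conditional mean of `k(Y)` agrees with the mean under the conditional law. -/
lemma ae_T_kbar_eq (h : IsNuisance P N) {k : ℝ → ℝ} (hk : Measurable k) {m : Bool → ℝ → 𝒳 → ℝ}
    (hm : IsCondMean P k m) (z : Bool) :
    ∀ᵐ a ∂T P N, kT P (fun v => k v.1) z a = m z (coord z a.2) a.1 := by
  have hmm : Measurable fun u : ℝ × Bool × 𝒳 => m u.2.1 u.1 u.2.2 := by
    have : (fun u : ℝ × Bool × 𝒳 => m u.2.1 u.1 u.2.2) = fun u =>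
        if u.2.1 = true then m true u.1 u.2.2 else m false u.1 u.2.2 := by
      ext u; cases u.2.1 <;> simp
    rw [this]
    have hsx : Measurable fun u : ℝ × Bool × 𝒳 => (u.1, u.2.2) :=
      measurable_fst.prodMk (measurable_snd.comp measurable_snd)
    exact Measurable.ite ((measurable_fst.comp measurable_snd) (measurableSet_singleton true))
      ((hm.1 true).comp hsx) ((hm.1 false).comp hsx)
  have hkm : Measurable fun v : Obs 𝒳 => k v.1 := hk.comp measurable_fst
  refine h.ae_T_of_ae (p := fun u => kbar P (fun v => k v.1) u = m u.2.1 u.1 u.2.2)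
    (measurableSet_eq_fun (measurable_kbar P hkm) hmm) ?_ z
  have h1 := condExp_prod_ae_eq_integral_condDistrib (μ := P) (X := fun v : Obs 𝒳 => v.2)
    (Y := fun v : Obs 𝒳 => v.1) (f := fun w : (ℝ × Bool × 𝒳) × ℝ => k w.2) measurable_snd
    measurable_fst.aemeasurable (hk.comp measurable_snd).stronglyMeasurable hm.2.1
  filter_upwards [h1, hm.2.2] with v e1 e2
  exact e1.symm.trans e2

lemma ae_regularPt (h : IsNuisance P N) : ∀ᵐ a ∂T P N, RegularPt P N a := by
  have hy : ∀ᵐ a ∂T P N, ∀ z, Integrable (fun y : ℝ => y) (kap P (pt z (a.1, coord z a.2))) :=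
    ae_all_iff.2 fun z => h.ae_T_of_ae (p := fun u => Integrable (fun y : ℝ => y) (kap P u))
      (measurableSet_integrable_kap measurable_id) (ae_integrable_kap measurable_id h.outcome.2.1) z
  filter_upwards [h.ae_T_F, ae_T_of_ae_x h.integrable_p, ae_T_of_ae_x h.prob_pos, hy] with a h1 h2
    h3 h4 using ⟨h1, h2, h3, h4⟩

lemma measurable_cF_tilt (h : IsNuisance P N) {c : ℝ → ℝ → ℝ} (hc : IsCopulaDensity c)
    {g : Obs 𝒳 → ℝ} (hg : Measurable g) : Measurable (cF c (N.tilt P g)) := by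
  have hF : ∀ z, Measurable fun a : 𝒳 × ℝ × ℝ => (N.tilt P g).F z (coord z a.2) a.1 := fun z =>
    (measurable_setIntegral_Iic (k := fun x t => (N.tilt P g).p z t x)
      (h.measurable_tilt_p hg z)).comp
      (measurable_fst.prodMk ((measurable_coord z).comp measurable_snd))
  exact hc.measurable.comp ((hF true).prodMk (hF false))

lemma measurable_base (h : IsNuisance P N) {g : Obs 𝒳 → ℝ} (hg : Measurable g) :
    Measurable fun a : 𝒳 × ℝ × ℝ => covMean P N g a.1 *
      ((armMean P N g true a.1)⁻¹ * (armMean P N g false a.1)⁻¹) :=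
  ((h.measurable_covMean hg).mul ((h.measurable_armMean hg true).inv.mul
    (h.measurable_armMean hg false).inv)).comp measurable_fst

lemma measurable_wN (h : IsNuisance P N) {c w : ℝ → ℝ → ℝ} (hc : IsCopulaDensity c)
    (hw : Measurable (Function.uncurry w)) {g : Obs 𝒳 → ℝ} (hg : Measurable g) :
    Measurable (wN c w P N g) :=
  (hw.comp measurable_snd).mul ((h.measurable_cF_tilt hc hg).mul (h.measurable_base hg))

lemma measurable_wA (h : IsNuisance P N) {c w : ℝ → ℝ → ℝ} (hc : IsCopulaDensity c)
    (hw : Measurable (Function.uncurry w)) {g : Obs 𝒳 → ℝ} (hg : Measurable g) :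
    Measurable (wA c w P N g) :=
  (h.measurable_wN hc hw hg).mul ((measurable_kT P hg true).mul (measurable_kT P hg false))

lemma measurable_wD (h : IsNuisance P N) {c w : ℝ → ℝ → ℝ} (hc : IsCopulaDensity c)
    (hw : Measurable (Function.uncurry w)) {g : Obs 𝒳 → ℝ} (hg : Measurable g) :
    Measurable (wD c w P N g) := by
  have hyg : Measurable fun v : Obs 𝒳 => v.1 * g v := measurable_fst.mul hg
  exact (h.measurable_wN hc hw hg).mul (((measurable_kT P hyg true).mul
    (measurable_kT P hg false)).sub ((measurable_kT P hyg false).mul (measurable_kT P hg true)))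

/-- The density of `T` of the law with density ratio `g` relative to `T P N`. -/
lemma T_tilt (h : IsNuisance P N) {g : Obs 𝒳 → ℝ} (hg : Measurable g)
    (hb : ∀ v, |g v - 1| ≤ 1 / 2) :
    T (tiltLaw P g) (N.tilt P g) = (T P N).withDensity fun a => ENNReal.ofReal
      (covMean P N g a.1 * ((armMean P N g true a.1)⁻¹ * (armMean P N g false a.1)⁻¹) *
        (kT P g true a * kT P g false a)) := by
  have h0 : ∀ v, 0 ≤ g v := fun v => (ratio_pos hb v).le
  have hG : ∀ u, 0 < kbar P g u := fun u => kbar_pos hg hb u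
  have hpt := h.measurable_tilt_p hg
  have hgX : Measurable fun x => ENNReal.ofReal (covMean P N g x) :=
    (h.measurable_covMean hg).ennreal_ofReal
  have hd1 : Measurable fun a : 𝒳 × ℝ × ℝ =>
      ENNReal.ofReal ((N.tilt P g).p true a.2.1 a.1 * (N.tilt P g).p false a.2.2 a.1) :=
    (((hpt true).comp (measurable_fst.prodMk (measurable_fst.comp measurable_snd))).mul
      ((hpt false).comp (measurable_fst.prodMk (measurable_snd.comp measurable_snd)))).ennreal_ofReal
  have hgX1 : Measurable fun a : 𝒳 × ℝ × ℝ => ENNReal.ofReal (covMean P N g a.1) :=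
    hgX.comp measurable_fst
  have hr : Measurable fun a : 𝒳 × ℝ × ℝ => ENNReal.ofReal
      (covMean P N g a.1 * ((armMean P N g true a.1)⁻¹ * (armMean P N g false a.1)⁻¹) *
        (kT P g true a * kT P g false a)) :=
    ((h.measurable_base hg).mul
      ((measurable_kT P hg true).mul (measurable_kT P hg false))).ennreal_ofReal
  have hpos := Measure.quasiMeasurePreserving_fst (μ := lawX P)
    (ν := (volume : Measure (ℝ × ℝ))) |>.ae (h.mean_pos hg hb)
  have : SFinite ((lawX P).withDensity fun x => ENNReal.ofReal (covMean P N g x)) := inferInstance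
  rw [T, T, h.lawX_tiltLaw hg h0 hb, prod_withDensity_left hgX,
    ← withDensity_mul _ hgX1 hd1,
    ← withDensity_mul _ h.measurable_dens.ennreal_ofReal hr]
  refine withDensity_congr_ae ?_
  filter_upwards [hpos] with a ha
  simp only [Pi.mul_apply]
  rw [← ENNReal.ofReal_mul ha.2.le, ← ENNReal.ofReal_mul (h.dens_nonneg a)]
  congr 1
  simp only [Nuisance.tilt, kT, pt, coord_true, coord_false, div_eq_mul_inv]
  ring

lemma integral_T_tilt (h : IsNuisance P N) {g : Obs 𝒳 → ℝ} (hg : Measurable g)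
    (hb : ∀ v, |g v - 1| ≤ 1 / 2) (φ : 𝒳 × ℝ × ℝ → ℝ) :
    (Integrable φ (T (tiltLaw P g) (N.tilt P g)) ↔ Integrable (fun a => covMean P N g a.1 *
      ((armMean P N g true a.1)⁻¹ * (armMean P N g false a.1)⁻¹) *
        (kT P g true a * kT P g false a) * φ a) (T P N)) ∧
    ∫ a, φ a ∂T (tiltLaw P g) (N.tilt P g) = ∫ a, covMean P N g a.1 *
      ((armMean P N g true a.1)⁻¹ * (armMean P N g false a.1)⁻¹) *
        (kT P g true a * kT P g false a) * φ a ∂T P N := by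
  have hG : ∀ u, 0 < kbar P g u := fun u => kbar_pos hg hb u
  have hm : Measurable fun a : 𝒳 × ℝ × ℝ => covMean P N g a.1 *
      ((armMean P N g true a.1)⁻¹ * (armMean P N g false a.1)⁻¹) *
        (kT P g true a * kT P g false a) :=
    (h.measurable_base hg).mul ((measurable_kT P hg true).mul (measurable_kT P hg false))
  have h0 : ∀ᵐ a ∂T P N, 0 ≤ covMean P N g a.1 *
      ((armMean P N g true a.1)⁻¹ * (armMean P N g false a.1)⁻¹) *
        (kT P g true a * kT P g false a) := by
    filter_upwards [ae_T_of_ae_x (h.mean_pos hg hb)] with a ha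
    exact mul_nonneg (mul_nonneg ha.2.le (mul_nonneg (inv_nonneg.2 (ha.1 _).le)
      (inv_nonneg.2 (ha.1 _).le))) (mul_nonneg (hG _).le (hG _).le)
  rw [h.T_tilt hg hb]
  exact ⟨integrable_withDensity_ofReal hm h0, integral_withDensity_ofReal hm h0 φ⟩

lemma tilt_contrast {g : Obs 𝒳 → ℝ} (a : 𝒳 × ℝ × ℝ) :
    (N.tilt P g).contrast a = kT P (fun v => v.1 * g v) true a / kT P g true a -
      kT P (fun v => v.1 * g v) false a / kT P g false a := by
  simp only [Nuisance.contrast, Nuisance.tilt, kT, pt, coord_true, coord_false]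

/-- The objective of the law with density ratio `g`, as an integral against `T P N`. -/
theorem objectiveObs_tilt (h : IsNuisance P N) {c w : ℝ → ℝ → ℝ} (hc : IsCopulaDensity c)
    (hw : Measurable (Function.uncurry w)) (hw0 : ∀ s₁ s₀, 0 ≤ w s₁ s₀) {g : Obs 𝒳 → ℝ}
    (hg : Measurable g) (hb : ∀ v, |g v - 1| ≤ 1 / 2) [IsProbabilityMeasure (tiltLaw P g)]
    (h2 : Integrable (fun a => wA c w P N g a * (N.tilt P g).contrast a ^ 2) (T P N)) :
    ∃ C : ℝ, ∀ {q : ℕ} (f : ℝ → ℝ → (Fin q → ℝ) → ℝ) (η : Fin q → ℝ),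
      Measurable (fun r : ℝ × ℝ => f r.1 r.2 η) →
      Integrable (fun a => wA c w P N g a * f a.2.1 a.2.2 η ^ 2) (T P N) →
      Integrable (fun a => f a.2.1 a.2.2 η * wD c w P N g a) (T P N) →
      0 ≤ C + 2 * ∫ a, f a.2.1 a.2.2 η ^ 2 / 2 * wA c w P N g a -
        f a.2.1 a.2.2 η * wD c w P N g a ∂T P N ∧
      objectiveObs (tiltLaw P g) (N.tilt P g) c w f η = ENNReal.ofReal
        (C + 2 * ∫ a, f a.2.1 a.2.2 η ^ 2 / 2 * wA c w P N g a -
          f a.2.1 a.2.2 η * wD c w P N g a ∂T P N) := by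
  have hG : ∀ u, kbar P g u ≠ 0 := fun u => (kbar_pos hg hb u).ne'
  have hT := h.integral_T_tilt hg hb
  -- The denominators of the reweighted outcome means are the factors `kT P g` in the density of the
  -- reweighted `T`; they cancel, so `wD` involves no quotient of these means.
  have hD : ∀ a, covMean P N g a.1 * ((armMean P N g true a.1)⁻¹ * (armMean P N g false a.1)⁻¹) *
        (kT P g true a * kT P g false a) * (w a.2.1 a.2.2 * cF c (N.tilt P g) a *
          (N.tilt P g).contrast a) = wD c w P N g a := by
    intro a
    have g1 : kT P g true a ≠ 0 := hG _
    have g0 : kT P g false a ≠ 0 := hG _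
    rw [tilt_contrast, wD, wN]
    field_simp
  have hA : ∀ a, covMean P N g a.1 * ((armMean P N g true a.1)⁻¹ * (armMean P N g false a.1)⁻¹) *
        (kT P g true a * kT P g false a) * (w a.2.1 a.2.2 * cF c (N.tilt P g) a) =
          wA c w P N g a := by
    intro a; rw [wA, wN]; ring
  obtain ⟨C, hC⟩ := (h.tilt hg hb).objectiveObs_eq hc hw hw0 (by
    rw [(hT _).1]
    refine h2.congr (Eventually.of_forall fun a => ?_)
    simp only [← hA]; ring)
  refine ⟨C, fun {q} f η hf hi1 hi2 => ?_⟩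
  have := hC f η hf
    (by
      rw [(hT _).1]
      refine hi1.congr (Eventually.of_forall fun a => ?_)
      simp only [← hA]; ring)
    (by
      rw [(hT _).1]
      refine hi2.congr (Eventually.of_forall fun a => ?_)
      simp only [← hD]; ring)
  rw [(hT _).2] at this
  have e : ∀ a, covMean P N g a.1 * ((armMean P N g true a.1)⁻¹ * (armMean P N g false a.1)⁻¹) *
        (kT P g true a * kT P g false a) * (f a.2.1 a.2.2 η ^ 2 / 2 *
          (w a.2.1 a.2.2 * cF c (N.tilt P g) a) - f a.2.1 a.2.2 η *
          (w a.2.1 a.2.2 * cF c (N.tilt P g) a * (N.tilt P g).contrast a)) =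
      f a.2.1 a.2.2 η ^ 2 / 2 * wA c w P N g a - f a.2.1 a.2.2 η * wD c w P N g a := by
    intro a; rw [← hA, ← hD]; ring
  simpa only [e] using this

end IsNuisance

end Ratio

end PCE

/-! ### Domination of the weights along a path -/

namespace PCE

variable {𝒳 : Type*} [MeasurableSpace 𝒳]

/-- Local envelopes as in `IsRegular`. -/
structure Envelope {q : ℕ} (c w : ℝ → ℝ → ℝ) (f : ℝ → ℝ → (Fin q → ℝ) → ℝ)
    (P : Measure (Obs 𝒳)) (N : Nuisance 𝒳) (η : Fin q → ℝ) (ρ : ℝ) (K b : ℝ → ℝ → ℝ)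
    (m : Bool → ℝ → 𝒳 → ℝ) : Prop where
  measurable_w : Measurable (Function.uncurry w)
  nonneg_w : ∀ s₁ s₀, 0 ≤ w s₁ s₀
  measurable_f : ∀ η', Measurable fun r : ℝ × ℝ => f r.1 r.2 η'
  pos : 0 < ρ
  lt_one : ρ < 1
  measurable_K : Measurable (Function.uncurry K)
  measurable_b : Measurable (Function.uncurry b)
  contDiffOn : ∀ s₁ s₀, ContDiffOn ℝ 2 (f s₁ s₀) (Metric.ball η ρ)
  bound_f : ∀ s₁ s₀, ∀ η' ∈ Metric.ball η ρ, |f s₁ s₀ η'| ≤ b s₁ s₀ ∧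
    (∀ i, |grad (f s₁ s₀) η' i| ≤ b s₁ s₀) ∧ ∀ i j, |hess (f s₁ s₀) η' i j| ≤ b s₁ s₀
  bound_c : ∀ u ∈ Ioo (0 : ℝ) 1, ∀ v ∈ Ioo (0 : ℝ) 1, ∀ u' v' : ℝ,
    |u' - u| ≤ ρ * (u * (1 - u)) → |v' - v| ≤ ρ * (v * (1 - v)) →
    c u' v' ≤ K u v ∧ u * (1 - u) * |cu c u' v'| ≤ K u v ∧ v * (1 - v) * |cv c u' v'| ≤ K u v
  condMean : IsCondMean P (fun y => y ^ 2) m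
  integrable : Integrable (fun a : 𝒳 × ℝ × ℝ => w a.2.1 a.2.2 *
    (b a.2.1 a.2.2 ^ 2 + m true a.2.1 a.1 + m false a.2.2 a.1) *
    K (N.F true a.2.1 a.1) (N.F false a.2.2 a.1) *
    N.p true a.2.1 a.1 * N.p false a.2.2 a.1) ((lawX P).prod volume)

lemma IsRegular.exists_envelope {q : ℕ} {c w : ℝ → ℝ → ℝ} {f : ℝ → ℝ → (Fin q → ℝ) → ℝ}
    {P : Measure (Obs 𝒳)} {N : Nuisance 𝒳} {η : Fin q → ℝ} (h : IsRegular c w f P N η) :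
    ∃ ρ K b m, Envelope c w f P N η ρ K b m := by
  obtain ⟨ρ, K, b, m, h1, h2, h3, h4, h5, h6, h7, h8, h9⟩ := h.envelope
  exact ⟨ρ, K, b, m, h.measurable_w, h.nonneg_w, h.measurable_f, h1, h2, h3, h4, h5, h6, h7, h8, h9⟩

lemma PathBound.congr_deriv {δ a' b' A C : ℝ} {a : ℝ → ℝ} (h : PathBound δ a a' A C)
    (e : a' = b') : PathBound δ a b' A C := e ▸ h

section PathBounds

variable {P : Measure (Obs 𝒳)} [IsProbabilityMeasure P] {N : Nuisance 𝒳} {g : ℝ → Obs 𝒳 → ℝ}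
  {s : Obs 𝒳 → ℝ} {K₀ δ : ℝ} {a : 𝒳 × ℝ × ℝ} {c w : ℝ → ℝ → ℝ} {q : ℕ}
  {f : ℝ → ℝ → (Fin q → ℝ) → ℝ} {η : Fin q → ℝ} {ρ : ℝ} {K b : ℝ → ℝ → ℝ}
  {m : Bool → ℝ → 𝒳 → ℝ}

lemma covMean_one (ha : RegularPt P N a) : covMean P N (fun _ => 1) a.1 = 1 := by
  rw [covMean, armMean_one (ha.integrable_p true).2, armMean_one (ha.integrable_p false).2,
    Nuisance.prob_true, Nuisance.prob_false]
  ring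

lemma kT_one (z : Bool) (a : 𝒳 × ℝ × ℝ) : kT P (fun _ => 1) z a = 1 := kbar_one _

lemma RatioPath.pathBound_covMean (rp : RatioPath g s K₀) (h : IsNuisance P N)
    (hδ : K₀ * δ ≤ 1 / 2) (ha : RegularPt P N a) :
    PathBound δ (fun θ => covMean P N (g θ) a.1) (covMean P N s a.1) 2 K₀ := by
  have hd : ∀ z, HasDerivAt (fun θ => armMean P N (g θ) z a.1) (armMean P N s z a.1) 0 :=
    fun z => rp.hasDerivAt_armMean (ha.integrable_p z).1 fun r => h.nonneg_p _ _ _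
  refine PathBound.of_sub_one (((hd true).const_mul _).add ((hd false).const_mul _))
    (by rw [rp.zero, covMean_one ha]) rp.pos.le hδ fun θ _ => ?_
  have hb : ∀ z, |armMean P N (g θ) z a.1 - 1| ≤ K₀ * |θ| := fun z =>
    rp.abs_armMean_sub_one_le (ha.integrable_p z).1 (fun r => h.nonneg_p _ _ _)
      (ha.integrable_p z).2 θ
  have e : covMean P N (g θ) a.1 - 1 = N.prob true a.1 * (armMean P N (g θ) true a.1 - 1) +
      N.prob false a.1 * (armMean P N (g θ) false a.1 - 1) := by
    simp only [covMean, Nuisance.prob_true, Nuisance.prob_false]; ring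
  have e1 : N.prob true a.1 + N.prob false a.1 = 1 := by
    simp only [Nuisance.prob_true, Nuisance.prob_false]; ring
  rw [e]
  refine (abs_add_le _ _).trans ?_
  rw [abs_mul, abs_mul, abs_of_pos (ha.prob_pos _), abs_of_pos (ha.prob_pos _)]
  have h1 := mul_le_mul_of_nonneg_left (hb true) (ha.prob_pos true).le
  have h0 := mul_le_mul_of_nonneg_left (hb false) (ha.prob_pos false).le
  calc _ ≤ (N.prob true a.1 + N.prob false a.1) * (K₀ * |θ|) := by linarith
    _ = _ := by rw [e1, one_mul]

lemma RatioPath.pathBound_inv_armMean (rp : RatioPath g s K₀) (h : IsNuisance P N)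
    (hδ : K₀ * δ ≤ 1 / 2) (ha : RegularPt P N a) (z : Bool) :
    PathBound δ (fun θ => (armMean P N (g θ) z a.1)⁻¹) (-armMean P N s z a.1) 2 K₀ :=
  PathBound.inv_of_sub_one (rp.hasDerivAt_armMean (ha.integrable_p z).1 fun r => h.nonneg_p _ _ _)
    (by rw [rp.zero, armMean_one (ha.integrable_p z).2]) rp.pos.le hδ fun θ _ =>
      rp.abs_armMean_sub_one_le (ha.integrable_p z).1 (fun r => h.nonneg_p _ _ _)
        (ha.integrable_p z).2 θ

/-- The distribution functions move at rate `4 K₀`, which becomes the rate of the arguments of `c`;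
`4 K₀ δ ≤ ρ` keeps these where the envelope `K` is valid. -/
lemma RatioPath.pathBound_cF (rp : RatioPath g s K₀) (h : IsNuisance P N)
    (hc : IsCopulaDensity c) (env : Envelope c w f P N η ρ K b m) (hδ : 4 * K₀ * δ ≤ ρ)
    (ha : RegularPt P N a) :
    PathBound δ (fun θ => cF c (N.tilt P (g θ)) a)
      (cu c (N.F true a.2.1 a.1) (N.F false a.2.2 a.1) * Fdot P N s true a.2.1 a.1 +
        cv c (N.F true a.2.1 a.1) (N.F false a.2.2 a.1) * Fdot P N s false a.2.2 a.1)
      (K (N.F true a.2.1 a.1) (N.F false a.2.2 a.1)) (2 * (4 * K₀)) := by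
  have hp0 : ∀ z r, 0 ≤ N.p z r a.1 := fun z r => h.nonneg_p _ _ _
  have hz : ∀ z t, (N.tilt P (g 0)).F z t a.1 = N.F z t a.1 := fun z t =>
    rp.tilt_F_zero (ha.integrable_p z).2 t
  have hF : ∀ z t, ∀ θ, |θ| < δ → |(N.tilt P (g θ)).F z t a.1 - N.F z t a.1| ≤
      4 * K₀ * |θ| * (N.F z t a.1 * (1 - N.F z t a.1)) := by
    intro z t θ hθ
    refine rp.abs_F_sub_le (ha.integrable_p z).1 (hp0 z) (ha.integrable_p z).2 t ?_
    have h1 := mul_le_mul_of_nonneg_left hθ.le rp.pos.le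
    have h2 := env.lt_one
    linarith
  have h4 : 0 ≤ 4 * K₀ := by have := rp.pos; linarith
  have := hc.pathBound (K := K) (U := fun θ => (N.tilt P (g θ)).F true a.2.1 a.1)
    (V := fun θ => (N.tilt P (g θ)).F false a.2.2 a.1) env.lt_one env.bound_c h4 hδ
    (by simpa only [hz, coord_true] using ha.F_mem true) (by simpa only [hz, coord_false] using ha.F_mem false)
    (rp.hasDerivAt_F (ha.integrable_p true).1 (hp0 true) (ha.integrable_p true).2 _)
    (rp.hasDerivAt_F (ha.integrable_p false).1 (hp0 false) (ha.integrable_p false).2 _)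
    (by simpa only [hz] using hF true a.2.1) (by simpa only [hz] using hF false a.2.2)
  simp only [hz] at this
  exact this

lemma cF_tilt_one (ha : RegularPt P N a) : cF c (N.tilt P fun _ => 1) a = cF c N a := by
  have hz : ∀ z t, (N.tilt P fun _ => 1).F z t a.1 = N.F z t a.1 := fun z t => by
    rw [tilt_F, armMean_one (ha.integrable_p z).2, div_one]
    simp only [kbar_one, mul_one]; rfl
  simp only [cF, hz]

lemma wN_one (ha : RegularPt P N a) : wN c w P N (fun _ => 1) a = w a.2.1 a.2.2 * cF c N a := by
  rw [wN, cF_tilt_one ha, covMean_one ha, armMean_one (ha.integrable_p _).2,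
    armMean_one (ha.integrable_p _).2]
  ring

lemma wA_one (ha : RegularPt P N a) : wA c w P N (fun _ => 1) a = w a.2.1 a.2.2 * cF c N a := by
  rw [wA, wN_one ha, kT_one, kT_one]; ring

lemma wD_one (ha : RegularPt P N a) : wD c w P N (fun _ => 1) a = w a.2.1 a.2.2 * cF c N a *
    (kT P (fun v => v.1) true a - kT P (fun v => v.1) false a) := by
  simp only [wD, wN_one ha, kT_one, mul_one]

variable (rp : RatioPath g s K₀) (h : IsNuisance P N) (hc : IsCopulaDensity c)
  (env : Envelope c w f P N η ρ K b m) (hδ0 : 0 < δ) (hδ : 4 * K₀ * δ ≤ ρ) (ha : RegularPt P N a)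

include rp h hc env hδ0 hδ ha

/-- Rates add: `8 K₀` from the copula density and `K₀` from each of the three other factors,
`covMean` and the two inverse arm means, which are bounded by `2`. -/
lemma RatioPath.pathBound_wN :
    PathBound δ (fun θ => wN c w P N (g θ) a) (wNdot c w P N s a)
      (w a.2.1 a.2.2 * (K (N.F true a.2.1 a.1) (N.F false a.2.2 a.1) * (2 * (2 * 2)))) (11 * K₀) := by
  have hδ' : K₀ * δ ≤ 1 / 2 := by have := env.lt_one; linarith
  have h1 := ((rp.pathBound_cF h hc env hδ ha).mul ((rp.pathBound_covMean h hδ' ha).mul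
    ((rp.pathBound_inv_armMean h hδ' ha true).mul (rp.pathBound_inv_armMean h hδ' ha false) hδ0)
      hδ0) hδ0).const_mul (env.nonneg_w a.2.1 a.2.2)
  refine (h1.mono (C₂ := 11 * K₀) (by linarith)).congr_deriv ?_
  rw [rp.zero, cF_tilt_one ha, covMean_one ha, armMean_one (ha.integrable_p _).2,
    armMean_one (ha.integrable_p _).2, wNdot]
  ring

/-- The conditional means of the ratio in the two arms add `2 K₀` to the rate of `wN` and a factor
`4` to its envelope. -/
lemma RatioPath.pathBound_wA :
    PathBound δ (fun θ => wA c w P N (g θ) a) (wAdot c w P N s a)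
      (w a.2.1 a.2.2 * (K (N.F true a.2.1 a.1) (N.F false a.2.2 a.1) * (2 * (2 * 2))) * (2 * 2))
      (13 * K₀) := by
  have hδ' : K₀ * δ ≤ 1 / 2 := by have := env.lt_one; linarith
  have h1 := (rp.pathBound_wN h hc env hδ0 hδ ha).mul
    ((rp.pathBound_kbar (P := P) hδ' (pt true (a.1, coord true a.2))).mul
      (rp.pathBound_kbar (P := P) hδ' (pt false (a.1, coord false a.2))) hδ0) hδ0
  refine (h1.mono (C₂ := 13 * K₀) (by linarith)).congr_deriv ?_
  rw [rp.zero, wN_one ha, kbar_one, kbar_one, wAdot, kT, kT]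
  ring

lemma RatioPath.pathBound_wD :
    PathBound δ (fun θ => wD c w P N (g θ) a) (wDdot c w P N s a)
      (w a.2.1 a.2.2 * (K (N.F true a.2.1 a.1) (N.F false a.2.2 a.1) * (2 * (2 * 2))) *
        (2 * kT P (fun v => |v.1|) true a * 2 + 2 * kT P (fun v => |v.1|) false a * 2))
      (13 * K₀) := by
  have hδ' : K₀ * δ ≤ 1 / 2 := by have := env.lt_one; linarith
  have h1 := (rp.pathBound_wN h hc env hδ0 hδ ha).mul
    (((rp.pathBound_kbar_fst (P := P) hδ0 hδ' (ha.integrable_y true)).mul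
      (rp.pathBound_kbar (P := P) hδ' (pt false (a.1, coord false a.2))) hδ0).sub
      ((rp.pathBound_kbar_fst (P := P) hδ0 hδ' (ha.integrable_y false)).mul
      (rp.pathBound_kbar (P := P) hδ' (pt true (a.1, coord true a.2))) hδ0)) hδ0
  refine (h1.mono (C₂ := 13 * K₀) (by linarith)).congr_deriv ?_
  rw [rp.zero, wN_one ha, kbar_one, kbar_one, wDdot]
  simp only [kT, mul_one]

end PathBounds

section Family

variable {P : Measure (Obs 𝒳)} [IsProbabilityMeasure P] {N : Nuisance 𝒳}
  {c w : ℝ → ℝ → ℝ} {q : ℕ} {f : ℝ → ℝ → (Fin q → ℝ) → ℝ} {η : Fin q → ℝ} {ρ : ℝ}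
  {K b : ℝ → ℝ → ℝ} {m : Bool → ℝ → 𝒳 → ℝ}

/-- The envelope of the weights, up to constants. -/
noncomputable def wK (w K : ℝ → ℝ → ℝ) (N : Nuisance 𝒳) (a : 𝒳 × ℝ × ℝ) : ℝ :=
  w a.2.1 a.2.2 * K (N.F true a.2.1 a.1) (N.F false a.2.2 a.1)

namespace Envelope

variable (env : Envelope c w f P N η ρ K b m) (h : IsNuisance P N) (hc : IsCopulaDensity c)

include env

omit [IsProbabilityMeasure P] in
lemma b_nonneg (s₁ s₀ : ℝ) : 0 ≤ b s₁ s₀ :=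
  (abs_nonneg _).trans (env.bound_f s₁ s₀ η (Metric.mem_ball_self env.pos)).1

include h

omit [IsProbabilityMeasure P] in
lemma measurable_wK : Measurable (wK w K N) :=
  (env.measurable_w.comp measurable_snd).mul
    (env.measurable_K.comp ((h.measurable_F_coord true).prodMk (h.measurable_F_coord false)))

/-- The first absolute conditional moments of `Y` are bounded by the second moments. -/
lemma ae_sq_kT_le : ∀ᵐ a ∂T P N, ∀ z,
    kT P (fun v => |v.1|) z a ^ 2 ≤ m z (coord z a.2) a.1 := by
  refine ae_all_iff.2 fun z => ?_
  have h2 : ∀ᵐ a ∂T P N, Integrable (fun y : ℝ => y ^ 2) (kap P (pt z (a.1, coord z a.2))) :=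
    h.ae_T_of_ae (p := fun u => Integrable (fun y : ℝ => y ^ 2) (kap P u))
      (IsNuisance.measurableSet_integrable_kap (measurable_id.pow_const 2))
      (IsNuisance.ae_integrable_kap (measurable_id.pow_const 2) env.condMean.2.1) z
  filter_upwards [h2, h.ae_regularPt, h.ae_T_kbar_eq (measurable_id.pow_const 2) env.condMean z]
    with a hi2 ha he
  rw [← he]
  have hy := (ha.integrable_y z).abs
  have e0 : kT P (fun v => |v.1|) z a = ∫ y, |y| ∂kap P (pt z (a.1, coord z a.2)) := rfl
  have e1 : kT P (fun v => v.1 ^ 2) z a = ∫ y, y ^ 2 ∂kap P (pt z (a.1, coord z a.2)) := rfl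
  change _ ≤ kT P (fun v => v.1 ^ 2) z a
  rw [e0, e1]
  set M := ∫ y, |y| ∂kap P (pt z (a.1, coord z a.2))
  -- Nonnegativity of the variance of `|Y|` under the conditional law.
  have key : 0 ≤ ∫ y, (y ^ 2 - 2 * M * |y| + M ^ 2) ∂kap P (pt z (a.1, coord z a.2)) :=
    integral_nonneg fun y => by
      have : y ^ 2 - 2 * M * |y| + M ^ 2 = (|y| - M) ^ 2 := by rw [← sq_abs y]; ring
      change 0 ≤ y ^ 2 - 2 * M * |y| + M ^ 2
      rw [this]; positivity
  have i1 : Integrable (fun y : ℝ => y ^ 2 - 2 * M * |y|) (kap P (pt z (a.1, coord z a.2))) :=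
    hi2.sub (hy.const_mul _)
  rw [integral_add i1 (integrable_const _), integral_sub hi2 (hy.const_mul _),
    integral_const_mul, integral_const] at key
  simp only [probReal_univ, one_smul] at key
  change 0 ≤ _ - 2 * M * M + M ^ 2 at key
  linarith

omit [IsProbabilityMeasure P] in
lemma integrable_wK : Integrable (fun a => wK w K N a *
    (b a.2.1 a.2.2 ^ 2 + m true a.2.1 a.1 + m false a.2.2 a.1)) (T P N) := by
  rw [h.integrable_T]
  refine env.integrable.congr (Eventually.of_forall fun a => ?_)
  simp only [wK]; ring

include hc

lemma ae_wK_nonneg : ∀ᵐ a ∂T P N, cF c N a ≤ K (N.F true a.2.1 a.1) (N.F false a.2.2 a.1) ∧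
    0 ≤ wK w K N a := by
  filter_upwards [h.ae_regularPt, h.ae_T_cF_nonneg hc] with a ha h0
  have hm : ∀ z, 0 ≤ ρ * (N.F z (coord z a.2) a.1 * (1 - N.F z (coord z a.2) a.1)) := fun z =>
    mul_nonneg env.pos.le (mul_nonneg (ha.F_mem z).1.le (sub_nonneg.2 (ha.F_mem z).2.le))
  have hle := (env.bound_c _ (ha.F_mem true) _ (ha.F_mem false) _ _
    (by rw [sub_self, abs_zero]; exact hm true) (by rw [sub_self, abs_zero]; exact hm false)).1
  exact ⟨hle, mul_nonneg (env.nonneg_w _ _) (h0.trans hle)⟩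

/-- A function dominated by the envelope is integrable. -/
lemma integrable_of_le {φ : 𝒳 × ℝ × ℝ → ℝ} {C : ℝ} (hφ : AEStronglyMeasurable φ (T P N))
    (hle : ∀ᵐ a ∂T P N, |φ a| ≤ C * (wK w K N a *
      (b a.2.1 a.2.2 ^ 2 + kT P (fun v => |v.1|) true a ^ 2 + kT P (fun v => |v.1|) false a ^ 2)))
    (hC : 0 ≤ C) : Integrable φ (T P N) := by
  refine ((env.integrable_wK h).const_mul C).mono' hφ ?_
  filter_upwards [hle, env.ae_sq_kT_le h, env.ae_wK_nonneg h hc] with a h1 h2 h3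
  refine h1.trans (mul_le_mul_of_nonneg_left (mul_le_mul_of_nonneg_left ?_ h3.2) hC)
  have t := h2 true
  have f := h2 false
  simp only [coord_true, coord_false] at t f
  linarith

variable {g : ℝ → Obs 𝒳 → ℝ} {s : Obs 𝒳 → ℝ} {K₀ δ : ℝ} (rp : RatioPath g s K₀)
  (hδ0 : 0 < δ) (hδρ : δ ≤ ρ) (hδ : 4 * K₀ * δ ≤ ρ)

include rp hδ0 hδρ hδ

/-- The objectives of the laws along a path form a weighted least squares family. -/
theorem leastSquares : LeastSquares (T P N) (fun a => f a.2.1 a.2.2) η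
    (fun θ => wA c w P N (g θ)) (fun θ => wD c w P N (g θ)) (wAdot c w P N s) (wDdot c w P N s)
    (fun a => 32 * wK w K N a)
    (fun a => 32 * wK w K N a * (kT P (fun v => |v.1|) true a + kT P (fun v => |v.1|) false a))
    (fun a => b a.2.1 a.2.2) (13 * K₀) δ := by
  have hmy : Measurable fun v : Obs 𝒳 => |v.1| := measurable_fst.abs
  have hm := env.measurable_wK h
  have hbm : Measurable fun a : 𝒳 × ℝ × ℝ => b a.2.1 a.2.2 := env.measurable_b.comp measurable_snd
  have hk0 : ∀ z a, 0 ≤ kT P (fun v => |v.1|) z a := fun z a => integral_nonneg fun y =>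
    abs_nonneg _
  -- `32` collects `2 (2 · 2)` from `wN` and `2 · 2` from the two conditional means of the ratio.
  have eA : ∀ a : 𝒳 × ℝ × ℝ, w a.2.1 a.2.2 * (K (N.F true a.2.1 a.1) (N.F false a.2.2 a.1) *
      (2 * (2 * 2))) * (2 * 2) = 32 * wK w K N a := fun a => by simp only [wK]; ring
  have eD : ∀ a : 𝒳 × ℝ × ℝ, w a.2.1 a.2.2 * (K (N.F true a.2.1 a.1) (N.F false a.2.2 a.1) *
      (2 * (2 * 2))) * (2 * kT P (fun v => |v.1|) true a * 2 +
        2 * kT P (fun v => |v.1|) false a * 2) = 32 * wK w K N a *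
      (kT P (fun v => |v.1|) true a + kT P (fun v => |v.1|) false a) := fun a => by
    simp only [wK]; ring
  have hA : ∀ a, RegularPt P N a → PathBound δ (fun θ => wA c w P N (g θ) a)
      (wAdot c w P N s a) (32 * wK w K N a) (13 * K₀) := fun a ha => by
    have := rp.pathBound_wA h hc env hδ0 hδ ha
    rwa [eA] at this
  have hD : ∀ a, RegularPt P N a → PathBound δ (fun θ => wD c w P N (g θ) a)
      (wDdot c w P N s a) (32 * wK w K N a *
      (kT P (fun v => |v.1|) true a + kT P (fun v => |v.1|) false a)) (13 * K₀) := fun a ha => by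
    have := rp.pathBound_wD h hc env hδ0 hδ ha
    rwa [eD] at this
  have hball := Metric.ball_subset_ball (x := η) hδρ
  refine ⟨hδ0, fun x => (env.measurable_f x).comp measurable_snd,
    fun a => (env.contDiffOn _ _).mono hball, fun a x hx => env.bound_f _ _ x (hball hx),
    fun θ _ => (h.measurable_wA hc env.measurable_w (rp.measurable θ)).aestronglyMeasurable,
    fun θ _ => (h.measurable_wD hc env.measurable_w (rp.measurable θ)).aestronglyMeasurable,
    ?_, ?_, ?_, ?_, ?_, ?_⟩
  · filter_upwards [h.ae_regularPt] with a ha θ hθ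
    exact ⟨(hA a ha).bound θ hθ, (hA a ha).lip θ hθ⟩
  · filter_upwards [h.ae_regularPt] with a ha θ hθ
    exact ⟨(hD a ha).bound θ hθ, (hD a ha).lip θ hθ⟩
  · filter_upwards [h.ae_regularPt] with a ha using (hA a ha).deriv
  · filter_upwards [h.ae_regularPt] with a ha using (hD a ha).deriv
  · refine env.integrable_of_le h hc (C := 32)
      ((hm.const_mul 32).mul (hbm.pow_const 2)).aestronglyMeasurable ?_ (by norm_num)
    filter_upwards [env.ae_wK_nonneg h hc] with a ha
    rw [abs_of_nonneg (mul_nonneg (mul_nonneg (by norm_num) ha.2) (sq_nonneg _))]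
    have := mul_nonneg ha.2 (add_nonneg (sq_nonneg (kT P (fun v => |v.1|) true a))
      (sq_nonneg (kT P (fun v => |v.1|) false a)))
    linarith
  · refine env.integrable_of_le h hc (C := 32) (((hm.const_mul 32).mul
      ((measurable_kT P hmy true).add (measurable_kT P hmy false))).mul hbm).aestronglyMeasurable ?_
      (by norm_num)
    filter_upwards [env.ae_wK_nonneg h hc] with a ha
    have hb := env.b_nonneg a.2.1 a.2.2
    rw [abs_of_nonneg (mul_nonneg (mul_nonneg (mul_nonneg (by norm_num) ha.2)
      (add_nonneg (hk0 _ _) (hk0 _ _))) hb), mul_assoc, mul_assoc]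
    refine mul_le_mul_of_nonneg_left (mul_le_mul_of_nonneg_left ?_ ha.2) (by norm_num)
    -- `(k₁ + k₀) b ≤ b² + k₁² + k₀²`, with `k_z` the absolute conditional moment of `Y` in arm `z`.
    nlinarith [sq_nonneg (b a.2.1 a.2.2 - kT P (fun v => |v.1|) true a),
      sq_nonneg (b a.2.1 a.2.2 - kT P (fun v => |v.1|) false a),
      sq_nonneg (kT P (fun v => |v.1|) true a), sq_nonneg (kT P (fun v => |v.1|) false a)]

/-- The objectives of the laws along a path. -/
theorem objectiveObs_path {θ : ℝ} (hθ : |θ| < δ) [IsProbabilityMeasure (tiltLaw P (g θ))] :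
    IsNuisance (tiltLaw P (g θ)) (N.tilt P (g θ)) ∧ ∃ C : ℝ, ∀ x ∈ Metric.ball η δ,
      0 ≤ C + 2 * ∫ a, f a.2.1 a.2.2 x ^ 2 / 2 * wA c w P N (g θ) a -
        f a.2.1 a.2.2 x * wD c w P N (g θ) a ∂T P N ∧
      objectiveObs (tiltLaw P (g θ)) (N.tilt P (g θ)) c w f x = ENNReal.ofReal
        (C + 2 * ∫ a, f a.2.1 a.2.2 x ^ 2 / 2 * wA c w P N (g θ) a -
          f a.2.1 a.2.2 x * wD c w P N (g θ) a ∂T P N) := by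
  have ls := env.leastSquares h hc rp hδ0 hδρ hδ
  have hK : K₀ * |θ| ≤ 1 / 2 := by
    have h1 := mul_le_mul_of_nonneg_left hθ.le rp.pos.le
    have h2 := env.lt_one
    linarith
  have hb := rp.bound_le hK
  have hg := rp.measurable θ
  refine ⟨h.tilt hg hb, ?_⟩
  have hyg : Measurable fun v : Obs 𝒳 => v.1 * g θ v := measurable_fst.mul hg
  have hgb : ∀ v, |g θ v| ≤ 2 := fun v => (rp.abs_le θ v).trans (by linarith)
  have hct : Measurable (N.tilt P (g θ)).contrast := by
    have : (N.tilt P (g θ)).contrast = fun a => kT P (fun v => v.1 * g θ v) true a /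
        kT P (g θ) true a - kT P (fun v => v.1 * g θ v) false a / kT P (g θ) false a :=
      funext fun a => IsNuisance.tilt_contrast a
    rw [this]
    exact ((measurable_kT P hyg true).div (measurable_kT P hg true)).sub
      ((measurable_kT P hyg false).div (measurable_kT P hg false))
  have h2 : Integrable (fun a => wA c w P N (g θ) a * (N.tilt P (g θ)).contrast a ^ 2)
      (T P N) := by
    -- `1024 = 32 · 32`: the first factor bounds the weight, the second is `2 · 4²`, from the square
    -- of a difference of two outcome means, each at most `4` times the absolute moment.
    refine env.integrable_of_le h hc (C := 1024) ((h.measurable_wA hc env.measurable_w hg).mul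
      (hct.pow_const 2)).aestronglyMeasurable ?_ (by norm_num)
    filter_upwards [h.ae_regularPt, ls.bound_a, env.ae_wK_nonneg h hc] with a ha hA h0
    have hq : ∀ z, |kT P (fun v => v.1 * g θ v) z a / kT P (g θ) z a| ≤
        4 * kT P (fun v => |v.1|) z a := by
      intro z
      have h1 : |kT P (fun v => v.1 * g θ v) z a| ≤ 2 * kT P (fun v => |v.1|) z a :=
        abs_kbar_fst_mul_le hgb (ha.integrable_y z)
      have h3 : 1 / 2 ≤ kT P (g θ) z a := by
        have h4 := (_root_.abs_le.1 (rp.abs_kbar_sub_one_le (P := P) θ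
          (pt z (a.1, coord z a.2)))).1
        change 1 / 2 ≤ kbar P (g θ) _
        linarith
      have h5 : 0 < kT P (g θ) z a := by linarith
      have h6 : 0 ≤ kT P (fun v => |v.1|) z a := integral_nonneg fun y => abs_nonneg _
      rw [abs_div, abs_of_pos h5, div_le_iff₀ h5]
      nlinarith
    have hcs : (N.tilt P (g θ)).contrast a ^ 2 ≤
        32 * (kT P (fun v => |v.1|) true a ^ 2 + kT P (fun v => |v.1|) false a ^ 2) := by
      rw [IsNuisance.tilt_contrast]
      have e1 := sq_le_sq' (_root_.abs_le.1 (hq true)).1 (_root_.abs_le.1 (hq true)).2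
      have e0 := sq_le_sq' (_root_.abs_le.1 (hq false)).1 (_root_.abs_le.1 (hq false)).2
      nlinarith [sq_nonneg (kT P (fun v => v.1 * g θ v) true a / kT P (g θ) true a +
        kT P (fun v => v.1 * g θ v) false a / kT P (g θ) false a)]
    rw [abs_mul, abs_of_nonneg (sq_nonneg ((N.tilt P (g θ)).contrast a))]
    calc _ ≤ 32 * wK w K N a * (32 * (kT P (fun v => |v.1|) true a ^ 2 +
          kT P (fun v => |v.1|) false a ^ 2)) :=
        mul_le_mul (hA θ hθ).1 hcs (sq_nonneg _) (mul_nonneg (by norm_num) h0.2)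
      _ ≤ _ := by
        have := mul_nonneg h0.2 (sq_nonneg (b a.2.1 a.2.2))
        linarith
  obtain ⟨C, hC⟩ := h.objectiveObs_tilt hc env.measurable_w env.nonneg_w hg hb h2
  refine ⟨C, fun x hx => hC f x (env.measurable_f x) ?_ ?_⟩
  · refine ls.int_a.mono' ((h.measurable_wA hc env.measurable_w hg).mul
      (((env.measurable_f x).comp measurable_snd).pow_const 2)).aestronglyMeasurable ?_
    filter_upwards [ls.bound_a] with a hA
    have hf := (ls.bound a x hx).1
    rw [norm_mul, Real.norm_eq_abs, norm_pow, Real.norm_eq_abs]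
    have := pow_le_pow_left₀ (abs_nonneg _) hf 2
    exact mul_le_mul (hA θ hθ).1 this (by positivity) ((abs_nonneg _).trans (hA θ hθ).1)
  · refine ls.int_d.mono' (((env.measurable_f x).comp measurable_snd).mul
      (h.measurable_wD hc env.measurable_w hg)).aestronglyMeasurable ?_
    filter_upwards [ls.bound_d] with a hA
    have hf := (ls.bound a x hx).1
    rw [norm_mul, Real.norm_eq_abs, Real.norm_eq_abs, mul_comm]
    exact mul_le_mul (hA θ hθ).1 hf (by positivity) ((abs_nonneg _).trans (hA θ hθ).1)

end Envelope

end Family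

end PCE

namespace PCE

/-! ## Integrals of inverse probability weighted functions -/

variable {𝒳 : Type*} [MeasurableSpace 𝒳]

/-- The inverse probability weight of arm `z`. -/
noncomputable def ipw (N : Nuisance 𝒳) (z z' : Bool) (x : 𝒳) : ℝ :=
  (if z' = z then 1 else 0) / N.prob z x

/-- The pair with `t` in the coordinate of arm `z` and `t'` in the other one. -/
def ins (z : Bool) (t t' : ℝ) : ℝ × ℝ := if z then (t, t') else (t', t)

@[simp] lemma ins_true (t t' : ℝ) : ins true t t' = (t, t') := rfl

@[simp] lemma ins_false (t t' : ℝ) : ins false t t' = (t', t) := rfl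

@[simp] lemma coord_ins (z : Bool) (t t' : ℝ) : coord z (ins z t t') = t := by
  cases z <;> rfl

/-- `((x, t), t') ↦ (x, ins z t t')`. -/
def splitE (𝒳 : Type*) [MeasurableSpace 𝒳] : Bool → (𝒳 × ℝ) × ℝ ≃ᵐ 𝒳 × ℝ × ℝ
  | true => MeasurableEquiv.prodAssoc
  | false => MeasurableEquiv.prodAssoc.trans
      ((MeasurableEquiv.refl 𝒳).prodCongr MeasurableEquiv.prodComm)

lemma splitE_apply (z : Bool) (b : (𝒳 × ℝ) × ℝ) :
    splitE 𝒳 z b = (b.1.1, ins z b.1.2 b.2) := by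
  cases z <;> rfl

lemma measurePreserving_splitE (μ : Measure 𝒳) [SFinite μ] (z : Bool) :
    MeasurePreserving (splitE 𝒳 z) ((μ.prod volume).prod volume) (μ.prod volume) := by
  cases z
  · exact ((MeasurePreserving.id μ).prod (Measure.measurePreserving_swap (μ := (volume : Measure ℝ))
      (ν := (volume : Measure ℝ)))).comp (measurePreserving_prodAssoc μ volume volume)
  · exact measurePreserving_prodAssoc μ volume volume

/-- `((x, t), r) ↦ ((x, r), t)`. -/
def exchE (𝒳 : Type*) [MeasurableSpace 𝒳] : (𝒳 × ℝ) × (ℝ × ℝ) ≃ᵐ (𝒳 × (ℝ × ℝ)) × ℝ :=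
  (MeasurableEquiv.prodAssoc.trans ((MeasurableEquiv.refl 𝒳).prodCongr
    MeasurableEquiv.prodComm)).trans MeasurableEquiv.prodAssoc.symm

lemma measurePreserving_exchE (μ : Measure 𝒳) [SFinite μ] :
    MeasurePreserving (exchE 𝒳) ((μ.prod volume).prod volume) ((μ.prod volume).prod volume) :=
  ((measurePreserving_prodAssoc μ (volume : Measure (ℝ × ℝ)) (volume : Measure ℝ)).symm
    MeasurableEquiv.prodAssoc).comp
    (((MeasurePreserving.id μ).prod (Measure.measurePreserving_swap (μ := (volume : Measure ℝ))
      (ν := (volume : Measure (ℝ × ℝ))))).comp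
      (measurePreserving_prodAssoc μ (volume : Measure ℝ) (volume : Measure (ℝ × ℝ))))

namespace IsNuisance

variable {P : Measure (Obs 𝒳)} [IsProbabilityMeasure P] {N : Nuisance 𝒳}

omit [IsProbabilityMeasure P] in
lemma measurable_ipw (h : IsNuisance P N) (z : Bool) :
    Measurable fun v : Obs 𝒳 => ipw N z v.2.2.1 v.2.2.2 :=
  (Measurable.ite ((measurable_fst.comp (measurable_snd.comp measurable_snd))
    (measurableSet_singleton z)) measurable_const measurable_const).div
    ((h.measurable_prob z).comp measurable_lawX_map)

/-- Inverse probability weighting reduces an integral over arm `z` to one over `(X, S_z)`. -/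
lemma integral_ipw (h : IsNuisance P N) (z : Bool) {R : 𝒳 × ℝ → ℝ} (hR : Measurable R)
    {k : Obs 𝒳 → ℝ} (hk : Measurable k)
    (hkk : ∀ᵐ a ∂(lawX P).prod volume, N.p z a.2 a.1 ≠ 0 →
      Integrable (fun y => k (y, pt z a)) (kap P (pt z a)))
    (hint : Integrable (fun a => N.p z a.2 a.1 * (R a * kbar P (fun v => |k v|) (pt z a)))
      ((lawX P).prod volume)) :
    Integrable (fun v : Obs 𝒳 => ipw N z v.2.2.1 v.2.2.2 * R (v.2.2.2, v.2.1) * k v) P ∧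
    ∫ v, ipw N z v.2.2.1 v.2.2.2 * R (v.2.2.2, v.2.1) * k v ∂P =
      ∫ a, N.p z a.2 a.1 * (R a * kbar P k (pt z a)) ∂(lawX P).prod volume := by
  have hRm : Measurable fun v : Obs 𝒳 => R (v.2.2.2, v.2.1) :=
    hR.comp (measurable_lawX_map.prodMk (measurable_fst.comp measurable_snd))
  have hpos := Measure.quasiMeasurePreserving_fst (μ := lawX P) (ν := (volume : Measure ℝ)) |>.ae
    h.prob_pos
  have hne : ∀ z', z' ≠ z → ∀ x, ipw N z z' x = 0 := fun z' hz x => by simp [ipw, hz]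
  have heq : ∀ x, ipw N z z x = (N.prob z x)⁻¹ := fun x => by simp [ipw]
  have kb : ∀ z' (a : 𝒳 × ℝ), kbar P (fun v => |ipw N z v.2.2.1 v.2.2.2 * R (v.2.2.2, v.2.1) * k v|)
      (pt z' a) = |ipw N z z' a.1 * R a| * kbar P (fun v => |k v|) (pt z' a) := by
    intro z' a
    simp only [kbar, abs_mul, pt]
    exact integral_const_mul _ _
  have kb' : ∀ z' (a : 𝒳 × ℝ), kbar P (fun v => ipw N z v.2.2.1 v.2.2.2 * R (v.2.2.2, v.2.1) * k v)
      (pt z' a) = ipw N z z' a.1 * R a * kbar P k (pt z' a) := by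
    intro z' a
    simp only [kbar, pt]
    exact integral_const_mul _ _
  obtain ⟨h1, h2⟩ := h.integral_eq (k := fun v => ipw N z v.2.2.1 v.2.2.2 *
      R (v.2.2.2, v.2.1) * k v) (((h.measurable_ipw z).mul hRm).mul hk)
    (fun z' => by
      filter_upwards [hkk] with a ha hp
      by_cases hz : z' = z
      · subst hz
        exact (ha hp).const_mul _
      · refine (integrable_zero _ _ _).congr (Eventually.of_forall fun y => ?_)
        simp only [pt, hne z' hz, zero_mul, Pi.zero_apply])
    (fun z' => by
      simp only [kb]
      by_cases hz : z' = z
      · subst hz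
        refine hint.abs.congr ?_
        filter_upwards [hpos] with a ha
        have h0 : 0 ≤ kbar P (fun v => |k v|) (pt z' a) := integral_nonneg fun y => abs_nonneg _
        rw [heq, abs_mul, abs_mul, abs_mul, abs_of_nonneg (h.nonneg_p _ _ _), abs_of_nonneg h0,
          abs_of_pos (inv_pos.2 (ha z'))]
        have := (ha z').ne'
        field_simp
      · refine (integrable_zero _ _ _).congr (Eventually.of_forall fun a => ?_)
        simp only [hne z' hz, zero_mul, abs_zero, mul_zero, Pi.zero_apply])
  refine ⟨h1, h2.trans ?_⟩
  simp only [kb']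
  have hz0 : ∫ a, N.prob (!z) a.1 * N.p (!z) a.2 a.1 * (ipw N z (!z) a.1 * R a *
      kbar P k (pt (!z) a)) ∂(lawX P).prod volume = 0 := by
    refine integral_eq_zero_of_ae (Eventually.of_forall fun a => ?_)
    have : ipw N z (!z) a.1 = 0 := hne _ (by cases z <;> simp) _
    simp only [this, zero_mul, mul_zero, Pi.zero_apply]
  have hsum : ∀ φ : Bool → ℝ, ∑ z', φ z' = φ z + φ (!z) := by
    intro φ; cases z
    · simp [add_comm]
    · simp
  rw [hsum, hz0, add_zero]
  refine integral_congr_ae ?_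
  filter_upwards [hpos] with a ha
  have := (ha z).ne'
  rw [heq]
  field_simp

/-- The function `p₁ p₀ φ` integrated over the coordinate of the other arm. -/
noncomputable def marg (N : Nuisance 𝒳) (φ : 𝒳 × ℝ × ℝ → ℝ) (z : Bool) (a : 𝒳 × ℝ) : ℝ :=
  ∫ t, N.p true (ins z a.2 t).1 a.1 * N.p false (ins z a.2 t).2 a.1 * φ (a.1, ins z a.2 t)

omit [IsProbabilityMeasure P] in
lemma measurable_marg (h : IsNuisance P N) {φ : 𝒳 × ℝ × ℝ → ℝ} (hφ : Measurable φ) (z : Bool) :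
    Measurable (marg N φ z) := by
  have hm : Measurable fun b : (𝒳 × ℝ) × ℝ => (fun a : 𝒳 × ℝ × ℝ => N.p true a.2.1 a.1 *
      N.p false a.2.2 a.1 * φ a) (splitE 𝒳 z b) :=
    (h.measurable_dens.mul hφ).comp (splitE 𝒳 z).measurable
  simp only [splitE_apply] at hm
  exact (hm.stronglyMeasurable.integral_prod_right' (ν := (volume : Measure ℝ))).measurable

omit [MeasurableSpace 𝒳] in
-- Makes the division by `p z` in the influence function harmless: where the density is `0`, so is
-- the numerator.
lemma marg_eq_zero {φ : 𝒳 × ℝ × ℝ → ℝ} {z : Bool} {a : 𝒳 × ℝ} (ha : N.p z a.2 a.1 = 0) :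
    marg N φ z a = 0 := by
  refine integral_eq_zero_of_ae (Eventually.of_forall fun t => ?_)
  cases z <;> simp [ha]

/-- Fubini's theorem for a function of `(x, s₁, s₀)` times a function of `(x, s_z)`. -/
lemma integral_marg (h : IsNuisance P N) {φ : 𝒳 × ℝ × ℝ → ℝ} (z : Bool)
    {ψ : 𝒳 × ℝ → ℝ} (hi : Integrable (fun a => φ a * ψ (a.1, coord z a.2)) (T P N)) :
    Integrable (fun a => marg N φ z a * ψ a) ((lawX P).prod volume) ∧
    ∫ a, marg N φ z a * ψ a ∂(lawX P).prod volume =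
      ∫ a, φ a * ψ (a.1, coord z a.2) ∂T P N := by
  have hmp := measurePreserving_splitE (lawX P) z
  rw [h.integrable_T] at hi
  have hi' := (hmp.integrable_comp_emb (splitE 𝒳 z).measurableEmbedding).2 hi
  have e : ∀ b : (𝒳 × ℝ) × ℝ, ((fun a : 𝒳 × ℝ × ℝ => N.p true a.2.1 a.1 * N.p false a.2.2 a.1 *
      (φ a * ψ (a.1, coord z a.2))) ∘ splitE 𝒳 z) b =
      N.p true (ins z b.1.2 b.2).1 b.1.1 * N.p false (ins z b.1.2 b.2).2 b.1.1 *
        φ (b.1.1, ins z b.1.2 b.2) * ψ b.1 := by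
    intro b
    simp only [Function.comp_apply, splitE_apply, coord_ins]
    ring
  have hi'' := hi'.congr (Eventually.of_forall e)
  have em : ∀ a : 𝒳 × ℝ, ∫ t, N.p true (ins z a.2 t).1 a.1 * N.p false (ins z a.2 t).2 a.1 *
      φ (a.1, ins z a.2 t) * ψ a = marg N φ z a * ψ a := fun a => integral_mul_const _ _
  constructor
  · have := hi''.integral_prod_left
    simpa only [em] using this
  · rw [h.integral_T, ← hmp.integral_comp (splitE 𝒳 z).measurableEmbedding]
    refine Eq.trans ?_ (integral_congr_ae (Eventually.of_forall e)).symm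
    rw [integral_prod _ hi'']
    exact integral_congr_ae (Eventually.of_forall fun a => (em a).symm)

/-- The integral of an inverse probability weighted conditional mean over the other arm. -/
lemma integral_ipw_marg (h : IsNuisance P N) (z : Bool) {φ : 𝒳 × ℝ × ℝ → ℝ} (hφ : Measurable φ)
    {k : Obs 𝒳 → ℝ} (hk : Measurable k)
    (hkk : ∀ᵐ a ∂(lawX P).prod volume, N.p z a.2 a.1 ≠ 0 →
      Integrable (fun y => k (y, pt z a)) (kap P (pt z a)))
    (hi : Integrable (fun a => φ a * kT P (fun v => |k v|) z a) (T P N)) :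
    Integrable (fun v : Obs 𝒳 => ipw N z v.2.2.1 v.2.2.2 *
      (marg N φ z (v.2.2.2, v.2.1) / N.p z v.2.1 v.2.2.2) * k v) P ∧
    ∫ v, ipw N z v.2.2.1 v.2.2.2 * (marg N φ z (v.2.2.2, v.2.1) / N.p z v.2.1 v.2.2.2) * k v ∂P =
      ∫ a, φ a * kT P k z a ∂T P N := by
  have hcanc : ∀ (a : 𝒳 × ℝ) (y : ℝ), N.p z a.2 a.1 * (marg N φ z a / N.p z a.2 a.1 * y) =
      marg N φ z a * y := by
    intro a y
    by_cases h0 : N.p z a.2 a.1 = 0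
    · rw [marg_eq_zero h0]; simp
    · field_simp
  have hi1 := h.integral_marg z (ψ := fun a => kbar P (fun v => |k v|) (pt z a)) hi
  have h1 := h.integral_ipw z (R := fun a => marg N φ z a / N.p z a.2 a.1)
    ((h.measurable_marg hφ z).div (h.measurable_p' z)) hk hkk (by simpa only [hcanc] using hi1.1)
  refine ⟨h1.1, h1.2.trans ?_⟩
  simp only [hcanc]
  refine (h.integral_marg z (ψ := fun a => kbar P k (pt z a)) ?_).2
  refine hi.mono (hφ.mul (measurable_kT P hk z)).aestronglyMeasurable
    (Eventually.of_forall fun a => ?_)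
  have h0 : 0 ≤ kT P (fun v => |k v|) z a := integral_nonneg fun y => abs_nonneg _
  rw [norm_mul, norm_mul, Real.norm_eq_abs (kT _ _ _ _), abs_of_nonneg h0]
  exact mul_le_mul_of_nonneg_left (norm_integral_le_integral_norm _) (norm_nonneg _)

/-- The deviation of an indicator from the conditional distribution function. -/
noncomputable def devF (N : Nuisance 𝒳) (z : Bool) (a : 𝒳 × ℝ × ℝ) (t : ℝ) : ℝ :=
  (if t ≤ coord z a.2 then 1 else 0) - N.F z (coord z a.2) a.1

omit [IsProbabilityMeasure P] in
lemma measurable_devF (h : IsNuisance P N) (z : Bool) :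
    Measurable fun b : (𝒳 × ℝ × ℝ) × ℝ => devF N z b.1 b.2 :=
  (Measurable.ite (measurableSet_le measurable_snd ((measurable_coord z).comp
    (measurable_snd.comp measurable_fst))) measurable_const measurable_const).sub
    ((h.measurable_F_coord z).comp measurable_fst)

/-- The function `p₁ p₀ φ {1 - κ (1(t ≤ s_z) - F_z)}` integrated over `(s₁, s₀)`. -/
noncomputable def devMarg (N : Nuisance 𝒳) (φ κ : 𝒳 × ℝ × ℝ → ℝ) (z : Bool) (a : 𝒳 × ℝ) : ℝ :=
  ∫ r : ℝ × ℝ, N.p true r.1 a.1 * N.p false r.2 a.1 * φ (a.1, r) *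
    (1 - κ (a.1, r) * devF N z (a.1, r) a.2)

omit [MeasurableSpace 𝒳] in
-- For `k` the conditional mean of a score the right side is `Fdot`: a distribution function changes
-- by the covariance of an indicator with the score. This is the origin of `r_u` and `r_v`.
lemma integral_p_mul_devF {z : Bool} {a : 𝒳 × ℝ × ℝ} (k : ℝ → ℝ)
    (hk : Integrable fun t => N.p z t a.1 * k t) :
    Integrable (fun t => N.p z t a.1 * k t * devF N z a t) ∧
    ∫ t, N.p z t a.1 * k t * devF N z a t = (∫ t in Iic (coord z a.2), N.p z t a.1 * k t) -
      N.F z (coord z a.2) a.1 * ∫ t, N.p z t a.1 * k t := by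
  have e : ∀ t, N.p z t a.1 * k t * devF N z a t =
      (Iic (coord z a.2)).indicator (fun t => N.p z t a.1 * k t) t -
        N.F z (coord z a.2) a.1 * (N.p z t a.1 * k t) := by
    intro t
    by_cases ht : t ≤ coord z a.2
    · rw [indicator_of_mem (mem_Iic.2 ht), devF, if_pos ht]; ring
    · rw [indicator_of_notMem (fun h => ht (mem_Iic.1 h)), devF, if_neg ht]; ring
  simp only [e]
  have h1 := hk.indicator (measurableSet_Iic (a := coord z a.2))
  refine ⟨h1.sub (hk.const_mul _), ?_⟩
  rw [integral_sub h1 (hk.const_mul _), integral_indicator measurableSet_Iic, integral_const_mul]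

/-- The mean absolute deviation of an indicator with mean `F` is `2 F (1 - F)`. Multiplied by a
derivative of `c` this is what the weighted derivative envelope controls, so that Fubini's theorem
applies. -/
lemma integral_abs_devF {z : Bool} {a : 𝒳 × ℝ × ℝ} (ha : RegularPt P N a) :
    Integrable (fun t => N.p z t a.1 * |devF N z a t|) ∧ ∫ t, N.p z t a.1 * |devF N z a t| =
      2 * (N.F z (coord z a.2) a.1 * (1 - N.F z (coord z a.2) a.1)) := by
  obtain ⟨hp, hp1⟩ := ha.integrable_p z
  obtain ⟨hF0, hF1⟩ := ha.F_mem z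
  have e : ∀ t, N.p z t a.1 * |devF N z a t| =
      (1 - 2 * N.F z (coord z a.2) a.1) * (Iic (coord z a.2)).indicator (fun t => N.p z t a.1) t +
        N.F z (coord z a.2) a.1 * N.p z t a.1 := by
    intro t
    by_cases ht : t ≤ coord z a.2
    · rw [indicator_of_mem (mem_Iic.2 ht), devF, if_pos ht, abs_of_pos (by linarith)]; ring
    · rw [indicator_of_notMem (fun h => ht (mem_Iic.1 h)), devF, if_neg ht, zero_sub, abs_neg,
        abs_of_pos hF0]; ring
  simp only [e]
  have h1 := (hp.indicator (measurableSet_Iic (a := coord z a.2))).const_mul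
    (1 - 2 * N.F z (coord z a.2) a.1)
  refine ⟨h1.add (hp.const_mul _), ?_⟩
  rw [integral_add h1 (hp.const_mul _), integral_const_mul, integral_const_mul,
    integral_indicator measurableSet_Iic, hp1]
  change (1 - 2 * N.F z (coord z a.2) a.1) * N.F z (coord z a.2) a.1 + _ = _
  ring

omit [IsProbabilityMeasure P] in
lemma measurable_devMarg_integrand (h : IsNuisance P N) {φ κ : 𝒳 × ℝ × ℝ → ℝ} (hφ : Measurable φ)
    (hκ : Measurable κ) (z : Bool) : Measurable fun b : (𝒳 × ℝ × ℝ) × ℝ =>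
      N.p true b.1.2.1 b.1.1 * N.p false b.1.2.2 b.1.1 * φ b.1 * (1 - κ b.1 * devF N z b.1 b.2) :=
  ((h.measurable_dens.mul hφ).comp measurable_fst).mul
    (measurable_const.sub ((hκ.comp measurable_fst).mul (h.measurable_devF z)))

omit [IsProbabilityMeasure P] in
lemma measurable_devMarg (h : IsNuisance P N) {φ κ : 𝒳 × ℝ × ℝ → ℝ} (hφ : Measurable φ)
    (hκ : Measurable κ) (z : Bool) : Measurable (devMarg N φ κ z) := by
  have hm : Measurable fun b : (𝒳 × ℝ) × (ℝ × ℝ) => (fun b : (𝒳 × ℝ × ℝ) × ℝ =>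
      N.p true b.1.2.1 b.1.1 * N.p false b.1.2.2 b.1.1 * φ b.1 *
        (1 - κ b.1 * devF N z b.1 b.2)) (exchE 𝒳 b) :=
    (h.measurable_devMarg_integrand hφ hκ z).comp (exchE 𝒳).measurable
  exact (hm.stronglyMeasurable.integral_prod_right' (ν := (volume : Measure (ℝ × ℝ)))).measurable

/-- The integral of an inverse probability weighted `devMarg`. -/
lemma integral_ipw_devMarg (h : IsNuisance P N) (z : Bool) {φ κ : 𝒳 × ℝ × ℝ → ℝ}
    (hφ : Measurable φ) (hκ : Measurable κ) {s : Obs 𝒳 → ℝ} (hs : Measurable s) {K₀ : ℝ}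
    (hsb : ∀ v, |s v| ≤ K₀) (hi : Integrable φ (T P N))
    (hi2 : Integrable (fun a => φ a * κ a *
      (N.F z (coord z a.2) a.1 * (1 - N.F z (coord z a.2) a.1))) (T P N)) :
    Integrable (fun v : Obs 𝒳 => ipw N z v.2.2.1 v.2.2.2 * devMarg N φ κ z (v.2.2.2, v.2.1) * s v)
      P ∧
    ∫ v, ipw N z v.2.2.1 v.2.2.2 * devMarg N φ κ z (v.2.2.2, v.2.1) * s v ∂P =
      ∫ a, φ a * (armMean P N s z a.1 - κ a * Fdot P N s z (coord z a.2) a.1) ∂T P N := by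
  let Ψ : (𝒳 × ℝ × ℝ) × ℝ → ℝ := fun b =>
    N.p true b.1.2.1 b.1.1 * N.p false b.1.2.2 b.1.1 * φ b.1 * (1 - κ b.1 * devF N z b.1 b.2)
  have hΨm : Measurable Ψ := h.measurable_devMarg_integrand hφ hκ z
  have hpm : Measurable fun b : (𝒳 × ℝ × ℝ) × ℝ => N.p z b.2 b.1.1 :=
    (h.measurable_p z).comp (measurable_snd.prodMk (measurable_fst.comp measurable_fst))
  have hreg := h.ae_T.1 h.ae_regularPt
  -- Joint absolute integrability in `(x, s₁, s₀, t)`. The bounded factor `k` comes out; integrating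
  -- the term with `κ` over `t` first produces `2 F (1 - F)`, which is where `hi2` is needed.
  have key : ∀ k : ℝ × Bool × 𝒳 → ℝ, Measurable k → ∀ B, (∀ u, |k u| ≤ B) →
      Integrable (fun b : (𝒳 × ℝ × ℝ) × ℝ => N.p z b.2 b.1.1 * k (b.2, z, b.1.1) * Ψ b)
        (((lawX P).prod volume).prod volume) := by
    intro k hk B hB
    have hkm : Measurable fun b : (𝒳 × ℝ × ℝ) × ℝ => k (b.2, z, b.1.1) :=
      hk.comp (measurable_snd.prodMk (measurable_const.prodMk (measurable_fst.comp measurable_fst)))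
    have hbd : ∀ a : 𝒳 × ℝ × ℝ, ∀ t, |N.p z t a.1 * k (t, z, a.1) * Ψ (a, t)| ≤
        B * (|N.p true a.2.1 a.1 * N.p false a.2.2 a.1 * φ a| * N.p z t a.1 +
          |N.p true a.2.1 a.1 * N.p false a.2.2 a.1 * (φ a * κ a)| *
            (N.p z t a.1 * |devF N z a t|)) := by
      intro a t
      have h1 : |Ψ (a, t)| ≤ |N.p true a.2.1 a.1 * N.p false a.2.2 a.1 * φ a| +
          |N.p true a.2.1 a.1 * N.p false a.2.2 a.1 * (φ a * κ a)| * |devF N z a t| := by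
        have e : Ψ (a, t) = N.p true a.2.1 a.1 * N.p false a.2.2 a.1 * φ a -
          N.p true a.2.1 a.1 * N.p false a.2.2 a.1 * (φ a * κ a) * devF N z a t := by
          simp only [Ψ]; ring
        rw [e]
        refine (abs_sub _ _).trans ?_
        rw [abs_mul _ (devF N z a t)]
      rw [abs_mul, abs_mul, abs_of_nonneg (h.nonneg_p _ _ _)]
      have h2 := mul_le_mul (mul_le_mul_of_nonneg_left (hB (t, z, a.1)) (h.nonneg_p z t a.1)) h1
        (abs_nonneg _) (mul_nonneg (h.nonneg_p z t a.1) ((abs_nonneg _).trans (hB (t, z, a.1))))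
      linarith
    have hB0 : 0 ≤ B := (abs_nonneg _).trans (hB (0, z, (nonempty_of_isProbabilityMeasure (lawX P)).some))
    have hdom : ∀ a : 𝒳 × ℝ × ℝ, RegularPt P N a → Integrable (fun t =>
        B * (|N.p true a.2.1 a.1 * N.p false a.2.2 a.1 * φ a| * N.p z t a.1 +
          |N.p true a.2.1 a.1 * N.p false a.2.2 a.1 * (φ a * κ a)| *
            (N.p z t a.1 * |devF N z a t|))) := fun a ha =>
      (((ha.integrable_p z).1.const_mul _).add ((integral_abs_devF ha).1.const_mul _)).const_mul B
    have hm : Measurable fun b : (𝒳 × ℝ × ℝ) × ℝ => N.p z b.2 b.1.1 * k (b.2, z, b.1.1) * Ψ b :=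
      (hpm.mul hkm).mul hΨm
    refine (integrable_prod_iff hm.aestronglyMeasurable).2 ⟨?_, ?_⟩
    · filter_upwards [hreg] with a ha
      by_cases h0 : N.p true a.2.1 a.1 * N.p false a.2.2 a.1 = 0
      · refine (integrable_zero _ _ _).congr (Eventually.of_forall fun t => ?_)
        simp only [Ψ, h0, zero_mul, mul_zero, Pi.zero_apply]
      · exact (hdom a (ha h0)).mono' (hm.comp (measurable_const.prodMk
          measurable_id)).aestronglyMeasurable (Eventually.of_forall fun t => hbd a t)
    · have hi' := (h.integrable_T.1 hi).abs
      have hi2' := (h.integrable_T.1 hi2).abs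
      refine ((hi'.add (hi2'.const_mul 2)).const_mul B).mono'
        (hm.norm.stronglyMeasurable.integral_prod_right').aestronglyMeasurable ?_
      filter_upwards [hreg] with a ha
      by_cases h0 : N.p true a.2.1 a.1 * N.p false a.2.2 a.1 = 0
      · simp only [Ψ, h0, zero_mul, mul_zero, norm_zero, integral_zero, Pi.add_apply, abs_zero,
          add_zero, le_refl]
      · have hr := ha h0
        rw [Real.norm_eq_abs, abs_of_nonneg (integral_nonneg fun t => norm_nonneg _)]
        refine (integral_mono_of_nonneg (Eventually.of_forall fun t => norm_nonneg _) (hdom a hr)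
          (Eventually.of_forall fun t => hbd a t)).trans (le_of_eq ?_)
        have hf := hr.F_mem z
        rw [integral_const_mul, integral_add ((hr.integrable_p z).1.const_mul _)
          ((integral_abs_devF hr).1.const_mul _), integral_const_mul, integral_const_mul,
          (hr.integrable_p z).2, (integral_abs_devF hr).2]
        simp only [Pi.add_apply]
        rw [← mul_assoc _ (φ a * κ a), abs_mul _ (_ * (1 - _)),
          abs_of_pos (mul_pos hf.1 (sub_pos.2 hf.2))]
        ring
  have hmp := measurePreserving_exchE (𝒳 := 𝒳) (lawX P)
  -- Fubini's theorem between `t`, the observed value of `S`, and `(s₁, s₀)`, over which `devMarg`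
  -- integrates.
  have swap : ∀ k : ℝ × Bool × 𝒳 → ℝ, Measurable k → ∀ B, (∀ u, |k u| ≤ B) →
      Integrable (fun a : 𝒳 × ℝ => N.p z a.2 a.1 * (devMarg N φ κ z a * k (pt z a)))
        ((lawX P).prod volume) ∧
      ∫ a : 𝒳 × ℝ, N.p z a.2 a.1 * (devMarg N φ κ z a * k (pt z a)) ∂(lawX P).prod volume =
        ∫ a : 𝒳 × ℝ × ℝ, (∫ t, N.p z t a.1 * k (t, z, a.1) * Ψ (a, t)) ∂(lawX P).prod volume := by
    intro k hk B hB
    have h1 := key k hk B hB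
    have h2 := (hmp.integrable_comp_emb (exchE 𝒳).measurableEmbedding).2 h1
    have e : ∀ b : (𝒳 × ℝ) × (ℝ × ℝ), ((fun b : (𝒳 × ℝ × ℝ) × ℝ => N.p z b.2 b.1.1 *
        k (b.2, z, b.1.1) * Ψ b) ∘ exchE 𝒳) b = N.p z b.1.2 b.1.1 * k (pt z b.1) *
          Ψ ((b.1.1, b.2), b.1.2) := fun b => rfl
    have h3 := h2.congr (Eventually.of_forall e)
    have em : ∀ a : 𝒳 × ℝ, ∫ r : ℝ × ℝ, N.p z a.2 a.1 * k (pt z a) * Ψ ((a.1, r), a.2) =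
        N.p z a.2 a.1 * (devMarg N φ κ z a * k (pt z a)) := by
      intro a
      have : ∫ r : ℝ × ℝ, N.p z a.2 a.1 * k (pt z a) * Ψ ((a.1, r), a.2) =
          N.p z a.2 a.1 * k (pt z a) * devMarg N φ κ z a := integral_const_mul _ _
      rw [this]; ring
    refine ⟨?_, ?_⟩
    · have := h3.integral_prod_left
      simpa only [em] using this
    · rw [← integral_prod _ h1, ← hmp.integral_comp (exchE 𝒳).measurableEmbedding]
      refine Eq.trans ?_ (integral_congr_ae (Eventually.of_forall e)).symm
      rw [integral_prod _ h3]
      exact integral_congr_ae (Eventually.of_forall fun a => (em a).symm)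
  have hsi : ∀ u, Integrable (fun y => s (y, u)) (kap P u) := fun u =>
    Integrable.of_bound (measurable_section hs u).aestronglyMeasurable K₀
      (Eventually.of_forall fun y => hsb _)
  have h1 := h.integral_ipw z (h.measurable_devMarg hφ hκ z) hs
    (Eventually.of_forall fun a _ => hsi _)
    (swap (kbar P fun v => |s v|) (measurable_kbar P hs.abs) K₀
      (abs_kbar_le fun v => by rw [abs_abs]; exact hsb v)).1
  refine ⟨h1.1, h1.2.trans ?_⟩
  rw [(swap (kbar P s) (measurable_kbar P hs) K₀ (abs_kbar_le hsb)).2, h.integral_T]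
  refine integral_congr_ae ?_
  filter_upwards [hreg] with a ha
  by_cases h0 : N.p true a.2.1 a.1 * N.p false a.2.2 a.1 = 0
  · simp [Ψ, h0]
  · have hr := ha h0
    have hps := integrable_p_mul_kbar (P := P) (hr.integrable_p z).1 hs hsb
    have hd := integral_p_mul_devF (N := N) (z := z) (a := a) (fun t => kbar P s (t, z, a.1)) hps
    have e : ∀ t, N.p z t a.1 * kbar P s (t, z, a.1) * Ψ (a, t) =
        N.p true a.2.1 a.1 * N.p false a.2.2 a.1 * φ a * (N.p z t a.1 * kbar P s (t, z, a.1)) -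
        N.p true a.2.1 a.1 * N.p false a.2.2 a.1 * φ a * κ a *
          (N.p z t a.1 * kbar P s (t, z, a.1) * devF N z a t) := by
      intro t; simp only [Ψ]; ring
    simp only [e]
    rw [integral_sub (hps.const_mul _) (hd.1.const_mul _), integral_const_mul, integral_const_mul,
      hd.2, Fdot]
    change _ * armMean P N s z a.1 - _ * (_ - _ * armMean P N s z a.1) = _
    ring

end IsNuisance

end PCE

namespace PCE

/-! ## The influence function represents the derivative of the estimating equation -/

section CopulaDerivatives

variable {c : ℝ → ℝ → ℝ}

/-- `∂c/∂u` for `z = true` and `∂c/∂v` for `z = false`. -/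
noncomputable def cd (c : ℝ → ℝ → ℝ) (z : Bool) (u v : ℝ) : ℝ := if z then cu c u v else cv c u v

lemma IsCopulaDensity.fderiv_eq (hc : IsCopulaDensity c) {u v : ℝ} (hu : u ∈ Ioo (0 : ℝ) 1)
    (hv : v ∈ Ioo (0 : ℝ) 1) (z : Bool) :
    fderiv ℝ (Function.uncurry c) (u, v) (ins z 1 0) = cd c z u v := by
  have hd := (hc.differentiableAt hu hv).hasFDerivAt
  cases z
  · have := hd.comp_hasDerivAt v ((hasDerivAt_const _ u).prodMk (hasDerivAt_id v))
    exact this.unique (hc.hasDerivAt_snd hu hv)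
  · have := hd.comp_hasDerivAt u ((hasDerivAt_id u).prodMk (hasDerivAt_const _ v))
    exact this.unique (hc.hasDerivAt_fst hu hv)

/-- The logarithmic derivatives of the copula density, set to `0` outside the open square. -/
noncomputable def cq (c : ℝ → ℝ → ℝ) (z : Bool) : ℝ × ℝ → ℝ :=
  (Ioo 0 1 ×ˢ Ioo 0 1).indicator fun r => cd c z r.1 r.2 / c r.1 r.2

/-- On the open square the partial derivatives are values of the continuous total derivative; the
value `0` outside extends measurability to the plane. -/
lemma IsCopulaDensity.measurable_cq (hc : IsCopulaDensity c) (z : Bool) : Measurable (cq c z) := by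
  have hs : MeasurableSet (Ioo (0 : ℝ) 1 ×ˢ Ioo (0 : ℝ) 1) := measurableSet_Ioo.prod measurableSet_Ioo
  have h1 : ContinuousOn (fun r => fderiv ℝ (Function.uncurry c) r (ins z 1 0))
      (Ioo (0 : ℝ) 1 ×ˢ Ioo (0 : ℝ) 1) :=
    (hc.contDiffOn.continuousOn_fderiv_of_isOpen (isOpen_Ioo.prod isOpen_Ioo) le_rfl).clm_apply
      continuousOn_const
  have h2 := (h1.measurable_piecewise (continuousOn_const (c := (0 : ℝ))) hs).div hc.measurable
  convert h2 using 1
  ext r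
  by_cases hr : r ∈ Ioo (0 : ℝ) 1 ×ˢ Ioo (0 : ℝ) 1
  · simp only [cq, indicator_of_mem hr, Pi.div_apply, piecewise_eq_of_mem _ _ _ hr,
      hc.fderiv_eq hr.1 hr.2, Function.uncurry]
  · simp only [cq, indicator_of_notMem hr, Pi.div_apply, piecewise_eq_of_notMem _ _ _ hr, zero_div]

lemma cq_of_mem {u v : ℝ} (hu : u ∈ Ioo (0 : ℝ) 1) (hv : v ∈ Ioo (0 : ℝ) 1) (z : Bool) :
    cq c z (u, v) = cd c z u v / c u v :=
  indicator_of_mem (show (u, v) ∈ Ioo (0 : ℝ) 1 ×ˢ Ioo (0 : ℝ) 1 from ⟨hu, hv⟩) _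

/-- At a zero of the copula density its derivatives vanish. -/
lemma IsCopulaDensity.mul_cq (hc : IsCopulaDensity c) {u v : ℝ} (hu : u ∈ Ioo (0 : ℝ) 1)
    (hv : v ∈ Ioo (0 : ℝ) 1) (z : Bool) : c u v * cq c z (u, v) = cd c z u v := by
  rw [cq_of_mem hu hv]
  -- A zero of the nonnegative `c` is a local minimum in each variable, so the partial derivatives
  -- vanish there; elsewhere `c` cancels.
  by_cases h0 : c u v = 0
  · rw [h0, zero_mul]
    cases z
    · have : IsLocalMin (fun v' => c u v') v := by
        filter_upwards [isOpen_Ioo.mem_nhds hv] with v' hv'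
        rw [h0]; exact hc.nonneg u hu v' hv'
      exact this.deriv_eq_zero.symm
    · have : IsLocalMin (fun u' => c u' v) u := by
        filter_upwards [isOpen_Ioo.mem_nhds hu] with u' hu'
        rw [h0]; exact hc.nonneg u' hu' v hv
      exact this.deriv_eq_zero.symm
  · field_simp

end CopulaDerivatives

variable {𝒳 : Type*} [MeasurableSpace 𝒳]

/-- `w ḟ e / (p₁ p₀)`. -/
noncomputable def beta {q : ℕ} (c w : ℝ → ℝ → ℝ) (f : ℝ → ℝ → (Fin q → ℝ) → ℝ) (N : Nuisance 𝒳)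
    (η : Fin q → ℝ) (i : Fin q) (a : 𝒳 × ℝ × ℝ) : ℝ :=
  w a.2.1 a.2.2 * grad (f a.2.1 a.2.2) η i * cF c N a

/-- `ν / (p₁ p₀)`. -/
noncomputable def nuT {q : ℕ} (c w : ℝ → ℝ → ℝ) (f : ℝ → ℝ → (Fin q → ℝ) → ℝ) (N : Nuisance 𝒳)
    (η : Fin q → ℝ) (i : Fin q) (a : 𝒳 × ℝ × ℝ) : ℝ :=
  beta c w f N η i a * (N.contrast a - f a.2.1 a.2.2 η)

/-- The logarithmic derivatives of the copula density at the conditional distribution functions. -/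
noncomputable def cqF (c : ℝ → ℝ → ℝ) (N : Nuisance 𝒳) (z : Bool) (a : 𝒳 × ℝ × ℝ) : ℝ :=
  cq c z (N.F true a.2.1 a.1, N.F false a.2.2 a.1)

section

variable {q : ℕ} {c w : ℝ → ℝ → ℝ} {f : ℝ → ℝ → (Fin q → ℝ) → ℝ} {N : Nuisance 𝒳}
  {η : Fin q → ℝ} (i : Fin q)

omit [MeasurableSpace 𝒳] in
lemma dens_mul_nuT (a : 𝒳 × ℝ × ℝ) : N.p true a.2.1 a.1 * N.p false a.2.2 a.1 *
    nuT c w f N η i a = nu c w f N η a.2.1 a.2.2 a.1 i := by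
  rw [nu, e_eq c N a, nuT, beta, Nuisance.contrast]; ring

omit [MeasurableSpace 𝒳] in
lemma dens_mul_beta (a : 𝒳 × ℝ × ℝ) : N.p true a.2.1 a.1 * N.p false a.2.2 a.1 *
    beta c w f N η i a =
      w a.2.1 a.2.2 * grad (f a.2.1 a.2.2) η i * N.e c a.2.1 a.2.2 a.1 := by
  rw [e_eq c N a, beta]; ring

end

namespace Envelope

variable {P : Measure (Obs 𝒳)} [IsProbabilityMeasure P] {N : Nuisance 𝒳}
  {c w : ℝ → ℝ → ℝ} {q : ℕ} {f : ℝ → ℝ → (Fin q → ℝ) → ℝ} {η : Fin q → ℝ} {ρ : ℝ}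
  {K b : ℝ → ℝ → ℝ} {m : Bool → ℝ → 𝒳 → ℝ}
  (env : Envelope c w f P N η ρ K b m) (h : IsNuisance P N) (hc : IsCopulaDensity c) (i : Fin q)

include env

omit [IsProbabilityMeasure P] in
lemma measurable_grad_f' {x : Fin q → ℝ} (hx : x ∈ Metric.ball η ρ) :
    Measurable fun r : ℝ × ℝ => grad (f r.1 r.2) x i :=
  measurable_grad (f := fun (r : ℝ × ℝ) => f r.1 r.2) hx (fun y _ => env.measurable_f y) (fun r =>
    ((env.contDiffOn r.1 r.2).differentiableOn (by norm_num)).differentiableAt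
      (Metric.isOpen_ball.mem_nhds hx)) i

omit [IsProbabilityMeasure P] in
lemma measurable_grad_f : Measurable fun a : 𝒳 × ℝ × ℝ => grad (f a.2.1 a.2.2) η i :=
  (env.measurable_grad_f' i (Metric.mem_ball_self env.pos)).comp measurable_snd

omit [IsProbabilityMeasure P] in
lemma measurable_hess_f (j : Fin q) : Measurable fun r : ℝ × ℝ => hess (f r.1 r.2) η i j :=
  measurable_grad (f := fun (r : ℝ × ℝ) y => grad (f r.1 r.2) y j) (Metric.mem_ball_self env.pos)
    (fun _ hy => env.measurable_grad_f' j hy)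
    (fun r => differentiableAt_grad (env.contDiffOn r.1 r.2) (Metric.mem_ball_self env.pos) j) i

include h hc

omit [IsProbabilityMeasure P] in
lemma measurable_beta : Measurable (beta c w f N η i) :=
  ((env.measurable_w.comp measurable_snd).mul (env.measurable_grad_f i)).mul (h.measurable_cF hc)

omit [IsProbabilityMeasure P] in
lemma measurable_nuT : Measurable (nuT c w f N η i) :=
  (env.measurable_beta h hc i).mul
    (h.measurable_contrast.sub ((env.measurable_f η).comp measurable_snd))

/-- The pointwise bounds behind the integrability of the terms of the influence function. -/
lemma ae_bounds : ∀ᵐ a ∂T P N, RegularPt P N a ∧ 0 ≤ wK w K N a ∧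
    (∀ z, kT P (fun v => v.1) z a = N.μ z (coord z a.2) a.1 ∧
      |N.μ z (coord z a.2) a.1| ≤ kT P (fun v => |v.1|) z a) ∧
    |beta c w f N η i a| ≤ wK w K N a * b a.2.1 a.2.2 ∧
    |nuT c w f N η i a| ≤ wK w K N a * (b a.2.1 a.2.2 *
      (kT P (fun v => |v.1|) true a + kT P (fun v => |v.1|) false a + b a.2.1 a.2.2)) ∧
    ∀ z, |nuT c w f N η i a * cqF c N z a *
        (N.F z (coord z a.2) a.1 * (1 - N.F z (coord z a.2) a.1))| ≤
      wK w K N a * (b a.2.1 a.2.2 *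
        (kT P (fun v => |v.1|) true a + kT P (fun v => |v.1|) false a + b a.2.1 a.2.2)) := by
  filter_upwards [h.ae_regularPt, env.ae_wK_nonneg h hc,
    h.ae_T_kbar_eq measurable_id h.outcome true, h.ae_T_kbar_eq measurable_id h.outcome false]
    with a ha hK e1 e0
  have hμ : ∀ z, kT P (fun v => v.1) z a = N.μ z (coord z a.2) a.1 ∧
      |N.μ z (coord z a.2) a.1| ≤ kT P (fun v => |v.1|) z a := by
    intro z
    have e : kT P (fun v => v.1) z a = N.μ z (coord z a.2) a.1 := by
      cases z
      · exact e0
      · exact e1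
    refine ⟨e, ?_⟩
    rw [← e]
    exact norm_integral_le_integral_norm (μ := kap P (pt z (a.1, coord z a.2))) (fun y : ℝ => y)
  have hf := env.bound_f a.2.1 a.2.2 η (Metric.mem_ball_self env.pos)
  have hw := env.nonneg_w a.2.1 a.2.2
  have hb := env.b_nonneg a.2.1 a.2.2
  have hF1 := ha.F_mem true
  have hF0 := ha.F_mem false
  simp only [coord_true, coord_false] at hF1 hF0
  have hc0 : 0 ≤ cF c N a := hc.nonneg _ hF1 _ hF0
  have hd : |N.contrast a - f a.2.1 a.2.2 η| ≤ kT P (fun v => |v.1|) true a +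
      kT P (fun v => |v.1|) false a + b a.2.1 a.2.2 := by
    have h1 := (hμ true).2
    have h0 := (hμ false).2
    simp only [coord_true, coord_false] at h1 h0
    rw [Nuisance.contrast]
    exact (abs_sub _ _).trans (add_le_add ((abs_sub _ _).trans (add_le_add h1 h0)) hf.1)
  have hβ : |beta c w f N η i a| ≤ wK w K N a * b a.2.1 a.2.2 := by
    rw [beta, abs_mul, abs_mul, abs_of_nonneg hw, abs_of_nonneg hc0, wK]
    have := mul_le_mul (mul_le_mul_of_nonneg_left (hf.2.1 i) hw) hK.1 hc0 (mul_nonneg hw hb)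
    linarith
  refine ⟨ha, hK.2, hμ, hβ, ?_, fun z => ?_⟩
  · rw [nuT, abs_mul, ← mul_assoc]
    exact mul_le_mul hβ hd (abs_nonneg _) (mul_nonneg hK.2 hb)
  -- `nuT` contains the factor `c` by which `cqF` divides. After cancellation the envelope of the
  -- derivative weighted by `F (1 - F)` applies, and no lower bound on `c` is needed.
  · have hmq : cF c N a * cqF c N z a = cd c z (N.F true a.2.1 a.1) (N.F false a.2.2 a.1) :=
      hc.mul_cq hF1 hF0 z
    have hm : ∀ z, 0 ≤ ρ * (N.F z (coord z a.2) a.1 * (1 - N.F z (coord z a.2) a.1)) := fun z =>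
      mul_nonneg env.pos.le (mul_nonneg (ha.F_mem z).1.le (sub_nonneg.2 (ha.F_mem z).2.le))
    have hle := env.bound_c _ hF1 _ hF0 _ _
      (by rw [sub_self, abs_zero]; exact hm true) (by rw [sub_self, abs_zero]; exact hm false)
    have hz : N.F z (coord z a.2) a.1 * (1 - N.F z (coord z a.2) a.1) *
        |cd c z (N.F true a.2.1 a.1) (N.F false a.2.2 a.1)| ≤
        K (N.F true a.2.1 a.1) (N.F false a.2.2 a.1) := by
      cases z
      · exact hle.2.2
      · exact hle.2.1
    have hFF : 0 ≤ N.F z (coord z a.2) a.1 * (1 - N.F z (coord z a.2) a.1) :=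
      mul_nonneg (ha.F_mem z).1.le (sub_nonneg.2 (ha.F_mem z).2.le)
    have e : nuT c w f N η i a * cqF c N z a *
        (N.F z (coord z a.2) a.1 * (1 - N.F z (coord z a.2) a.1)) =
        w a.2.1 a.2.2 * (N.F z (coord z a.2) a.1 * (1 - N.F z (coord z a.2) a.1) *
          cd c z (N.F true a.2.1 a.1) (N.F false a.2.2 a.1)) *
          (grad (f a.2.1 a.2.2) η i * (N.contrast a - f a.2.1 a.2.2 η)) := by
      rw [← hmq, nuT, beta]; ring
    rw [e, abs_mul, abs_mul, abs_mul (_ * (1 - _)), abs_mul (grad _ _ _), abs_of_nonneg hw,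
      abs_of_nonneg hFF, wK]
    exact mul_le_mul (mul_le_mul_of_nonneg_left hz hw)
      (mul_le_mul (hf.2.1 i) hd (abs_nonneg _) hb) (by positivity) hK.2

/-- Functions bounded by the envelopes of `ae_bounds` are integrable. -/
lemma integrable_of_bound {φ : 𝒳 × ℝ × ℝ → ℝ} {C : ℝ} (hC : 0 ≤ C)
    (hφ : AEStronglyMeasurable φ (T P N))
    (hle : ∀ᵐ a ∂T P N, 0 ≤ wK w K N a → |φ a| ≤ C * (wK w K N a * (b a.2.1 a.2.2 *
        (kT P (fun v => |v.1|) true a + kT P (fun v => |v.1|) false a + b a.2.1 a.2.2)))) :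
    Integrable φ (T P N) := by
  -- The `2` comes from `b (k₁ + k₀ + b) ≤ 2 (b² + k₁² + k₀²)`.
  refine env.integrable_of_le h hc (C := C * 2) hφ ?_ (by linarith)
  filter_upwards [hle, env.ae_wK_nonneg h hc] with a h1 h2
  refine (h1 h2.2).trans ?_
  rw [mul_assoc C 2]
  refine mul_le_mul_of_nonneg_left ?_ hC
  rw [mul_left_comm 2]
  refine mul_le_mul_of_nonneg_left ?_ h2.2
  nlinarith [sq_nonneg (b a.2.1 a.2.2 - kT P (fun v => |v.1|) true a),
      sq_nonneg (b a.2.1 a.2.2 - kT P (fun v => |v.1|) false a),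
      sq_nonneg (kT P (fun v => |v.1|) true a), sq_nonneg (kT P (fun v => |v.1|) false a)]

lemma integrable_nuT : Integrable (nuT c w f N η i) (T P N) := by
  refine env.integrable_of_bound h hc zero_le_one (env.measurable_nuT h hc i).aestronglyMeasurable ?_
  filter_upwards [env.ae_bounds h hc i] with a ha _
  rw [one_mul]; exact ha.2.2.2.2.1

omit env [IsProbabilityMeasure P] in
lemma measurable_cqF (z : Bool) : Measurable (cqF c N z) :=
  (hc.measurable_cq z).comp ((h.measurable_F_coord true).prodMk (h.measurable_F_coord false))

lemma integrable_nuT_cqF (z : Bool) : Integrable (fun a => nuT c w f N η i a * cqF c N z a *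
    (N.F z (coord z a.2) a.1 * (1 - N.F z (coord z a.2) a.1))) (T P N) := by
  have hm := h.measurable_F_coord z
  refine env.integrable_of_bound h hc zero_le_one (((env.measurable_nuT h hc i).mul
    (measurable_cqF h hc z)).mul (hm.mul (measurable_const.sub hm))).aestronglyMeasurable ?_
  filter_upwards [env.ae_bounds h hc i] with a ha _
  rw [one_mul]; exact ha.2.2.2.2.2 z

variable {s : Obs 𝒳 → ℝ} {K₀ : ℝ} (hs : Measurable s) (hsb : ∀ v, |s v| ≤ K₀)

include hs hsb

/-- Given `(S, Z, X)`, the residual `Y - μ_z` times the score has mean `E(Y s) - μ_z E(s)`, a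
conditional covariance: the first-order change of the outcome mean. This is the contribution of
`t₃`. -/
lemma integral_ipw_resid (z : Bool) :
    Integrable (fun v : Obs 𝒳 => ipw N z v.2.2.1 v.2.2.2 * (IsNuisance.marg N (beta c w f N η i) z
      (v.2.2.2, v.2.1) / N.p z v.2.1 v.2.2.2) * ((v.1 - N.μ z v.2.1 v.2.2.2) * s v)) P ∧
    Integrable (fun a => beta c w f N η i a * (kT P (fun v => v.1 * s v) z a -
      kT P (fun v => v.1) z a * kT P s z a)) (T P N) ∧
    ∫ v, ipw N z v.2.2.1 v.2.2.2 * (IsNuisance.marg N (beta c w f N η i) z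
      (v.2.2.2, v.2.1) / N.p z v.2.1 v.2.2.2) * ((v.1 - N.μ z v.2.1 v.2.2.2) * s v) ∂P =
    ∫ a, beta c w f N η i a * (kT P (fun v => v.1 * s v) z a -
      kT P (fun v => v.1) z a * kT P s z a) ∂T P N := by
  have hsx : Measurable fun v : Obs 𝒳 => (v.2.1, v.2.2.2) :=
    (measurable_fst.comp measurable_snd).prodMk measurable_lawX_map
  have hkm : Measurable fun v : Obs 𝒳 => (v.1 - N.μ z v.2.1 v.2.2.2) * s v :=
    (measurable_fst.sub ((h.outcome.1 z).comp hsx)).mul hs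
  have hK0 : 0 ≤ K₀ := (abs_nonneg _).trans (hsb (nonempty_of_isProbabilityMeasure P).some)
  have hres : ∀ u : ℝ × Bool × 𝒳, Integrable (fun y : ℝ => y) (kap P u) →
      Integrable (fun y => (y - N.μ z u.1 u.2.2) * s (y, u)) (kap P u) := fun u hu =>
    (hu.sub (integrable_const _)).mul_bdd (c := K₀) (measurable_section hs u).aestronglyMeasurable
      (Eventually.of_forall fun y => hsb _)
  have hk : ∀ᵐ a ∂T P N, |beta c w f N η i a * kT P (fun v => |(v.1 - N.μ z v.2.1 v.2.2.2) * s v|) z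
        a| ≤ 2 * K₀ * (wK w K N a * (b a.2.1 a.2.2 *
        (kT P (fun v => |v.1|) true a + kT P (fun v => |v.1|) false a + b a.2.1 a.2.2))) ∧
      kT P (fun v => (v.1 - N.μ z v.2.1 v.2.2.2) * s v) z a = kT P (fun v => v.1 * s v) z a -
        kT P (fun v => v.1) z a * kT P s z a := by
    filter_upwards [env.ae_bounds h hc i] with a ha
    obtain ⟨hr, hw, hμ, hβ, -, -⟩ := ha
    have hy := hr.integrable_y z
    have hb := env.b_nonneg a.2.1 a.2.2
    have hk0 : ∀ z, 0 ≤ kT P (fun v => |v.1|) z a := fun z => integral_nonneg fun y => abs_nonneg _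
    have hz : kT P (fun v => |v.1|) z a ≤ kT P (fun v => |v.1|) true a +
        kT P (fun v => |v.1|) false a := by
      have h1 := hk0 true
      have h0 := hk0 false
      cases z <;> linarith
    constructor
    -- `|Y - μ| ≤ |Y| + |μ|`, and `|μ|` is at most the absolute moment of `Y`; hence the `2`.
    · have h1 : kT P (fun v => |(v.1 - N.μ z v.2.1 v.2.2.2) * s v|) z a ≤
          2 * K₀ * kT P (fun v => |v.1|) z a := by
        have : kT P (fun v => |(v.1 - N.μ z v.2.1 v.2.2.2) * s v|) z a ≤
            ∫ y, (|y| + |N.μ z (coord z a.2) a.1|) * K₀ ∂kap P (pt z (a.1, coord z a.2)) := by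
          refine integral_mono (hres _ hy).abs ((hy.abs.add (integrable_const _)).mul_const _)
            fun y => ?_
          change |(y - N.μ z (coord z a.2) a.1) * s (y, pt z (a.1, coord z a.2))| ≤ _
          rw [abs_mul]
          exact mul_le_mul (abs_sub _ _) (hsb _) (abs_nonneg _)
            (add_nonneg (abs_nonneg _) (abs_nonneg _))
        refine this.trans ?_
        rw [integral_mul_const, integral_add hy.abs (integrable_const _), integral_const,
          probReal_univ, one_smul]
        have h2 := (hμ z).2
        change (kT P (fun v => |v.1|) z a + _) * K₀ ≤ _
        nlinarith
      have h2 : 0 ≤ kT P (fun v => |(v.1 - N.μ z v.2.1 v.2.2.2) * s v|) z a :=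
        integral_nonneg fun y => abs_nonneg _
      rw [abs_mul, abs_of_nonneg h2]
      refine (mul_le_mul hβ h1 h2 (mul_nonneg hw hb)).trans ?_
      have h3 : kT P (fun v => |v.1|) z a ≤ kT P (fun v => |v.1|) true a +
        kT P (fun v => |v.1|) false a + b a.2.1 a.2.2 := by linarith
      have h4 := mul_le_mul_of_nonneg_left h3 (mul_nonneg (mul_nonneg (by norm_num : (0:ℝ) ≤ 2) hK0)
        (mul_nonneg hw hb))
      linarith
    · rw [(hμ z).1]
      have e1 : ∀ y, (y - N.μ z (coord z a.2) a.1) * s (y, pt z (a.1, coord z a.2)) =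
          y * s (y, pt z (a.1, coord z a.2)) -
            N.μ z (coord z a.2) a.1 * s (y, pt z (a.1, coord z a.2)) := fun y => by ring
      change ∫ y, (y - N.μ z (coord z a.2) a.1) * s (y, pt z (a.1, coord z a.2))
        ∂kap P (pt z (a.1, coord z a.2)) = _
      simp only [e1]
      have hsi : Integrable (fun y => s (y, pt z (a.1, coord z a.2)))
          (kap P (pt z (a.1, coord z a.2))) :=
        Integrable.of_bound (measurable_section hs _).aestronglyMeasurable K₀
          (Eventually.of_forall fun y => hsb _)
      rw [integral_sub (integrable_fst_mul_kap hs hsb hy) (hsi.const_mul _), integral_const_mul]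
      rfl
  have hi : Integrable (fun a => beta c w f N η i a *
      kT P (fun v => |(v.1 - N.μ z v.2.1 v.2.2.2) * s v|) z a) (T P N) := by
    refine env.integrable_of_bound h hc (C := 2 * K₀) (by positivity)
      ((env.measurable_beta h hc i).mul (measurable_kT P hkm.abs z)).aestronglyMeasurable ?_
    filter_upwards [hk] with a ha _ using ha.1
  have hy := h.ae_snd (p := fun u => Integrable (fun y : ℝ => y) (kap P u))
    (IsNuisance.measurableSet_integrable_kap measurable_id)
    (IsNuisance.ae_integrable_kap measurable_id h.outcome.2.1) z
  have h1 := h.integral_ipw_marg z (env.measurable_beta h hc i) hkm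
    (by filter_upwards [hy] with a ha hp using hres _ (ha hp)) hi
  have hcongr : (fun a => beta c w f N η i a *
      kT P (fun v => (v.1 - N.μ z v.2.1 v.2.2.2) * s v) z a) =ᵐ[T P N] fun a =>
      beta c w f N η i a * (kT P (fun v => v.1 * s v) z a -
        kT P (fun v => v.1) z a * kT P s z a) := by
    filter_upwards [hk] with a ha
    rw [ha.2]
  refine ⟨h1.1, ?_, h1.2.trans (integral_congr_ae hcongr)⟩
  refine Integrable.congr (hi.mono ((env.measurable_beta h hc i).mul
    (measurable_kT P hkm z)).aestronglyMeasurable (Eventually.of_forall fun a => ?_)) hcongr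
  have h0 : 0 ≤ kT P (fun v => |(v.1 - N.μ z v.2.1 v.2.2.2) * s v|) z a :=
    integral_nonneg fun y => abs_nonneg _
  rw [Pi.mul_apply, norm_mul, norm_mul, Real.norm_eq_abs (kT P (fun v => |_|) _ _), abs_of_nonneg h0]
  exact mul_le_mul_of_nonneg_left (norm_integral_le_integral_norm _) (norm_nonneg _)

end Envelope

end PCE

/-! ### Assembly of the influence function from its terms -/

namespace PCE

variable {𝒳 : Type*} [MeasurableSpace 𝒳] {P : Measure (Obs 𝒳)} [IsProbabilityMeasure P]
  {N : Nuisance 𝒳}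

/-- Two integrable functions with the same integral. -/
structure SameIntegral {A B : Type*} [MeasurableSpace A] [MeasurableSpace B] (μ : Measure A)
    (φ : A → ℝ) (ν : Measure B) (ψ : B → ℝ) : Prop where
  left : Integrable φ μ
  right : Integrable ψ ν
  eq : ∫ a, φ a ∂μ = ∫ b, ψ b ∂ν

namespace SameIntegral

variable {A B : Type*} [MeasurableSpace A] [MeasurableSpace B] {μ : Measure A} {φ φ' : A → ℝ}
  {ν : Measure B} {ψ ψ' : B → ℝ}

lemma add (h : SameIntegral μ φ ν ψ) (h' : SameIntegral μ φ' ν ψ') :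
    SameIntegral μ (fun a => φ a + φ' a) ν (fun b => ψ b + ψ' b) :=
  ⟨h.left.add h'.left, h.right.add h'.right, by
    rw [integral_add h.left h'.left, integral_add h.right h'.right, h.eq, h'.eq]⟩

lemma sub (h : SameIntegral μ φ ν ψ) (h' : SameIntegral μ φ' ν ψ') :
    SameIntegral μ (fun a => φ a - φ' a) ν (fun b => ψ b - ψ' b) :=
  ⟨h.left.sub h'.left, h.right.sub h'.right, by
    rw [integral_sub h.left h'.left, integral_sub h.right h'.right, h.eq, h'.eq]⟩

lemma congr (h : SameIntegral μ φ ν ψ) (h1 : φ =ᵐ[μ] φ') (h2 : ψ =ᵐ[ν] ψ') :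
    SameIntegral μ φ' ν ψ' :=
  ⟨h.left.congr h1, h.right.congr h2, by
    rw [← integral_congr_ae h1, ← integral_congr_ae h2, h.eq]⟩

end SameIntegral

lemma RegularPt.abs_armMean_le {a : 𝒳 × ℝ × ℝ} (ha : RegularPt P N a) (h : IsNuisance P N)
    {s : Obs 𝒳 → ℝ} {K₀ : ℝ} (hsb : ∀ v, |s v| ≤ K₀) (z : Bool) :
    |armMean P N s z a.1| ≤ K₀ := by
  obtain ⟨hp, hp1⟩ := ha.integrable_p z
  have := norm_integral_le_of_norm_le (f := fun r => N.p z r a.1 * kbar P s (r, z, a.1))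
    (hp.mul_const K₀) (Eventually.of_forall fun r => by
      rw [norm_mul, Real.norm_eq_abs, Real.norm_eq_abs, abs_of_nonneg (h.nonneg_p _ _ _)]
      exact mul_le_mul_of_nonneg_left (abs_kbar_le hsb _) (h.nonneg_p _ _ _))
  rwa [integral_mul_const, hp1, one_mul] at this

/-- `Fdot` is the covariance of an indicator with a score bounded by `K₀`, hence at most `K₀` times
the mean absolute deviation `2 F (1 - F)`. -/
lemma RegularPt.abs_Fdot_le {a : 𝒳 × ℝ × ℝ} (ha : RegularPt P N a) (h : IsNuisance P N)
    {s : Obs 𝒳 → ℝ} (hs : Measurable s) {K₀ : ℝ} (hsb : ∀ v, |s v| ≤ K₀) (z : Bool) :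
    |Fdot P N s z (coord z a.2) a.1| ≤
      2 * K₀ * (N.F z (coord z a.2) a.1 * (1 - N.F z (coord z a.2) a.1)) := by
  obtain ⟨hp, hp1⟩ := ha.integrable_p z
  have hd := IsNuisance.integral_abs_devF ha (z := z)
  have e := (IsNuisance.integral_p_mul_devF (N := N) (z := z) (a := a)
    (fun t => kbar P s (t, z, a.1)) (integrable_p_mul_kbar hp hs hsb)).2
  have := norm_integral_le_of_norm_le
    (f := fun t => N.p z t a.1 * kbar P s (t, z, a.1) * IsNuisance.devF N z a t)
    (hd.1.mul_const K₀) (Eventually.of_forall fun r => by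
      rw [norm_mul, norm_mul, Real.norm_eq_abs, Real.norm_eq_abs, Real.norm_eq_abs,
        abs_of_nonneg (h.nonneg_p _ _ _), mul_right_comm]
      exact mul_le_mul_of_nonneg_left (abs_kbar_le hsb _)
        (mul_nonneg (h.nonneg_p _ _ _) (abs_nonneg _)))
  rw [e, integral_mul_const, hd.2] at this
  rw [Fdot]
  change |(∫ r in Iic (coord z a.2), N.p z r a.1 * kbar P s (r, z, a.1)) -
    N.F z (coord z a.2) a.1 * armMean P N s z a.1| ≤ _ at this
  linarith

lemma IsNuisance.measurable_Fdot (h : IsNuisance P N) {s : Obs 𝒳 → ℝ} (hs : Measurable s)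
    (z : Bool) : Measurable fun a : 𝒳 × ℝ × ℝ => Fdot P N s z (coord z a.2) a.1 := by
  have hk : Measurable (Function.uncurry fun (x : 𝒳) t => N.p z t x * kbar P s (t, z, x)) :=
    (h.measurable_p' z).mul ((measurable_kbar P hs).comp (measurable_pt z))
  exact ((measurable_setIntegral_Iic hk).comp
    (measurable_fst.prodMk ((measurable_coord z).comp measurable_snd))).sub
      ((h.measurable_F_coord z).mul ((h.measurable_armMean hs z).comp measurable_fst))

omit [IsProbabilityMeasure P] [MeasurableSpace 𝒳] in
lemma ipw1_eq (z : Bool) (x : 𝒳) : ipw1 N z x = ipw N true z x := rfl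

omit [IsProbabilityMeasure P] [MeasurableSpace 𝒳] in
lemma ipw0_eq (z : Bool) (x : 𝒳) : ipw0 N z x = ipw N false z x := by
  cases z <;> simp [ipw0, ipw, Nuisance.prob_false]

namespace Envelope

variable {c w : ℝ → ℝ → ℝ} {q : ℕ} {f : ℝ → ℝ → (Fin q → ℝ) → ℝ} {η : Fin q → ℝ} {ρ : ℝ}
  {K b : ℝ → ℝ → ℝ} {m : Bool → ℝ → 𝒳 → ℝ}
  (env : Envelope c w f P N η ρ K b m) (h : IsNuisance P N) (hc : IsCopulaDensity c) (i : Fin q)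

include h in
-- At regular points the arguments of `c` lie in the open square, where `cqF` is the quotient in
-- `ru` and `rv`; where a density vanishes both integrands vanish. The exceptional set of `x` does
-- not depend on `t`.
lemma ae_devMarg : ∀ᵐ x ∂lawX P, ∀ t,
    ∫ r : ℝ × ℝ, nu c w f N η r.1 r.2 x i * ru c N r.1 r.2 t x =
      IsNuisance.devMarg N (nuT c w f N η i) (cqF c N true) true (x, t) ∧
    ∫ r : ℝ × ℝ, nu c w f N η r.1 r.2 x i * rv c N r.1 r.2 t x =
      IsNuisance.devMarg N (nuT c w f N η i) (cqF c N false) false (x, t) := by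
  filter_upwards [Measure.ae_ae_of_ae_prod (h.ae_T.1 h.ae_regularPt)] with x hx t
  constructor
  · refine integral_congr_ae ?_
    filter_upwards [hx] with r hr
    have hn := dens_mul_nuT (c := c) (w := w) (f := f) (N := N) (η := η) i (x, r)
    by_cases h0 : N.p true r.1 x * N.p false r.2 x = 0
    · simp only at hn
      rw [← hn, h0]; simp
    · have := hr h0
      simp only at hn
      rw [hn, ru, cqF, cq_of_mem (show N.F true r.1 x ∈ Ioo (0 : ℝ) 1 from this.F_mem true)
        (show N.F false r.2 x ∈ Ioo (0 : ℝ) 1 from this.F_mem false)]; rfl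
  · refine integral_congr_ae ?_
    filter_upwards [hx] with r hr
    have hn := dens_mul_nuT (c := c) (w := w) (f := f) (N := N) (η := η) i (x, r)
    by_cases h0 : N.p true r.1 x * N.p false r.2 x = 0
    · simp only at hn
      rw [← hn, h0]; simp
    · have := hr h0
      simp only at hn
      rw [hn, rv, cqF, cq_of_mem (show N.F true r.1 x ∈ Ioo (0 : ℝ) 1 from this.F_mem true)
        (show N.F false r.2 x ∈ Ioo (0 : ℝ) 1 from this.F_mem false)]; rfl

omit [IsProbabilityMeasure P] [MeasurableSpace 𝒳] in
lemma marg_nuT (x : 𝒳) (t : ℝ) :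
    IsNuisance.marg N (nuT c w f N η i) true (x, t) = ∫ s₀, nu c w f N η t s₀ x i ∧
    IsNuisance.marg N (nuT c w f N η i) false (x, t) = ∫ s₁, nu c w f N η s₁ t x i := by
  constructor
  · exact integral_congr_ae (Eventually.of_forall fun t' => dens_mul_nuT i (x, ins true t t'))
  · exact integral_congr_ae (Eventually.of_forall fun t' => dens_mul_nuT i (x, ins false t t'))

omit [IsProbabilityMeasure P] [MeasurableSpace 𝒳] in
lemma marg_beta (x : 𝒳) (t : ℝ) :
    IsNuisance.marg N (beta c w f N η i) true (x, t) =
      ∫ s₀, w t s₀ * grad (f t s₀) η i * N.e c t s₀ x ∧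
    IsNuisance.marg N (beta c w f N η i) false (x, t) =
      ∫ s₁, w s₁ t * grad (f s₁ t) η i * N.e c s₁ t x := by
  constructor
  · exact integral_congr_ae (Eventually.of_forall fun t' => dens_mul_beta i (x, ins true t t'))
  · exact integral_congr_ae (Eventually.of_forall fun t' => dens_mul_beta i (x, ins false t t'))

omit [IsProbabilityMeasure P] [MeasurableSpace 𝒳] in
-- With `κ = 0`, `devMarg` is a plain integral. Writing `t₁` as a sum over arms of inverse
-- probability weights times `prob z * t₁` lets `integral_ipw_devMarg` treat it like the terms of
-- `t₂`.
lemma devMarg_zero (z : Bool) (x : 𝒳) (t : ℝ) :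
    IsNuisance.devMarg N (fun a => N.prob z a.1 * nuT c w f N η i a) 0 z (x, t) =
      N.prob z x * t1 c w f N η x i := by
  rw [IsNuisance.devMarg, t1, ← integral_const_mul]
  refine integral_congr_ae (Eventually.of_forall fun r => ?_)
  have := dens_mul_nuT (c := c) (w := w) (f := f) (N := N) (η := η) i (x, r)
  simp only at this
  simp only [Pi.zero_apply, zero_mul, sub_zero, mul_one, ← this]
  ring

include h in
/-- The terms of the influence function in terms of inverse probability weights. -/
lemma ae_tSum : ∀ᵐ v ∂P, tSum c w f N η v i =
    ∑ z, (ipw N z v.2.2.1 v.2.2.2 * IsNuisance.devMarg N (fun a => N.prob z a.1 *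
        nuT c w f N η i a) 0 z (v.2.2.2, v.2.1) +
      (ipw N z v.2.2.1 v.2.2.2 * (IsNuisance.marg N (nuT c w f N η i) z (v.2.2.2, v.2.1) /
        N.p z v.2.1 v.2.2.2) - ipw N z v.2.2.1 v.2.2.2 *
        IsNuisance.devMarg N (nuT c w f N η i) (cqF c N z) z (v.2.2.2, v.2.1)) +
      (if z then 1 else -1) * (ipw N z v.2.2.1 v.2.2.2 *
        (IsNuisance.marg N (beta c w f N η i) z (v.2.2.2, v.2.1) / N.p z v.2.1 v.2.2.2) *
          (v.1 - N.μ z v.2.1 v.2.2.2))) := by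
  have h1 := ae_of_ae_map (μ := P) measurable_lawX_map.aemeasurable
    (ae_devMarg (c := c) (w := w) (f := f) (η := η) h i)
  have h2 := ae_of_ae_map (μ := P) measurable_lawX_map.aemeasurable h.prob_pos
  filter_upwards [h1, h2] with v e1 e2
  obtain ⟨y, s, z, x⟩ := v
  simp only at e1 e2 ⊢
  -- Only the observed arm has a nonzero weight, and there `prob z` cancels it.
  have ht : ipw N true z x * (N.prob true x * t1 c w f N η x i) +
      ipw N false z x * (N.prob false x * t1 c w f N η x i) = t1 c w f N η x i := by
    have p1 := (e2 true).ne'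
    have p0 := (e2 false).ne'
    cases z
    · simp only [ipw]; simp; field_simp
    · simp only [ipw]; simp; field_simp
  rw [Fintype.sum_bool, devMarg_zero, devMarg_zero, tSum, t2, t3, (e1 s).1, (e1 s).2,
    ← (marg_nuT i x s).1, ← (marg_nuT i x s).2, ← (marg_beta i x s).1, ← (marg_beta i x s).2,
    ipw1_eq, ipw0_eq]
  simp only [if_true, Bool.false_eq_true, if_false]
  nth_rewrite 1 [← ht]
  ring

variable {s : Obs 𝒳 → ℝ} {K₀ : ℝ} (hs : Measurable s) (hsb : ∀ v, |s v| ≤ K₀)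

include env h hc hs hsb

/-- The influence function represents the derivative of the estimating equation. -/
theorem sameIntegral_tSum_mul : SameIntegral P (fun v => tSum c w f N η v i * s v) (T P N)
    fun a => grad (f a.2.1 a.2.2) η i *
      (wDdot c w P N s a - f a.2.1 a.2.2 η * wAdot c w P N s a) := by
  have hν := env.integrable_nuT h hc i
  have hνm := env.measurable_nuT h hc i
  have hK0 : 0 ≤ K₀ := (abs_nonneg _).trans (hsb (nonempty_of_isProbabilityMeasure P).some)
  have hsi : ∀ u, Integrable (fun y => s (y, u)) (kap P u) := fun u =>
    Integrable.of_bound (measurable_section hs u).aestronglyMeasurable K₀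
      (Eventually.of_forall fun y => hsb _)
  have hpm : ∀ z, Measurable fun a : 𝒳 × ℝ × ℝ => N.prob z a.1 := fun z =>
    (h.measurable_prob z).comp measurable_fst
  have hpν : ∀ z, Integrable (fun a => N.prob z a.1 * nuT c w f N η i a) (T P N) := fun z => by
    refine hν.abs.mono' ((hpm z).mul hνm).aestronglyMeasurable ?_
    filter_upwards [h.ae_regularPt] with a ha
    have h1 := ha.prob_pos true
    have h0 := ha.prob_pos false
    have hz : N.prob z a.1 ≤ 1 := by
      rw [Nuisance.prob_true] at h1
      rw [Nuisance.prob_false] at h0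
      cases z
      · rw [Nuisance.prob_false]; linarith
      · rw [Nuisance.prob_true]; linarith
    rw [norm_mul, Real.norm_eq_abs, Real.norm_eq_abs, abs_of_pos (ha.prob_pos z)]
    exact mul_le_of_le_one_left (abs_nonneg _) hz
  have ham : ∀ z, Measurable fun a : 𝒳 × ℝ × ℝ => armMean P N s z a.1 := fun z =>
    (h.measurable_armMean hs z).comp measurable_fst
  have hab : ∀ z, ∀ᵐ a ∂T P N, ‖armMean P N s z a.1‖ ≤ K₀ := fun z => by
    filter_upwards [h.ae_regularPt] with a ha using ha.abs_armMean_le h hsb z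
  -- `t₁` contributes `prob z * armMean`, which sums over the arms to `covMean P N s`, the score of
  -- the law of `X`.
  have hJ : ∀ z, SameIntegral P (fun v => ipw N z v.2.2.1 v.2.2.2 * IsNuisance.devMarg N (fun a =>
        N.prob z a.1 * nuT c w f N η i a) 0 z (v.2.2.2, v.2.1) * s v) (T P N) (fun a =>
        N.prob z a.1 * nuT c w f N η i a * (armMean P N s z a.1 -
          (0 : 𝒳 × ℝ × ℝ → ℝ) a * Fdot P N s z (coord z a.2) a.1)) := fun z => by
    have := h.integral_ipw_devMarg z ((hpm z).mul hνm) measurable_zero hs hsb (hpν z) (by simp)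
    refine ⟨this.1, ?_, this.2⟩
    simp only [Pi.zero_apply, zero_mul, sub_zero]
    exact (hpν z).mul_bdd (ham z).aestronglyMeasurable (hab z)
  -- The first part of `t₂` contributes the conditional mean of the score given `(S, Z, X)` in each
  -- arm.
  have hA : ∀ z, SameIntegral P (fun v => ipw N z v.2.2.1 v.2.2.2 *
      (IsNuisance.marg N (nuT c w f N η i) z (v.2.2.2, v.2.1) / N.p z v.2.1 v.2.2.2) * s v)
      (T P N) (fun a => nuT c w f N η i a * kT P s z a) := fun z => by
    have := h.integral_ipw_marg z hνm hs
      (Eventually.of_forall fun a _ => hsi _) (hν.mul_bdd (c := K₀)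
        (measurable_kT P hs.abs z).aestronglyMeasurable (Eventually.of_forall fun a =>
          abs_kbar_le (fun v => by rw [abs_abs]; exact hsb v) _))
    exact ⟨this.1, hν.mul_bdd (c := K₀) (measurable_kT P hs z).aestronglyMeasurable
      (Eventually.of_forall fun a => abs_kbar_le hsb _), this.2⟩
  -- The second part of `t₂` accounts for the normalization of the conditional densities and for the
  -- distribution functions inside `c`.
  have hR : ∀ z, SameIntegral P (fun v => ipw N z v.2.2.1 v.2.2.2 *
      IsNuisance.devMarg N (nuT c w f N η i) (cqF c N z) z (v.2.2.2, v.2.1) * s v) (T P N)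
      (fun a => nuT c w f N η i a * (armMean P N s z a.1 -
        cqF c N z a * Fdot P N s z (coord z a.2) a.1)) := fun z => by
    have hq := env.integrable_nuT_cqF h hc i z
    have := h.integral_ipw_devMarg z hνm (measurable_cqF h hc z) hs hsb hν hq
    refine ⟨this.1, ?_, this.2⟩
    simp only [mul_sub]
    refine (hν.mul_bdd (ham z).aestronglyMeasurable (hab z)).sub ((hq.abs.const_mul (2 * K₀)).mono'
      (hνm.mul ((measurable_cqF h hc z).mul (h.measurable_Fdot hs z))).aestronglyMeasurable ?_)
    filter_upwards [h.ae_regularPt] with a ha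
    have hF := ha.F_mem z
    rw [← mul_assoc, norm_mul, abs_mul, abs_of_pos (mul_pos hF.1 (sub_pos.2 hF.2)),
      Real.norm_eq_abs, Real.norm_eq_abs]
    have := mul_le_mul_of_nonneg_left (ha.abs_Fdot_le h hs hsb z)
      (abs_nonneg (nuT c w f N η i a * cqF c N z a))
    linarith
  -- This is `t₃`, which enters with opposite signs in the two arms.
  have hB : ∀ z, SameIntegral P _ (T P N) _ := fun z => by
    have := env.integral_ipw_resid h hc i hs hsb z
    exact ⟨this.1, this.2.1, this.2.2⟩
  have hz := fun z => ((hJ z).add ((hA z).sub (hR z)))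
  refine (((hz true).add (hz false)).add ((hB true).sub (hB false))).congr ?_ ?_
  · filter_upwards [ae_tSum (c := c) (w := w) (f := f) (η := η) h i] with v hv
    rw [hv, Fintype.sum_bool]
    simp only [if_true, Bool.false_eq_true, if_false]
    ring
  -- Pointwise the contributions add up to the derivative of `grad f * (wD - f wA)`, once `c` times
  -- its logarithmic derivatives is rewritten as the derivatives and the contrast as a difference of
  -- conditional means of `Y`.
  · filter_upwards [env.ae_bounds h hc i] with a ha
    obtain ⟨hr, -, hμ, -⟩ := ha
    have q1 : cF c N a * cqF c N true a = cu c (N.F true a.2.1 a.1) (N.F false a.2.2 a.1) :=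
      hc.mul_cq (hr.F_mem true) (hr.F_mem false) true
    have q0 : cF c N a * cqF c N false a = cv c (N.F true a.2.1 a.1) (N.F false a.2.2 a.1) :=
      hc.mul_cq (hr.F_mem true) (hr.F_mem false) false
    have hct : N.contrast a = kT P (fun v => v.1) true a - kT P (fun v => v.1) false a := by
      rw [(hμ true).1, (hμ false).1]; rfl
    simp only [wDdot, wAdot, wNdot, ← q1, ← q0, covMean, nuT, beta, hct, Pi.zero_apply, coord_true,
      coord_false]
    ring

end Envelope

end PCE

namespace PCE

/-! ## The tangent space of the nonparametric model -/

variable {𝒳 : Type*} [MeasurableSpace 𝒳] {P : Measure (Obs 𝒳)} [IsProbabilityMeasure P]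

omit [IsProbabilityMeasure P] in
lemma IsSubmodel.exists_bound {Pθ : ℝ → Measure (Obs 𝒳)} {s : Obs 𝒳 → ℝ}
    (h : IsSubmodel P Pθ s) : ∃ K, ∀ᵐ v ∂P, ‖s v‖ ≤ K := by
  obtain ⟨g, s', K, rp, hs, -⟩ := h.exists_ratioPath
  refine ⟨K, ?_⟩
  filter_upwards [hs] with v hv
  rw [hv]; exact rp.abs_score_le v

/-- Bounded functions with mean zero are scores. -/
lemma isSubmodel_linear {s : Obs 𝒳 → ℝ} (hs : Measurable s) (hb : ∀ v, |s v| ≤ 1)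
    (h0 : ∫ v, s v ∂P = 0) :
    IsSubmodel P (fun θ => P.withDensity fun v => ENNReal.ofReal (1 + θ * s v)) s := by
  have hi : Integrable s P := Integrable.of_bound hs.aestronglyMeasurable 1 (Eventually.of_forall hb)
  refine ⟨hs, fun θ v => 1 + θ * s v, 1, fun θ => measurable_const.add (hs.const_mul θ), ?_,
    Eventually.of_forall fun v => ?_⟩
  · filter_upwards [Metric.ball_mem_nhds (0 : ℝ) one_pos] with θ hθ
    rw [Metric.mem_ball, Real.dist_eq, sub_zero] at hθ
    have hle : ∀ v, |θ * s v| ≤ |θ| := fun v => by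
      rw [abs_mul]; exact mul_le_of_le_one_right (abs_nonneg _) (hb v)
    refine ⟨⟨?_⟩, rfl, Eventually.of_forall fun v => ?_⟩
    · have hi' : Integrable (fun v => 1 + θ * s v) P := (integrable_const 1).add (hi.const_mul θ)
      rw [withDensity_apply _ MeasurableSet.univ, Measure.restrict_univ,
        ← ofReal_integral_eq_lintegral_ofReal hi' (Eventually.of_forall fun v => ?_)]
      · rw [integral_add (integrable_const 1) (hi.const_mul θ), integral_const_mul, h0]
        simp
      · have := (abs_le.1 (hle v)).1
        change 0 ≤ 1 + θ * s v
        linarith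
    · rw [add_sub_cancel_left, one_mul]; exact hle v
  · simpa using ((hasDerivAt_id (0 : ℝ)).mul_const (s v)).const_add 1

/-- The tangent space contains all square integrable functions with mean zero. -/
theorem mem_tangentSpace {h : Lp ℝ 2 P} (h0 : ∫ v, h v ∂P = 0) : h ∈ tangentSpace P := by
  rw [tangentSpace, ← Submodule.orthogonal_orthogonal_eq_closure, Submodule.mem_orthogonal]
  -- A function orthogonal to all scores is orthogonal to every centred indicator, hence almost
  -- surely constant, and constants are orthogonal to centred functions. So the double orthogonal
  -- complement of the scores contains every centred function.
  intro y hy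
  rw [Submodule.mem_orthogonal] at hy
  have hyi : Integrable y P := (Lp.memLp y).integrable (by norm_num)
  have hA : ∀ A, MeasurableSet A → ∫ v in A, y v ∂P = ∫ v in A, (∫ v, y v ∂P) ∂P := by
    intro A hA
    set s : Obs 𝒳 → ℝ := fun v => A.indicator 1 v - P.real A with hs
    have hsm : Measurable s := (measurable_one.indicator hA).sub_const _
    have hsb : ∀ v, |s v| ≤ 1 := fun v => by
      have h1 : P.real A ≤ 1 := measureReal_le_one
      have h2 : 0 ≤ P.real A := measureReal_nonneg
      rw [abs_le]
      by_cases hv : v ∈ A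
      · simp only [hs, indicator_of_mem hv, Pi.one_apply]; constructor <;> linarith
      · simp only [hs, indicator_of_notMem hv]; constructor <;> linarith
    have hs0 : ∫ v, s v ∂P = 0 := by
      have h1 : Integrable (A.indicator (1 : Obs 𝒳 → ℝ)) P := (integrable_const (1 : ℝ)).indicator hA
      rw [show ∫ v, s v ∂P = ∫ v, A.indicator 1 v - P.real A ∂P from rfl,
        integral_sub h1 (integrable_const _), integral_indicator_one hA]
      simp
    have hsL : MemLp s 2 P := MemLp.of_bound hsm.aestronglyMeasurable 1 (Eventually.of_forall hsb)
    have := hy (hsL.toLp s) (Submodule.subset_span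
      ⟨_, s, isSubmodel_linear hsm hsb hs0, hsL.coeFn_toLp⟩)
    rw [L2.inner_def] at this
    have e : ∀ᵐ v ∂P, inner ℝ (hsL.toLp s v) (y v) = A.indicator y v - P.real A * y v := by
      filter_upwards [hsL.coeFn_toLp] with v hv
      rw [hv]
      by_cases hvA : v ∈ A
      · simp [hs, indicator_of_mem hvA]; ring
      · simp [hs, indicator_of_notMem hvA]; ring
    rw [integral_congr_ae e, integral_sub (hyi.indicator hA) (hyi.const_mul _),
      integral_indicator hA, integral_const_mul] at this
    rw [setIntegral_const, smul_eq_mul]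
    linarith
  have hy' : y =ᵐ[P] fun _ => ∫ v, y v ∂P :=
    hyi.ae_eq_of_forall_setIntegral_eq _ _ (integrable_const _) fun A hAm _ => hA A hAm
  rw [L2.inner_def]
  have e : ∀ᵐ v ∂P, inner ℝ (y v) (h v) = (∫ v, y v ∂P) * h v := by
    filter_upwards [hy'] with v hv
    rw [hv]; simp [mul_comm]
  rw [integral_congr_ae e, integral_const_mul, h0, mul_zero]

/-- Functions in the tangent space are determined by their inner products with the scores. -/
theorem ae_eq_of_tangentSpace {φ ψ : Obs 𝒳 → ℝ} (hφ : ∃ h ∈ tangentSpace P, h =ᵐ[P] φ)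
    (hψ : ∃ h ∈ tangentSpace P, h =ᵐ[P] ψ)
    (heq : ∀ Pθ s, IsSubmodel P Pθ s → ∫ v, φ v * s v ∂P = ∫ v, ψ v * s v ∂P) : φ =ᵐ[P] ψ := by
  obtain ⟨h, hh, eh⟩ := hφ
  obtain ⟨k, hk, ek⟩ := hψ
  -- Scores are bounded, so their products with square integrable functions can be integrated
  -- separately, and orthogonality need only be checked on the spanning set. The difference then
  -- lies in the tangent space and in its orthogonal complement.
  have horth : h - k ∈ (Submodule.span ℝ {h : Lp ℝ 2 P | ∃ Pθ s, IsSubmodel P Pθ s ∧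
      h =ᵐ[P] s}).topologicalClosureᗮ := by
    rw [Submodule.orthogonal_closure, Submodule.mem_orthogonal]
    intro u hu
    induction hu using Submodule.span_induction with
    | zero => simp
    | add x y _ _ hx hy => rw [inner_add_left, hx, hy, add_zero]
    | smul a x _ hx => rw [inner_smul_left, hx, mul_zero]
    | mem u hu =>
      obtain ⟨Pθ, s, hs, hus⟩ := hu
      obtain ⟨K, hK⟩ := hs.exists_bound
      have hsm := hs.1.aestronglyMeasurable (μ := P)
      have e : ∀ᵐ v ∂P, inner ℝ (u v) ((h - k : Lp ℝ 2 P) v) = h v * s v - k v * s v := by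
        filter_upwards [hus, Lp.coeFn_sub h k] with v h1 h2
        rw [h1, h2]; simp; ring
      have hi : ∀ h : Lp ℝ 2 P, Integrable (fun v => h v * s v) P := fun h =>
        ((Lp.memLp h).integrable (by norm_num)).mul_bdd hsm hK
      rw [L2.inner_def, integral_congr_ae e, integral_sub (hi h) (hi k), sub_eq_zero]
      refine Eq.trans (integral_congr_ae ?_) ((heq Pθ s hs).trans (integral_congr_ae ?_))
      · filter_upwards [eh] with v hv; rw [hv]
      · filter_upwards [ek] with v hv; rw [hv]
  have hz : h - k = 0 := by
    have := (Submodule.mem_orthogonal _ _).1 horth (h - k) (Submodule.sub_mem _ hh hk)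
    exact inner_self_eq_zero.1 this
  have hhk : h = k := sub_eq_zero.1 hz
  exact eh.symm.trans (hhk ▸ ek)

end PCE

namespace PCE

/-! ## The efficient influence function of an observed law -/

variable {𝒳 : Type*} [MeasurableSpace 𝒳] {P : Measure (Obs 𝒳)} [IsProbabilityMeasure P]
  {N : Nuisance 𝒳} {c w : ℝ → ℝ → ℝ} {q : ℕ} {f : ℝ → ℝ → (Fin q → ℝ) → ℝ} {η : Fin q → ℝ}
  {ρ : ℝ} {K b : ℝ → ℝ → ℝ} {m : Bool → ℝ → 𝒳 → ℝ}

omit [IsProbabilityMeasure P] in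
lemma tiltLaw_one : tiltLaw P (fun _ => 1) = P := by simp [tiltLaw]

/-- The objective of the law with density ratio `g`, up to an affine transformation. -/
noncomputable def quad (c w : ℝ → ℝ → ℝ) (f : ℝ → ℝ → (Fin q → ℝ) → ℝ) (P : Measure (Obs 𝒳))
    [IsFiniteMeasure P] (N : Nuisance 𝒳) (g : Obs 𝒳 → ℝ) (x : Fin q → ℝ) : ℝ :=
  ∫ a, f a.2.1 a.2.2 x ^ 2 / 2 * wA c w P N g a - f a.2.1 a.2.2 x * wD c w P N g a ∂T P N

/-- The Hessian of the objective of an observed law, divided by `2`. -/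
noncomputable def hessObs (c w : ℝ → ℝ → ℝ) (f : ℝ → ℝ → (Fin q → ℝ) → ℝ) (P : Measure (Obs 𝒳))
    (N : Nuisance 𝒳) (η : Fin q → ℝ) : Matrix (Fin q) (Fin q) ℝ :=
  Matrix.of fun i j => ∫ a, cF c N a * (w a.2.1 a.2.2 * (grad (f a.2.1 a.2.2) η i *
    grad (f a.2.1 a.2.2) η j - (N.contrast a - f a.2.1 a.2.2 η) * hess (f a.2.1 a.2.2) η i j)) ∂T P N

lemma IsNuisance.ae_wD_one (h : IsNuisance P N) : ∀ᵐ a ∂T P N,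
    wA c w P N (fun _ => 1) a = w a.2.1 a.2.2 * cF c N a ∧
    wD c w P N (fun _ => 1) a = w a.2.1 a.2.2 * cF c N a * N.contrast a := by
  filter_upwards [h.ae_regularPt, h.ae_T_kbar_eq measurable_id h.outcome true,
    h.ae_T_kbar_eq measurable_id h.outcome false] with a ha e1 e0
  refine ⟨wA_one ha, ?_⟩
  rw [wD_one ha, Nuisance.contrast]
  simp only [id_eq] at e1 e0
  rw [e1, e0]; rfl

section AffineOrder

variable {C a b : ℝ}

lemma ofReal_affine_le_iff (hb : 0 ≤ C + 2 * b) :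
    ENNReal.ofReal (C + 2 * a) ≤ ENNReal.ofReal (C + 2 * b) ↔ a ≤ b := by
  rw [ENNReal.ofReal_le_ofReal_iff hb]; constructor <;> intro h <;> linarith

lemma ofReal_affine_lt_iff (ha : 0 ≤ C + 2 * a) :
    ENNReal.ofReal (C + 2 * a) < ENNReal.ofReal (C + 2 * b) ↔ a < b := by
  rw [ENNReal.ofReal_lt_ofReal_iff_of_nonneg ha]; constructor <;> intro h <;> linarith

end AffineOrder

namespace Envelope

variable (env : Envelope c w f P N η ρ K b m) (h : IsNuisance P N) (hc : IsCopulaDensity c)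

include env h hc

/-- The objectives along a path are smooth if `η` minimizes the objective of `P`. -/
theorem exists_smoothFamily (hmin : ∀ x, objectiveObs P N c w f η ≤ objectiveObs P N c w f x)
    {g : ℝ → Obs 𝒳 → ℝ} {s : Obs 𝒳 → ℝ} {K₀ : ℝ} (rp : RatioPath g s K₀) : ∃ δ > 0,
    (∃ G DG, SmoothFamily (fun θ => quad c w f P N (g θ)) G DG η (hessObs c w f P N η)
      (fun i => ∫ v, tSum c w f N η v i * s v ∂P) δ ∧
      ∀ i, G 0 η i = -∫ v, tSum c w f N η v i ∂P) ∧
    ∀ θ, |θ| < δ → IsProbabilityMeasure (tiltLaw P (g θ)) →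
      IsNuisance (tiltLaw P (g θ)) (N.tilt P (g θ)) ∧ ∃ C : ℝ, ∀ x ∈ Metric.ball η δ,
        0 ≤ C + 2 * quad c w f P N (g θ) x ∧ objectiveObs (tiltLaw P (g θ)) (N.tilt P (g θ)) c w f x =
          ENNReal.ofReal (C + 2 * quad c w f P N (g θ) x) := by
  obtain ⟨δ, hδ0, hδρ, hδ⟩ : ∃ δ > 0, δ ≤ ρ ∧ 4 * K₀ * δ ≤ ρ := by
    have hK : 0 < 4 * K₀ := by have := rp.pos; linarith
    refine ⟨min ρ (ρ / (4 * K₀)), lt_min env.pos (div_pos env.pos hK), min_le_left _ _, ?_⟩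
    calc 4 * K₀ * min ρ (ρ / (4 * K₀)) ≤ 4 * K₀ * (ρ / (4 * K₀)) :=
          mul_le_mul_of_nonneg_left (min_le_right _ _) hK.le
      _ = ρ := mul_div_cancel₀ _ hK.ne'
  have hpath : ∀ θ, |θ| < δ → IsProbabilityMeasure (tiltLaw P (g θ)) →
      IsNuisance (tiltLaw P (g θ)) (N.tilt P (g θ)) ∧ ∃ C : ℝ, ∀ x ∈ Metric.ball η δ,
        0 ≤ C + 2 * quad c w f P N (g θ) x ∧ objectiveObs (tiltLaw P (g θ)) (N.tilt P (g θ)) c w f x =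
          ENNReal.ofReal (C + 2 * quad c w f P N (g θ) x) := fun θ hθ _ =>
    env.objectiveObs_path h hc rp hδ0 hδρ hδ hθ
  -- At `θ = 0` the law is `P`, with possibly other versions of its nuisance functions; the
  -- objective does not depend on the versions.
  have hlm : IsLocalMin (quad c w f P N (g 0)) η := by
    have h0 : tiltLaw P (g 0) = P := by rw [rp.zero, tiltLaw_one]
    obtain ⟨hN, C, hC⟩ := hpath 0 (by simpa using hδ0) (by rw [h0]; infer_instance)
    rw [h0] at hN hC
    filter_upwards [Metric.ball_mem_nhds η hδ0] with x hx
    have h1 := hC η (Metric.mem_ball_self hδ0)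
    have h2 := hC x hx
    have h3 := hmin x
    rw [h.objectiveObs_unique hN, h1.2, h.objectiveObs_unique hN, h2.2] at h3
    exact (ofReal_affine_le_iff h2.1).1 h3
  refine ⟨δ, hδ0, ?_, hpath⟩
  have hsf := (env.leastSquares h hc rp hδ0 hδρ hδ).smoothFamily hlm
  have hA : (Matrix.of fun i j => ∫ a, grad (f a.2.1 a.2.2) η i * grad (f a.2.1 a.2.2) η j *
      wA c w P N (g 0) a + hess (f a.2.1 a.2.2) η i j * (f a.2.1 a.2.2 η * wA c w P N (g 0) a -
        wD c w P N (g 0) a) ∂T P N) = hessObs c w f P N η := by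
    ext i j
    refine integral_congr_ae ?_
    filter_upwards [h.ae_wD_one (c := c) (w := w)] with a ha
    rw [rp.zero, ha.1, ha.2]; ring
  have hg : (fun i => ∫ a, grad (f a.2.1 a.2.2) η i * (wDdot c w P N s a -
      f a.2.1 a.2.2 η * wAdot c w P N s a) ∂T P N) =
      fun i => ∫ v, tSum c w f N η v i * s v ∂P := funext fun i =>
    (env.sameIntegral_tSum_mul h hc i rp.measurable_score rp.abs_score_le).eq.symm
  rw [hA, hg] at hsf
  refine ⟨_, _, hsf, fun i => ?_⟩
  -- The representation holds for every bounded measurable `s`, centred or not. The constant `1` is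
  -- formally the derivative along `g = 1 + θ`, and the weights are homogeneous of degree one in
  -- `g`; so their derivatives are the weights themselves, and the mean of `tSum` is minus the
  -- gradient at `η`.
  have h1 := (env.sameIntegral_tSum_mul h hc i (s := fun _ => 1) (K₀ := 1) measurable_const
    fun _ => by simp).eq
  simp only [mul_one] at h1
  rw [h1, ← integral_neg]
  refine integral_congr_ae ?_
  filter_upwards [h.ae_regularPt] with a ha
  have hF : ∀ z, Fdot P N (fun _ => 1) z (coord z a.2) a.1 = 0 := fun z => by
    simp only [Fdot, kbar_one, mul_one, armMean_one (ha.integrable_p z).2]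
    exact sub_self _
  have hF1 := hF true
  have hF0 := hF false
  simp only [coord_true, coord_false] at hF1 hF0
  simp only [rp.zero, wA_one ha, wD_one ha, wDdot, wAdot, wNdot, kT_one, covMean_one ha,
    armMean_one (ha.integrable_p _).2, hF1, hF0, mul_one]
  ring

/-- The mean is minus the gradient of the objective, which vanishes at the minimizer; the constant
path at `P` gives access to it. -/
lemma integral_tSum (hmin : ∀ x, objectiveObs P N c w f η ≤ objectiveObs P N c w f x) (i : Fin q) :
    ∫ v, tSum c w f N η v i ∂P = 0 := by
  have rp : RatioPath (fun _ (_ : Obs 𝒳) => 1) (fun _ => 0) 1 :=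
    ⟨one_pos, fun _ => measurable_const, measurable_const, fun θ v => by simp,
      fun v => hasDerivAt_const _ _⟩
  obtain ⟨δ, -, ⟨G, DG, hsf, hG⟩, -⟩ := env.exists_smoothFamily h hc hmin rp
  have := hG i
  rw [hsf.score_zero] at this
  exact (neg_eq_zero.1 this.symm)

/-- The efficient influence function of the projection parameter of an observed law. -/
theorem isEIF (hmin : ∀ x, objectiveObs P N c w f η ≤ objectiveObs P N c w f x)
    (hH : IsUnit (hessObs c w f P N η).det)
    (hL2 : ∀ i, MemLp (fun v => tSum c w f N η v i) 2 P) :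
    IsEIF c w f P η fun v => (hessObs c w f P N η)⁻¹.mulVec (tSum c w f N η v) := by
  refine ⟨fun i => ?_, fun Pθ s hs => ?_, fun Pθ s hs ηθ hη => ?_⟩
  · have hm : MemLp (fun v => (hessObs c w f P N η)⁻¹.mulVec (tSum c w f N η v) i) 2 P := by
      simp only [Matrix.mulVec, dotProduct]
      exact memLp_finsetSum _ fun j _ => (hL2 j).const_mul _
    refine ⟨hm.toLp _, mem_tangentSpace ?_, hm.coeFn_toLp⟩
    rw [integral_congr_ae hm.coeFn_toLp]
    simp only [Matrix.mulVec, dotProduct]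
    rw [integral_finsetSum _ fun j _ => ((hL2 j).integrable (by norm_num)).const_mul _]
    simp only [integral_const_mul, env.integral_tSum h hc hmin, mul_zero, Finset.sum_const_zero]
  · obtain ⟨g, s', K₀, rp, -, hP⟩ := hs.exists_ratioPath
    obtain ⟨δ, hδ, ⟨G, DG, hsf, -⟩, hpath⟩ := env.exists_smoothFamily h hc hmin rp
    obtain ⟨B, hB, hBδ, ηθ, h0, hcont, hev⟩ := hsf.exists_curve hH hδ
    refine ⟨ηθ, h0, hcont, B, hB, ?_⟩
    filter_upwards [hev, hP, Metric.ball_mem_nhds (0 : ℝ) hδ] with θ hθ hPθ hθδ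
    rw [Metric.mem_ball, Real.dist_eq, sub_zero] at hθδ
    obtain ⟨hN, C, hC⟩ := hpath θ hθδ hPθ.2
    rw [hPθ.1]
    refine ⟨_, hN, hθ.1, ?_, fun x hx hne => ?_⟩
    · rw [(hC _ (hBδ hθ.1)).2]; exact ENNReal.ofReal_lt_top
    · rw [(hC _ (hBδ hθ.1)).2, (hC _ (hBδ hx)).2,
        ofReal_affine_lt_iff (hC _ (hBδ hθ.1)).1]
      exact hθ.2 x hx hne
  · obtain ⟨g, s', K₀, rp, hss, hP⟩ := hs.exists_ratioPath
    obtain ⟨δ, hδ, ⟨G, DG, hsf, -⟩, hpath⟩ := env.exists_smoothFamily h hc hmin rp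
    obtain ⟨h0, hcont, B, hB, hev⟩ := hη
    -- The curve eventually runs inside the interior of this neighbourhood, where minimality over
    -- `B` is local minimality of the smooth objective.
    have hB' : interior (B ∩ Metric.ball η δ) ∈ 𝓝 (ηθ 0) := by
      rw [h0]; exact interior_mem_nhds.2 (inter_mem hB (Metric.ball_mem_nhds η hδ))
    have hder := hsf.hasDerivAt_of_isLocalMin hH h0 hcont (by
      filter_upwards [hev, hP, Metric.ball_mem_nhds (0 : ℝ) hδ, hcont.eventually hB'] with θ hθ hPθ
        hθδ hθB
      rw [Metric.mem_ball, Real.dist_eq, sub_zero] at hθδ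
      obtain ⟨hN, C, hC⟩ := hpath θ hθδ hPθ.2
      rw [hPθ.1] at hθ
      -- The curve may come with versions `N'` of the nuisance functions other than the reweighted
      -- ones; the objectives agree.
      obtain ⟨N', hN', -, -, hlt⟩ := hθ
      have : IsProbabilityMeasure (tiltLaw P (g θ)) := hPθ.2
      filter_upwards [isOpen_interior.mem_nhds hθB] with x hx
      by_cases hne : x = ηθ θ
      · rw [hne]
      · have hθb := (interior_subset hθB).2
        have hxb := interior_subset hx
        have := (hlt x hxb.1 hne).le
        rw [hN'.objectiveObs_unique hN, (hC _ hθb).2, hN'.objectiveObs_unique hN, (hC x hxb.2).2,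
          ofReal_affine_le_iff (hC x hxb.2).1] at this
        exact this)
    refine hder.congr_deriv ?_
    ext i
    have e : ∀ᵐ v ∂P, (hessObs c w f P N η)⁻¹.mulVec (tSum c w f N η v) i * s v =
        ∑ j, (hessObs c w f P N η)⁻¹ i j * (tSum c w f N η v j * s' v) := by
      filter_upwards [hss] with v hv
      rw [hv, Matrix.mulVec, dotProduct, Finset.sum_mul]
      exact Finset.sum_congr rfl fun j _ => by ring
    rw [integral_congr_ae e, integral_finsetSum _ fun j _ =>
      (env.sameIntegral_tSum_mul h hc j rp.measurable_score rp.abs_score_le).left.const_mul _]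
    simp only [integral_const_mul, Matrix.mulVec, dotProduct]

end Envelope

/-- Efficient influence functions are unique. -/
theorem IsEIF.ae_eq {φ ψ : Obs 𝒳 → Fin q → ℝ} (hφ : IsEIF c w f P η φ) (hψ : IsEIF c w f P η ψ) :
    φ =ᵐ[P] ψ := by
  have : ∀ i, (fun v => φ v i) =ᵐ[P] fun v => ψ v i := fun i =>
    ae_eq_of_tangentSpace (hφ.mem_tangentSpace i) (hψ.mem_tangentSpace i) fun Pθ s hs => by
      -- Without a curve the derivative conditions would be vacuous. Along one and the same curve
      -- both means equal its unique derivative.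
      obtain ⟨ηθ, hη⟩ := hφ.exists_curve Pθ s hs
      exact congrFun ((hφ.hasDerivAt Pθ s hs ηθ hη).unique (hψ.hasDerivAt Pθ s hs ηθ hη)) i
  filter_upwards [ae_all_iff.2 this] with v hv
  exact funext hv

end PCE

namespace PCE

/-! ## Identification of the Hessian of the objective -/

variable {Ω 𝒳 : Type*} [MeasurableSpace Ω] [StandardBorelSpace Ω] [MeasurableSpace 𝒳]
  {Q : Measure Ω} [IsProbabilityMeasure Q] {D : Causal Ω 𝒳}
  {N : Nuisance 𝒳} {c w : ℝ → ℝ → ℝ} {q : ℕ} {f : ℝ → ℝ → (Fin q → ℝ) → ℝ} {η : Fin q → ℝ}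
  {ρ : ℝ} {K b : ℝ → ℝ → ℝ} {m : Bool → ℝ → 𝒳 → ℝ}

/-- The integrand is affine in `τ`. The part without `τ` is a function of `(S₁, S₀)`; in the linear
part `τ` may be replaced by the contrast, of which it is the conditional mean given the stratum. The
envelope makes the two parts integrable separately. -/
theorem Causal.IsModel.H_eq (hD : D.IsModel Q c) (hc : IsCopulaDensity c)
    (hN : IsNuisance (D.obsLaw Q) N) (env : Envelope c w f (D.obsLaw Q) N η ρ K b m) :
    D.H Q w f η = hessObs c w f (D.obsLaw Q) N η := by
  have := hD.isProbabilityMeasure_obsLaw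
  ext i j
  have hw : Measurable fun r : ℝ × ℝ => w r.1 r.2 := env.measurable_w
  have hη := Metric.mem_ball_self (x := η) env.pos
  have hgm := fun i => env.measurable_grad_f' i hη
  have hhm := env.measurable_hess_f i j
  have hfm := env.measurable_f η
  have hcm := hN.measurable_cF hc
  set k : ℝ × ℝ → ℝ := fun r => w r.1 r.2 * hess (f r.1 r.2) η i j with hk
  set l : ℝ × ℝ → ℝ := fun r => w r.1 r.2 * (grad (f r.1 r.2) η i * grad (f r.1 r.2) η j +
    f r.1 r.2 η * hess (f r.1 r.2) η i j) with hl
  have hkm : Measurable k := hw.mul hhm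
  have hlm : Measurable l := hw.mul (((hgm i).mul (hgm j)).add (hfm.mul hhm))
  have hwc : ∀ᵐ a ∂T (D.obsLaw Q) N, 0 ≤ w a.2.1 a.2.2 * cF c N a ∧
      w a.2.1 a.2.2 * cF c N a ≤ wK w K N a := by
    filter_upwards [env.ae_wK_nonneg hN hc, hN.ae_T_cF_nonneg hc] with a h1 h2
    exact ⟨mul_nonneg (env.nonneg_w _ _) h2, mul_le_mul_of_nonneg_left h1.1 (env.nonneg_w _ _)⟩
  have hk0 : ∀ z a, 0 ≤ kT (D.obsLaw Q) (fun v => |v.1|) z a := fun z a =>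
    integral_nonneg fun y => abs_nonneg _
  have hki : Integrable (fun a => cF c N a * (k a.2 * N.contrast a)) (T (D.obsLaw Q) N) := by
    refine env.integrable_of_bound hN hc zero_le_one
      (hcm.mul ((hkm.comp measurable_snd).mul hN.measurable_contrast)).aestronglyMeasurable ?_
    filter_upwards [env.ae_bounds hN hc i, hwc] with a ha h1 h2
    have hf := env.bound_f a.2.1 a.2.2 η hη
    have hb := env.b_nonneg a.2.1 a.2.2
    have hμ := ha.2.2.1
    have hct : |N.contrast a| ≤ kT (D.obsLaw Q) (fun v => |v.1|) true a +
        kT (D.obsLaw Q) (fun v => |v.1|) false a + b a.2.1 a.2.2 := by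
      have h3 := (abs_sub (N.μ true a.2.1 a.1) (N.μ false a.2.2 a.1)).trans
        (add_le_add (hμ true).2 (hμ false).2)
      rw [Nuisance.contrast]; linarith
    have e : cF c N a * (k a.2 * N.contrast a) = w a.2.1 a.2.2 * cF c N a *
        (hess (f a.2.1 a.2.2) η i j * N.contrast a) := by simp only [hk]; ring
    rw [e, abs_mul, abs_of_nonneg h1.1, abs_mul, one_mul]
    exact mul_le_mul h1.2 (mul_le_mul (hf.2.2 i j) hct (abs_nonneg _) hb) (by positivity) h2
  have hli : Integrable (fun a => cF c N a * l a.2) (T (D.obsLaw Q) N) := by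
    refine env.integrable_of_bound hN hc zero_le_two
      (hcm.mul (hlm.comp measurable_snd)).aestronglyMeasurable ?_
    filter_upwards [hwc] with a h1 h2
    have hf := env.bound_f a.2.1 a.2.2 η hη
    have hb := env.b_nonneg a.2.1 a.2.2
    have e : cF c N a * l a.2 = w a.2.1 a.2.2 * cF c N a * (grad (f a.2.1 a.2.2) η i *
        grad (f a.2.1 a.2.2) η j + f a.2.1 a.2.2 η * hess (f a.2.1 a.2.2) η i j) := by
      simp only [hl]; ring
    have hq : |grad (f a.2.1 a.2.2) η i * grad (f a.2.1 a.2.2) η j +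
        f a.2.1 a.2.2 η * hess (f a.2.1 a.2.2) η i j| ≤ 2 * (b a.2.1 a.2.2 *
        (kT (D.obsLaw Q) (fun v => |v.1|) true a + kT (D.obsLaw Q) (fun v => |v.1|) false a +
          b a.2.1 a.2.2)) := by
      refine (abs_add_le _ _).trans ?_
      rw [abs_mul, abs_mul]
      have h3 := mul_le_mul (hf.2.1 i) (hf.2.1 j) (abs_nonneg _) hb
      have h4 := mul_le_mul hf.1 (hf.2.2 i j) (abs_nonneg _) hb
      have h5 := mul_nonneg hb (add_nonneg (hk0 true a) (hk0 false a))
      linarith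
    rw [e, abs_mul, abs_of_nonneg h1.1, mul_left_comm 2]
    exact mul_le_mul h1.2 hq (abs_nonneg _) h2
  have ht := hD.integral_mul_tau hc hN hkm hki
  have hlm' : Measurable fun a : 𝒳 × ℝ × ℝ => l a.2 := hlm.comp measurable_snd
  have hli' := (hD.integrable_XU hc hN hlm').2 hli
  have hle := hD.integral_XU hc hN hlm'
  have e1 : ∀ ω, w (D.S true ω) (D.S false ω) * (grad (f (D.S true ω) (D.S false ω)) η i *
      grad (f (D.S true ω) (D.S false ω)) η j - (D.tau Q ω - f (D.S true ω) (D.S false ω) η) *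
        hess (f (D.S true ω) (D.S false ω)) η i j) = l (D.XU ω).2 - k (D.U ω) * D.tau Q ω := by
    intro ω
    simp only [hk, hl, Causal.XU, Causal.U]; ring
  have e2 : ∀ a : 𝒳 × ℝ × ℝ, cF c N a * (w a.2.1 a.2.2 * (grad (f a.2.1 a.2.2) η i *
      grad (f a.2.1 a.2.2) η j - (N.contrast a - f a.2.1 a.2.2 η) * hess (f a.2.1 a.2.2) η i j)) =
      cF c N a * l a.2 - cF c N a * (k a.2 * N.contrast a) := by
    intro a
    simp only [hk, hl]; ring
  simp only [Causal.H, hessObs, Matrix.of_apply, e1, e2]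
  rw [integral_sub hli' ht.1, integral_sub hli hki, ht.2, hle]

end PCE

/-! ### The projection parameter and its efficient influence function under the causal model -/

theorem theoremS2 {Ω 𝒳 : Type*} [MeasurableSpace Ω] [StandardBorelSpace Ω] [MeasurableSpace 𝒳]
    (Q : Measure Ω) [IsProbabilityMeasure Q] (D : PCE.Causal Ω 𝒳)
    {q : ℕ} (c w : ℝ → ℝ → ℝ) (f : ℝ → ℝ → (Fin q → ℝ) → ℝ)
    (hc : PCE.IsCopulaDensity c) (hD : D.IsModel Q c)
    (N : PCE.Nuisance 𝒳) (hN : PCE.IsNuisance (D.obsLaw Q) N)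
    (η : Fin q → ℝ) (hη : D.IsProjection Q w f η)
    (hreg : PCE.IsRegular c w f (D.obsLaw Q) N η)
    (hH : IsUnit (D.H Q w f η).det)
    (hL2 : ∀ i, MemLp (fun v => PCE.tSum c w f N η v i) 2 (D.obsLaw Q)) :
    PCE.IsProjectionOn c w f Set.univ (D.obsLaw Q) η ∧
    PCE.IsEIF c w f (D.obsLaw Q) η
      (fun v => (D.H Q w f η)⁻¹.mulVec (PCE.tSum c w f N η v)) ∧
    ∀ φ : PCE.Obs 𝒳 → Fin q → ℝ, PCE.IsEIF c w f (D.obsLaw Q) η φ →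
      φ =ᵐ[D.obsLaw Q] fun v => (D.H Q w f η)⁻¹.mulVec (PCE.tSum c w f N η v) := by
  have := hD.isProbabilityMeasure_obsLaw
  obtain ⟨ρ, K, b, m, env⟩ := hreg.exists_envelope
  have hobj : ∀ x, D.objective Q w f x = PCE.objectiveObs (D.obsLaw Q) N c w f x := fun x =>
    hD.objective_eq_objectiveObs hc hN hreg.measurable_w hreg.nonneg_w (hreg.measurable_f x)
  have hproj : PCE.IsProjectionOn c w f Set.univ (D.obsLaw Q) η := by
    refine ⟨N, hN, Set.mem_univ _, ?_, fun x _ hx => ?_⟩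
    · rw [← hobj]; exact hη.1
    · rw [← hobj, ← hobj]; exact hη.2 x hx
  have hmin : ∀ x, PCE.objectiveObs (D.obsLaw Q) N c w f η ≤
      PCE.objectiveObs (D.obsLaw Q) N c w f x := fun x => by
    by_cases hx : x = η
    · rw [hx]
    · rw [← hobj, ← hobj]; exact (hη.2 x hx).le
  have hHeq := hD.H_eq hc hN env
  rw [hHeq] at hH ⊢
  have hE := env.isEIF hN hc hmin hH hL2
  exact ⟨hproj, hE, fun φ hφ => hφ.ae_eq hE⟩
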